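/- Fix a finite first-order signature $\tau$ (relation symbols and function symbols, constants being nullary functions) and $k\in\mathbb N$. Let $\mathsf{FO}(k)$ be first-order logic over $\tau$ with the $k$ reusable variables $V=\{x_1,\dots,x_k\}$ and if-then-else terms: $$\varphi ::= R(\bar t)\mid \varphi\vee\varphi\mid\varphi\wedge\varphi\mid\neg\varphi\mid\exists x.\varphi\mid\forall x.\varphi,\qquad t ::= x\mid f(\bar t)\mid \mathsf{ite}(\varphi,t,t')\qquad(x\in V),$$ where $\mathsf{ite}(\varphi,t,t')$ has the value of $t$ if $\varphi$ holds and the value of $t'$ otherwise. Expressions of $\mathsf{FO}(k)$ are identified with trees over the ranked alphabet consisting of the symbols of $\tau$ with their arities, $\mathsf{ite}$ (arity 3), $\wedge,\vee$ (arity 2), $\neg,\forall x,\exists x$ (arity 1) and $x$ (arity 0), for $x\in V$. An instance consists of finitely many positive and finitely many negative $\tau$-structures with finite nonempty domains, given by their domains and the tables of their relations and functions, and of a regular tree grammar $G$ over this ranked alphabet: a finite set of nonterminals, a start nonterminal $S$, and finitely many rules $B\to t$, where $B$ is a nonterminal and $t$ is a tree that may have nonterminals as leaves; $L(G)$ is the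 set of nonterminal-free trees derivable from $S$. Let $|G|$ be the number of nonterminals plus the number of rules plus the total number of nodes of the right-hand sides, let $m$ be the number of structures, and let $n$ be the largest size of a domain ($n=0$ if $m=0$). A separator is a sentence (a formula without free variables) in $L(G)$ that is true in every positive structure and false in every negative one. Theorem. For each such fixed $\tau$ and $k$ there is a single algorithm that, on every instance, decides whether a separator exists and, if one exists, constructs a separator, given as a directed acyclic graph, that is, as a tree with shared subtrees. On a unit-cost random access machine with addition, subtraction and indirect addressing, its running time is at most exponential in the length of the input, that is, at most $2^{q(\ell)}$ for a polynomial $q$ and inputs of length $\ell$ (domains and the set of nonterminals are written in unary), and it is $$O\big(2^{p(m\,n^{k})}\,|G|\big)$$ for a polynomial $p$, where for $k=0$ the factor $n^k$ is replaced by $n$. The polynomials and the constant in $O(\cdot)$ depend only on $\tau$ and $k$. -/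

import Mathlib

universe u v w x

/-! ## Ranked trees and regular tree grammars -/

/-- Finite ordered ranked trees over the ranked alphabet `S` (the symbol `s` has arity `ar s`), with
additional nullary symbols taken from `X`; this is the set `T_S(X)` of terms. -/
inductive RTree {S : Type w} (ar : S → ℕ) (X : Type x) : Type (max w x)
  | leaf (B : X) : RTree ar X
  | node (s : S) (children : Fin (ar s) → RTree ar X) : RTree ar X

namespace RTree

variable {S : Type w} {ar : S → ℕ}

/-- Number of nodes. -/
def size {X : Type x} : RTree ar X → ℕ
  | leaf _ => 1
  | node _ ch => 1 + ∑ i, (ch i).size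

/-- A ground tree (an element of `T_S`), seen as a tree with additional leaves from `X`. -/
def ofGround {X : Type x} : RTree ar Empty → RTree ar X
  | leaf e => e.elim
  | node s ch => node s fun i => (ch i).ofGround

/-- Prefix (Polish) notation of a tree, one word per node. -/
def encode {X : Type x} (codeS : S → ℕ) (codeX : X → ℕ) : RTree ar X → List ℕ
  | leaf B => [codeX B]
  | node s ch => codeS s :: (List.ofFn fun i => (ch i).encode codeS codeX).flatten

end RTree

/-- A regular tree grammar over the ranked alphabet `(S, ar)`. The nonterminals are named
`0, …, numNT - 1`, and the finite set of rewrite rules `B → t` is given as a list. -/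
structure RTG {S : Type w} (ar : S → ℕ) where
  numNT : ℕ
  start : Fin numNT
  rules : List (Fin numNT × RTree ar (Fin numNT))

namespace RTG

variable {S : Type w} {ar : S → ℕ}

/-- One rewrite step `C[B] ⇒ C[t]`, for a context `C` and a rule `B → t`. -/
inductive Step (G : RTG ar) : RTree ar (Fin G.numNT) → RTree ar (Fin G.numNT) → Prop
  | rule {B : Fin G.numNT} {t : RTree ar (Fin G.numNT)} (h : (B, t) ∈ G.rules) :
      Step G (.leaf B) t
  | context {s : S} {ch : Fin (ar s) → RTree ar (Fin G.numNT)} (i : Fin (ar s))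
      {t : RTree ar (Fin G.numNT)} (h : Step G (ch i) t) :
      Step G (.node s ch) (.node s (Function.update ch i t))

/-- The language `L(G)`: the ground trees derivable from the start symbol. -/
def language (G : RTG ar) : Set (RTree ar Empty) :=
  {t | Relation.ReflTransGen G.Step (.leaf G.start) t.ofGround}

/-- The size `|G|`: the number of nonterminals plus the sizes of all rules. -/
def size (G : RTG ar) : ℕ :=
  G.numNT + (G.rules.map fun r => 1 + r.2.size).sum

end RTG

/-! ## First-order logic with `k` reusable variables and if-then-else terms -/

/-- The two syntactic categories. -/
inductive Kind
  | formula
  | term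

/-- The expressions of `FO(k)` over the signature `L`, with variables `x_0, …, x_{k-1}`:
`φ ::= R(t,…,t) | φ ∨ φ | φ ∧ φ | ¬ φ | ∃ x. φ | ∀ x. φ` and
`t ::= x | f(t,…,t) | ite(φ, t, t')`; constants are the nullary function symbols. -/
inductive FOExpr (L : FirstOrder.Language.{u, v}) (k : ℕ) : Kind → Type (max u v)
  | rel {l : ℕ} (R : L.Relations l) (ts : Fin l → FOExpr L k .term) : FOExpr L k .formula
  | or (φ ψ : FOExpr L k .formula) : FOExpr L k .formula
  | and (φ ψ : FOExpr L k .formula) : FOExpr L k .formula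
  | neg (φ : FOExpr L k .formula) : FOExpr L k .formula
  | ex (x : Fin k) (φ : FOExpr L k .formula) : FOExpr L k .formula
  | all (x : Fin k) (φ : FOExpr L k .formula) : FOExpr L k .formula
  | var (x : Fin k) : FOExpr L k .term
  | fn {l : ℕ} (f : L.Functions l) (ts : Fin l → FOExpr L k .term) : FOExpr L k .term
  | ite (φ : FOExpr L k .formula) (t t' : FOExpr L k .term) : FOExpr L k .term

/-- Formulas of `FO(k)`. -/
abbrev FOFormula (L : FirstOrder.Language.{u, v}) (k : ℕ) := FOExpr L k .formula

/-- The type of values of an expression in a structure with domain `M`: truth values for formulas,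
elements for terms. -/
abbrev Kind.Val (M : Type) : Kind → Type
  | .formula => Prop
  | .term => M

/-- The ranked alphabet of `FO(k)` over the signature `L`. -/
inductive FOSym (L : FirstOrder.Language.{u, v}) (k : ℕ) : Type (max u v)
  | rel {l : ℕ} (R : L.Relations l) : FOSym L k
  | fn {l : ℕ} (f : L.Functions l) : FOSym L k
  | ite : FOSym L k
  | and : FOSym L k
  | or : FOSym L k
  | neg : FOSym L k
  | all (x : Fin k) : FOSym L k
  | ex (x : Fin k) : FOSym L k
  | var (x : Fin k) : FOSym L k

/-- Arities of the symbols of the ranked alphabet of `FO(k)`. -/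
def FOSym.arity {L : FirstOrder.Language.{u, v}} {k : ℕ} : FOSym L k → ℕ
  | .rel (l := l) _ => l
  | .fn (l := l) _ => l
  | .ite => 3
  | .and => 2
  | .or => 2
  | .neg => 1
  | .all _ => 1
  | .ex _ => 1
  | .var _ => 0

/-- Trees over the ranked alphabet of `FO(k)`, without nonterminals. -/
abbrev FOTree (L : FirstOrder.Language.{u, v}) (k : ℕ) := RTree (FOSym.arity (L := L) (k := k)) Empty

/-- Regular tree grammars over `FO(k)`. The alphabet has one sort only, so such a grammar may also
generate trees that are not the tree of any formula. -/
abbrev FOGrammar (L : FirstOrder.Language.{u, v}) (k : ℕ) := RTG (FOSym.arity (L := L) (k := k))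

namespace FOExpr

variable {L : FirstOrder.Language.{u, v}} {k : ℕ}

open Classical in
/-- The value of an expression in the structure `M` under the assignment `a`. -/
noncomputable def eval (M : Type) [L.Structure M] :
    {κ : Kind} → FOExpr L k κ → (Fin k → M) → κ.Val M
  | _, rel R ts, a => FirstOrder.Language.Structure.RelMap (M := M) R fun i => (ts i).eval M a
  | _, or φ ψ, a => φ.eval M a ∨ ψ.eval M a
  | _, and φ ψ, a => φ.eval M a ∧ ψ.eval M a
  | _, neg φ, a => ¬ φ.eval M a
  | _, ex x φ, a => ∃ b : M, φ.eval M (Function.update a x b)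
  | _, all x φ, a => ∀ b : M, φ.eval M (Function.update a x b)
  | _, var x, a => a x
  | _, fn f ts, a => FirstOrder.Language.Structure.funMap (M := M) f fun i => (ts i).eval M a
  | _, ite φ t t', a => if φ.eval M a then t.eval M a else t'.eval M a

/-- The set of free variables. -/
def freeVars : {κ : Kind} → FOExpr L k κ → Set (Fin k)
  | _, rel _ ts => ⋃ i, (ts i).freeVars
  | _, or φ ψ => φ.freeVars ∪ ψ.freeVars
  | _, and φ ψ => φ.freeVars ∪ ψ.freeVars
  | _, neg φ => φ.freeVars
  | _, ex x φ => φ.freeVars \ {x}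
  | _, all x φ => φ.freeVars \ {x}
  | _, var x => {x}
  | _, fn _ ts => ⋃ i, (ts i).freeVars
  | _, ite φ t t' => φ.freeVars ∪ t.freeVars ∪ t'.freeVars

/-- A sentence is a formula without free variables. -/
def IsSentence (φ : FOFormula L k) : Prop := φ.freeVars = ∅

/-- The tree over the ranked alphabet of `FO(k)` that represents an expression. -/
def toTree : {κ : Kind} → FOExpr L k κ → FOTree L k
  | _, rel R ts => .node (.rel R) fun i => (ts i).toTree
  | _, or φ ψ => .node .or ![φ.toTree, ψ.toTree]
  | _, and φ ψ => .node .and ![φ.toTree, ψ.toTree]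
  | _, neg φ => .node .neg ![φ.toTree]
  | _, ex x φ => .node (.ex x) ![φ.toTree]
  | _, all x φ => .node (.all x) ![φ.toTree]
  | _, var x => .node (.var x) ![]
  | _, fn f ts => .node (.fn f) fun i => (ts i).toTree
  | _, ite φ t t' => .node .ite ![φ.toTree, t.toTree, t'.toTree]

end FOExpr

/-- A finite `L`-structure. Its domain is nonempty, and its elements are named `0, …, size - 1`. -/
structure FinStruct (L : FirstOrder.Language.{u, v}) where
  size : ℕ
  size_pos : 0 < size
  str : L.Structure (Fin size)

/-- `A ⊨ φ`. (For a sentence the truth value does not depend on the assignment.) -/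
def FinStruct.Models {L : FirstOrder.Language.{u, v}} {k : ℕ} (A : FinStruct L) (φ : FOFormula L k) : Prop :=
  letI := A.str
  ∀ a : Fin k → Fin A.size, φ.eval (Fin A.size) a

/-! ## The separator synthesis problem -/

/-- An instance of separator synthesis for `FO(k)`: positive structures, negative structures, and a
regular tree grammar over `FO(k)`. -/
structure SepInstance (L : FirstOrder.Language.{u, v}) (k : ℕ) where
  pos : List (FinStruct L)
  neg : List (FinStruct L)
  grammar : FOGrammar L k

namespace SepInstance

variable {L : FirstOrder.Language.{u, v}} {k : ℕ}

/-- `φ` is a sentence of the grammar, true on every positive structure and false on every negative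
one. -/
def IsSolution (I : SepInstance L k) (φ : FOFormula L k) : Prop :=
  φ.toTree ∈ I.grammar.language ∧ φ.IsSentence ∧
    (∀ A ∈ I.pos, A.Models φ) ∧ (∀ B ∈ I.neg, ¬ B.Models φ)

/-- `m`: the number of structures. -/
def numStructs (I : SepInstance L k) : ℕ := (I.pos ++ I.neg).length

/-- `n`: the maximum size of a structure (`0` if there is no structure). -/
def maxSize (I : SepInstance L k) : ℕ := ((I.pos ++ I.neg).map FinStruct.size).foldr max 0

end SepInstance

/-! ## Input and output encodings, as lists of machine words -/

section Encoding

variable {L : FirstOrder.Language.{u, v}} [Finite L.Symbols] {k : ℕ}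

open Classical in
/-- The table of a function symbol (its values) or a relation symbol (`1` for true, `0` for false);
the tuple `(a_0, …, a_{l-1})` has index `∑ i, a_i * size ^ i`. -/
noncomputable def FinStruct.table (A : FinStruct L) : L.Symbols → List ℕ
  | .inl ⟨l, f⟩ =>
    letI := A.str
    List.ofFn fun j : Fin (A.size ^ l) =>
      ((FirstOrder.Language.Structure.funMap f (finFunctionFinEquiv.symm j) : Fin A.size) : ℕ)
  | .inr ⟨l, R⟩ =>
    letI := A.str
    List.ofFn fun j : Fin (A.size ^ l) =>
      if FirstOrder.Language.Structure.RelMap R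
        (finFunctionFinEquiv.symm j : Fin l → Fin A.size) then 1 else 0

/-- A structure: its domain in unary, then the tables of the symbols of the signature, in a fixed
order. -/
noncomputable def FinStruct.encode (A : FinStruct L) : List ℕ :=
  List.replicate A.size 1 ++ [0] ++
    (List.ofFn fun j => A.table ((Finite.equivFin L.Symbols).symm j)).flatten

/-- Code of a symbol of the ranked alphabet of `FO(k)`. -/
noncomputable def FOSym.code : FOSym L k → ℕ
  | .and => 0
  | .or => 1
  | .neg => 2
  | .ite => 3
  | .all x => 4 + x
  | .ex x => 4 + k + x
  | .var x => 4 + 2 * k + x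
  | .fn (l := l) f => 4 + 3 * k + Finite.equivFin L.Symbols (.inl ⟨l, f⟩)
  | .rel (l := l) R => 4 + 3 * k + Finite.equivFin L.Symbols (.inr ⟨l, R⟩)

/-- A grammar: its nonterminals in unary, the start symbol, the number of rules, and then, for each
rule, its left-hand side followed by its right-hand side in prefix notation. -/
noncomputable def FOGrammar.encode (G : FOGrammar L k) : List ℕ :=
  List.replicate G.numNT 1 ++ [0, (G.start : ℕ), G.rules.length] ++
    G.rules.flatMap fun r => (r.1 : ℕ) ::
      r.2.encode FOSym.code fun B : Fin G.numNT => 4 + 3 * k + Nat.card L.Symbols + (B : ℕ)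

/-- An instance of the separator synthesis problem. The numerical value of every word is at most the
length of the list plus a constant that depends only on `L` and `k`. -/
noncomputable def SepInstance.encode (I : SepInstance L k) : List ℕ :=
  [I.pos.length, I.neg.length] ++ I.pos.flatMap FinStruct.encode ++
    I.neg.flatMap FinStruct.encode ++ FOGrammar.encode I.grammar

end Encoding

/-- A directed acyclic graph that represents a tree with shared subtrees: each node carries a symbol
and the positions of its children in the list. -/
abbrev TreeDag {S : Type w} (ar : S → ℕ) := List (Σ s : S, Fin (ar s) → ℕ)

namespace TreeDag

variable {S : Type w} {ar : S → ℕ}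

/-- The node at position `i` unfolds to the tree `t`; children occur before their parents. -/
inductive UnfoldsAt (d : TreeDag ar) : ℕ → RTree ar Empty → Prop
  | node {i : ℕ} {s : S} {c : Fin (ar s) → ℕ} {ch : Fin (ar s) → RTree ar Empty}
      (hi : d[i]? = some ⟨s, c⟩) (hlt : ∀ j, c j < i) (hc : ∀ j, UnfoldsAt d (c j) (ch j)) :
      UnfoldsAt d i (.node s ch)

/-- The graph represents the tree `t`; its root is the last node. -/
def Represents (d : TreeDag ar) (t : RTree ar Empty) : Prop :=
  d.UnfoldsAt (d.length - 1) t

/-- Each node is written as its symbol, followed by the positions of its children. -/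
def encode (codeS : S → ℕ) (d : TreeDag ar) : List ℕ :=
  d.flatMap fun p => codeS p.1 :: List.ofFn p.2

end TreeDag

/-! ## Random access machines with unit cost -/

namespace RAM

/-- Registers (a program can mention only finitely many of them) and a memory of words. -/
structure State where
  reg : ℕ → ℕ
  mem : ℕ → ℕ

/-- Structured programs of a random access machine with addition, truncated subtraction and indirect
addressing. Numbers at most double in a step, so `T` steps can be simulated by a Turing machine in
time polynomial in `T` and the length of the input: exponential time means the same for both. -/
inductive Program
  /-- do nothing -/
  | skip
  /-- `reg r := c` -/
  | const (r c : ℕ)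
  /-- `reg r := reg a + reg b` -/
  | add (r a b : ℕ)
  /-- `reg r := reg a - reg b`, or `0` if this is negative -/
  | sub (r a b : ℕ)
  /-- `reg r := mem (reg a)` -/
  | load (r a : ℕ)
  /-- `mem (reg a) := reg r` -/
  | store (a r : ℕ)
  /-- first `P`, then `Q` -/
  | seq (P Q : Program)
  /-- `P` if `reg r ≠ 0`, otherwise `Q` -/
  | cond (r : ℕ) (P Q : Program)
  /-- repeat `P` as long as `reg r ≠ 0` -/
  | loop (r : ℕ) (P : Program)

/-- `Exec P s T s'`: started in the state `s`, the program `P` halts after exactly `T` steps in the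
state `s'`. Every instruction and every test is one step. -/
inductive Exec : Program → State → ℕ → State → Prop
  | skip (s : State) : Exec .skip s 1 s
  | const (r c : ℕ) (s : State) :
      Exec (.const r c) s 1 { s with reg := Function.update s.reg r c }
  | add (r a b : ℕ) (s : State) :
      Exec (.add r a b) s 1 { s with reg := Function.update s.reg r (s.reg a + s.reg b) }
  | sub (r a b : ℕ) (s : State) :
      Exec (.sub r a b) s 1 { s with reg := Function.update s.reg r (s.reg a - s.reg b) }
  | load (r a : ℕ) (s : State) :
      Exec (.load r a) s 1 { s with reg := Function.update s.reg r (s.mem (s.reg a)) }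
  | store (a r : ℕ) (s : State) :
      Exec (.store a r) s 1 { s with mem := Function.update s.mem (s.reg a) (s.reg r) }
  | seq {P Q : Program} {s s' s'' : State} {T U : ℕ}
      (hP : Exec P s T s') (hQ : Exec Q s' U s'') : Exec (.seq P Q) s (T + U) s''
  | cond_pos {r : ℕ} {P Q : Program} {s s' : State} {T : ℕ}
      (hr : s.reg r ≠ 0) (hP : Exec P s T s') : Exec (.cond r P Q) s (T + 1) s'
  | cond_neg {r : ℕ} {P Q : Program} {s s' : State} {T : ℕ}
      (hr : s.reg r = 0) (hQ : Exec Q s T s') : Exec (.cond r P Q) s (T + 1) s'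
  | loop_done {r : ℕ} {P : Program} {s : State}
      (hr : s.reg r = 0) : Exec (.loop r P) s 1 s
  | loop_step {r : ℕ} {P : Program} {s s' s'' : State} {T U : ℕ}
      (hr : s.reg r ≠ 0) (hP : Exec P s T s') (hL : Exec (.loop r P) s' U s'') :
      Exec (.loop r P) s (T + U + 1) s''

/-- The input is written to the memory cells `0, 1, …`, its length to register `0`; everything else
is `0`. -/
def init (input : List ℕ) : State where
  reg r := if r = 0 then input.length else 0
  mem a := input.getD a 0

/-- On the given input, `P` halts after exactly `T` steps with the given output, which is the block
of memory of length `reg 0` that begins at the address `reg 1`. -/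
def Program.Outputs (P : Program) (input output : List ℕ) (T : ℕ) : Prop :=
  ∃ s : State, Exec P (init input) T s ∧
    output = (List.range (s.reg 0)).map fun i => s.mem (s.reg 1 + i)

end RAM

/-!
A set of pairs is computed bottom-up. The *value* of an expression of `FO(k)` consists of its truth
value or its element at every *point*, that is, at every pair of a structure of the instance and an
assignment in it, of the set of its free variables, and of its kind (formula or term). Whether a
formula is a solution depends only on its value (`digits_eq_target_iff`), and the value of a compound
expression depends only on its root symbol and on the values of its children (`IsDig.build`). There are
at most `N ≤ m * n ^ k` points, so a value can be coded by a number below `V = (n + 2) ^ (N + k + 1)`,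
which is `2 ^ poly(m * n ^ k)`, with `n` in place of `n ^ k` if `k = 0`.

An *item* is a position of a right-hand side of the grammar or a nonterminal. A grammar derives `t`
from an item if and only if it does so in parallel (`mem_language_iff`). Then either the item is a
nonterminal, and the derivation begins with a rule for it, or the item and `t` have the same root, and
the children of `t` are derived from those of the item. The set of all pairs of an item and the value of some expression derivable
from it is therefore the least set closed under three rules: a value passes from a right-hand side to
its left-hand side, from a nonterminal to its occurrences, and from the children of a node to the node.
The program saturates the set of known pairs under these rules with a queue. It adds at most one node to
a directed acyclic graph for each new pair, so that every known pair is witnessed by a node of this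
graph (soundness: `semOK`, and the invariant `WInv`). At the end the set is closed (`run_saturate`), so
it contains all derivable pairs (`closed_complete`). Hence a solution exists if and only if the start
symbol has the target value, and the graph up to the witness of this pair is the answer (`run_core`).

The program is written in a small language with variables, arrays, and loops whose numbers of
iterations are given by variables. It is compiled to the random access machine (`comp_reaches`,
`toRAM_outputs`), with a bound for the running time that is read off the syntax. Only two of the
variables that bound loops depend on the grammar: the length of the input, and the number of pairs,
which is the length of the input times `2 * V`. Loops over these two are never nested
(`oneBig_synthesis`), and this makes the running time linear in `|G|` (`Pr.bd_le_of_oneBig`). All other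
loop bounds are `2 ^ poly(m * n ^ k)` (`bounds_arith`), and the nesting depth is a constant.
-/

/-! ### Programs with bounded loops, and their compilation to random access machines -/

namespace LoopProg

/-- The state of a loop program: named variables and named unbounded arrays of natural numbers. -/
structure LState (ν α : Type) where
  v : ν → ℕ
  a : α → ℕ → ℕ

/-- Expressions: constants, variables, sum, truncated difference, array access, and a choice that
tests whether its first argument is nonzero. -/
inductive Ex (ν α : Type)
  | c (n : ℕ) : Ex ν α
  | v (x : ν) : Ex ν α
  | add (e f : Ex ν α) : Ex ν α
  | sub (e f : Ex ν α) : Ex ν α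
  | rd (a : α) (e : Ex ν α) : Ex ν α
  | ite (b e f : Ex ν α) : Ex ν α

/-- Loop programs. The body of `loop p P` is repeated as often as the value of `p` on entry says. -/
inductive Pr (ν α : Type)
  | skip : Pr ν α
  | set (x : ν) (e : Ex ν α) : Pr ν α
  | wr (a : α) (i e : Ex ν α) : Pr ν α
  | seq (P Q : Pr ν α) : Pr ν α
  | branch (e : Ex ν α) (P Q : Pr ν α) : Pr ν α
  | loop (p : ν) (P : Pr ν α) : Pr ν α

infixr:60 ";;" => Pr.seq

variable {ν α : Type}

/-- The value of an expression. -/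
def Ex.ev (s : LState ν α) : Ex ν α → ℕ
  | c n => n
  | v x => s.v x
  | add e f => e.ev s + f.ev s
  | sub e f => e.ev s - f.ev s
  | rd a e => s.a a (e.ev s)
  | ite b e f => if b.ev s ≠ 0 then e.ev s else f.ev s

/-- An upper bound for the number of machine steps that evaluate an expression. -/
def Ex.cost : Ex ν α → ℕ
  | c _ => 1
  | v _ => 1
  | add e f => e.cost + f.cost + 1
  | sub e f => e.cost + f.cost + 1
  | rd _ e => e.cost + 9
  | ite b e f => b.cost + e.cost + f.cost + 1

section Semantics

variable [DecidableEq ν] [DecidableEq α]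

/-- Assignment to a variable. -/
def LState.set (s : LState ν α) (x : ν) (n : ℕ) : LState ν α := ⟨Function.update s.v x n, s.a⟩

/-- Assignment to an array cell. -/
def LState.wr (s : LState ν α) (b : α) (i n : ℕ) : LState ν α :=
  ⟨s.v, Function.update s.a b (Function.update (s.a b) i n)⟩

omit [DecidableEq α] in
theorem LState.set_v (s : LState ν α) (x y : ν) (n : ℕ) :
    (s.set x n).v y = if y = x then n else s.v y := by
  simp [LState.set, Function.update_apply]

omit [DecidableEq α] in
theorem LState.set_a (s : LState ν α) (x : ν) (n : ℕ) : (s.set x n).a = s.a := rfl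

omit [DecidableEq ν] in
theorem LState.wr_v (s : LState ν α) (b : α) (i n : ℕ) : (s.wr b i n).v = s.v := rfl

omit [DecidableEq ν] in
theorem LState.wr_a (s : LState ν α) (b b' : α) (i n : ℕ) :
    (s.wr b i n).a b' = if b' = b then Function.update (s.a b') i n else s.a b' := by
  by_cases h : b' = b
  · subst h; simp [LState.wr]
  · simp [LState.wr, h]

/-- The state after the run of a program. -/
def run : Pr ν α → LState ν α → LState ν α
  | .skip, s => s
  | .set x e, s => s.set x (e.ev s)
  | .wr b i e, s => s.wr b (i.ev s) (e.ev s)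
  | .seq P Q, s => run Q (run P s)
  | .branch e P Q, s => if e.ev s ≠ 0 then run P s else run Q s
  | .loop p P, s => (run P)^[s.v p] s

section RunLemmas

variable (s : LState ν α)

@[simp] theorem run_skip : run .skip s = s := rfl
@[simp] theorem run_set (x : ν) (e : Ex ν α) : run (.set x e) s = s.set x (e.ev s) := rfl
@[simp] theorem run_wr (b : α) (i e : Ex ν α) : run (.wr b i e) s = s.wr b (i.ev s) (e.ev s) := rfl
@[simp] theorem run_seq (P Q : Pr ν α) : run (.seq P Q) s = run Q (run P s) := rfl
@[simp] theorem run_branch (e : Ex ν α) (P Q : Pr ν α) :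
    run (.branch e P Q) s = if e.ev s ≠ 0 then run P s else run Q s := rfl

end RunLemmas

/-- The variables that a program may change. -/
def Pr.wv : Pr ν α → List ν
  | .skip => []
  | .set x _ => [x]
  | .wr _ _ _ => []
  | .seq P Q => P.wv ++ Q.wv
  | .branch _ P Q => P.wv ++ Q.wv
  | .loop _ P => P.wv

/-- The arrays that a program may change. -/
def Pr.wa : Pr ν α → List α
  | .skip => []
  | .set _ _ => []
  | .wr b _ _ => [b]
  | .seq P Q => P.wa ++ Q.wa
  | .branch _ P Q => P.wa ++ Q.wa
  | .loop _ P => P.wa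

/-- The variables that bound the loops of a program. -/
def Pr.lv : Pr ν α → List ν
  | .skip => []
  | .set _ _ => []
  | .wr _ _ _ => []
  | .seq P Q => P.lv ++ Q.lv
  | .branch _ P Q => P.lv ++ Q.lv
  | .loop p P => p :: P.lv

/-- The two states agree outside the variables and arrays that `P` may change. -/
structure Frame (P : Pr ν α) (s s' : LState ν α) : Prop where
  v : ∀ x, x ∉ P.wv → s'.v x = s.v x
  a : ∀ b, b ∉ P.wa → s'.a b = s.a b

omit [DecidableEq ν] [DecidableEq α] in
theorem Frame.refl (P : Pr ν α) (s : LState ν α) : Frame P s s := ⟨fun _ _ => rfl, fun _ _ => rfl⟩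

omit [DecidableEq ν] [DecidableEq α] in
theorem Frame.trans {P : Pr ν α} {s s' s'' : LState ν α} (h : Frame P s s') (h' : Frame P s' s'') :
    Frame P s s'' :=
  ⟨fun x hx => (h'.v x hx).trans (h.v x hx), fun b hb => (h'.a b hb).trans (h.a b hb)⟩

/-- A run changes only the variables and arrays that occur as targets in the text of the program.
Since the lists of targets are computable, side conditions of this kind are proved by `decide`. -/
theorem run_frame (P : Pr ν α) (s : LState ν α) : Frame P s (run P s) := by
  induction P generalizing s with
  | skip => exact Frame.refl _ _
  | set x e =>
    refine ⟨fun y hy => ?_, fun b _ => rfl⟩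
    simp only [Pr.wv, List.mem_singleton] at hy
    simp [run, LState.set_v, hy]
  | wr b i e =>
    refine ⟨fun y _ => rfl, fun b' hb => ?_⟩
    simp only [Pr.wa, List.mem_singleton] at hb
    simp [run, LState.wr_a, hb]
  | seq P Q ihP ihQ =>
    refine ⟨fun x hx => ?_, fun b hb => ?_⟩
    · simp only [Pr.wv, List.mem_append, not_or] at hx
      exact ((ihQ _).v x hx.2).trans ((ihP _).v x hx.1)
    · simp only [Pr.wa, List.mem_append, not_or] at hb
      exact ((ihQ _).a b hb.2).trans ((ihP _).a b hb.1)
  | branch e P Q ihP ihQ =>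
    refine ⟨fun x hx => ?_, fun b hb => ?_⟩
    · simp only [Pr.wv, List.mem_append, not_or] at hx
      simp only [run]
      split_ifs
      · exact (ihP _).v x hx.1
      · exact (ihQ _).v x hx.2
    · simp only [Pr.wa, List.mem_append, not_or] at hb
      simp only [run]
      split_ifs
      · exact (ihP _).a b hb.1
      · exact (ihQ _).a b hb.2
  | loop p P ih =>
    have key : ∀ n s, Frame P s ((run P)^[n] s) := by
      intro n
      induction n with
      | zero => exact fun s => Frame.refl _ _
      | succ n ihn =>
        intro s
        rw [Function.iterate_succ_apply]
        exact (ih s).trans (ihn _)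
    exact ⟨(key _ _).v, (key _ _).a⟩

theorem run_v (P : Pr ν α) (s : LState ν α) {x : ν} (h : x ∉ P.wv) : (run P s).v x = s.v x :=
  (run_frame P s).v x h

theorem run_a (P : Pr ν α) (s : LState ν α) {b : α} (h : b ∉ P.wa) : (run P s).a b = s.a b :=
  (run_frame P s).a b h

/-- The invariant rule for loops; the body may use that everything it does not write is unchanged. -/
theorem loop_inv (I : ℕ → LState ν α → Prop) (P : Pr ν α) (p : ν) (s : LState ν α) (h0 : I 0 s)
    (step : ∀ i s', i < s.v p → Frame P s s' → I i s' → I (i + 1) (run P s')) :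
    I (s.v p) (run (.loop p P) s) := by
  have key : ∀ n ≤ s.v p, Frame P s ((run P)^[n] s) ∧ I n ((run P)^[n] s) := by
    intro n
    induction n with
    | zero => exact fun _ => ⟨Frame.refl _ _, h0⟩
    | succ n ih =>
      intro hn
      obtain ⟨hF, hI⟩ := ih (by omega)
      rw [Function.iterate_succ_apply']
      exact ⟨hF.trans (run_frame _ _), step n _ (by omega) hF hI⟩
  exact (key _ le_rfl).2

end Semantics

/-! ### Compilation -/

section Compile

open RAM

/-- `P` halts within `T` steps. -/
def Reaches (P : Program) (σ : State) (T : ℕ) (σ' : State) : Prop := ∃ T' ≤ T, Exec P σ T' σ'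

theorem Reaches.seq {P Q : Program} {σ σ' σ'' : State} {T U : ℕ} (h : Reaches P σ T σ')
    (h' : Reaches Q σ' U σ'') : Reaches (.seq P Q) σ (T + U) σ'' := by
  obtain ⟨t, ht, hP⟩ := h
  obtain ⟨u, hu, hQ⟩ := h'
  exact ⟨t + u, by omega, .seq hP hQ⟩

theorem Reaches.mono {P : Program} {σ σ' : State} {T U : ℕ} (h : Reaches P σ T σ') (hTU : T ≤ U) :
    Reaches P σ U σ' := by
  obtain ⟨t, ht, hP⟩ := h
  exact ⟨t, by omega, hP⟩

theorem Reaches.of_exec {P : Program} {σ σ' : State} {T : ℕ} (h : Exec P σ T σ') :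
    Reaches P σ T σ' := ⟨T, le_rfl, h⟩

theorem Reaches.cond_pos {P Q : Program} {σ σ' : State} {T r : ℕ} (hr : σ.reg r ≠ 0)
    (h : Reaches P σ T σ') : Reaches (.cond r P Q) σ (T + 1) σ' := by
  obtain ⟨t, ht, hP⟩ := h
  exact ⟨t + 1, by omega, .cond_pos hr hP⟩

theorem Reaches.cond_neg {P Q : Program} {σ σ' : State} {T r : ℕ} (hr : σ.reg r = 0)
    (h : Reaches Q σ T σ') : Reaches (.cond r P Q) σ (T + 1) σ' := by
  obtain ⟨t, ht, hP⟩ := h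
  exact ⟨t + 1, by omega, .cond_neg hr hP⟩

theorem Reaches.loop_step {P : Program} {σ σ' σ'' : State} {T U r : ℕ} (hr : σ.reg r ≠ 0)
    (h : Reaches P σ T σ') (h' : Reaches (.loop r P) σ' U σ'') :
    Reaches (.loop r P) σ (T + U + 1) σ'' := by
  obtain ⟨t, ht, hP⟩ := h
  obtain ⟨u, hu, hQ⟩ := h'
  exact ⟨t + u + 1, by omega, .loop_step hr hP hQ⟩

/-- The number of machine words per array index: the arrays are interleaved. -/
abbrev stride : ℕ := 32

/-- How variables and arrays are laid out: the variable `x` lives in register `2 * reg x`, and the cell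
`i` of the array `b` at the address `base + 32 * i + slot b`. The odd registers are for
temporary values; register `1` holds `base` and register `3` holds `0`. -/
structure Layout (ν α : Type) where
  reg : ν → ℕ
  slot : α → ℕ
  reg_inj : Function.Injective reg
  slot_inj : Function.Injective slot
  slot_lt : ∀ b, slot b < stride

variable (Λ : Layout ν α)

/-- Turns an index held in the temporary register `r` into the address of that cell of `b`. -/
def addrOf (b : α) (r : ℕ) : Program :=
  .seq (.add r r r) <| .seq (.add r r r) <| .seq (.add r r r) <| .seq (.add r r r) <|
  .seq (.add r r r) <| .seq (.add r r 1) <| .seq (.const (r + 2) (Λ.slot b)) (.add r r (r + 2))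

/-- Code that leaves the value of an expression in register `2 * t + 1`. -/
def compE (t : ℕ) : Ex ν α → Program
  | .c n => .const (2 * t + 1) n
  | .v x => .add (2 * t + 1) (2 * Λ.reg x) 3
  | .add e f => .seq (compE t e) (.seq (compE (t + 1) f) (.add (2 * t + 1) (2 * t + 1) (2 * t + 3)))
  | .sub e f => .seq (compE t e) (.seq (compE (t + 1) f) (.sub (2 * t + 1) (2 * t + 1) (2 * t + 3)))
  | .rd b e => .seq (compE t e) (.seq (addrOf Λ b (2 * t + 1)) (.load (2 * t + 1) (2 * t + 1)))
  | .ite b e f => .seq (compE t b) (.cond (2 * t + 1) (compE t e) (compE t f))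

/-- Code for a program; it uses the temporary registers from `2 * t + 1` on. -/
def comp (t : ℕ) : Pr ν α → Program
  | .skip => .skip
  | .set x e => .seq (compE Λ t e) (.add (2 * Λ.reg x) (2 * t + 1) 3)
  | .wr b i e => .seq (compE Λ t e) (.seq (compE Λ (t + 1) i)
      (.seq (addrOf Λ b (2 * t + 3)) (.store (2 * t + 3) (2 * t + 1))))
  | .seq P Q => .seq (comp t P) (comp t Q)
  | .branch e P Q => .seq (compE Λ t e) (.cond (2 * t + 1) (comp t P) (comp t Q))
  | .loop p P => .seq (.add (2 * t + 1) (2 * Λ.reg p) 3) (.loop (2 * t + 1)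
      (.seq (comp (t + 1) P) (.seq (.const (2 * t + 3) 1) (.sub (2 * t + 1) (2 * t + 1) (2 * t + 3)))))

/-- The machine state `σ` represents the state `s` of a loop program. -/
structure Rel (base : ℕ) (s : LState ν α) (σ : State) : Prop where
  v : ∀ x, σ.reg (2 * Λ.reg x) = s.v x
  a : ∀ b i, σ.mem (base + 32 * i + Λ.slot b) = s.a b i
  one : σ.reg 1 = base
  three : σ.reg 3 = 0

/-- Registers other than the temporary ones from `2 * t + 1` on are the same. -/
def Keeps (t : ℕ) (σ σ' : State) : Prop := ∀ r, r % 2 = 0 ∨ r < 2 * t + 1 → σ'.reg r = σ.reg r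

/-- Temporary registers below `2 * t + 1` are the same. -/
def KeepsTemp (t : ℕ) (σ σ' : State) : Prop := ∀ r, r % 2 = 1 → r < 2 * t + 1 → σ'.reg r = σ.reg r

variable {Λ}

theorem Rel.of_keeps {base t : ℕ} {s : LState ν α} {σ σ' : State} (h : Rel Λ base s σ)
    (ht : 2 ≤ t) (hm : σ'.mem = σ.mem) (hk : Keeps t σ σ') : Rel Λ base s σ' where
  v x := by rw [hk _ (Or.inl (by omega))]; exact h.v x
  a b i := by rw [hm]; exact h.a b i
  one := by rw [hk _ (Or.inr (by omega))]; exact h.one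
  three := by rw [hk _ (Or.inr (by omega))]; exact h.three

/-- Doubling five times multiplies the index by the stride 32; the base address and the slot of the
array are added. -/
theorem addrOf_reaches' (b : α) (r : ℕ) (hr : r ≠ 1) (σ : State) :
    ∃ σ', Reaches (addrOf Λ b r) σ 8 σ' ∧ σ'.mem = σ.mem ∧
      σ'.reg r = σ.reg 1 + 32 * σ.reg r + Λ.slot b ∧
      ∀ q, q ≠ r → q ≠ r + 2 → σ'.reg q = σ.reg q := by
  refine ⟨_, .of_exec (.seq (.add ..) (.seq (.add ..) (.seq (.add ..) (.seq (.add ..)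
    (.seq (.add ..) (.seq (.add ..) (.seq (.const ..) (.add ..)))))))), rfl, ?_, ?_⟩
  · have h2 : ¬ (r = r + 2) := by omega
    simp only [Function.update_apply, if_true, if_neg hr.symm, if_neg h2]
    ring
  · intro q h1 h2
    simp only [Function.update_apply, if_neg h1, if_neg h2]

theorem addrOf_reaches (b : α) (t : ℕ) (ht : 2 ≤ t) (σ : State) :
    ∃ σ', Reaches (addrOf Λ b (2 * t + 1)) σ 8 σ' ∧ σ'.mem = σ.mem ∧
      σ'.reg (2 * t + 1) = σ.reg 1 + 32 * σ.reg (2 * t + 1) + Λ.slot b ∧ Keeps t σ σ' := by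
  obtain ⟨σ', h1, h2, h3, h4⟩ := addrOf_reaches' (Λ := Λ) b (2 * t + 1) (by omega) σ
  exact ⟨σ', h1, h2, h3, fun r hr => h4 r (by omega) (by omega)⟩

theorem Keeps.trans {t u : ℕ} {σ σ' σ'' : State} (h : Keeps t σ σ') (h' : Keeps u σ' σ'')
    (htu : t ≤ u) : Keeps t σ σ'' := fun r hr => by
  rw [h' r (by omega), h r hr]

/-- The code for an expression leaves its value in register `2 * t + 1` and changes only temporary
registers from there on, within the bound `Ex.cost`. -/
theorem compE_reaches {base : ℕ} {s : LState ν α} (e : Ex ν α) (t : ℕ) (σ : State) (ht : 2 ≤ t)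
    (h : Rel Λ base s σ) :
    ∃ σ', Reaches (compE Λ t e) σ e.cost σ' ∧ σ'.mem = σ.mem ∧ σ'.reg (2 * t + 1) = e.ev s ∧
      Keeps t σ σ' := by
  induction e generalizing t σ with
  | c n =>
    refine ⟨_, .of_exec (.const ..), rfl, by simp [Ex.ev], fun r hr => ?_⟩
    have h1 : ¬ (r = 2 * t + 1) := by omega
    simp [h1]
  | v x =>
    refine ⟨_, .of_exec (.add ..), rfl, by simp [Ex.ev, h.three, h.v], fun r hr => ?_⟩
    have h1 : ¬ (r = 2 * t + 1) := by omega
    simp [h1]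
  | add e f ihe ihf =>
    obtain ⟨σ₁, he, hm₁, hv₁, hk₁⟩ := ihe t σ ht h
    obtain ⟨σ₂, hf, hm₂, hv₂, hk₂⟩ := ihf (t + 1) σ₁ (by omega) (h.of_keeps ht hm₁ hk₁)
    refine ⟨_, (he.seq (hf.seq (.of_exec (.add ..)))).mono (by simp [Ex.cost]; omega),
      by simp [hm₁, hm₂], ?_, fun r hr => ?_⟩
    · have := hk₂ (2 * t + 1) (by omega)
      simp only [Function.update_self, Ex.ev, this, hv₁]
      rw [← hv₂]; rfl
    · have h1 : ¬ (r = 2 * t + 1) := by omega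
      simp only [Function.update_apply, if_neg h1]
      exact hk₁.trans hk₂ (by omega) r hr
  | sub e f ihe ihf =>
    obtain ⟨σ₁, he, hm₁, hv₁, hk₁⟩ := ihe t σ ht h
    obtain ⟨σ₂, hf, hm₂, hv₂, hk₂⟩ := ihf (t + 1) σ₁ (by omega) (h.of_keeps ht hm₁ hk₁)
    refine ⟨_, (he.seq (hf.seq (.of_exec (.sub ..)))).mono (by simp [Ex.cost]; omega),
      by simp [hm₁, hm₂], ?_, fun r hr => ?_⟩
    · have := hk₂ (2 * t + 1) (by omega)
      simp only [Function.update_self, Ex.ev, this, hv₁]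
      rw [← hv₂]; rfl
    · have h1 : ¬ (r = 2 * t + 1) := by omega
      simp only [Function.update_apply, if_neg h1]
      exact hk₁.trans hk₂ (by omega) r hr
  | rd b e ih =>
    obtain ⟨σ₁, he, hm₁, hv₁, hk₁⟩ := ih t σ ht h
    obtain ⟨σ₂, hf, hm₂, hv₂, hk₂⟩ := addrOf_reaches (Λ := Λ) b t ht σ₁
    have hR := h.of_keeps ht hm₁ hk₁
    refine ⟨_, (he.seq (hf.seq (.of_exec (.load ..)))).mono (by simp [Ex.cost]),
      by simp [hm₁, hm₂], ?_, fun r hr => ?_⟩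
    · simp only [Function.update_self, Ex.ev, hv₂, hv₁, hm₂]
      rw [hR.one, hR.a]
    · have h1 : ¬ (r = 2 * t + 1) := by omega
      simp only [Function.update_apply, if_neg h1]
      exact hk₁.trans hk₂ (by omega) r hr
  | ite b e f ihb ihe ihf =>
    obtain ⟨σ₁, hb, hm₁, hv₁, hk₁⟩ := ihb t σ ht h
    have hR := h.of_keeps ht hm₁ hk₁
    by_cases hc : b.ev s = 0
    · obtain ⟨σ₂, hf, hm₂, hv₂, hk₂⟩ := ihf t σ₁ ht hR
      exact ⟨σ₂, (hb.seq (.cond_neg (by rw [hv₁, hc]) hf)).mono (by simp [Ex.cost]; omega),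
        hm₂.trans hm₁, by simp [Ex.ev, hc, hv₂], hk₁.trans hk₂ le_rfl⟩
    · obtain ⟨σ₂, hf, hm₂, hv₂, hk₂⟩ := ihe t σ₁ ht hR
      exact ⟨σ₂, (hb.seq (.cond_pos (by rw [hv₁]; exact hc) hf)).mono (by simp [Ex.cost]; omega),
        hm₂.trans hm₁, by simp [Ex.ev, hc, hv₂], hk₁.trans hk₂ le_rfl⟩

/-- A bound for the running time, computed from the syntax, when `B` bounds the loop variables. -/
def Pr.bd (B : ν → ℕ) : Pr ν α → ℕ
  | .skip => 1
  | .set _ e => e.cost + 1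
  | .wr _ i e => i.cost + e.cost + 9
  | .seq P Q => P.bd B + Q.bd B
  | .branch e P Q => e.cost + P.bd B + Q.bd B + 1
  | .loop p P => 2 + B p * (P.bd B + 3)

variable [DecidableEq ν] [DecidableEq α]

omit [DecidableEq α] in
/-- Copying the temporary register with the new value into the register of `x` simulates an
assignment; register 3 holds zero. -/
theorem Rel.set {base t : ℕ} {s : LState ν α} {σ : State} (h : Rel Λ base s σ) (x : ν)
    (n : ℕ) (hn : σ.reg (2 * t + 1) = n) : Rel Λ base (s.set x n)
      { σ with reg := Function.update σ.reg (2 * Λ.reg x) (σ.reg (2 * t + 1) + σ.reg 3) } where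
  v y := by
    simp only [LState.set_v, Function.update_apply]
    by_cases hy : y = x
    · simp [hy, hn, h.three]
    · have : Λ.reg y ≠ Λ.reg x := fun hh => hy (Λ.reg_inj hh)
      rw [if_neg (by omega), if_neg hy, h.v]
  a b i := h.a b i
  one := by
    simp only [Function.update_apply]
    rw [if_neg (by omega), h.one]
  three := by
    simp only [Function.update_apply]
    rw [if_neg (by omega), h.three]

/-- The compiled program simulates the loop program within the syntactic time bound, provided that
the loop variables are bounded by `B` on entry and are never changed. -/
theorem comp_reaches {base : ℕ} (B : ν → ℕ) (P : Pr ν α) (t : ℕ) (s : LState ν α) (σ : State)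
    (ht : 2 ≤ t) (h : Rel Λ base s σ) (hB : ∀ p ∈ P.lv, s.v p ≤ B p) (hw : ∀ p ∈ P.lv, p ∉ P.wv) :
    ∃ σ', Reaches (comp Λ t P) σ (P.bd B) σ' ∧ Rel Λ base (run P s) σ' ∧ KeepsTemp t σ σ' := by
  induction P generalizing t s σ with
  | skip => exact ⟨σ, .of_exec (.skip _), h, fun _ _ _ => rfl⟩
  | set x e =>
    obtain ⟨σ₁, he, hm₁, hv₁, hk₁⟩ := compE_reaches e t σ ht h
    refine ⟨_, he.seq (.of_exec (.add ..)), (h.of_keeps ht hm₁ hk₁).set x _ hv₁, fun r hr hr' => ?_⟩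
    simp only [Function.update_apply]
    rw [if_neg (by omega), hk₁ r (by omega)]
  | wr b i e =>
    obtain ⟨σ₁, he, hm₁, hv₁, hk₁⟩ := compE_reaches e t σ ht h
    have hR₁ := h.of_keeps ht hm₁ hk₁
    obtain ⟨σ₂, hi, hm₂, hv₂, hk₂⟩ := compE_reaches i (t + 1) σ₁ (by omega) hR₁
    have hR₂ := hR₁.of_keeps (by omega) hm₂ hk₂
    obtain ⟨σ₃, ha, hm₃, hv₃, hk₃⟩ := addrOf_reaches (Λ := Λ) b (t + 1) (by omega) σ₂
    have hR₃ := hR₂.of_keeps (by omega) hm₃ hk₃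
    refine ⟨_, (he.seq (hi.seq (ha.seq (.of_exec (.store ..))))).mono (by simp [Pr.bd]; omega), ?_,
      fun r hr hr' => ?_⟩
    · have e1 : σ₃.reg (2 * t + 1) = e.ev s := by
        rw [hk₃ _ (by omega), hk₂ _ (by omega), hv₁]
      have e2 : σ₃.reg (2 * t + 3) = base + 32 * i.ev s + Λ.slot b := by
        have : 2 * t + 3 = 2 * (t + 1) + 1 := by ring
        rw [this, hv₃, hv₂, hR₂.one]
      refine ⟨hR₃.v, fun b' i' => ?_, hR₃.one, hR₃.three⟩
      simp only [run, LState.wr_a, e1, e2, Function.update_apply]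
      have l1 := Λ.slot_lt b
      have l2 := Λ.slot_lt b'
      simp only [stride] at l1 l2
      by_cases hb : b' = b
      · subst hb
        by_cases hi : i' = i.ev s
        · simp [hi]
        · rw [if_neg (by omega)]
          simp only [if_true, hi, if_false, Function.update_apply]
          exact hR₃.a _ _
      · have : Λ.slot b' ≠ Λ.slot b := fun hh => hb (Λ.slot_inj hh)
        rw [if_neg (by omega), if_neg hb]
        exact hR₃.a _ _
    · show σ₃.reg r = _
      rw [hk₃ _ (by omega), hk₂ _ (by omega), hk₁ _ (by omega)]
  | seq P Q ihP ihQ =>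
    obtain ⟨σ₁, hP, hR₁, hk₁⟩ := ihP t s σ ht h (fun p hp => hB p (by simp [Pr.lv, hp]))
      (fun p hp hp' => hw p (by simp [Pr.lv, hp]) (by simp [Pr.wv, hp']))
    obtain ⟨σ₂, hQ, hR₂, hk₂⟩ := ihQ t (run P s) σ₁ ht hR₁ (fun p hp => by
        rw [run_v P s (fun hp' => hw p (by simp [Pr.lv, hp]) (by simp [Pr.wv, hp']))]
        exact hB p (by simp [Pr.lv, hp]))
      (fun p hp hp' => hw p (by simp [Pr.lv, hp]) (by simp [Pr.wv, hp']))
    exact ⟨σ₂, hP.seq hQ, hR₂, fun r hr hr' => (hk₂ r hr hr').trans (hk₁ r hr hr')⟩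
  | branch e P Q ihP ihQ =>
    obtain ⟨σ₁, he, hm₁, hv₁, hk₁⟩ := compE_reaches e t σ ht h
    have hR := h.of_keeps ht hm₁ hk₁
    by_cases hc : e.ev s = 0
    · obtain ⟨σ₂, hQ, hR₂, hk₂⟩ := ihQ t s σ₁ ht hR (fun p hp => hB p (by simp [Pr.lv, hp]))
        (fun p hp hp' => hw p (by simp [Pr.lv, hp]) (by simp [Pr.wv, hp']))
      exact ⟨σ₂, (he.seq (.cond_neg (by rw [hv₁, hc]) hQ)).mono (by simp [Pr.bd]; omega),
        by simpa [run, hc] using hR₂, fun r hr hr' => (hk₂ r hr hr').trans (hk₁ r (.inr hr'))⟩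
    · obtain ⟨σ₂, hQ, hR₂, hk₂⟩ := ihP t s σ₁ ht hR (fun p hp => hB p (by simp [Pr.lv, hp]))
        (fun p hp hp' => hw p (by simp [Pr.lv, hp]) (by simp [Pr.wv, hp']))
      exact ⟨σ₂, (he.seq (.cond_pos (by rw [hv₁]; exact hc) hQ)).mono (by simp [Pr.bd]; omega),
        by simpa [run, hc] using hR₂, fun r hr hr' => (hk₂ r hr hr').trans (hk₁ r (.inr hr'))⟩
  | loop p P ih =>
    have hw' : ∀ q ∈ P.lv, q ∉ P.wv := fun q hq => hw q (by simp [Pr.lv, hq])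
    have key : ∀ n (s : LState ν α) σ, Rel Λ base s σ → (∀ q ∈ P.lv, s.v q ≤ B q) →
        σ.reg (2 * t + 1) = n → ∃ σ', Reaches (.loop (2 * t + 1) (.seq (comp Λ (t + 1) P)
          (.seq (.const (2 * t + 3) 1) (.sub (2 * t + 1) (2 * t + 1) (2 * t + 3))))) σ
          (1 + n * (P.bd B + 3)) σ' ∧ Rel Λ base ((run P)^[n] s) σ' ∧ KeepsTemp t σ σ' := by
      intro n
      induction n with
      | zero =>
        intro s σ h _ hn
        exact ⟨σ, (Reaches.of_exec (.loop_done hn)).mono (by omega), h, fun _ _ _ => rfl⟩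
      | succ n ihn =>
        intro s σ h hB hn
        obtain ⟨σ₁, hP, hR₁, hk₁⟩ := ih (t + 1) s σ (by omega) h hB hw'
        have hn₁ : σ₁.reg (2 * t + 1) = n + 1 := by rw [hk₁ _ (by omega) (by omega), hn]
        let σ₂ : State :=
          ⟨Function.update (Function.update σ₁.reg (2 * t + 3) 1) (2 * t + 1) n, σ₁.mem⟩
        have hR₂ : Rel Λ base (run P s) σ₂ := by
          refine hR₁.of_keeps ht rfl fun r hr => ?_
          simp only [σ₂, Function.update_apply]
          rw [if_neg (by omega), if_neg (by omega)]
        obtain ⟨σ₃, hL, hR₃, hk₃⟩ := ihn (run P s) σ₂ hR₂ (fun q hq => by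
          rw [run_v P s (hw' q hq)]; exact hB q hq) (by simp [σ₂])
        refine ⟨σ₃, (Reaches.loop_step (U := 1 + n * (P.bd B + 3)) (by omega) (hP.seq (.seq (.of_exec (.const ..))
          (.of_exec (.sub ..)))) ?_).mono ?_, by rw [Function.iterate_succ_apply]; exact hR₃,
          fun r hr hr' => ?_⟩
        · convert hL using 3
          simp [hn₁]
        · ring_nf; omega
        · rw [hk₃ r hr hr']
          simp only [σ₂, Function.update_apply]
          rw [if_neg (by omega), if_neg (by omega), hk₁ r hr (by omega)]
    have hR₀ : Rel Λ base s { σ with reg := Function.update σ.reg (2 * t + 1) (s.v p) } := by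
      refine h.of_keeps ht rfl fun r hr => ?_
      simp only [Function.update_apply]
      rw [if_neg (by omega)]
    obtain ⟨σ', hL, hR', hk'⟩ := key (s.v p) s _ hR₀ (fun q hq => hB q (by simp [Pr.lv, hq]))
      (by simp)
    refine ⟨σ', (Reaches.seq (.of_exec (.add ..)) (?_ : Reaches _ _ (1 + s.v p * (P.bd B + 3)) _)).mono
      ?_, hR', fun r hr hr' => ?_⟩
    · convert hL using 3
      rw [h.v, h.three, add_zero]
    · have := Nat.mul_le_mul_right (P.bd B + 3) (hB p (by simp [Pr.lv]))
      simp only [Pr.bd]; omega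
    · rw [hk' r hr hr']
      simp only [Function.update_apply]
      rw [if_neg (by omega)]

end Compile

end LoopProg

namespace LoopProg

open RAM

variable {ν α : Type}

/-! ### Input and output of compiled programs -/

section InOut

variable (Λ : Layout ν α)

/-- Sets the base address to the length of the input, and copies the input into the array `b`. The
copying goes downwards, and its target is above the input. -/
def loadInput (b : α) : Program :=
  .seq (.add 1 0 3) <| .seq (.add 5 0 3) <| .loop 5 <|
    .seq (.const 7 1) <| .seq (.sub 5 5 7) <| .seq (.load 11 5) <| .seq (.add 7 5 3) <|
    .seq (addrOf Λ b 7) (.store 7 11)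

/-- Moves the cells `0, …, reg 0 - 1` of the array `b` into consecutive addresses from `base` on. The
cell `i` moves from the address `base + 32 * i + slot b` down to `base + i`, so that no cell is
overwritten before it is read. -/
def storeOutput (b : α) (len : ν) : Program :=
  .seq (.add 0 (2 * Λ.reg len) 3) <| .seq (.add 5 0 3) <| .seq (.const 11 0) <| .loop 5 <|
    .seq (.add 7 11 3) <| .seq (addrOf Λ b 7) <| .seq (.load 7 7) <| .seq (.add 9 11 1) <|
    .seq (.store 9 7) <| .seq (.const 7 1) <| .seq (.add 11 11 7) <| .sub 5 5 7

variable {Λ}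

/-- After the input has been copied, all even registers but register 0 are zero, and so are all
arrays but `b`, for the memory of the machine is zero above the input. -/
theorem loadInput_reaches [DecidableEq α] (b : α) (input : List ℕ) :
    ∃ σ, Reaches (loadInput Λ b) (init input) (3 + 14 * input.length) σ ∧ σ.reg 1 = input.length ∧
      (∀ r, r % 2 = 0 ∨ r = 3 → σ.reg r = if r = 0 then input.length else 0) ∧
      ∀ b' i, σ.mem (input.length + 32 * i + Λ.slot b') =
        if b' = b then input.getD i 0 else 0 := by
  have key : ∀ n ≤ input.length, ∀ σ : State, σ.reg 5 = n → σ.reg 1 = input.length →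
      (∀ r, r % 2 = 0 ∨ r = 3 → σ.reg r = if r = 0 then input.length else 0) →
      (∀ i, i < input.length → σ.mem i = input.getD i 0) →
      (∀ b' i, σ.mem (input.length + 32 * i + Λ.slot b') =
        if b' = b ∧ n ≤ i then input.getD i 0 else 0) →
      ∃ σ', Reaches (.loop 5 <|
        .seq (.const 7 1) <| .seq (.sub 5 5 7) <| .seq (.load 11 5) <| .seq (.add 7 5 3) <|
        .seq (addrOf Λ b 7) (.store 7 11)) σ (1 + 14 * n) σ' ∧ σ'.reg 1 = input.length ∧
      (∀ r, r % 2 = 0 ∨ r = 3 → σ'.reg r = if r = 0 then input.length else 0) ∧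
      ∀ b' i, σ'.mem (input.length + 32 * i + Λ.slot b') =
        if b' = b then input.getD i 0 else 0 := by
    intro n
    induction n with
    | zero =>
      intro _ σ h5 h1 he hm ha
      exact ⟨σ, (Reaches.of_exec (.loop_done h5)).mono (by omega), h1, he, by simpa using ha⟩
    | succ n ih =>
      intro hn σ h5 h1 he hm ha
      let σ₁ : State := ⟨Function.update (Function.update (Function.update (Function.update σ.reg
        7 1) 5 n) 11 (input.getD n 0)) 7 n, σ.mem⟩
      obtain ⟨σ₂, hA, hm₂, hv₂, hk₂⟩ := addrOf_reaches' (Λ := Λ) b 7 (by omega) σ₁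
      have hone : σ₁.reg 1 = input.length := by simp [σ₁, h1]
      have hseven : σ₁.reg 7 = n := by simp [σ₁]
      rw [hone, hseven] at hv₂
      have e11 : σ₂.reg 11 = input.getD n 0 := by rw [hk₂ 11 (by omega) (by omega)]; simp [σ₁]
      have hbody : Reaches (.seq (.const 7 1) <| .seq (.sub 5 5 7) <| .seq (.load 11 5) <|
          .seq (.add 7 5 3) <| .seq (addrOf Λ b 7) (.store 7 11)) σ 13
          ⟨σ₂.reg, Function.update σ₂.mem (σ₂.reg 7) (σ₂.reg 11)⟩ := by
        refine (Reaches.seq (.of_exec (.const ..)) (Reaches.seq (.of_exec (.sub ..)) (Reaches.seq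
          (.of_exec (.load ..)) (Reaches.seq (.of_exec (.add ..)) (?_ : Reaches _ _ 9 _))))).mono
          (by omega)
        refine Reaches.seq (T := 8) (σ' := σ₂) ?_ (.of_exec (.store ..))
        convert hA using 2
        have h3 := he 3 (by omega)
        funext r
        have hmn := hm n (by omega)
        simp [Function.update_apply, h5, h3, hmn]
      obtain ⟨σ₃, hL, h1₃, he₃, ha₃⟩ := ih (by omega)
        ⟨σ₂.reg, Function.update σ₂.mem (σ₂.reg 7) (σ₂.reg 11)⟩
        (by simp only; rw [hk₂ 5 (by omega) (by omega)]; simp [σ₁])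
        (by simp only; rw [hk₂ 1 (by omega) (by omega), hone])
        (fun r hr => by
          simp only
          rw [hk₂ r (by omega) (by omega), ← he r hr]
          simp only [σ₁, Function.update_apply]
          rw [if_neg (by omega), if_neg (by omega), if_neg (by omega), if_neg (by omega)])
        (fun i hi => by
          simp only [hv₂, Function.update_apply]
          rw [if_neg (by omega), hm₂]
          exact hm i hi)
        (fun b' i => by
          simp only [hv₂, e11, Function.update_apply, hm₂]
          have l1 := Λ.slot_lt b
          have l2 := Λ.slot_lt b'
          simp only [stride] at l1 l2
          by_cases hb : b' = b
          · subst hb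
            by_cases hi : i = n
            · subst hi; simp
            · rw [if_neg (by omega)]
              have : σ₁.mem = σ.mem := rfl
              rw [this, ha]
              congr 1
              simp only [true_and, eq_iff_iff]
              omega
          · have : Λ.slot b' ≠ Λ.slot b := fun hh => hb (Λ.slot_inj hh)
            rw [if_neg (by omega)]
            have : σ₁.mem = σ.mem := rfl
            rw [this, ha]
            simp [hb])
      exact ⟨σ₃, (Reaches.loop_step (by omega) hbody hL).mono (by omega), h1₃, he₃, ha₃⟩
  obtain ⟨σ, hL, h1, he, ha⟩ := key input.length le_rfl
    ⟨Function.update (Function.update (init input).reg 1 input.length) 5 input.length,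
      (init input).mem⟩ (by simp) (by simp) (fun r hr => by
        simp only [Function.update_apply, init]
        rw [if_neg (by omega), if_neg (by omega)])
    (fun i _ => rfl) (fun b' i => by
      simp only [init]
      split_ifs with h
      · rw [List.getD_eq_default _ _ (by omega), List.getD_eq_default _ _ (by omega)]
      · exact List.getD_eq_default _ _ (by omega))
  refine ⟨σ, (Reaches.seq (.of_exec (.add ..)) (Reaches.seq (.of_exec (.add ..))
    (?_ : Reaches _ _ (1 + 14 * input.length) _))).mono (by omega), h1, he, ha⟩
  convert hL using 3 <;> simp [init]

theorem storeOutput_reaches [DecidableEq α] {base : ℕ} {s : LState ν α} {σ : State}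
    (h : Rel Λ base s σ) (b : α) (len : ν) :
    ∃ σ', Reaches (storeOutput Λ b len) σ (4 + 19 * s.v len) σ' ∧ σ'.reg 0 = s.v len ∧
      ∀ i < s.v len, σ'.mem (σ'.reg 1 + i) = s.a b i := by
  have key : ∀ n ≤ s.v len, ∀ σ : State, σ.reg 5 = n → σ.reg 11 = s.v len - n → σ.reg 1 = base →
      σ.reg 3 = 0 → σ.reg 0 = s.v len → (∀ i < s.v len - n, σ.mem (base + i) = s.a b i) →
      (∀ i, s.v len - n ≤ i → σ.mem (base + 32 * i + Λ.slot b) = s.a b i) →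
      ∃ σ', Reaches (.loop 5 <|
    .seq (.add 7 11 3) <| .seq (addrOf Λ b 7) <| .seq (.load 7 7) <| .seq (.add 9 11 1) <|
    .seq (.store 9 7) <| .seq (.const 7 1) <| .seq (.add 11 11 7) <| .sub 5 5 7) σ (1 + 19 * n) σ' ∧
      σ'.reg 0 = s.v len ∧ σ'.reg 1 = base ∧ ∀ i < s.v len, σ'.mem (base + i) = s.a b i := by
    intro n
    induction n with
    | zero =>
      intro _ σ h5 h11 h1 h3 h0 hlo hhi
      exact ⟨σ, (Reaches.of_exec (.loop_done h5)).mono (by omega), h0, h1, by simpa using hlo⟩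
    | succ n ih =>
      intro hn σ h5 h11 h1 h3 h0 hlo hhi
      obtain ⟨j, hj⟩ : ∃ j, j = s.v len - (n + 1) := ⟨_, rfl⟩
      rw [← hj] at h11 hlo hhi
      let σ₁ : State := ⟨Function.update σ.reg 7 j, σ.mem⟩
      obtain ⟨σ₂, hA, hm₂, hv₂, hk₂⟩ := addrOf_reaches' (Λ := Λ) b 7 (by omega) σ₁
      have hone : σ₁.reg 1 = base := by simp [σ₁, h1]
      have hseven : σ₁.reg 7 = j := by simp [σ₁]
      rw [hone, hseven] at hv₂
      have e7 : σ₂.mem (σ₂.reg 7) = s.a b j := by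
        rw [hv₂, hm₂]; exact hhi j le_rfl
      have g : ∀ r, r ≠ 7 → r ≠ 9 → σ₂.reg r = σ.reg r := fun r h7 h9 => by
        rw [hk₂ r h7 h9]; simp [σ₁, h7]
      let σ₃ : State := ⟨Function.update (Function.update (Function.update (Function.update
        (Function.update σ₂.reg 7 (s.a b j)) 9 (j + base)) 7 1) 11 (j + 1)) 5 n,
        Function.update σ.mem (j + base) (s.a b j)⟩
      have hbody : Reaches (.seq (.add 7 11 3) <| .seq (addrOf Λ b 7) <| .seq (.load 7 7) <|
          .seq (.add 9 11 1) <| .seq (.store 9 7) <| .seq (.const 7 1) <| .seq (.add 11 11 7) <|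
          .sub 5 5 7) σ 18 σ₃ := by
        refine (Reaches.seq (.of_exec (.add ..)) (Reaches.seq (σ' := σ₂) (T := 8) ?_
          (?_ : Reaches _ _ 6 σ₃))).mono (by omega)
        · convert hA using 2
          simp [h11, h3]
        · have := Reaches.seq (.of_exec (.load 7 7 σ₂)) (Reaches.seq (.of_exec (.add 9 11 1 _))
            (Reaches.seq (.of_exec (.store 9 7 _)) (Reaches.seq (.of_exec (.const 7 1 _))
            (Reaches.seq (.of_exec (.add 11 11 7 _)) (.of_exec (.sub 5 5 7 _))))))
          convert this.mono _ using 1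
          · simp only [e7, g 11 (by omega) (by omega), g 1 (by omega) (by omega),
              g 5 (by omega) (by omega), h11, h1, h5, σ₃, ne_eq, Nat.reduceEqDiff,
              not_false_eq_true, Function.update_of_ne, Function.update_self, hm₂]
            simp [σ₁]
          · omega
      obtain ⟨σ₄, hL, h⟩ := ih (by omega) σ₃ (by simp [σ₃]) (by simp [σ₃]; omega)
        (by simp [σ₃, g, h1]) (by simp [σ₃, g, h3]) (by simp [σ₃, g, h0])
        (fun i hi => by
          simp only [σ₃, Function.update_apply]
          by_cases hij : i = j
          · subst hij; rw [if_pos (by omega)]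
          · rw [if_neg (by omega)]; exact hlo i (by omega))
        (fun i hi => by
          simp only [σ₃, Function.update_apply]
          rw [if_neg (by omega)]; exact hhi i (by omega))
      exact ⟨σ₄, (Reaches.loop_step (by omega) hbody hL).mono (by omega), h⟩
  obtain ⟨σ', hL, h0', h1', hm'⟩ := key (s.v len) le_rfl
    ⟨Function.update (Function.update (Function.update σ.reg 0 (s.v len)) 5 (s.v len)) 11 0, σ.mem⟩
    (by simp) (by simp) (by simp [h.one]) (by simp [h.three]) (by simp) (fun i hi => by omega)
    (fun i _ => h.a b i)
  refine ⟨σ', (Reaches.seq (.of_exec (.add ..)) (Reaches.seq (.of_exec (.add ..)) (Reaches.seq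
    (.of_exec (.const ..)) (?_ : Reaches _ _ (1 + 19 * s.v len) _)))).mono (by omega), h0', ?_⟩
  · convert hL using 3
    simp [h.v, h.three]
  · rw [h1']; exact hm'

/-- The machine program that loads the input, runs a loop program, and delivers the first `len`
cells of the array `bo` as the output. -/
def toRAM (Λ : Layout ν α) (bi bo : α) (len : ν) (P : Pr ν α) : Program :=
  .seq (loadInput Λ bi) (.seq (comp Λ 2 P) (storeOutput Λ bo len))

end InOut

/-- The initial state of a loop program: the input in an array, its length in a variable. -/
def initState [DecidableEq ν] [DecidableEq α] (bi : α) (x : ν) (input : List ℕ) : LState ν α where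
  v y := if y = x then input.length else 0
  a b i := if b = bi then input.getD i 0 else 0

/-- The compiled program `P`, started in `s`, halts within `T` steps. -/
def RunsIn [DecidableEq ν] [DecidableEq α] (Λ : Layout ν α) (P : Pr ν α) (s : LState ν α) (T : ℕ) :
    Prop :=
  ∀ base σ, Rel Λ base s σ → ∃ σ', Reaches (comp Λ 2 P) σ T σ' ∧ Rel Λ base (run P s) σ'

section RunsIn

variable [DecidableEq ν] [DecidableEq α] {Λ : Layout ν α}

theorem RunsIn.seq {P Q : Pr ν α} {s : LState ν α} {T U : ℕ} (h : RunsIn Λ P s T)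
    (h' : RunsIn Λ Q (run P s) U) : RunsIn Λ (P;;Q) s (T + U) := by
  intro base σ hσ
  obtain ⟨σ₁, h1, hR₁⟩ := h base σ hσ
  obtain ⟨σ₂, h2, hR₂⟩ := h' base σ₁ hR₁
  exact ⟨σ₂, h1.seq h2, hR₂⟩

/-- A program whose loop variables are bounded by `B` and are not changed by it runs within the
syntactic bound. -/
theorem RunsIn.of_bd {P : Pr ν α} {s : LState ν α} (B : ν → ℕ) (hB : ∀ p ∈ P.lv, s.v p ≤ B p)
    (hw : ∀ p ∈ P.lv, p ∉ P.wv) : RunsIn Λ P s (P.bd B) := by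
  intro base σ hσ
  obtain ⟨σ', h1, h2, -⟩ := comp_reaches B P 2 s σ le_rfl hσ hB hw
  exact ⟨σ', h1, h2⟩

/-- The machine program outputs what the loop program has written to the array `bo`. The machine
starts with the length of the input in register 0, so this has to be the register of the variable
`x`. -/
theorem toRAM_outputs {bi bo : α} {x len : ν} {P : Pr ν α} {input : List ℕ} {T : ℕ}
    (hx : Λ.reg x = 0) (h : RunsIn Λ P (initState bi x input) T) :
    ∃ T' ≤ 7 + 14 * input.length + T + 19 * (run P (initState bi x input)).v len,
      (toRAM Λ bi bo len P).Outputs input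
        ((List.range ((run P (initState bi x input)).v len)).map fun i =>
          (run P (initState bi x input)).a bo i) T' := by
  obtain ⟨σ₁, h1, hb, hr, hm⟩ := loadInput_reaches (Λ := Λ) bi input
  have hR₁ : Rel Λ input.length (initState bi x input) σ₁ := by
    refine ⟨fun y => ?_, fun b i => ?_, hb, by simp [hr]⟩
    · rw [hr _ (by omega)]
      by_cases hy : y = x
      · subst hy; simp [hx, initState]
      · have : Λ.reg y ≠ 0 := fun hh => hy (Λ.reg_inj (hh.trans hx.symm))
        simp [initState, hy, this]
    · simp [hm, initState]
  obtain ⟨σ₂, h2, hR⟩ := h input.length σ₁ hR₁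
  obtain ⟨σ₃, h3, h0, hm₃⟩ := storeOutput_reaches hR bo len
  obtain ⟨T', hT', hE⟩ := h1.seq (h2.seq h3)
  refine ⟨T', by omega, σ₃, hE, ?_⟩
  rw [h0]
  exact List.map_congr_left fun i hi => (hm₃ i (by simpa using hi)).symm

end RunsIn

/-! ### Running times -/

section Time

variable [DecidableEq ν] [DecidableEq α]

/-- Whether every loop of the program is bounded by a variable that is not in `big`. -/
def Pr.noBig (big : List ν) (P : Pr ν α) : Bool := P.lv.all fun p => !(big.contains p)

/-- Whether loops that are bounded by variables in `big` are never nested. -/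
def Pr.oneBig (big : List ν) : Pr ν α → Bool
  | .skip => true
  | .set _ _ => true
  | .wr _ _ _ => true
  | .seq P Q => P.oneBig big && Q.oneBig big
  | .branch _ P Q => P.oneBig big && Q.oneBig big
  | .loop p P => if big.contains p then P.noBig big else P.oneBig big

/-- The constant factor of the running time of a program. -/
def Pr.weight : Pr ν α → ℕ
  | .skip => 1
  | .set _ e => e.cost + 1
  | .wr _ i e => i.cost + e.cost + 9
  | .seq P Q => P.weight + Q.weight
  | .branch e P Q => e.cost + P.weight + Q.weight + 1
  | .loop _ P => P.weight + 5

/-- The nesting depth of the loops of a program. -/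
def Pr.depth : Pr ν α → ℕ
  | .skip => 0
  | .set _ _ => 0
  | .wr _ _ _ => 0
  | .seq P Q => max P.depth Q.depth
  | .branch _ P Q => max P.depth Q.depth
  | .loop _ P => P.depth + 1

omit [DecidableEq ν] [DecidableEq α] in
/-- The common step of the two time bounds: a factor `X` for each loop body, one more for the loop. -/
theorem bd_loop_le {w X B S Y : ℕ} (hX : X ≤ w * Y) (hB : B ≤ S) (hS : 1 ≤ S) (hY : 1 ≤ Y) :
    2 + B * (X + 3) ≤ (w + 5) * (Y * S) := by
  have h1 : B * (X + 3) ≤ S * (w * Y + 3) := Nat.mul_le_mul hB (by omega)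
  have h2 : 1 ≤ Y * S := Nat.mul_pos hY hS
  have h3 : S ≤ Y * S := Nat.le_mul_of_pos_left _ hY
  nlinarith

omit [DecidableEq α] in
/-- The running time of a program without big loops: each level of nesting contributes a factor `S`.
-/
theorem Pr.bd_le_of_noBig {big : List ν} {B : ν → ℕ} {S : ℕ} (hS : 1 ≤ S)
    (hB : ∀ p, p ∉ big → B p ≤ S) (P : Pr ν α) (h : P.noBig big = true) :
    P.bd B ≤ P.weight * S ^ P.depth := by
  have hpow : ∀ n, 1 ≤ S ^ n := fun n => Nat.one_le_pow _ _ hS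
  induction P with
  | skip => simp [Pr.bd, Pr.weight, Pr.depth]
  | set x e => simp [Pr.bd, Pr.weight, Pr.depth]
  | wr b i e => simp [Pr.bd, Pr.weight, Pr.depth]
  | seq P Q ihP ihQ =>
    simp only [Pr.noBig, Pr.lv, List.all_append, Bool.and_eq_true] at h
    have h1 := ihP h.1
    have h2 := ihQ h.2
    have h3 := Nat.mul_le_mul_left P.weight (Nat.pow_le_pow_right hS (le_max_left P.depth Q.depth))
    have h4 := Nat.mul_le_mul_left Q.weight (Nat.pow_le_pow_right hS (le_max_right P.depth Q.depth))
    simp only [Pr.bd, Pr.weight, Pr.depth, add_mul]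
    omega
  | branch e P Q ihP ihQ =>
    simp only [Pr.noBig, Pr.lv, List.all_append, Bool.and_eq_true] at h
    have h1 := ihP h.1
    have h2 := ihQ h.2
    have h3 := Nat.mul_le_mul_left P.weight (Nat.pow_le_pow_right hS (le_max_left P.depth Q.depth))
    have h4 := Nat.mul_le_mul_left Q.weight (Nat.pow_le_pow_right hS (le_max_right P.depth Q.depth))
    have h5 := Nat.mul_le_mul_left (e.cost + 1) (hpow (max P.depth Q.depth))
    simp only [Pr.bd, Pr.weight, Pr.depth, add_mul] at *
    omega
  | loop p P ih =>
    simp only [Pr.noBig, Pr.lv, List.all_cons, Bool.and_eq_true, Bool.not_eq_true',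
      List.contains_eq_mem, decide_eq_false_iff_not] at h
    simp only [Pr.bd, Pr.weight, Pr.depth, pow_succ]
    exact bd_loop_le (ih (by simpa [Pr.noBig] using h.2)) (hB p h.1) hS (hpow _)

omit [DecidableEq α] in
/-- A program without nested loops over big variables runs in time linear in the big variables. -/
theorem Pr.bd_le_of_oneBig {big : List ν} {B : ν → ℕ} {S G : ℕ} (hS : 1 ≤ S) (hG : 1 ≤ G)
    (hB : ∀ p, p ∉ big → B p ≤ S) (hB' : ∀ p ∈ big, B p ≤ S * G) (P : Pr ν α)
    (h : P.oneBig big = true) :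
    P.bd B ≤ P.weight * (S ^ P.depth * G) := by
  have hpow : ∀ n, 1 ≤ S ^ n * G := fun n => Nat.mul_pos (Nat.one_le_pow _ _ hS) hG
  induction P with
  | skip => simpa [Pr.bd, Pr.weight, Pr.depth] using hG
  | set x e => simpa [Pr.bd, Pr.weight, Pr.depth] using Nat.mul_le_mul_left (e.cost + 1) hG
  | wr b i e => simpa [Pr.bd, Pr.weight, Pr.depth] using Nat.mul_le_mul_left (i.cost + e.cost + 9) hG
  | seq P Q ihP ihQ =>
    simp only [Pr.oneBig, Bool.and_eq_true] at h
    have h1 := ihP h.1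
    have h2 := ihQ h.2
    have h3 := Nat.mul_le_mul_left P.weight (Nat.mul_le_mul_right G
      (Nat.pow_le_pow_right hS (le_max_left P.depth Q.depth)))
    have h4 := Nat.mul_le_mul_left Q.weight (Nat.mul_le_mul_right G
      (Nat.pow_le_pow_right hS (le_max_right P.depth Q.depth)))
    simp only [Pr.bd, Pr.weight, Pr.depth, add_mul]
    omega
  | branch e P Q ihP ihQ =>
    simp only [Pr.oneBig, Bool.and_eq_true] at h
    have h1 := ihP h.1
    have h2 := ihQ h.2
    have h3 := Nat.mul_le_mul_left P.weight (Nat.mul_le_mul_right G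
      (Nat.pow_le_pow_right hS (le_max_left P.depth Q.depth)))
    have h4 := Nat.mul_le_mul_left Q.weight (Nat.mul_le_mul_right G
      (Nat.pow_le_pow_right hS (le_max_right P.depth Q.depth)))
    have h5 := Nat.mul_le_mul_left (e.cost + 1) (hpow (max P.depth Q.depth))
    simp only [Pr.bd, Pr.weight, Pr.depth, add_mul] at *
    omega
  | loop p P ih =>
    simp only [Pr.oneBig] at h
    simp only [Pr.bd, Pr.weight, Pr.depth, pow_succ]
    split_ifs at h with hp
    · have h1 := Pr.bd_le_of_noBig hS hB P h
      have := bd_loop_le h1 (hB' p (by simpa using hp)) (Nat.mul_pos hS hG)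
        (Nat.one_le_pow P.depth _ hS)
      rwa [mul_assoc (S ^ P.depth)]
    · have := bd_loop_le (ih h) (hB p (by simpa using hp)) hS (hpow _)
      rwa [mul_right_comm (S ^ P.depth)] at this

end Time

/-! ### The separator synthesis program -/

/-- The variables of the synthesis program. They fall into four groups.

* Constants of the problem and of the input: `len` is the length of the input, `k` the number of
  variables of the logic, `J` the number of symbols of the signature, `R` a strict bound for the
  arities, for `k` and for `J`, `NC` the number of symbols of the ranked alphabet, and `CB` the code of
  the first symbol of the signature.
* Quantities of the instance: `m` structures, of which the first `np` are positive, `n` the largest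
  size, `nk = n ^ k`, `N` the number of points, `b = n + 2` the base and `E = N + k + 1` the number of
  digits of a value, `V = b ^ E` the number of values, `VR = V ^ R` the number of tuples of values, and
  `MV = 2 * len * V` a bound for the number of pairs of an item and a value; `st` is the item of the
  start symbol.
* State of the saturation: `t` and `tail` delimit the entries of the queue that still have to be
  handled, `nd` is the number of nodes of the graph, and `wl` the number of words written for it.
* All others are counters, addresses and intermediate results. -/
inductive Var
  -- `len` is the first, because the machine receives the length of the input in register 0
  | len | k | J | R | NC | CB
  | m | np | n | nk | N | b | E | V | VR | MV
  | pos | base | sz | pw | i | A | w | st | nn | sp | lhs | p | j | idx | mi | qq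
  | tc | tail | nd | wl | u | t | v | cd | ce | to | c | ar | pR | tau | q | r | ok | oE | ch | e
  | op | x | o | px | d | val
  deriving DecidableEq

/-- The arrays of the synthesis program; the entry `0` stands for none in the arrays of items.

* `IN` is the input.
* Indexed by codes of symbols: the arity `AR`, the kinds `K0` of the first and `K1` of the other
  children, the kind `RK` of the result, the number `OP` of the operation, and its parameter `OA`.
* Indexed by `a * R + i` for structure number `a`: the power `PW` of its size with exponent `i`, and
  the address `TAB` of the table of symbol number `i`.
* Indexed by points: the offset `SB = a * R` of the structure, the number `AI` of the assignment, and
  the truth value `POS` of the structure being positive.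
* `SKp` and `SKj` are the stack of the places, given by a parent and a child position, where the next
  subtrees of a right-hand side belong.
* Indexed by items: the parent `PA` of a subtree, whether the item is an inner node (`ND`), the
  left-hand side `CP` if the item is the root of a right-hand side, and the next occurrence `NX` of the
  same nonterminal. `CH` at `p * R + j` is the child number `j` of the item `p`.
* `QU` and `QV` are the items and the values in the queue. At `u * V + v`, for the item `u` and the
  value `v`, the array `MK` marks the known pairs, `DP` is the node of the graph that witnesses the pair,
  and `DE` is the end of the encoding of this node. `DW` is the answer.
* `D` holds the digits of the values of the children, `CD` their nodes of the graph, and `RS` the digits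
  of the result. -/
inductive Arr
  | IN | AR | K0 | K1 | RK | OP | OA
  | PW | TAB | SB | AI | POS
  | SKp | SKj | CP | PA | CH | ND | NX
  | QU | QV | MK | DP | DE | DW
  | D | CD | RS
  deriving DecidableEq

/-- Registers and memory slots of the synthesis program. -/
def layout : Layout Var Arr where
  reg := Var.ctorIdx
  slot := Arr.ctorIdx
  reg_inj := Function.LeftInverse.injective Var.ofNat_ctorIdx
  slot_inj := Function.LeftInverse.injective Arr.ofNat_ctorIdx
  slot_lt b := by cases b <;> decide

/-- Expressions of the synthesis program. -/
abbrev Expr' := Ex Var Arr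

/-- Statements of the synthesis program. -/
abbrev Prog := Pr Var Arr

/-- States of the synthesis program. -/
abbrev PState := LState Var Arr

namespace Prog

/-- The variable `y` as an expression. -/
abbrev rv (y : Var) : Expr' := .v y

prefix:max "§" => rv

/-- Array access as an expression. -/
abbrev rd (a : Arr) (e : Expr') : Expr' := .rd a e

instance : Add Expr' := ⟨.add⟩

instance : Sub Expr' := ⟨.sub⟩

instance (n : ℕ) : OfNat Expr' n := ⟨.c n⟩

/-- The truth value of `e < f`. -/
def ltE (e f : Expr') : Expr' := .ite (.sub f e) (.c 1) (.c 0)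

/-- The truth value of `e = f`. -/
def eqE (e f : Expr') : Expr' := .ite (.add (.sub e f) (.sub f e)) (.c 0) (.c 1)

/-- Choice by the value of the first expression. -/
abbrev iteE (b e f : Expr') : Expr' := .ite b e f

open Pr (skip set wr branch loop)

/-- `a := y * z`, by at most `bnd` additions. -/
def mul (a y z bnd : Var) : Prog :=
  set a 0;; set .mi 0;;
  loop bnd (set a (iteE (ltE (§.mi) (rv z)) (rv a + rv y) (rv a));; set .mi (§.mi + 1))

/-- Division with remainder, by at most `bnd` subtractions: `qq` receives the quotient of `a` by `y`,
and `a` the remainder. -/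
def divmod (a y bnd : Var) : Prog :=
  set .qq 0;; loop bnd (branch (ltE (rv a) (rv y)) skip (set a (rv a - rv y);; set .qq (§.qq + 1)))

/-- `a := ` the number of ones in the input from the address `pos` on. -/
def unary (a : Var) : Prog :=
  set a 0;; loop .len (set a (rv a + eqE (rd .IN (§.pos + rv a)) 1))

/-- Writes one power of the size, and computes the next one. -/
def powBody : Prog :=
  wr .PW (§.base + §.i) (§.pw);; mul .w .pw .sz .len;; set .pw (§.w);; set .i (§.i + 1)

/-- Records the address of one table, and skips the table. -/
def tabBody : Prog :=
  wr .TAB (§.base + §.i) (§.pos);;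
  set .pos (§.pos + rd .PW (§.base + rd .AR (§.CB + §.i)));; set .i (§.i + 1)

/-- Reads one structure: the powers of its size, and the addresses of its tables. -/
def readStruct : Prog :=
  unary .sz;;
  set .pos (§.pos + §.sz + 1);;
  set .pw 1;; set .i 0;;
  loop .R powBody;; set .i 0;; loop .J tabBody;;
  set .base (§.base + §.R);;
  set .n (iteE (ltE (§.n) (§.sz)) (§.sz) (§.n))

/-- Reads the numbers of positive and of all structures. -/
def readHeader : Prog :=
  set .m (rd .IN 0 + rd .IN 1);; set .np (rd .IN 0);; set .pos 2;; set .base 0;; set .n 0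

/-- Reads all structures. -/
def readStructs : Prog := loop .m readStruct

/-- Computes `n ^ k`. -/
def computeNK : Prog := set .nk 1;; loop .k (mul .w .nk .n .n;; set .nk (§.w))

/-- Appends the point with assignment number `i`, if the structure has so many assignments. -/
def pointBody : Prog :=
  branch (ltE (§.i) (rd .PW (§.base + §.k)))
    (wr .SB (§.N) (§.base);; wr .AI (§.N) (§.i);; wr .POS (§.N) (ltE (§.A) (§.np));;
      set .N (§.N + 1)) skip;;
  set .i (§.i + 1)

/-- Lists the points of one structure. -/
def structPoints : Prog :=
  set .i 0;; loop .nk pointBody;; set .base (§.base + §.R);; set .A (§.A + 1)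

/-- Lists the pairs of a structure and an assignment. -/
def listPoints : Prog :=
  set .N 0;; set .base 0;; set .A 0;;
  loop .m structPoints

/-- Computes the base and the number of the digits. Base `n + 2` leaves room for truth values even
if `n = 0`. -/
def computeBE : Prog := set .b (§.n + 2);; set .E (§.N + §.k + 1)

/-- Computes the number of values, `b ^ E`. -/
def computeV : Prog := set .V 1;; loop .E (mul .w .V .b .b;; set .V (§.w))

/-- Computes the number of tuples of values, `V ^ R`. -/
def computeVR : Prog := set .VR 1;; loop .R (mul .w .VR .V .V;; set .VR (§.w))

/-- Computes a bound for the number of pairs of an item and a value. Positions in the input are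
items, and the nonterminals follow them, so that there are at most `2 * len` items. -/
def computeMV : Prog := set .w (§.len + §.len);; mul .MV .w .V .V

/-- Puts the places of the children of the node at `pos` on the stack, the first one on top. -/
def pushSlot : Prog :=
  branch (§.ar) (set .ar (§.ar - 1);; wr .SKp (§.sp) (§.pos);; wr .SKj (§.sp) (§.ar);;
    set .sp (§.sp + 1)) skip

/-- Handles one word of the rules. The stack holds the places where the next trees have to be put: a
parent and a child position, or the parent `0` for the root of a right-hand side. -/
def readWord : Prog :=
  set .w (rd .IN (§.pos));;
  branch (§.sp)
    (set .sp (§.sp - 1);; set .p (rd .SKp (§.sp));; set .j (rd .SKj (§.sp));;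
      branch (§.p)
        (wr .PA (§.pos) (§.p);; mul .idx .p .R .R;; wr .CH (§.idx + §.j) (§.pos))
        (wr .CP (§.pos) (§.len + §.lhs));;
      branch (ltE (§.w) (§.NC))
        (wr .ND (§.pos) 1;; set .ar (rd .AR (§.w));;
          loop .R pushSlot)
        (set .idx (§.len + (§.w - §.NC));; wr .NX (§.pos) (rd .NX (§.idx));;
          wr .NX (§.idx) (§.pos)))
    (set .lhs (§.w);; wr .SKp 0 0;; set .sp 1)

/-- Handles the word at `pos`, if there is one. -/
def wordStep : Prog := branch (ltE (§.pos) (§.len)) (readWord;; set .pos (§.pos + 1)) skip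

/-- Reads the grammar. The item of a position of a right-hand side is its address in the input, and
the item of a nonterminal is its number plus the length of the input. -/
def readGrammar : Prog :=
  unary .nn;; set .pos (§.pos + §.nn + 1);; set .st (§.len + rd .IN (§.pos));;
  set .pos (§.pos + 2);; set .sp 0;;
  loop .len wordStep

/-- Records that item `to` has the value `v`, with the graph node `cd`, unless this is known. -/
def push : Prog :=
  branch (§.to)
    (mul .idx .to .V .V;; set .idx (§.idx + §.v);;
      branch (rd .MK (§.idx)) skip
        (wr .MK (§.idx) 1;; wr .DP (§.idx) (§.cd);; wr .DE (§.idx) (§.ce);;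
          wr .QU (§.tail) (§.to);; wr .QV (§.tail) (§.v);; set .tail (§.tail + 1)))
    skip

/-- Adds the contribution of one argument to the index of the table entry. -/
def tabValBody : Prog :=
  branch (ltE (§.j) (§.ar))
    (set .d (rd .D (§.o));; set .px (rd .PW (§.base + §.j));; mul .idx .px .d .b;;
      set .w (§.w + §.idx)) skip;;
  set .o (§.o + §.E);; set .j (§.j + 1)

/-- The value of the symbol at a point when the symbol belongs to the signature: a table look-up. -/
def evalTab : Prog :=
  set .w 0;; set .j 0;; set .o (§.e);; loop .R tabValBody;;
  set .r (rd .IN (rd .TAB (§.base + §.x) + §.w))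

/-- Takes one value of the quantified variable into account. -/
def quantBody : Prog :=
  branch (ltE (§.i) (§.sz))
    (set .r (iteE (eqE (§.op) 4) (iteE (rd .D (§.o)) (§.r) 0) (iteE (rd .D (§.o)) 1 (§.r)));;
      set .o (§.o + §.px)) skip;;
  set .i (§.i + 1)

/-- The value of a quantifier at a point. -/
def evalQuant : Prog :=
  mul .w .px .q .n;; set .o (§.e - §.w);; set .r (eqE (§.op) 4);; set .i 0;;
  loop .n quantBody

/-- The value of the symbol at a point, from the values of the children at all points. -/
def evalAt : Prog :=
  set .base (rd .SB (§.e));; set .sz (rd .PW (§.base + 1));;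
  branch (eqE (§.op) 0) (set .r (iteE (rd .D (§.e)) (rd .D (§.E + §.e)) 0))
  (branch (eqE (§.op) 1) (set .r (iteE (rd .D (§.e)) 1 (rd .D (§.E + §.e))))
  (branch (eqE (§.op) 2) (set .r (1 - rd .D (§.e)))
  (branch (eqE (§.op) 3)
    (set .r (iteE (rd .D (§.e)) (rd .D (§.E + §.e)) (rd .D (§.E + §.E + §.e))))
  (branch (eqE (§.op) 7) evalTab
    (set .px (rd .PW (§.base + §.x));; set .q (rd .AI (§.e));; divmod .q .px .nk;;
      set .q (§.qq);; divmod .q .sz .nk;;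
      branch (eqE (§.op) 6) (set .r (§.q)) evalQuant)))))

/-- Computes the digit of the result at the point `e`. -/
def evalPointBody : Prog := evalAt;; wr .RS (§.e) (§.r);; set .e (§.e + 1)

/-- Computes the digits of the result at all points. -/
def evalPoints : Prog := set .e 0;; loop .N evalPointBody

/-- Takes one child into account when the freeness of a variable is computed. -/
def orBody : Prog :=
  branch (ltE (§.j) (§.ar)) (set .r (iteE (rd .D (§.o)) 1 (§.r))) skip;;
  set .o (§.o + §.E);; set .j (§.j + 1)

/-- Computes whether variable number `i` is free in the result: it is not if the symbol binds it, it
is if the symbol is this variable, and otherwise it is free if it is free in a child. -/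
def evalFreeBody : Prog :=
  set .r 0;; set .j 0;; set .o (§.N + §.i);; loop .R orBody;;
  wr .RS (§.N + §.i) (iteE (eqE (§.x) (§.i))
    (iteE (eqE (§.op) 4) 0 (iteE (eqE (§.op) 5) 0 (iteE (eqE (§.op) 6) 1 (§.r)))) (§.r));;
  set .i (§.i + 1)

/-- The set of free variables of the result. -/
def evalFree : Prog :=
  set .i 0;; loop .k evalFreeBody

/-- Adds one digit to `val`. -/
def encodeBody : Prog :=
  set .d (rd .RS (§.e));; mul .idx .pw .d .b;; set .val (§.val + §.idx);;
  mul .idx .pw .b .b;; set .pw (§.idx);; set .e (§.e + 1)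

/-- Sets `val` to the code of the digits in `RS`. -/
def encodeRS : Prog :=
  set .val 0;; set .pw 1;; set .e 0;; loop .E encodeBody

/-- Appends the graph node of one child to the encoding of the graph. -/
def emitWord : Prog :=
  branch (ltE (§.j) (§.ar)) (wr .DW (§.wl) (rd .CD (§.j));; set .wl (§.wl + 1)) skip;;
  set .j (§.j + 1)

/-- Records that the node `p` has the value `val`, with a new node of the graph, unless this is
known. -/
def emit : Prog :=
  mul .idx .p .V .V;; set .idx (§.idx + §.val);;
  branch (rd .MK (§.idx)) skip
    (wr .DW (§.wl) (§.c);; set .wl (§.wl + 1);; set .j 0;;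
      loop .R emitWord;;
      wr .MK (§.idx) 1;; wr .DP (§.idx) (§.nd);; wr .DE (§.idx) (§.wl);; set .nd (§.nd + 1);;
      wr .QU (§.tail) (§.p);; wr .QV (§.tail) (§.val);; set .tail (§.tail + 1))

/-- Splits one digit off a value. -/
def digitBody : Prog :=
  divmod .q .b .V;; wr .D (§.oE + §.e) (§.q);; set .q (§.qq);; set .e (§.e + 1)

/-- Decodes one component of a tuple of values: checks whether the child has this value, and spreads
its digits. -/
def decodeChild : Prog :=
  divmod .q .V .VR;; set .w (§.q);; set .tau (§.qq);;
  branch (ltE (§.j) (§.ar))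
    (set .ch (rd .CH (§.pR + §.j));; mul .idx .ch .V .V;; set .idx (§.idx + §.w);;
      set .ok (iteE (rd .MK (§.idx)) (§.ok) 0);; wr .CD (§.j) (rd .DP (§.idx))) skip;;
  set .q (§.w);; set .e 0;;
  loop .E digitBody;;
  branch (ltE (§.j) (§.ar))
    (set .ok (iteE (eqE (rd .D (§.oE + §.N + §.k))
      (iteE (§.j) (rd .K1 (§.c)) (rd .K0 (§.c)))) (§.ok) 0)) skip;;
  set .q (§.tau);; set .oE (§.oE + §.E);; set .j (§.j + 1)

/-- Applies the symbol of the node `p` to the tuple of values with code `tc`. -/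
def applyTuple : Prog :=
  set .q (§.tc);; set .j 0;; set .oE 0;; set .ok 1;; loop .R decodeChild;;
  branch (§.ok)
    (set .op (rd .OP (§.c));; set .x (rd .OA (§.c));; evalPoints;; evalFree;;
      wr .RS (§.N + §.k) (rd .RK (§.c));; encodeRS;; emit) skip

/-- Handles one tuple of values. -/
def tupleStep : Prog := applyTuple;; set .tc (§.tc + 1)

/-- Applies the symbol of the node `p` to all tuples of values that are known for its children. -/
def combine : Prog :=
  set .c (rd .IN (§.p));; set .ar (rd .AR (§.c));; mul .pR .p .R .R;;
  set .tc 0;; loop .VR tupleStep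

/-- Applies the symbol at the position `u`, if this is an inner node. -/
def combineStep : Prog :=
  branch (rd .ND (§.u)) (set .p (§.u);; combine) skip;; set .u (§.u + 1)

/-- Initializes the queue and the graph, and applies all symbols once. Since no value is known at
the start, this yields the values of the nullary symbols. -/
def combineAll : Prog :=
  set .wl 1;; wr .DW 0 1;; set .tail 0;; set .nd 0;; set .u 0;;
  loop .len combineStep

/-- Handles one entry of the queue. -/
def processEntry : Prog :=
  set .u (rd .QU (§.t));; set .v (rd .QV (§.t));; mul .idx .u .V .V;; set .idx (§.idx + §.v);;
  set .cd (rd .DP (§.idx));; set .ce (rd .DE (§.idx));;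
  set .to (rd .NX (§.u));; push;; set .to (rd .CP (§.u));; push;;
  branch (rd .PA (§.u)) (set .p (rd .PA (§.u));; combine) skip

/-- Handles entry number `t` of the queue, if it exists. -/
def saturateStep : Prog := branch (ltE (§.t) (§.tail)) processEntry skip;; set .t (§.t + 1)

/-- Handles all entries of the queue, including those that are added on the way. -/
def saturate : Prog := set .t 0;; loop .MV saturateStep

/-- Writes the digit of the target at one point. -/
def targetBody : Prog := wr .RS (§.e) (rd .POS (§.e));; set .e (§.e + 1)

/-- Writes that variable number `i` is not free. -/
def zeroBody : Prog := wr .RS (§.N + §.i) 0;; set .i (§.i + 1)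

/-- Looks up the value of a solution at the start symbol; `i` becomes the length of the answer. -/
def answer : Prog :=
  set .e 0;; loop .N targetBody;; set .i 0;; loop .k zeroBody;;
  wr .RS (§.N + §.k) 1;; encodeRS;; mul .idx .st .V .V;; set .idx (§.idx + §.val);;
  branch (rd .MK (§.idx)) (set .i (rd .DE (§.idx))) (wr .DW 0 0;; set .i 1)

end Prog

attribute [simp] LState.set_v LState.set_a LState.wr_v LState.wr_a

theorem LState.ext' {s s' : PState} (hv : ∀ x, s.v x = s'.v x) (ha : ∀ b, s.a b = s'.a b) : s = s' := by
  cases s; cases s'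
  congr
  · exact funext hv
  · exact funext ha

namespace Prog

/-! ### Arithmetic subroutines -/

section Expr

variable (s : PState) (e f g : Expr')

@[simp] theorem ev_add : (e + f).ev s = e.ev s + f.ev s := rfl
@[simp] theorem ev_sub : (e - f).ev s = e.ev s - f.ev s := rfl
@[simp] theorem ev_ofNat (n : ℕ) : (no_index (OfNat.ofNat n) : Expr').ev s = n := rfl
@[simp] theorem ev_rv (x : Var) : (rv x).ev s = s.v x := rfl
@[simp] theorem ev_rd (a : Arr) : (rd a e).ev s = s.a a (e.ev s) := rfl
@[simp] theorem ev_ite : (iteE e f g).ev s = if e.ev s ≠ 0 then f.ev s else g.ev s := rfl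

@[simp] theorem ev_ltE : (ltE e f).ev s = if e.ev s < f.ev s then 1 else 0 := by
  simp only [ltE, Ex.ev, Nat.sub_ne_zero_iff_lt]

@[simp] theorem ev_eqE : (eqE e f).ev s = if e.ev s = f.ev s then 1 else 0 := by
  change (if e.ev s - f.ev s + (f.ev s - e.ev s) ≠ 0 then 0 else 1) = _
  by_cases h : e.ev s = f.ev s
  · rw [if_neg (by omega), if_pos h]
  · rw [if_pos (by omega), if_neg h]

end Expr

/-- Multiplication by repeated addition; the bound of the loop may exceed the factor, and the
surplus iterations have no effect. -/
theorem run_mul {a y z bnd : Var} (s : PState) (h : s.v z ≤ s.v bnd) (hya : y ≠ a) (hza : z ≠ a)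
    (hba : bnd ≠ a) (hym : y ≠ .mi) (hzm : z ≠ .mi) (ham : a ≠ .mi) (hbm : bnd ≠ .mi) :
    run (mul a y z bnd) s = (s.set a (s.v y * s.v z)).set .mi (s.v bnd) := by
  have key := loop_inv (fun i s' => s' = (s.set a (s.v y * min i (s.v z))).set .mi i)
    (.seq (.set a (iteE (ltE (§.mi) (rv z)) (rv a + rv y) (rv a))) (.set .mi (§.mi + 1))) bnd
    ((s.set a 0).set .mi 0) (by simp) (fun i s' hi _ hs' => by
      subst hs'
      refine LState.ext' (fun x => ?_) (fun b => by simp)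
      have : Var.mi ≠ a := ham.symm
      by_cases hx : x = .mi
      · simp [hx, this]
      · by_cases hxa : x = a
        · subst hxa
          by_cases hlt : i < s.v z
          · have e1 : min (i + 1) (s.v z) = i + 1 := by omega
            have e2 : min i (s.v z) = i := by omega
            simp [*, hlt, mul_add]
          · have e1 : min (i + 1) (s.v z) = s.v z := by omega
            have e2 : min i (s.v z) = s.v z := by omega
            simp [*, hlt]
        · simp [hx, hxa])
  have hb : ((s.set a 0).set .mi 0).v bnd = s.v bnd := by simp [hba, hbm]
  rw [hb, min_eq_right h] at key
  exact key

/-- Division by repeated subtraction; the bound of the loop may exceed the quotient. -/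
theorem run_divmod {a y bnd : Var} (s : PState) (h : s.v a / s.v y ≤ s.v bnd) (hy : 0 < s.v y)
    (hya : y ≠ a) (hyq : y ≠ .qq) (haq : a ≠ .qq) (hbq : bnd ≠ .qq) :
    run (divmod a y bnd) s = (s.set a (s.v a % s.v y)).set .qq (s.v a / s.v y) := by
  have key := loop_inv (fun i s' => s' = (s.set a (s.v a - s.v y * min i (s.v a / s.v y))).set .qq
      (min i (s.v a / s.v y)))
    (.branch (ltE (rv a) (rv y)) .skip (.seq (.set a (rv a - rv y)) (.set .qq (§.qq + 1)))) bnd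
    (s.set .qq 0) (LState.ext' (fun x => by
      by_cases hx : x = .qq
      · simp [hx]
      · by_cases hxa : x = a <;> simp [hx, hxa, haq]) (fun b => by simp)) (fun i s' hi _ hs' => by
      subst hs'
      refine LState.ext' (fun x => ?_) (fun b => by
        simp only [run_branch]; split_ifs <;> simp)
      have hdm := Nat.div_add_mod (s.v a) (s.v y)
      have hml := Nat.mod_lt (s.v a) hy
      by_cases hlt : i < s.v a / s.v y
      · have e1 : min (i + 1) (s.v a / s.v y) = i + 1 := by omega
        have e2 : min i (s.v a / s.v y) = i := by omega
        have h2 : s.v y * (i + 1) ≤ s.v y * (s.v a / s.v y) := Nat.mul_le_mul_left _ hlt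
        have h3 : ¬ (s.v a - s.v y * i < s.v y) := by rw [mul_add] at h2; omega
        by_cases hx : x = .qq
        · simp [hx, e1, e2, haq, hya, hyq, h3, haq.symm]
        · by_cases hxa : x = a
          · simp [hxa, e1, e2, haq, hya, hyq, h3, mul_add, Nat.sub_sub]
          · simp [hx, hxa, e1, e2, haq, hya, hyq, h3]
      · have e1 : min (i + 1) (s.v a / s.v y) = s.v a / s.v y := by omega
        have e2 : min i (s.v a / s.v y) = s.v a / s.v y := by omega
        have h3 : s.v a - s.v y * (s.v a / s.v y) < s.v y := by omega
        simp [e1, e2, haq, hya, hyq, h3])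
  have hb : (s.set .qq 0).v bnd = s.v bnd := by simp [hbq]
  rw [hb, min_eq_right h] at key
  have e : s.v a - s.v y * (s.v a / s.v y) = s.v a % s.v y := by
    have := Nat.div_add_mod (s.v a) (s.v y); omega
  rw [e] at key
  exact key

/-- Counting the ones at the positions `pos, pos + 1, …`: the counter sticks at the first word that
is not `1`, so that a loop over the length of the input suffices. -/
theorem run_unary {a : Var} (s : PState) (n : ℕ) (hn : n ≤ s.v .len)
    (h1 : ∀ i < n, s.a .IN (s.v .pos + i) = 1) (h2 : s.a .IN (s.v .pos + n) ≠ 1) (hal : a ≠ .len)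
    (hap : a ≠ .pos) : run (unary a) s = s.set a n := by
  have key := loop_inv (fun i s' => s' = s.set a (min i n))
    (.set a (rv a + eqE (rd .IN (§.pos + rv a)) 1)) .len (s.set a 0) (by simp)
    (fun i s' hi _ hs' => by
      subst hs'
      refine LState.ext' (fun x => ?_) (fun b => by simp)
      by_cases hx : x = a
      · by_cases hlt : i < n
        · have e1 : min (i + 1) n = i + 1 := by omega
          have e2 : min i n = i := by omega
          simp [hx, e1, e2, hap.symm, h1 i hlt]
        · have e1 : min (i + 1) n = n := by omega
          have e2 : min i n = n := by omega
          simp [hx, e1, e2, hap.symm, h2]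
      · simp [hx])
  have hb : (s.set a 0).v .len = s.v .len := by simp [hal.symm]
  rw [hb, min_eq_right hn] at key
  exact key

/-- The number with the given digits in base `b`. -/
def ofDig (b : ℕ) (f : ℕ → ℕ) (n : ℕ) : ℕ := ∑ i ∈ Finset.range n, f i * b ^ i

theorem ofDig_succ (b : ℕ) (f : ℕ → ℕ) (n : ℕ) : ofDig b f (n + 1) = ofDig b f n + f n * b ^ n :=
  Finset.sum_range_succ _ _

theorem ofDig_congr {b : ℕ} {f g : ℕ → ℕ} {n : ℕ} (h : ∀ i < n, f i = g i) :
    ofDig b f n = ofDig b g n :=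
  Finset.sum_congr rfl fun i hi => by rw [h i (Finset.mem_range.1 hi)]

theorem ofDig_lt {b : ℕ} {f : ℕ → ℕ} {n : ℕ} (h : ∀ i < n, f i < b) : ofDig b f n < b ^ n := by
  induction n with
  | zero => simp [ofDig]
  | succ n ih =>
    rw [ofDig_succ, pow_succ]
    have h1 := ih fun i hi => h i (by omega)
    have h2 : (f n + 1) * b ^ n ≤ b * b ^ n := Nat.mul_le_mul_right _ (h n (by omega))
    linarith

/-- The digits can be read off the number. -/
theorem ofDig_digit {b : ℕ} {f : ℕ → ℕ} {n i : ℕ} (h : ∀ i < n, f i < b) (hi : i < n) :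
    ofDig b f n / b ^ i % b = f i := by
  induction n with
  | zero => omega
  | succ n ih =>
    have hb : 0 < b := lt_of_le_of_lt (Nat.zero_le _) (h i hi)
    rw [ofDig_succ]
    rcases Nat.lt_succ_iff_lt_or_eq.1 hi with hlt | rfl
    · obtain ⟨k, rfl⟩ : ∃ k, n = i + 1 + k := ⟨n - (i + 1), by omega⟩
      have e : f (i + 1 + k) * b ^ (i + 1 + k) = b ^ i * (b * (f (i + 1 + k) * b ^ k)) := by ring
      rw [e, Nat.add_mul_div_left _ _ (pow_pos hb i), Nat.add_mul_mod_self_left]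
      exact ih (fun j hj => h j (by omega)) hlt
    · rw [Nat.add_mul_div_right _ _ (pow_pos hb i), Nat.div_eq_of_lt (ofDig_lt fun j hj =>
        h j (by omega)), zero_add, Nat.mod_eq_of_lt (h i (by omega))]

theorem run_encodeRS (s : PState) (h : ∀ e < s.v .E, s.a .RS e < s.v .b) :
    (run encodeRS s).v .val = ofDig (s.v .b) (s.a .RS) (s.v .E) := by
  refine (loop_inv (fun i s' => s'.v .e = i ∧ s'.v .pw = s.v .b ^ i ∧
    s'.v .val = ofDig (s.v .b) (s.a .RS) i) encodeBody .E (((s.set .val 0).set .pw 1).set .e 0)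
    (by simp [ofDig]) ?_).2.2
  rintro i s' hi hF ⟨h1, h2, h3⟩
  have hb : s'.v .b = s.v .b := by rw [hF.v _ (by decide)]; simp
  have hR : s'.a .RS = s.a .RS := by rw [hF.a _ (by decide)]; simp
  have := h i (by simpa using hi)
  simp only [encodeBody, run_seq, run_set]
  rw [run_mul (s'.set .d _) (by simp [h1, hR, hb]; omega) (by decide) (by decide) (by decide)
    (by decide) (by decide) (by decide) (by decide)]
  rw [run_mul _ (by simp) (by decide) (by decide) (by decide)
    (by decide) (by decide) (by decide) (by decide)]
  simp [h1, h2, h3, hR, hb, ofDig_succ, pow_succ]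
  ring

/-! ### Evaluation of a symbol -/

open Pr (skip set wr branch loop)

/-- The value of variable number `x` at the point `e`. -/
def coordVal (s : PState) (x e : ℕ) : ℕ :=
  s.a .AI e / s.a .PW (s.a .SB e + x) % s.a .PW (s.a .SB e + 1)

/-- The digits of the first child at the points that differ from `e` in variable number `x` only. -/
def sliceVal (s : PState) (x e i : ℕ) : ℕ :=
  s.a .D (e - s.a .PW (s.a .SB e + x) * coordVal s x e + i * s.a .PW (s.a .SB e + x))

/-- The table entry of symbol number `x` at the point `e`. -/
def tabVal (s : PState) (x ar e : ℕ) : ℕ :=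
  s.a .IN (s.a .TAB (s.a .SB e + x) +
    ∑ j ∈ Finset.range ar, s.a .D (e + j * s.v .E) * s.a .PW (s.a .SB e + j))

open Classical in
/-- The value of a symbol at the point `e`, from the values of its children in the array `D`. -/
noncomputable def pointVal (s : PState) (op x ar e : ℕ) : ℕ :=
  if op = 0 then if s.a .D e ≠ 0 then s.a .D (s.v .E + e) else 0
  else if op = 1 then if s.a .D e ≠ 0 then 1 else s.a .D (s.v .E + e)
  else if op = 2 then 1 - s.a .D e
  else if op = 3 then if s.a .D e ≠ 0 then s.a .D (s.v .E + e) else s.a .D (s.v .E + s.v .E + e)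
  else if op = 7 then tabVal s x ar e
  else if op = 6 then coordVal s x e
  else if op = 4 then if ∀ i < s.a .PW (s.a .SB e + 1), sliceVal s x e i ≠ 0 then 1 else 0
  else if ∃ i < s.a .PW (s.a .SB e + 1), sliceVal s x e i ≠ 0 then 1 else 0

theorem run_evalTab (s : PState) (har : s.v .ar ≤ s.v .R) (hbase : s.v .base = s.a .SB (s.v .e))
    (hD : ∀ j < s.v .ar, s.a .D (s.v .e + j * s.v .E) < s.v .b) :
    (run evalTab s).v .r = tabVal s (s.v .x) (s.v .ar) (s.v .e) := by
  obtain ⟨s₀, hs₀⟩ : ∃ s₀, s₀ = ((s.set .w 0).set .j 0).set .o (s.v .e) := ⟨_, rfl⟩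
  have key := loop_inv (fun i s' => s'.v .j = i ∧ s'.v .o = s.v .e + i * s.v .E ∧
    s'.v .w = ∑ j ∈ Finset.range (min i (s.v .ar)),
      s.a .D (s.v .e + j * s.v .E) * s.a .PW (s.a .SB (s.v .e) + j)) tabValBody .R s₀
    (by simp [hs₀]) ?_
  · have hF := run_frame (.loop .R tabValBody) s₀
    simp only [evalTab, run_seq, run_set, ev_ofNat, ev_rv, LState.set_v, reduceCtorEq, if_false]
    rw [← hs₀]
    generalize run (.loop .R tabValBody) s₀ = s₁ at key hF
    obtain ⟨-, -, hw⟩ := key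
    have e1 : s₀.v .R = s.v .R := by simp [hs₀]
    rw [e1, min_eq_right har] at hw
    have h1 := hF.a .IN (by decide)
    have h2 := hF.a .TAB (by decide)
    have h3 := hF.v .base (by decide)
    have h4 := hF.v .x (by decide)
    simp [hs₀] at h1 h2 h3 h4
    simp [h1, h2, h3, h4, hw, tabVal, hbase]
  · rintro i s' hi hF ⟨h1, h2, h3⟩
    have hb := hF.v .b (by decide)
    have hE := hF.v .E (by decide)
    have har' := hF.v .ar (by decide)
    have hba := hF.v .base (by decide)
    have hDD := hF.a .D (by decide)
    have hPW := hF.a .PW (by decide)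
    simp [hs₀] at hb hE har' hba hDD hPW hi
    simp only [tabValBody, run_seq, run_branch, run_set]
    by_cases hlt : i < s.v .ar
    · have e1 : min (i + 1) (s.v .ar) = i + 1 := by omega
      have e2 : min i (s.v .ar) = i := by omega
      have := hD i hlt
      rw [run_mul _ (by simp [h2, hDD, hb]; omega) (by decide) (by decide) (by decide)
        (by decide) (by decide) (by decide) (by decide)]
      simp [h1, h2, h3, har', hlt, hE, e1, e2, hPW, hDD, hba, hbase, Finset.sum_range_succ]
      ring_nf
      trivial
    · have e1 : min (i + 1) (s.v .ar) = s.v .ar := by omega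
      have e2 : min i (s.v .ar) = s.v .ar := by omega
      simp [h1, h2, h3, har', hlt, hE, e1, e2, add_mul, add_assoc]

theorem run_evalQuant (s : PState) (hq : s.v .q ≤ s.v .n) (hsz : s.v .sz ≤ s.v .n)
    (hop : s.v .op = 4 ∨ s.v .op = 5) :
    (run evalQuant s).v .r = if s.v .op = 4
      then if ∀ i < s.v .sz, s.a .D (s.v .e - s.v .px * s.v .q + i * s.v .px) ≠ 0 then 1 else 0
      else if ∃ i < s.v .sz, s.a .D (s.v .e - s.v .px * s.v .q + i * s.v .px) ≠ 0 then 1 else 0 := by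
  classical
  simp only [evalQuant, run_seq, run_set]
  rw [run_mul _ hq (by decide) (by decide) (by decide) (by decide) (by decide) (by decide)
    (by decide)]
  simp only [ev_sub, ev_ofNat, ev_eqE, ev_rv, LState.set_v, reduceCtorEq, if_true, if_false]
  generalize hs₀ : (((LState.set _ _ _).set _ _).set _ _ : PState) = s₀
  obtain ⟨f, hf⟩ : ∃ f : ℕ → ℕ, f = fun i => s.a .D (s.v .e - s.v .px * s.v .q + i * s.v .px) :=
    ⟨_, rfl⟩
  have hf' : ∀ i, s.a .D (s.v .e - s.v .px * s.v .q + i * s.v .px) = f i := by simp [hf]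
  simp only [hf']
  have key := loop_inv (fun i s' => s'.v .i = i ∧
    s'.v .o = s.v .e - s.v .px * s.v .q + min i (s.v .sz) * s.v .px ∧
    s'.v .r = if s.v .op = 4 then if ∀ j < min i (s.v .sz), f j ≠ 0 then 1 else 0
      else if ∃ j < min i (s.v .sz), f j ≠ 0 then 1 else 0) quantBody .n s₀
    (by simp [← hs₀]) ?_
  · obtain ⟨-, -, h⟩ := key
    have : s₀.v .n = s.v .n := by simp [← hs₀]
    rw [this, min_eq_right hsz] at h
    exact h
  · rintro i s' hi hF ⟨h1, h2, h3⟩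
    have hsz' := hF.v .sz (by decide)
    have hop' := hF.v .op (by decide)
    have hpx := hF.v .px (by decide)
    have hD := hF.a .D (by decide)
    simp [← hs₀] at hsz' hop' hpx hD
    simp only [quantBody, run_seq, run_branch, run_set]
    by_cases hlt : i < s.v .sz
    · have e1 : min (i + 1) (s.v .sz) = i + 1 := by omega
      have e2 : min i (s.v .sz) = i := by omega
      rw [e2] at h2 h3
      have hfi : s'.a .D (s'.v .o) = f i := by rw [hD, h2, hf']
      refine ⟨by simp [h1, hsz', hlt], by simp [h1, h2, hsz', hlt, hpx, e1, add_mul, add_assoc], ?_⟩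
      simp only [h1, hsz', hlt, hop', e1, ev_ltE, ev_rv, ev_ite, ev_eqE, ev_ofNat, ev_rd, hfi, if_true,
        ne_eq, one_ne_zero, not_false_eq_true, LState.set_v, reduceCtorEq, if_false, h3]
      rcases hop with h4 | h5
      · simp only [h4, if_true, Nat.forall_lt_succ_right, one_ne_zero, not_false_eq_true]
        by_cases hfz : f i = 0 <;> simp [hfz]
      · simp only [h5, Nat.reduceEqDiff, if_false, Nat.exists_lt_succ_right]
        by_cases hfz : f i = 0 <;> simp [hfz]
    · have e1 : min (i + 1) (s.v .sz) = s.v .sz := by omega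
      have e2 : min i (s.v .sz) = s.v .sz := by omega
      rw [e2] at h2 h3
      simp [h1, h2, h3, hsz', hlt, e1]

/-- What the evaluation of a symbol relies on. -/
structure EvalOK (s : PState) : Prop where
  ar_le : s.v .ar ≤ s.v .R
  E_le : s.v .N ≤ s.v .E
  pw_pos : ∀ e < s.v .N, 0 < s.a .PW (s.a .SB e + s.v .x)
  sz_pos : ∀ e < s.v .N, 0 < s.a .PW (s.a .SB e + 1)
  sz_le : ∀ e < s.v .N, s.a .PW (s.a .SB e + 1) ≤ s.v .n
  ai_lt : ∀ e < s.v .N, s.a .AI e < s.v .nk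
  d_lt : ∀ j < s.v .ar, ∀ e < s.v .E, s.a .D (e + j * s.v .E) < s.v .b
  n_le : ∀ e < s.v .N, s.a .AI e / s.a .PW (s.a .SB e + s.v .x) ≤ s.v .nk
  op_le : s.v .op ≤ 7

theorem run_evalAt (s : PState) (h : EvalOK s) (he : s.v .e < s.v .N) :
    (run evalAt s).v .r = pointVal s (s.v .op) (s.v .x) (s.v .ar) (s.v .e) := by
  have hd := fun j hj => h.d_lt j hj (s.v .e) (he.trans_le h.E_le)
  obtain ⟨s₀, hs₀⟩ : ∃ s₀, s₀ = (s.set .base (s.a .SB (s.v .e))).set .sz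
    (s.a .PW (s.a .SB (s.v .e) + 1)) := ⟨_, rfl⟩
  have hv : ∀ y, y ≠ .base → y ≠ .sz → s₀.v y = s.v y := fun y h1 h2 => by simp [hs₀, h1, h2]
  have ha : s₀.a = s.a := by simp [hs₀]
  have hbase : s₀.v .base = s.a .SB (s.v .e) := by simp [hs₀]
  have hsz : s₀.v .sz = s.a .PW (s.a .SB (s.v .e) + 1) := by simp [hs₀]
  have e1 : run evalAt s = run (branch (eqE (§.op) 0) (set .r (iteE (rd .D (§.e)) (rd .D (§.E + §.e)) 0))
      (branch (eqE (§.op) 1) (set .r (iteE (rd .D (§.e)) 1 (rd .D (§.E + §.e))))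
      (branch (eqE (§.op) 2) (set .r (1 - rd .D (§.e)))
      (branch (eqE (§.op) 3)
        (set .r (iteE (rd .D (§.e)) (rd .D (§.E + §.e)) (rd .D (§.E + §.E + §.e))))
      (branch (eqE (§.op) 7) evalTab
        (set .px (rd .PW (§.base + §.x));; set .q (rd .AI (§.e));; divmod .q .px .nk;;
          set .q (§.qq);; divmod .q .sz .nk;;
          branch (eqE (§.op) 6) (set .r (§.q)) evalQuant)))))) s₀ := by
    simp only [evalAt, run_seq, run_set, hs₀]
    rfl
  rw [e1]
  simp only [run_branch, ev_eqE, ev_rv, ev_ofNat, hv .op (by decide) (by decide)]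
  have htab : s.v .op = 7 → (run evalTab s₀).v .r = tabVal s (s.v .x) (s.v .ar) (s.v .e) := by
    intro _
    rw [run_evalTab]
    · simp [tabVal, hv, ha]
    · rw [hv _ (by decide) (by decide), hv _ (by decide) (by decide)]; exact h.ar_le
    · rw [hbase, ha, hv _ (by decide) (by decide)]
    · simpa [hv, ha] using hd
  have hcoord : ∀ P : Prog, run (set .px (rd .PW (§.base + §.x));; set .q (rd .AI (§.e));;
      divmod .q .px .nk;; set .q (§.qq);; divmod .q .sz .nk;; P) s₀ =
      run P ((((s₀.set .px (s.a .PW (s.a .SB (s.v .e) + s.v .x))).set .q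
        (coordVal s (s.v .x) (s.v .e))).set .qq (s.a .AI (s.v .e) /
          s.a .PW (s.a .SB (s.v .e) + s.v .x) / s.a .PW (s.a .SB (s.v .e) + 1)))) := by
    intro P
    have hpw := h.pw_pos _ he
    have hszp := h.sz_pos _ he
    have hlt := h.ai_lt _ he
    have hn := h.n_le _ he
    simp only [run_seq, run_set]
    rw [run_divmod (y := .px) _ (by simpa [hbase, hv, ha] using hn) (by simpa [hbase, hv, ha] using hpw)
      (by decide) (by decide) (by decide) (by decide)]
    rw [run_divmod (y := .sz) _ (by
        simpa [hbase, hsz, hv, ha] using (Nat.div_le_self _ _).trans hn)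
      (by simpa [hbase, hsz, hv, ha] using hszp)
      (by decide) (by decide) (by decide) (by decide)]
    congr 1
    refine LState.ext' (fun y => ?_) (fun b => by simp)
    simp only [LState.set_v, LState.set_a, ev_rd, ev_add, ev_rv, hbase, hsz, ha, hv, coordVal,
      ne_eq, reduceCtorEq, not_false_eq_true, if_true, if_false]
    by_cases hq : y = .qq
    · simp [hq]
    · by_cases hq' : y = .q
      · simp [hq']
      · by_cases hp : y = .px <;> simp [hp, hq, hq']
  have hop := h.op_le
  obtain ⟨o, ho⟩ : ∃ o, o = s.v .op := ⟨_, rfl⟩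
  rw [← ho] at hop htab
  simp only [← ho, pointVal]
  clear e1
  interval_cases o
  · simp [hv, ha]
  · simp [hv, ha]
  · simp [hv, ha]
  · simp [hv, ha]
  · simp only [Nat.reduceEqDiff, OfNat.ofNat_ne_zero, reduceIte, ne_eq, one_ne_zero,
      not_true_eq_false, not_false_eq_true, hcoord, run_branch, ev_eqE, ev_rv, ev_ofNat,
      LState.set_v, reduceCtorEq, hv, ← ho]
    rw [run_evalQuant _ ?_ ?_ ?_]
    · simp only [hv, ha, ← ho, sliceVal, hsz, LState.set_v, LState.set_a, reduceCtorEq, reduceIte,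
        Nat.reduceEqDiff, ne_eq, not_false_eq_true]
      congr!
    · simp only [LState.set_v, reduceCtorEq, if_false, if_true, hv, ne_eq, not_false_eq_true]
      exact (Nat.mod_lt _ (h.sz_pos _ he)).le.trans (h.sz_le _ he)
    · simp only [LState.set_v, reduceCtorEq, if_false, hv, ne_eq, not_false_eq_true, hsz]
      exact h.sz_le _ he
    · simp [hv, ← ho]
  · simp only [Nat.reduceEqDiff, OfNat.ofNat_ne_zero, reduceIte, ne_eq, one_ne_zero,
      not_true_eq_false, not_false_eq_true, hcoord, run_branch, ev_eqE, ev_rv, ev_ofNat,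
      LState.set_v, reduceCtorEq, hv, ← ho]
    rw [run_evalQuant _ ?_ ?_ ?_]
    · simp only [hv, ha, ← ho, sliceVal, hsz, LState.set_v, LState.set_a, reduceCtorEq, reduceIte,
        Nat.reduceEqDiff, ne_eq, not_false_eq_true]
      congr!
    · simp only [LState.set_v, reduceCtorEq, if_false, if_true, hv, ne_eq, not_false_eq_true]
      exact (Nat.mod_lt _ (h.sz_pos _ he)).le.trans (h.sz_le _ he)
    · simp only [LState.set_v, reduceCtorEq, if_false, hv, ne_eq, not_false_eq_true, hsz]
      exact h.sz_le _ he
    · simp [hv, ← ho]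
  · simp only [Nat.reduceEqDiff, OfNat.ofNat_ne_zero, reduceIte, ne_eq, one_ne_zero,
      not_true_eq_false, not_false_eq_true, hcoord, run_branch, ev_eqE, ev_rv, ev_ofNat,
      LState.set_v, reduceCtorEq, hv, ← ho, run_set]
  · simpa using htab rfl

/-- Two states agree in everything that the value of a symbol at a point depends on. -/
structure EvalAgree (s s' : PState) : Prop where
  v : ∀ x ∈ [Var.ar, .R, .N, .E, .x, .n, .nk, .b, .op], s'.v x = s.v x
  a : ∀ b ∈ [Arr.PW, .SB, .AI, .D, .IN, .TAB], s'.a b = s.a b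

theorem EvalAgree.evalOK {s s' : PState} (h : EvalAgree s s') (hs : EvalOK s) : EvalOK s' := by
  have hv := h.v
  have ha := h.a
  simp only [List.forall_mem_cons, List.not_mem_nil, false_imp_iff, implies_true, and_true] at hv ha
  obtain ⟨v1, v2, v3, v4, v5, v6, v7, v8, v9⟩ := hv
  obtain ⟨a1, a2, a3, a4, a5, a6⟩ := ha
  obtain ⟨h1, h2, h3, h4, h5, h6, h7, h8, h9⟩ := hs
  constructor <;> simp only [v1, v2, v3, v4, v5, v6, v7, v8, v9, a1, a2, a3, a4] <;> assumption

theorem EvalAgree.pointVal {s s' : PState} (h : EvalAgree s s') :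
    Prog.pointVal s' = Prog.pointVal s := by
  have hv := h.v
  have ha := h.a
  simp only [List.forall_mem_cons, List.not_mem_nil, false_imp_iff, implies_true, and_true] at hv ha
  obtain ⟨v1, v2, v3, v4, v5, v6, v7, v8, v9⟩ := hv
  obtain ⟨a1, a2, a3, a4, a5, a6⟩ := ha
  funext op x ar e
  simp only [Prog.pointVal, tabVal, sliceVal, coordVal, v4, a1, a2, a3, a4, a5, a6]
  congr!

theorem run_evalPoints (s : PState) (h : EvalOK s) :
    ∀ e < s.v .N, (run evalPoints s).a .RS e = pointVal s (s.v .op) (s.v .x) (s.v .ar) e := by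
  refine (loop_inv (fun i s' => s'.v .e = i ∧ ∀ e < i, s'.a .RS e =
    pointVal s (s.v .op) (s.v .x) (s.v .ar) e) evalPointBody .N (s.set .e 0) (by simp) ?_).2
  rintro i s' hi hF ⟨h1, h2⟩
  have hA : EvalAgree s s' := by
    refine ⟨fun x hx => ?_, fun b hb => ?_⟩
    · rw [hF.v x (by revert x; decide)]
      have : x ≠ .e := by revert x; decide
      simp [this]
    · rw [hF.a b (by revert b; decide)]; simp
  have hAt := run_evalAt s' (hA.evalOK h) (by rw [h1, hA.v _ (by decide)]; simpa using hi)
  rw [hA.pointVal, hA.v _ (by decide), hA.v _ (by decide), hA.v _ (by decide), h1] at hAt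
  have hRS := run_a evalAt s' (b := .RS) (by decide)
  have he := run_v evalAt s' (x := .e) (by decide)
  refine ⟨by simp [evalPointBody, he, h1], fun e hei => ?_⟩
  simp only [evalPointBody, run_seq, run_set, run_wr, LState.set_a, LState.wr_a, if_true, ev_rv,
    he, h1, hAt, hRS, Function.update_apply]
  split_ifs with hc
  · rw [hc]
  · exact h2 e (by omega)

open Classical in
/-- The digit that says whether variable number `i` is free. -/
noncomputable def freeVal (s : PState) (i : ℕ) : ℕ :=
  if s.v .x = i ∧ (s.v .op = 4 ∨ s.v .op = 5) then 0
  else if s.v .x = i ∧ s.v .op = 6 then 1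
  else if ∃ j < s.v .ar, s.a .D (s.v .N + i + j * s.v .E) ≠ 0 then 1 else 0

theorem run_orLoop (s : PState) (hr : s.v .r = 0) (hj : s.v .j = 0) (har : s.v .ar ≤ s.v .R) :
    (run (loop .R orBody) s).v .r =
      if ∃ j < s.v .ar, s.a .D (s.v .o + j * s.v .E) ≠ 0 then 1 else 0 := by
  classical
  obtain ⟨f, hf⟩ : ∃ f : ℕ → ℕ, ∀ i, f i = s.a .D (s.v .o + i * s.v .E) := ⟨_, fun _ => rfl⟩
  simp only [← hf]
  have key := loop_inv (fun i s' => s'.v .j = i ∧ s'.v .o = s.v .o + i * s.v .E ∧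
    s'.v .r = if ∃ j < min i (s.v .ar), f j ≠ 0 then 1 else 0) orBody .R s
    (by simp [hr, hj]) ?_
  · rw [min_eq_right har] at key; exact key.2.2
  · rintro i s' hi hF ⟨h1, h2, h3⟩
    have har' := hF.v .ar (by decide)
    have hE := hF.v .E (by decide)
    have hD := hF.a .D (by decide)
    have hfi : s'.a .D (s'.v .o) = f i := by rw [hD, h2, hf]
    simp only [orBody, run_seq, run_branch, run_set, ev_ltE, ev_rv, h1, har']
    by_cases hlt : i < s.v .ar
    · have e1 : min (i + 1) (s.v .ar) = i + 1 := by omega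
      have e2 : min i (s.v .ar) = i := by omega
      rw [e2] at h3
      refine ⟨by simp [hlt, h1], by simp [hlt, h2, hE]; ring, ?_⟩
      simp only [hlt, if_true, ne_eq, one_ne_zero, not_false_eq_true, e1, ev_ite, ev_rd,
        ev_rv, hfi, h3, LState.set_v, reduceCtorEq, if_false, ev_ofNat, Nat.exists_lt_succ_right]
      by_cases hfz : f i = 0 <;> simp [hfz]
    · have e1 : min (i + 1) (s.v .ar) = s.v .ar := by omega
      have e2 : min i (s.v .ar) = s.v .ar := by omega
      rw [e2] at h3
      refine ⟨by simp [hlt, h1], by simp [hlt, h2, hE]; ring, by simp [hlt, e1, h3]⟩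

theorem run_evalFree (s : PState) (har : s.v .ar ≤ s.v .R) :
    (∀ i < s.v .k, (run evalFree s).a .RS (s.v .N + i) = freeVal s i) ∧
      ∀ e < s.v .N, (run evalFree s).a .RS e = s.a .RS e := by
  refine (loop_inv (fun i s' => s'.v .i = i ∧ (∀ j < i, s'.a .RS (s.v .N + j) = freeVal s j) ∧
    ∀ e < s.v .N, s'.a .RS e = s.a .RS e) evalFreeBody .k (s.set .i 0) (by simp) ?_).2
  rintro i s' hi hF ⟨h1, h2, h3⟩
  obtain ⟨s₀, hs₀⟩ : ∃ s₀, s₀ = ((s'.set .r 0).set .j 0).set .o (s'.v .N + s'.v .i) := ⟨_, rfl⟩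
  have hv : ∀ x ∈ [Var.ar, .R, .N, .E, .x, .op, .k], s₀.v x = s.v x := by
    intro x hx
    have : x ≠ .i ∧ x ≠ .r ∧ x ≠ .j ∧ x ≠ .o := by revert x; decide
    have e1 := hF.v x (by clear this; revert x; decide)
    simp [hs₀, this, e1]
  have hD : s₀.a .D = s.a .D := by rw [hs₀]; simpa using hF.a .D (by decide)
  have hN' := hF.v .N (by decide)
  simp only [LState.set_v, reduceCtorEq, if_false] at hN'
  have hor := run_orLoop s₀ (by simp [hs₀]) (by simp [hs₀]) (by
    rw [hv _ (by decide), hv _ (by decide)]; exact har)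
  have ho : s₀.v .o = s.v .N + i := by simp [hs₀, hN', h1]
  rw [hv .ar (by decide), hv .E (by decide), ho, hD] at hor
  have hG := run_frame (loop .R orBody) s₀
  have hE : run evalFreeBody s' = run (wr .RS (§.N + §.i) (iteE (eqE (§.x) (§.i))
    (iteE (eqE (§.op) 4) 0 (iteE (eqE (§.op) 5) 0 (iteE (eqE (§.op) 6) 1 (§.r)))) (§.r));;
    set .i (§.i + 1)) (run (loop .R orBody) s₀) := by
      simp only [evalFreeBody, run_seq, run_set, hs₀]
      rfl
  rw [hE]
  generalize run (loop .R orBody) s₀ = s₁ at hor hG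
  have v1 : s₁.v .i = i := by rw [hG.v _ (by decide)]; simp [hs₀, h1]
  have v2 : s₁.v .N = s.v .N := by rw [hG.v _ (by decide), hv _ (by decide)]
  have v3 : s₁.v .x = s.v .x := by rw [hG.v _ (by decide), hv _ (by decide)]
  have v4 : s₁.v .op = s.v .op := by rw [hG.v _ (by decide), hv _ (by decide)]
  have v5 : s₁.a .RS = s'.a .RS := by rw [hG.a _ (by decide)]; simp [hs₀]
  refine ⟨by simp [v1], fun j hj => ?_, fun e he => ?_⟩
  · simp only [run_seq, run_wr, run_set, LState.set_a, LState.wr_a, if_true, ev_add, ev_rv, v1, v2,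
      Function.update_apply, v5]
    by_cases hji : j = i
    · subst hji
      simp only [if_true, ev_ite, ev_eqE, ev_rv, ev_ofNat, v1, v3, v4, hor, freeVal]
      by_cases hx : s.v .x = j
      · by_cases h4 : s.v .op = 4
        · simp [hx, h4]
        · by_cases h5 : s.v .op = 5
          · simp [hx, h5]
          · by_cases h6 : s.v .op = 6
            · simp [hx, h6]
            · simp only [hx, h4, h5, h6]; simp
      · simp only [hx]; simp
    · rw [if_neg (by omega)]
      exact h2 j (by omega)
  · simp only [run_seq, run_wr, run_set, LState.set_a, LState.wr_a, if_true, ev_add, ev_rv, v1, v2,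
      Function.update_apply, v5]
    rw [if_neg (by omega)]
    exact h3 e he

/-! ### Decoding of a tuple of values -/

/-- Digit number `i` of the tuple of values with code `τ`: the digits of the components are listed one
after the other. -/
def tupleDig (g : PState) (τ i : ℕ) : ℕ :=
  τ / g.v .V ^ (i / g.v .E) % g.v .V / g.v .b ^ (i % g.v .E) % g.v .b

/-- Whether component number `j` of a tuple is acceptable for the node `p`: it is a known value of the
child, and it has the right kind. -/
def childOK (s : PState) (p τ j : ℕ) : Prop :=
  s.a .MK (s.a .CH (p * s.v .R + j) * s.v .V + τ / s.v .V ^ j % s.v .V) ≠ 0 ∧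
    tupleDig s τ (j * s.v .E + s.v .N + s.v .k) =
      if j ≠ 0 then s.a .K1 (s.a .IN p) else s.a .K0 (s.a .IN p)

theorem run_digitLoop (s : PState) (he : s.v .e = 0) (hb : 0 < s.v .b) (hq : s.v .q ≤ s.v .V) :
    (run (loop .E digitBody) s).a .D = fun i =>
      if s.v .oE ≤ i ∧ i < s.v .oE + s.v .E then s.v .q / s.v .b ^ (i - s.v .oE) % s.v .b
      else s.a .D i := by
  refine (loop_inv (fun i s' => s'.v .e = i ∧ s'.v .q = s.v .q / s.v .b ^ i ∧ s'.a .D = fun j =>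
      if s.v .oE ≤ j ∧ j < s.v .oE + i then s.v .q / s.v .b ^ (j - s.v .oE) % s.v .b
      else s.a .D j) digitBody .E s ⟨he, by simp, ?_⟩ ?_).2.2
  · funext j
    rw [if_neg (by omega)]
  · rintro i s' hi hF ⟨h1, h2, h3⟩
    have hb' := hF.v .b (by decide)
    have hV' := hF.v .V (by decide)
    have ho' := hF.v .oE (by decide)
    have hle : s.v .q / s.v .b ^ i / s.v .b ≤ s.v .V :=
      (Nat.div_le_self _ _).trans ((Nat.div_le_self _ _).trans hq)
    simp only [digitBody, run_seq]
    rw [run_divmod _ (by rw [hb', hV', h2]; exact hle) (by rw [hb']; exact hb)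
      (by decide) (by decide) (by decide) (by decide)]
    refine ⟨by simp [h1], by simp [h2, hb', pow_succ, Nat.div_div_eq_div_mul], ?_⟩
    simp only [run_set, run_wr, LState.set_a, LState.wr_a, if_true, ev_add, ev_rv, LState.set_v,
      reduceCtorEq, if_false, ho', h1, h2, h3, hb']
    funext j
    simp only [Function.update_apply]
    by_cases hj : j = s.v .oE + i
    · subst hj; simp
    · rw [if_neg hj]
      congr 1
      simp only [eq_iff_iff]
      omega

theorem tupleDig_eq (g : PState) (τ j e : ℕ) (he : e < g.v .E) :
    tupleDig g τ (j * g.v .E + e) = τ / g.v .V ^ j % g.v .V / g.v .b ^ e % g.v .b := by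
  have hE : 0 < g.v .E := by omega
  rw [tupleDig, add_comm, mul_comm, Nat.add_mul_div_left _ _ hE, Nat.add_mul_mod_self_left,
    Nat.div_eq_of_lt he, Nat.mod_eq_of_lt he, zero_add]

open Classical in
/-- The tuple with code `τ` is split into its components, all their digits are written to `D`, and
the flag `ok` tells whether every component that belongs to a child is acceptable. The array `CD`
receives the nodes of the graph that witness the components. -/
theorem run_decodeLoop (s : PState) (τ : ℕ) (hj : s.v .j = 0) (hq : s.v .q = τ) (ho : s.v .oE = 0)
    (hok : s.v .ok = 1) (hc : s.v .c = s.a .IN (s.v .p)) (hpR : s.v .pR = s.v .p * s.v .R)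
    (har : s.v .ar ≤ s.v .R) (hb : 0 < s.v .b) (hV : 0 < s.v .V) (hVR : τ ≤ s.v .VR)
    (hE : s.v .E = s.v .N + s.v .k + 1) :
    let s' := run (loop .R decodeChild) s
    (s'.a .D = fun i => if i < s.v .R * s.v .E then tupleDig s τ i else s.a .D i) ∧
      (s'.v .ok = if ∀ j < s.v .ar, childOK s (s.v .p) τ j then 1 else 0) ∧
      ∀ j < s.v .ar, s'.a .CD j =
        s.a .DP (s.a .CH (s.v .p * s.v .R + j) * s.v .V + τ / s.v .V ^ j % s.v .V) := by
  have key := loop_inv (fun i s' => s'.v .j = i ∧ s'.v .q = τ / s.v .V ^ i ∧ s'.v .oE = i * s.v .E ∧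
    (s'.a .D = fun j => if j < i * s.v .E then tupleDig s τ j else s.a .D j) ∧
    (s'.v .ok = if ∀ j < min i (s.v .ar), childOK s (s.v .p) τ j then 1 else 0) ∧
      ∀ j < min i (s.v .ar), s'.a .CD j =
        s.a .DP (s.a .CH (s.v .p * s.v .R + j) * s.v .V + τ / s.v .V ^ j % s.v .V)) decodeChild .R s
    ⟨hj, by simp [hq], by simp [ho], by simp, by simp [hok], by simp⟩ ?_
  · rw [min_eq_right har] at key
    exact key.2.2.2
  · rintro i s' hi hF ⟨h1, h2, h3, h4, h5, h6⟩
    have fv : ∀ x ∈ [Var.E, .N, .k, .b, .V, .VR, .ar, .c, .pR, .R], s'.v x = s.v x := fun x hx =>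
      hF.v x (by revert x; decide)
    have fa : ∀ b ∈ [Arr.CH, .MK, .DP, .K0, .K1], s'.a b = s.a b := fun b hb' =>
      hF.a b (by revert b; decide)
    -- the first part of the body splits off the component and checks its mark
    obtain ⟨w, hw⟩ : ∃ w, w = τ / s.v .V ^ i % s.v .V := ⟨_, rfl⟩
    obtain ⟨ix, hix⟩ : ∃ ix, ix = s.a .CH (s.v .p * s.v .R + i) * s.v .V + w := ⟨_, rfl⟩
    obtain ⟨s₁, hs₁⟩ : ∃ s₁, s₁ = run (divmod .q .V .VR;; set .w (§.q);; set .tau (§.qq);;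
      branch (ltE (§.j) (§.ar))
        (set .ch (rd .CH (§.pR + §.j));; mul .idx .ch .V .V;; set .idx (§.idx + §.w);;
        set .ok (iteE (rd .MK (§.idx)) (§.ok) 0);; wr .CD (§.j) (rd .DP (§.idx))) skip;;
      set .q (§.w);; set .e 0) s' := ⟨_, rfl⟩
    have hF₁ : Frame _ s' s₁ := hs₁ ▸ run_frame _ s'
    have hrun : run decodeChild s' = run (branch (ltE (§.j) (§.ar))
      (set .ok (iteE (eqE (rd .D (§.oE + §.N + §.k))
        (iteE (§.j) (rd .K1 (§.c)) (rd .K0 (§.c)))) (§.ok) 0)) skip;;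
      set .q (§.tau);; set .oE (§.oE + §.E);; set .j (§.j + 1)) (run (loop .E digitBody) s₁) := by
      rw [hs₁]; rfl
    have p1 : s₁.v .q = w ∧ s₁.v .e = 0 ∧ s₁.v .tau = τ / s.v .V ^ (i + 1) ∧
        (s₁.v .ok = if i < s.v .ar then if s.a .MK ix ≠ 0 then s'.v .ok else 0 else s'.v .ok) ∧
        s₁.a .CD = if i < s.v .ar then Function.update (s'.a .CD) i (s.a .DP ix) else s'.a .CD := by
      have hdiv : τ / s.v .V ^ i / s.v .V ≤ s.v .VR :=
        (Nat.div_le_self _ _).trans ((Nat.div_le_self _ _).trans hVR)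
      rw [hs₁]
      simp only [run_seq]
      rw [run_divmod _ (by rw [h2, fv _ (by decide), fv _ (by decide)]; exact hdiv)
        (by rw [fv _ (by decide)]; exact hV) (by decide) (by decide) (by decide) (by decide)]
      simp only [run_set, run_branch, ev_ltE, ev_rv, LState.set_v, reduceCtorEq, if_false,
        fv .ar (by decide), h1, if_true]
      by_cases hlt : i < s.v .ar
      · simp only [hlt, if_true, ne_eq, one_ne_zero, not_false_eq_true, run_seq, run_set]
        rw [run_mul _ (by simp) (by decide) (by decide) (by decide)
          (by decide) (by decide) (by decide) (by decide)]
        simp [fv .V (by decide), h1, h2, fa .CH (by decide), fa .MK (by decide), fa .DP (by decide),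
          fv .pR (by decide), hpR, ← hw, ← hix, pow_succ, Nat.div_div_eq_div_mul]
      · simp [hlt, fv .V (by decide), h2, pow_succ, Nat.div_div_eq_div_mul, ← hw]
    obtain ⟨q1, q2, q3, q4, q5⟩ := p1
    have fv₁ : ∀ x ∈ [Var.E, .N, .k, .b, .V, .ar, .c], s₁.v x = s.v x := fun x hx => by
      rw [hF₁.v x (by revert x; decide)]; exact fv x (by revert x; decide)
    have fa₁ : ∀ b ∈ [Arr.K0, .K1], s₁.a b = s.a b := fun b hb' => by
      rw [hF₁.a b (by revert b; decide)]; exact fa b (by revert b; decide)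
    have hoE₁ : s₁.v .oE = i * s.v .E := by rw [hF₁.v _ (by decide), h3]
    have hj₁ : s₁.v .j = i := by rw [hF₁.v _ (by decide), h1]
    have hD₁ : s₁.a .D = s'.a .D := hF₁.a _ (by decide)
    have hwV : w < s.v .V := by rw [hw]; exact Nat.mod_lt _ hV
    have hdig := run_digitLoop s₁ q2 (by rw [fv₁ _ (by decide)]; exact hb)
      (by rw [q1, fv₁ _ (by decide)]; exact hwV.le)
    rw [hoE₁, q1, fv₁ .E (by decide), fv₁ .b (by decide), hD₁, h4] at hdig
    rw [hrun]
    have hF₂ := run_frame (loop .E digitBody) s₁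
    generalize run (loop .E digitBody) s₁ = s₂ at hdig hF₂
    have fv₂ : ∀ x ∈ [Var.E, .N, .k, .ar, .c], s₂.v x = s.v x := fun x hx => by
      rw [hF₂.v x (by revert x; decide)]; exact fv₁ x (by revert x; decide)
    have fa₂ : ∀ b ∈ [Arr.K0, .K1], s₂.a b = s.a b := fun b hb' => by
      rw [hF₂.a b (by revert b; decide)]; exact fa₁ b hb'
    have hj₂ : s₂.v .j = i := by rw [hF₂.v _ (by decide), hj₁]
    have hoE₂ : s₂.v .oE = i * s.v .E := by rw [hF₂.v _ (by decide), hoE₁]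
    have htau : s₂.v .tau = τ / s.v .V ^ (i + 1) := by rw [hF₂.v _ (by decide), q3]
    have hok₂ : s₂.v .ok = s₁.v .ok := hF₂.v _ (by decide)
    have hCD₂ : s₂.a .CD = s₁.a .CD := hF₂.a _ (by decide)
    have hDfin : s₂.a .D = fun j => if j < (i + 1) * s.v .E then tupleDig s τ j else s.a .D j := by
      rw [hdig]
      funext j
      rw [add_mul, one_mul]
      by_cases hlo : i * s.v .E ≤ j ∧ j < i * s.v .E + s.v .E
      · rw [if_pos hlo, if_pos hlo.2]
        obtain ⟨e, rfl⟩ : ∃ e, j = i * s.v .E + e := ⟨j - i * s.v .E, by omega⟩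
        rw [tupleDig_eq _ _ _ _ (by omega), hw, Nat.add_sub_cancel_left]
      · rw [if_neg hlo]
        show (if j < i * s.v .E then _ else _) = _
        congr 1
        simp only [eq_iff_iff]
        omega
    have hkind : s₂.a .D (i * s.v .E + s.v .N + s.v .k) =
        tupleDig s τ (i * s.v .E + s.v .N + s.v .k) := by
      rw [hDfin]
      exact if_pos (by rw [add_mul, one_mul]; omega)
    simp only [run_seq, run_branch, run_set, ev_ltE, ev_rv, hj₂, fv₂ .ar (by decide)]
    by_cases hlt : i < s.v .ar
    · have e1 : min (i + 1) (s.v .ar) = i + 1 := by omega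
      have e2 : min i (s.v .ar) = i := by omega
      rw [e2] at h5 h6
      refine ⟨by simp [hlt, hj₂], by simp [hlt, htau], by simp [hlt, hoE₂, fv₂, add_mul],
        by simpa [hlt] using hDfin, ?_, fun j hj => ?_⟩
      · simp only [hlt, e1, if_true, ne_eq, one_ne_zero, not_false_eq_true, LState.set_v,
          reduceCtorEq, if_false, ev_ite, ev_eqE, ev_rd, ev_add, ev_rv, hoE₂, fv₂ .N (by decide),
          fv₂ .k (by decide), hkind, hj₂, fa₂ .K0 (by decide), fa₂ .K1 (by decide),
          fv₂ .c (by decide), hok₂, q4, h5, Nat.forall_lt_succ_right, ev_ofNat, hc]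
        have hco : childOK s (s.v .p) τ i ↔ s.a .MK ix ≠ 0 ∧
            tupleDig s τ (i * s.v .E + s.v .N + s.v .k) =
              if i ≠ 0 then s.a .K1 (s.a .IN (s.v .p)) else s.a .K0 (s.a .IN (s.v .p)) := by
          rw [childOK, ← hw, ← hix]
        rw [if_congr (and_congr_right fun _ => hco) rfl rfl]
        by_cases hall : ∀ j < i, childOK s (s.v .p) τ j
        · rw [if_pos hall, if_congr (and_iff_right hall) rfl rfl]
          by_cases hm : s.a .MK ix = 0 <;>
          by_cases hk : tupleDig s τ (i * s.v .E + s.v .N + s.v .k) =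
              if i ≠ 0 then s.a .K1 (s.a .IN (s.v .p)) else s.a .K0 (s.a .IN (s.v .p)) <;>
          simp [hm, hk]
        · rw [if_neg (c := _ ∧ _) (fun h => hall h.1), if_neg hall]
          simp
      · rw [e1] at hj
        simp only [hlt, if_true, ne_eq, one_ne_zero, not_false_eq_true, LState.set_a, hCD₂, q5,
          Function.update_apply]
        by_cases hji : j = i
        · subst hji; simp [hix, hw]
        · rw [if_neg hji]; exact h6 j (by omega)
    · have e1 : min (i + 1) (s.v .ar) = s.v .ar := by omega
      have e2 : min i (s.v .ar) = s.v .ar := by omega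
      rw [e2] at h5 h6
      refine ⟨by simp [hlt, hj₂], by simp [hlt, htau], by simp [hlt, hoE₂, fv₂, add_mul],
        by simpa [hlt] using hDfin, ?_, fun j hj => ?_⟩
      · simp [hlt, hok₂, q4, h5, e1]
      · rw [e1] at hj
        simp [hlt, hCD₂, q5, h6 j hj]

/-! ### Graphs with shared subtrees -/

section Dag

variable {S : Type*} {ar : S → ℕ}

theorem unfoldsAt_lt_length {d : TreeDag ar} {i : ℕ} {t : RTree ar Empty} (h : d.UnfoldsAt i t) :
    i < d.length := by
  cases h with
  | node hi _ _ => exact (List.getElem?_eq_some_iff.1 hi).1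

theorem unfoldsAt_append {d d' : TreeDag ar} {i : ℕ} {t : RTree ar Empty} (h : d.UnfoldsAt i t) :
    TreeDag.UnfoldsAt (d ++ d') i t := by
  induction h with
  | node hi hlt hc ih =>
    refine .node ?_ hlt ih
    rw [List.getElem?_append_left (List.getElem?_eq_some_iff.1 hi).1]
    exact hi

theorem unfoldsAt_take {d : TreeDag ar} {i n : ℕ} {t : RTree ar Empty} (h : d.UnfoldsAt i t)
    (hn : i < n) : TreeDag.UnfoldsAt (d.take n) i t := by
  induction h with
  | node hi hlt hc ih =>
    refine .node ?_ hlt fun j => ih j ((hlt j).trans hn)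
    rw [List.getElem?_take_of_lt hn]
    exact hi

theorem encode_append (f : S → ℕ) (d d' : TreeDag ar) :
    TreeDag.encode f (d ++ d') = d.encode f ++ d'.encode f :=
  List.flatMap_append

end Dag

/-! ### The value of a node -/

/-- The variables that do not change during saturation. -/
abbrev constV : List Var := [.len, .k, .R, .N, .b, .E, .V, .VR, .MV, .n, .nk, .st, .J, .m, .np]

/-- The arrays that do not change during saturation. -/
abbrev constA : List Arr :=
  [.IN, .AR, .K0, .K1, .RK, .OP, .OA, .PW, .TAB, .SB, .AI, .POS, .CP, .PA, .CH, .ND, .NX]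

/-- Two states agree in everything that does not change during saturation. -/
structure Agree (g s : PState) : Prop where
  v : ∀ x ∈ constV, s.v x = g.v x
  a : ∀ b ∈ constA, s.a b = g.a b

theorem Agree.of_frame {g s s' : PState} {P : Prog} (h : Agree g s) (hF : Frame P s s')
    (hv : ∀ x ∈ constV, x ∉ P.wv := by decide) (ha : ∀ b ∈ constA, b ∉ P.wa := by decide) :
    Agree g s' :=
  ⟨fun x hx => (hF.v x (hv x hx)).trans (h.v x hx), fun b hb => (hF.a b (ha b hb)).trans (h.a b hb)⟩

/-- The numerical relations that the saturation relies on. -/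
structure GOK (g : PState) : Prop where
  b_eq : g.v .b = g.v .n + 2
  E_eq : g.v .E = g.v .N + g.v .k + 1
  V_eq : g.v .V = g.v .b ^ g.v .E
  VR_eq : g.v .VR = g.v .V ^ g.v .R
  MV_eq : g.v .MV = (g.v .len + g.v .len) * g.v .V
  R_gt : 1 < g.v .R
  ar_le : ∀ c, g.a .AR c ≤ g.v .R
  op_le : ∀ c, g.a .OP c ≤ 7
  oa_lt : ∀ c, g.a .OA c < g.v .R
  pw_pos : ∀ e < g.v .N, ∀ i < g.v .R, 0 < g.a .PW (g.a .SB e + i)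
  sz_le : ∀ e < g.v .N, g.a .PW (g.a .SB e + 1) ≤ g.v .n
  ai_lt : ∀ e < g.v .N, g.a .AI e < g.v .nk
  nd : ∀ p, g.a .ND p ≠ 0 → 0 < p ∧ p < g.v .len
  ch : ∀ p, g.a .ND p ≠ 0 → ∀ j < g.a .AR (g.a .IN p), g.a .PA (g.a .CH (p * g.v .R + j)) = p
  pa : ∀ u, g.a .PA u ≠ 0 → g.a .ND (g.a .PA u) ≠ 0
  cp_lt : ∀ u, g.a .CP u < g.v .len + g.v .len
  nx_lt : ∀ u, g.a .NX u < g.v .len + g.v .len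

theorem GOK.b_pos {g : PState} (h : GOK g) : 0 < g.v .b := by rw [h.b_eq]; omega

theorem GOK.V_pos {g : PState} (h : GOK g) : 0 < g.v .V := by rw [h.V_eq]; exact pow_pos h.b_pos _

theorem GOK.E_pos {g : PState} (h : GOK g) : 0 < g.v .E := by rw [h.E_eq]; omega

/-- The state in which the symbol with code `c` is applied to the tuple of values with code `τ`. -/
def evalState (g : PState) (c τ : ℕ) : PState where
  v x := if x = .ar then g.a .AR c else if x = .op then g.a .OP c else if x = .x then g.a .OA c
    else g.v x
  a d := if d = .D then tupleDig g τ else g.a d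

/-- The digits of the value of the symbol with code `c` for the tuple of values with code `τ`. -/
noncomputable def resDigit (g : PState) (c τ e : ℕ) : ℕ :=
  if e < g.v .N then pointVal (evalState g c τ) (g.a .OP c) (g.a .OA c) (g.a .AR c) e
  else if e < g.v .N + g.v .k then freeVal (evalState g c τ) (e - g.v .N)
  else g.a .RK c

/-- The value of the symbol with code `c` for the tuple of values with code `τ`. -/
noncomputable def resVal (g : PState) (c τ : ℕ) : ℕ := ofDig (g.v .b) (resDigit g c τ) (g.v .E)

theorem GOK.tupleDig_lt {g : PState} (h : GOK g) (τ i : ℕ) : tupleDig g τ i < g.v .b :=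
  Nat.mod_lt _ h.b_pos

theorem GOK.tupleDig_eq_zero {g : PState} (h : GOK g) {τ i : ℕ} (hτ : τ < g.v .VR)
    (hi : g.v .R * g.v .E ≤ i) : tupleDig g τ i = 0 := by
  have h1 : g.v .R ≤ i / g.v .E := (Nat.le_div_iff_mul_le h.E_pos).2 hi
  rw [tupleDig, Nat.div_eq_of_lt (a := τ)]
  · simp
  · rw [h.VR_eq] at hτ
    exact hτ.trans_le (Nat.pow_le_pow_right h.V_pos h1)

/-- The evaluation of a symbol may be applied to arbitrary tuples of values, even those that are not
values of expressions. -/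
theorem GOK.evalOK {g : PState} (h : GOK g) (c τ : ℕ) : EvalOK (evalState g c τ) where
  ar_le := by simpa [evalState] using h.ar_le c
  E_le := by simp [evalState, h.E_eq]; omega
  pw_pos e he := by
    simp [evalState] at he
    simpa [evalState] using h.pw_pos e he _ (h.oa_lt c)
  sz_pos e he := by
    simp [evalState] at he
    simpa [evalState] using h.pw_pos e he _ h.R_gt
  sz_le e he := by
    simp [evalState] at he
    simpa [evalState] using h.sz_le e he
  ai_lt e he := by
    simp [evalState] at he
    simpa [evalState] using h.ai_lt e he
  d_lt j hj e he := by simpa [evalState] using h.tupleDig_lt τ _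
  n_le e he := by
    simp [evalState] at he
    simpa [evalState] using (Nat.div_le_self _ _).trans (h.ai_lt e he).le
  op_le := by simpa [evalState] using h.op_le c

/-- After the digits of the children have been decoded, the result is computed digit by digit, and
it is encoded as a number. -/
theorem run_resVal {g s : PState} (h : GOK g) (hA : Agree g s) (c τ : ℕ)
    (har : s.v .ar = g.a .AR c) (hop : s.v .op = g.a .OP c) (hx : s.v .x = g.a .OA c)
    (hc : s.v .c = c) (hD : s.a .D = tupleDig g τ) (hlt : ∀ e < g.v .E, resDigit g c τ e < g.v .b) :
    (run (evalPoints;; evalFree;; wr .RS (§.N + §.k) (rd .RK (§.c));; encodeRS) s).v .val =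
      resVal g c τ := by
  have hE : EvalAgree (evalState g c τ) s := by
    have v : ∀ x ∈ [Var.R, .N, .E, .n, .nk, .b], s.v x = g.v x := fun x hx =>
      hA.v x (by revert x; decide)
    have a : ∀ b ∈ [Arr.PW, .SB, .AI, .IN, .TAB], s.a b = g.a b := fun b hb =>
      hA.a b (by revert b; decide)
    simp only [List.forall_mem_cons, List.not_mem_nil, false_imp_iff, implies_true, and_true] at v a
    constructor <;>
    simp [List.forall_mem_cons, evalState, har, hop, hx, hD, v, a]
  have h1 := run_evalPoints s (hE.evalOK (h.evalOK c τ))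
  rw [hE.pointVal, hA.v .N (by decide), har, hop, hx] at h1
  simp only [run_seq]
  have hF₁ := run_frame evalPoints s
  have h2 := run_evalFree (run evalPoints s) (by
    rw [hF₁.v _ (by decide), hF₁.v _ (by decide), har, hA.v _ (by decide)]; exact h.ar_le c)
  have hF₂ := run_frame evalFree (run evalPoints s)
  obtain ⟨h2, h3⟩ := h2
  generalize run evalFree (run evalPoints s) = s₂ at h2 h3 hF₂
  have hA₁ : Agree g (run evalPoints s) := hA.of_frame hF₁
  have hA₂ : Agree g s₂ := hA₁.of_frame hF₂
  have fr : ∀ i, freeVal (run evalPoints s) i = freeVal (evalState g c τ) i := by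
    intro i
    have e1 : (run evalPoints s).a .D = tupleDig g τ := by rw [hF₁.a _ (by decide), hD]
    have e2 : (run evalPoints s).v .x = g.a .OA c := by rw [hF₁.v _ (by decide), hx]
    have e3 : (run evalPoints s).v .op = g.a .OP c := by rw [hF₁.v _ (by decide), hop]
    have e4 : (run evalPoints s).v .ar = g.a .AR c := by rw [hF₁.v _ (by decide), har]
    have e5 := hA₁.v .N (by decide)
    have e6 := hA₁.v .E (by decide)
    simp [freeVal, evalState, e1, e2, e3, e4, e5, e6]
  have hcc : s₂.v .c = c := by rw [hF₂.v _ (by decide), hF₁.v _ (by decide), hc]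
  have hdig : ∀ e < g.v .E,
      (run (wr .RS (§.N + §.k) (rd .RK (§.c))) s₂).a .RS e = resDigit g c τ e := by
    intro e he
    rw [h.E_eq] at he
    simp only [run_wr, LState.wr_a, if_true, ev_add, ev_rv, ev_rd, hA₂.v .N (by decide),
      hA₂.v .k (by decide), hA₂.a .RK (by decide), hcc, Function.update_apply, resDigit]
    by_cases h4 : e < g.v .N
    · rw [if_neg (by omega), if_pos h4, h3 e (by rw [hA₁.v _ (by decide)]; exact h4), h1 e h4]
    · rw [if_neg h4]
      by_cases h5 : e < g.v .N + g.v .k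
      · rw [if_neg (by omega), if_pos h5, ← fr, ← h2 _ (by rw [hA₁.v _ (by decide)]; omega),
          hA₁.v _ (by decide)]
        congr 1
        omega
      · rw [if_pos (by omega), if_neg h5]
  have eb : (run (wr .RS (§.N + §.k) (rd .RK (§.c))) s₂).v .b = g.v .b := by
    rw [run_v _ _ (by decide)]; exact hA₂.v _ (by decide)
  have eE : (run (wr .RS (§.N + §.k) (rd .RK (§.c))) s₂).v .E = g.v .E := by
    rw [run_v _ _ (by decide)]; exact hA₂.v _ (by decide)
  rw [run_encodeRS _ (by rw [eb, eE]; intro e he; rw [hdig e he]; exact hlt e he), eb, eE, resVal]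
  exact ofDig_congr hdig

/-! ### The work list -/

section Worklist

variable {S : Type*} {ar : S → ℕ} {f : S → ℕ} {g : PState} {Sem : ℕ → ℕ → RTree ar Empty → Prop}

/-- The closure properties of the relation between items, values and trees that the saturation relies
on: a value passes from a right-hand side to the nonterminal, from there to its occurrences, and from
the children of a node to the node. -/
structure SemOK (f : S → ℕ) (g : PState) (Sem : ℕ → ℕ → RTree ar Empty → Prop) : Prop where
  next : ∀ u v t, Sem u v t → g.a .NX u ≠ 0 → Sem (g.a .NX u) v t
  up : ∀ u v t, Sem u v t → g.a .CP u ≠ 0 → Sem (g.a .CP u) v t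
  comb : ∀ p, g.a .ND p ≠ 0 → ∃ s, f s = g.a .IN p ∧ ar s = g.a .AR (g.a .IN p) ∧
    ∀ τ (ch : Fin (ar s) → RTree ar Empty), τ < g.v .VR →
    (∀ j : Fin (ar s), Sem (g.a .CH (p * g.v .R + j)) (τ / g.v .V ^ (j : ℕ) % g.v .V) (ch j)) →
    (∀ j < ar s, tupleDig g τ (j * g.v .E + g.v .N + g.v .k) =
      if j ≠ 0 then g.a .K1 (g.a .IN p) else g.a .K0 (g.a .IN p)) →
    (∀ e < g.v .E, resDigit g (g.a .IN p) τ e < g.v .b) ∧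
      Sem p (resVal g (g.a .IN p) τ) (.node s ch)

/-- Item `u` is known to have the value `v`. -/
def Marked (s : PState) (u v : ℕ) : Prop := s.a .MK (u * s.v .V + v) ≠ 0

instance (s : PState) (u v : ℕ) : Decidable (Marked s u v) := inferInstanceAs (Decidable (_ ≠ 0))

/-- The value `v` of the item `u` is justified by the node `cd` of the graph `dl`, and the encoding of
the graph up to this node ends at `ce`. -/
def Good (f : S → ℕ) (Sem : ℕ → ℕ → RTree ar Empty → Prop) (dl : TreeDag ar) (u v cd ce : ℕ) : Prop :=
  ∃ t, Sem u v t ∧ dl.UnfoldsAt cd t ∧ ce = 1 + (TreeDag.encode f (dl.take (cd + 1))).length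

/-- The invariant of the saturation; `dl` is the graph that has been written so far. -/
structure WInv (f : S → ℕ) (g : PState) (Sem : ℕ → ℕ → RTree ar Empty → Prop) (dl : TreeDag ar)
    (s : PState) : Prop where
  agree : Agree g s
  dz : ∀ i, g.v .R * g.v .E ≤ i → s.a .D i = 0
  entry : ∀ t < s.v .tail, s.a .QU t ≠ 0 ∧ s.a .QU t < g.v .len + g.v .len ∧ s.a .QV t < g.v .V ∧
    Marked s (s.a .QU t) (s.a .QV t)
  inj : ∀ t < s.v .tail, ∀ t' < s.v .tail, s.a .QU t = s.a .QU t' → s.a .QV t = s.a .QV t' → t = t'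
  queued : ∀ u v, v < g.v .V → Marked s u v → ∃ t < s.v .tail, s.a .QU t = u ∧ s.a .QV t = v
  good : ∀ u v, v < g.v .V → Marked s u v →
    Good f Sem dl u v (s.a .DP (u * g.v .V + v)) (s.a .DE (u * g.v .V + v))
  nd : s.v .nd = dl.length
  words : (List.range (s.v .wl)).map (s.a .DW) = 1 :: dl.encode f
  nd_le : s.v .nd ≤ s.v .tail
  wl_le : s.v .wl ≤ 1 + (g.v .R + 1) * s.v .nd

/-- The queue and the set of known values have grown. -/
structure Ext (s s' : PState) : Prop where
  tail : s.v .tail ≤ s'.v .tail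
  queue : ∀ t < s.v .tail, s'.a .QU t = s.a .QU t ∧ s'.a .QV t = s.a .QV t
  mark : ∀ i, s.a .MK i ≠ 0 → s'.a .MK i ≠ 0

theorem Ext.refl (s : PState) : Ext s s := ⟨le_rfl, fun _ _ => ⟨rfl, rfl⟩, fun _ h => h⟩

theorem Ext.trans {s s' s'' : PState} (h : Ext s s') (h' : Ext s' s'') : Ext s s'' :=
  ⟨h.tail.trans h'.tail, fun t ht => ⟨(h'.queue t (ht.trans_le h.tail)).1.trans (h.queue t ht).1,
    (h'.queue t (ht.trans_le h.tail)).2.trans (h.queue t ht).2⟩, fun i hi => h'.mark i (h.mark i hi)⟩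

theorem Good.append {dl dl' : TreeDag ar} {u v cd ce : ℕ} (h : Good f Sem dl u v cd ce) :
    Good f Sem (dl ++ dl') u v cd ce := by
  obtain ⟨t, h1, h2, h3⟩ := h
  refine ⟨t, h1, unfoldsAt_append h2, ?_⟩
  rw [List.take_append_of_le_length (unfoldsAt_lt_length h2)]
  exact h3

/-- What the invariant depends on. -/
theorem WInv.congr' {dl : TreeDag ar} {s s' : PState} (h : WInv f g Sem dl s) (hA : Agree g s')
    (hD : ∀ i, g.v .R * g.v .E ≤ i → s'.a .D i = 0) (hv : ∀ x ∈ [Var.tail, .nd, .wl], s'.v x = s.v x)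
    (ha : ∀ b ∈ [Arr.QU, .QV, .MK, .DP, .DE, .DW], s'.a b = s.a b) :
    WInv f g Sem dl s' ∧ Ext s s' := by
  simp only [List.forall_mem_cons, List.not_mem_nil, false_imp_iff, implies_true, and_true] at hv ha
  obtain ⟨v1, v2, v3⟩ := hv
  obtain ⟨a1, a2, a3, a4, a5, a6⟩ := ha
  have hV : s'.v .V = s.v .V := by rw [hA.v _ (by decide), h.agree.v _ (by decide)]
  have hM : ∀ u v, Marked s' u v ↔ Marked s u v := fun u v => by rw [Marked, Marked, hV, a3]
  refine ⟨⟨hA, hD, ?_, ?_, ?_, ?_, ?_, ?_, ?_, ?_⟩, ⟨v1.ge, ?_, ?_⟩⟩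
  · simpa only [v1, a1, a2, hM] using h.entry
  · simpa only [v1, a1, a2] using h.inj
  · simpa only [v1, a1, a2, hM] using h.queued
  · simpa only [hM, a4, a5] using h.good
  · rw [v2, h.nd]
  · rw [v3, a6, h.words]
  · rw [v1, v2]; exact h.nd_le
  · rw [v2, v3]; exact h.wl_le
  · simp [a1, a2]
  · simp [a3]

theorem WInv.congr {dl : TreeDag ar} {s s' : PState} (h : WInv f g Sem dl s) (hA : Agree g s')
    (hD : s'.a .D = s.a .D) (hv : ∀ x ∈ [Var.tail, .nd, .wl], s'.v x = s.v x)
    (ha : ∀ b ∈ [Arr.QU, .QV, .MK, .DP, .DE, .DW], s'.a b = s.a b) :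
    WInv f g Sem dl s' ∧ Ext s s' :=
  h.congr' hA (by rw [hD]; exact h.dz) hv ha

theorem WInv.of_frame {dl : TreeDag ar} {s s' : PState} {P : Prog} (h : WInv f g Sem dl s)
    (hF : Frame P s s')
    (hv : ∀ x ∈ constV, x ∉ P.wv := by decide) (ha : ∀ b ∈ constA, b ∉ P.wa := by decide)
    (hD : .D ∉ P.wa := by decide) (hv' : ∀ x ∈ [Var.tail, .nd, .wl], x ∉ P.wv := by decide)
    (ha' : ∀ b ∈ [Arr.QU, .QV, .MK, .DP, .DE, .DW], b ∉ P.wa := by decide) :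
    WInv f g Sem dl s' ∧ Ext s s' :=
  h.congr (h.agree.of_frame hF hv ha) (hF.a _ hD) (fun x hx => hF.v x (hv' x hx))
    (fun b hb => hF.a b (ha' b hb))

theorem pair_index {V u v u' v' : ℕ} (hv : v < V) (hv' : v' < V) (h : u * V + v = u' * V + v') :
    u = u' ∧ v = v' := by
  have h1 : (u * V + v) / V = u := by
    rw [add_comm, Nat.add_mul_div_right _ _ (by omega), Nat.div_eq_of_lt hv, zero_add]
  have h2 : (u' * V + v') / V = u' := by
    rw [add_comm, Nat.add_mul_div_right _ _ (by omega), Nat.div_eq_of_lt hv', zero_add]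
  have : u = u' := by rw [← h1, ← h2, h]
  subst this
  exact ⟨rfl, by omega⟩

/-- A new entry of the queue preserves the invariant. The graph `dl ++ dl'` may have new nodes. -/
theorem WInv.insert {dl dl' : TreeDag ar} {s s' : PState} {u v cd ce : ℕ} (h : WInv f g Sem dl s)
    (hA : Agree g s') (hD : s'.a .D = s.a .D) (hu0 : u ≠ 0) (hu : u < g.v .len + g.v .len)
    (hv : v < g.v .V) (hnew : ¬ Marked s u v) (hG : Good f Sem (dl ++ dl') u v cd ce)
    (hMK : s'.a .MK = Function.update (s.a .MK) (u * g.v .V + v) 1)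
    (hDP : s'.a .DP = Function.update (s.a .DP) (u * g.v .V + v) cd)
    (hDE : s'.a .DE = Function.update (s.a .DE) (u * g.v .V + v) ce)
    (hQU : s'.a .QU = Function.update (s.a .QU) (s.v .tail) u)
    (hQV : s'.a .QV = Function.update (s.a .QV) (s.v .tail) v)
    (htail : s'.v .tail = s.v .tail + 1) (hnd : s'.v .nd = s.v .nd + dl'.length)
    (hl : dl'.length ≤ 1)
    (hw : (List.range (s'.v .wl)).map (s'.a .DW) = 1 :: (dl ++ dl').encode f)
    (hwl : s'.v .wl ≤ s.v .wl + (g.v .R + 1) * dl'.length) :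
    WInv f g Sem (dl ++ dl') s' ∧ Ext s s' ∧ Marked s' u v := by
  have hV : s'.v .V = g.v .V := hA.v _ (by decide)
  have hV₀ : s.v .V = g.v .V := h.agree.v _ (by decide)
  have hM : ∀ u' v', v' < g.v .V → (Marked s' u' v' ↔ (u' = u ∧ v' = v) ∨ Marked s u' v') := by
    intro u' v' hv'
    rw [Marked, Marked, hV, hMK, Function.update_apply, hV₀]
    by_cases he : u' * g.v .V + v' = u * g.v .V + v
    · have := pair_index hv' hv he
      simp [this]
    · rw [if_neg he]
      constructor
      · exact Or.inr
      · rintro (⟨rfl, rfl⟩ | h')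
        · exact absurd rfl he
        · exact h'
  have hmark : Marked s' u v := (hM u v hv).2 (Or.inl ⟨rfl, rfl⟩)
  have hq : ∀ t < s.v .tail, s'.a .QU t = s.a .QU t ∧ s'.a .QV t = s.a .QV t := fun t ht => by
    rw [hQU, hQV, Function.update_of_ne ht.ne, Function.update_of_ne ht.ne]
    exact ⟨rfl, rfl⟩
  have hql : s'.a .QU (s.v .tail) = u ∧ s'.a .QV (s.v .tail) = v := by
    rw [hQU, hQV, Function.update_self, Function.update_self]; exact ⟨rfl, rfl⟩
  have hne : ∀ t < s.v .tail, s.a .QU t = u → s.a .QV t = v → False := fun t ht h1 h2 => by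
    have := (h.entry t ht).2.2.2
    rw [h1, h2] at this
    exact hnew this
  refine ⟨⟨hA, by rw [hD]; exact h.dz, ?_, ?_, ?_, ?_, ?_, hw, ?_, ?_⟩, ⟨by omega, hq, ?_⟩, hmark⟩
  · intro t ht
    rw [htail] at ht
    rcases Nat.lt_succ_iff_lt_or_eq.1 ht with ht | rfl
    · obtain ⟨h1, h2, h3, h4⟩ := h.entry t ht
      rw [(hq t ht).1, (hq t ht).2]
      exact ⟨h1, h2, h3, (hM _ _ h3).2 (Or.inr h4)⟩
    · rw [hql.1, hql.2]
      exact ⟨hu0, hu, hv, hmark⟩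
  · intro t ht t' ht' h1 h2
    rw [htail] at ht ht'
    rcases Nat.lt_succ_iff_lt_or_eq.1 ht with ht | rfl <;>
    rcases Nat.lt_succ_iff_lt_or_eq.1 ht' with ht' | rfl
    · rw [(hq t ht).1, (hq t' ht').1] at h1
      rw [(hq t ht).2, (hq t' ht').2] at h2
      exact h.inj t ht t' ht' h1 h2
    · rw [(hq t ht).1, hql.1] at h1
      rw [(hq t ht).2, hql.2] at h2
      exact (hne t ht h1 h2).elim
    · rw [(hq t' ht').1, hql.1] at h1
      rw [(hq t' ht').2, hql.2] at h2
      exact (hne t' ht' h1.symm h2.symm).elim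
    · rfl
  · intro u' v' hv' hm
    rcases (hM _ _ hv').1 hm with ⟨rfl, rfl⟩ | hm
    · exact ⟨s.v .tail, by omega, hql⟩
    · obtain ⟨t, ht, h1, h2⟩ := h.queued u' v' hv' hm
      exact ⟨t, by omega, by rw [(hq t ht).1, h1], by rw [(hq t ht).2, h2]⟩
  · intro u' v' hv' hm
    rw [hDP, hDE]
    by_cases he : u' = u ∧ v' = v
    · obtain ⟨rfl, rfl⟩ := he
      rw [Function.update_self, Function.update_self]
      exact hG
    · have hm' : Marked s u' v' := ((hM _ _ hv').1 hm).resolve_left he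
      have hne : u' * g.v .V + v' ≠ u * g.v .V + v := fun h' => he (pair_index hv' hv h')
      rw [Function.update_of_ne hne, Function.update_of_ne hne]
      exact (h.good u' v' hv' hm').append
  · rw [hnd, h.nd, List.length_append]
  · have := h.nd_le; omega
  · rw [hnd, mul_add]
    have := h.wl_le
    omega
  · intro i hi
    rw [hMK, Function.update_apply]
    split_ifs
    · exact one_ne_zero
    · exact hi

/-- A value passes from an item to an item without a new node of the graph: the same tree is a
witness for both. -/
theorem run_push {dl : TreeDag ar} {s : PState} (h : WInv f g Sem dl s)
    (hto : s.v .to < g.v .len + g.v .len) (hv : s.v .v < g.v .V)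
    (hG : s.v .to ≠ 0 → Good f Sem dl (s.v .to) (s.v .v) (s.v .cd) (s.v .ce)) :
    WInv f g Sem dl (run push s) ∧ Ext s (run push s) ∧
      (s.v .to ≠ 0 → Marked (run push s) (s.v .to) (s.v .v)) := by
  have hA' : Agree g (run push s) := h.agree.of_frame (run_frame push s)
  have hV₀ : s.v .V = g.v .V := h.agree.v _ (by decide)
  by_cases h0 : s.v .to = 0
  · have : run push s = s := by simp [push, h0]
    rw [this]
    exact ⟨h, Ext.refl s, fun h => absurd h0 h⟩
  · have e1 : ∀ P Q : Prog, run (mul .idx .to .V .V;; set .idx (§.idx + §.v);;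
        branch (rd .MK (§.idx)) P Q) s = if Marked s (s.v .to) (s.v .v) then
          run P ((s.set .idx (s.v .to * g.v .V + s.v .v)).set .mi (g.v .V))
        else run Q ((s.set .idx (s.v .to * g.v .V + s.v .v)).set .mi (g.v .V)) := by
      intro P Q
      simp only [run_seq]
      rw [run_mul _ le_rfl (by decide) (by decide) (by decide) (by decide) (by decide) (by decide)
        (by decide)]
      have : (LState.set ((s.set .idx (s.v .to * g.v .V)).set .mi (g.v .V)) .idx
          (s.v .to * g.v .V + s.v .v) : PState) =
          (s.set .idx (s.v .to * g.v .V + s.v .v)).set .mi (g.v .V) := by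
        refine LState.ext' (fun x => ?_) (fun b => by simp)
        by_cases hx : x = .idx
        · simp [hx]
        · by_cases hy : x = .mi <;> simp [hx, hy]
      simp only [run_set, run_branch, ev_add, ev_rv, LState.set_v, LState.set_a, reduceCtorEq,
        if_true, if_false, ev_rd, this, Marked, hV₀]
    have e2 : run push s = if Marked s (s.v .to) (s.v .v) then
          run skip ((s.set .idx (s.v .to * g.v .V + s.v .v)).set .mi (g.v .V))
        else run (wr .MK (§.idx) 1;; wr .DP (§.idx) (§.cd);; wr .DE (§.idx) (§.ce);;
          wr .QU (§.tail) (§.to);; wr .QV (§.tail) (§.v);; set .tail (§.tail + 1))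
          ((s.set .idx (s.v .to * g.v .V + s.v .v)).set .mi (g.v .V)) := by
      rw [push, run_branch, if_pos (by simpa using h0), e1]
    by_cases hm : Marked s (s.v .to) (s.v .v)
    · rw [if_pos hm] at e2
      have := h.congr hA' (by simp [e2]) (by simp [e2]) (by simp [e2])
      exact ⟨this.1, this.2, fun _ => by
        have h2 := this.2.mark _ hm
        rwa [hV₀, ← hA'.v .V (by decide)] at h2⟩
    · rw [if_neg hm] at e2
      have := h.insert (dl' := []) (u := s.v .to) (v := s.v .v) hA' (by simp [e2]) h0 hto hv hm
        (by rw [List.append_nil]; exact hG h0) (by simp [e2]) (by simp [e2]) (by simp [e2])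
        (by simp [e2]) (by simp [e2]) (by simp [e2]) (by simp [e2]) (by simp)
        (by simp [e2, h.words]) (by simp [e2])
      rw [List.append_nil] at this
      exact ⟨this.1, this.2.1, fun _ => this.2.2⟩

theorem run_emitLoop (s : PState) (hj : s.v .j = 0) (har : s.v .ar ≤ s.v .R) :
    (run (loop .R emitWord) s).v .wl = s.v .wl + s.v .ar ∧
    (run (loop .R emitWord) s).a .DW = fun i =>
      if s.v .wl ≤ i ∧ i < s.v .wl + s.v .ar then s.a .CD (i - s.v .wl) else s.a .DW i := by
  have key := loop_inv (fun i s' => s'.v .j = i ∧ s'.v .wl = s.v .wl + min i (s.v .ar) ∧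
    s'.a .DW = fun j => if s.v .wl ≤ j ∧ j < s.v .wl + min i (s.v .ar) then s.a .CD (j - s.v .wl)
      else s.a .DW j) emitWord .R s ⟨hj, by simp, ?_⟩ ?_
  · rw [min_eq_right har] at key
    exact key.2
  · funext j
    rw [if_neg (by omega)]
  · rintro i s' hi hF ⟨h1, h2, h3⟩
    have har' := hF.v .ar (by decide)
    have hCD := hF.a .CD (by decide)
    simp only [emitWord, run_seq, run_branch, run_set, ev_ltE, ev_rv, h1, har']
    by_cases hlt : i < s.v .ar
    · have e1 : min (i + 1) (s.v .ar) = i + 1 := by omega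
      have e2 : min i (s.v .ar) = i := by omega
      rw [e2] at h2 h3
      refine ⟨by simp [hlt, h1], by simp [hlt, h2, e1, add_assoc], ?_⟩
      simp only [hlt, if_true, ne_eq, one_ne_zero, not_false_eq_true, run_seq, run_wr, run_set, e1,
        LState.set_a, LState.wr_a, ev_rv, ev_rd, h1, h2, h3, hCD]
      funext j
      rw [Function.update_apply]
      by_cases hj' : j = s.v .wl + i
      · subst hj'; simp
      · rw [if_neg hj']
        congr 1
        simp only [eq_iff_iff]
        omega
    · have e1 : min (i + 1) (s.v .ar) = s.v .ar := by omega
      have e2 : min i (s.v .ar) = s.v .ar := by omega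
      rw [e2] at h2 h3
      exact ⟨by simp [hlt, h1], by simp [hlt, h2, e1], by simp [hlt, h3, e1]⟩

/-- The new value of the node `p` is witnessed by a new node of the graph, whose children are the
witnesses of the values of the child items. -/
theorem run_emit {dl : TreeDag ar} {s : PState} (h : WInv f g Sem dl s) {p v : ℕ}
    (hp : s.v .p = p) (hval : s.v .val = v) (hp0 : p ≠ 0) (hpl : p < g.v .len) (hv : v < g.v .V)
    {sy : S} {ch : Fin (ar sy) → RTree ar Empty} (hsy : f sy = s.v .c) (har : ar sy = s.v .ar)
    (harR : ar sy ≤ g.v .R)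
    (hch : ∀ j : Fin (ar sy), dl.UnfoldsAt (s.a .CD j) (ch j)) (hS : Sem p v (.node sy ch)) :
    ∃ dl', WInv f g Sem dl' (run emit s) ∧ Ext s (run emit s) ∧ Marked (run emit s) p v := by
  have hA' : Agree g (run emit s) := h.agree.of_frame (run_frame emit s)
  have hV₀ : s.v .V = g.v .V := h.agree.v _ (by decide)
  have hD' := run_a emit s (b := .D) (by decide)
  obtain ⟨s₀, hs₀⟩ : ∃ s₀, s₀ = (s.set .idx (p * g.v .V + v)).set .mi (g.v .V) := ⟨_, rfl⟩
  have e1 : ∀ P Q : Prog, run (mul .idx .p .V .V;; set .idx (§.idx + §.val);;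
      branch (rd .MK (§.idx)) P Q) s = if Marked s p v then run P s₀ else run Q s₀ := by
    intro P Q
    simp only [run_seq]
    rw [run_mul _ le_rfl (by decide) (by decide) (by decide) (by decide) (by decide) (by decide)
      (by decide)]
    have : (LState.set ((s.set .idx (p * g.v .V)).set .mi (g.v .V)) .idx
        (p * g.v .V + v) : PState) = s₀ := by
      rw [hs₀]
      refine LState.ext' (fun x => ?_) (fun b => by simp)
      by_cases hx : x = .idx
      · simp [hx]
      · by_cases hy : x = .mi <;> simp [hx, hy]
    simp only [run_set, run_branch, ev_add, ev_rv, LState.set_v, LState.set_a, reduceCtorEq,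
      if_true, if_false, ev_rd, this, Marked, hV₀, hp, hval]
    simp [hs₀]
  have e2 : run emit s = _ := e1 _ _
  by_cases hm : Marked s p v
  · rw [if_pos hm] at e2
    have := h.congr hA' (by simp [e2, hs₀]) (by simp [e2, hs₀]) (by simp [e2, hs₀])
    exact ⟨dl, this.1, this.2, by
      have h2 := this.2.mark _ hm
      rwa [hV₀, ← hA'.v .V (by decide)] at h2⟩
  · rw [if_neg hm] at e2
    obtain ⟨s₁, hs₁⟩ : ∃ s₁, s₁ = ((s₀.wr .DW (s.v .wl) (s.v .c)).set .wl (s.v .wl + 1)).set .j 0 :=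
      ⟨_, rfl⟩
    have e3 : run emit s = run (wr .MK (§.idx) 1;; wr .DP (§.idx) (§.nd);; wr .DE (§.idx) (§.wl);;
        set .nd (§.nd + 1);; wr .QU (§.tail) (§.p);; wr .QV (§.tail) (§.val);;
        set .tail (§.tail + 1)) (run (loop .R emitWord) s₁) := by
      rw [e2, hs₁]
      simp [run_seq, hs₀]
    have hF := run_frame (loop .R emitWord) s₁
    have hl := run_emitLoop s₁ (by simp [hs₁]) (by
      simp [hs₁, hs₀, ← har, h.agree.v .R (by decide)]; exact harR)
    generalize run (loop .R emitWord) s₁ = s₂ at e3 hF hl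
    have v1 : s₁.v .wl = s.v .wl + 1 := by simp [hs₁]
    have v2 : s₁.v .ar = ar sy := by simp [hs₁, hs₀, har]
    have v3 : s₁.a .CD = s.a .CD := by simp [hs₁, hs₀]
    have v4 : s₁.a .DW = Function.update (s.a .DW) (s.v .wl) (f sy) := by simp [hs₁, hs₀, hsy]
    rw [v1, v2, v3, v4] at hl
    obtain ⟨hwl, hDW⟩ := hl
    have w1 : s₂.v .idx = p * g.v .V + v := by rw [hF.v _ (by decide)]; simp [hs₁, hs₀]
    have w2 : s₂.v .nd = s.v .nd := by rw [hF.v _ (by decide)]; simp [hs₁, hs₀]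
    have w3 : s₂.v .tail = s.v .tail := by rw [hF.v _ (by decide)]; simp [hs₁, hs₀]
    have w4 : s₂.v .p = p := by rw [hF.v _ (by decide)]; simp [hs₁, hs₀, hp]
    have w5 : s₂.v .val = v := by rw [hF.v _ (by decide)]; simp [hs₁, hs₀, hval]
    have w6 : ∀ b ∈ [Arr.MK, .DP, .DE, .QU, .QV], s₂.a b = s.a b := fun b hb => by
      have : b ≠ .DW := by revert b; decide
      rw [hF.a _ (by clear this; revert b; decide)]; simp [hs₁, hs₀, this]
    simp only [List.forall_mem_cons, List.not_mem_nil, false_imp_iff, implies_true, and_true] at w6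
    obtain ⟨a1, a2, a3, a4, a5⟩ := w6
    have henc : TreeDag.encode f (dl ++ [⟨sy, fun j => s.a .CD j⟩]) =
        dl.encode f ++ f sy :: List.ofFn fun j : Fin (ar sy) => s.a .CD j := by
      rw [encode_append]
      simp [TreeDag.encode]
    have hlen : s.v .wl = 1 + (dl.encode f).length := by
      have := congrArg List.length h.words
      simpa [add_comm] using this
    have hins := h.insert (dl' := [⟨sy, fun j => s.a .CD j⟩]) (u := p) (v := v) (s' := run emit s)
      (cd := s.v .nd) (ce := s₂.v .wl) hA' hD' hp0 (by omega) hv hm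
      ⟨_, hS, ?_, ?_⟩ (by simp [e3, w1, a1]) (by simp [e3, w1, w2, a2])
      (by simp [e3, w1, w2, a3]) (by simp [e3, w3, w4, a4]) (by simp [e3, w3, w5, a5])
      (by simp [e3, w3]) (by simp [e3, w2]) (by simp) ?_ ?_
    · exact ⟨_, hins⟩
    · refine .node (c := fun j => s.a .CD j) ?_ (fun j => ?_) fun j => unfoldsAt_append (hch j)
      · rw [h.nd]; simp
      · rw [h.nd]; exact unfoldsAt_lt_length (hch j)
    · rw [h.nd, List.take_of_length_le (by simp), henc, hwl, hlen]
      simp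
      omega
    · have x1 : (run emit s).v .wl = s.v .wl + 1 + ar sy := by simp [e3, hwl]
      have x2 : (run emit s).a .DW = s₂.a .DW := by simp [e3]
      rw [x1, x2, henc, hDW, List.range_add, List.range_succ]
      simp only [List.map_append, List.map_map, List.map_cons, List.map_nil]
      rw [← List.cons_append, ← h.words]
      have y1 : (List.range (s.v .wl)).map (fun i => if s.v .wl + 1 ≤ i ∧ i < s.v .wl + 1 + ar sy then
          s.a .CD (i - (s.v .wl + 1)) else Function.update (s.a .DW) (s.v .wl) (f sy) i) =
          (List.range (s.v .wl)).map (s.a .DW) := by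
        refine List.map_congr_left fun i hi => ?_
        rw [List.mem_range] at hi
        rw [if_neg (by omega), Function.update_of_ne hi.ne]
      rw [y1, if_neg (by omega), Function.update_self, List.append_assoc]
      congr 2
      rw [List.singleton_append]
      congr 1
      refine List.ext_getElem (by simp) fun i h1 h2 => ?_
      simp at h1
      simp [h1]
      omega
    · have x1 : (run emit s).v .wl = s.v .wl + 1 + ar sy := by simp [e3, hwl]
      rw [x1]
      simp
      omega

/-- All components of the tuple of values with code `τ` are acceptable for the node `p`. -/
def TupleOK (g s : PState) (p τ : ℕ) : Prop := ∀ j < g.a .AR (g.a .IN p), childOK s p τ j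

theorem Agree.tupleDig_eq {s : PState} (h : Agree g s) : tupleDig s = tupleDig g := by
  funext τ i
  simp only [tupleDig, h.v .E (by decide), h.v .V (by decide), h.v .b (by decide)]

theorem Agree.childOK_iff {s : PState} (h : Agree g s) (p τ j : ℕ) : childOK s p τ j ↔
    Marked s (g.a .CH (p * g.v .R + j)) (τ / g.v .V ^ j % g.v .V) ∧
      tupleDig g τ (j * g.v .E + g.v .N + g.v .k) =
        if j ≠ 0 then g.a .K1 (g.a .IN p) else g.a .K0 (g.a .IN p) := by
  simp only [childOK, Marked, h.tupleDig_eq, h.v .E (by decide), h.v .V (by decide),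
    h.v .R (by decide), h.v .N (by decide), h.v .k (by decide), h.a .CH (by decide),
    h.a .K1 (by decide), h.a .K0 (by decide), h.a .IN (by decide)]

theorem Ext.marked {s s' : PState} (h : Ext s s') (hA : Agree g s) (hA' : Agree g s') {u v : ℕ}
    (hm : Marked s u v) : Marked s' u v := by
  have := h.mark _ hm
  rwa [hA.v .V (by decide), ← hA'.v .V (by decide)] at this

/-- If all components of the tuple are known values of the children, of the right kinds, the
resulting value of the node becomes known. Otherwise nothing happens. -/
theorem run_applyTuple (hg : GOK g) (hS : SemOK f g Sem) {dl : TreeDag ar} {s : PState}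
    (h : WInv f g Sem dl s) {p τ : ℕ} (hp : s.v .p = p) (htc : s.v .tc = τ) (hτ : τ < g.v .VR)
    (hND : g.a .ND p ≠ 0) (hc : s.v .c = g.a .IN p) (har : s.v .ar = g.a .AR (g.a .IN p))
    (hpR : s.v .pR = p * g.v .R) :
    ∃ dl', WInv f g Sem dl' (run applyTuple s) ∧ Ext s (run applyTuple s) ∧
      (TupleOK g s p τ → Marked (run applyTuple s) p (resVal g (g.a .IN p) τ)) := by
  classical
  obtain ⟨s₀, hs₀⟩ : ∃ s₀, s₀ = (((s.set .q τ).set .j 0).set .oE 0).set .ok 1 := ⟨_, rfl⟩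
  have hrun : run applyTuple s = run (branch (§.ok)
    (set .op (rd .OP (§.c));; set .x (rd .OA (§.c));; evalPoints;; evalFree;;
      wr .RS (§.N + §.k) (rd .RK (§.c));; encodeRS;; emit) skip) (run (loop .R decodeChild) s₀) := by
    simp only [applyTuple, run_seq, run_set, hs₀, ev_rv, htc, ev_ofNat]
  have hv₀ : ∀ x ∈ [Var.p, .c, .ar, .pR, .tail, .nd, .wl] ++ constV, s₀.v x = s.v x := by
    intro x hx
    have : x ≠ .q ∧ x ≠ .j ∧ x ≠ .oE ∧ x ≠ .ok := by revert x; decide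
    simp [hs₀, this]
  have ha₀ : s₀.a = s.a := by simp [hs₀]
  have hA₀ : Agree g s₀ := ⟨fun x hx => (hv₀ x (by clear hrun; revert x; decide)).trans (h.agree.v x hx),
    fun b hb => by rw [ha₀]; exact h.agree.a b hb⟩
  have hdec := run_decodeLoop s₀ τ (by simp [hs₀]) (by simp [hs₀]) (by simp [hs₀]) (by simp [hs₀])
    (by rw [hv₀ _ (by decide), hv₀ _ (by decide), hc, hA₀.a _ (by decide), hp])
    (by rw [hv₀ .pR (by decide), hv₀ .p (by decide), hA₀.v _ (by decide), hpR, hp])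
    (by rw [hv₀ _ (by decide), har, hA₀.v _ (by decide)]; exact hg.ar_le _)
    (by rw [hA₀.v _ (by decide)]; exact hg.b_pos) (by rw [hA₀.v _ (by decide)]; exact hg.V_pos)
    (by rw [hA₀.v _ (by decide)]; exact hτ.le)
    (by rw [hA₀.v _ (by decide), hA₀.v _ (by decide), hA₀.v _ (by decide)]; exact hg.E_eq)
  have hF := run_frame (loop .R decodeChild) s₀
  generalize run (loop .R decodeChild) s₀ = s₁ at hrun hdec hF
  obtain ⟨hD, hok, hCD⟩ := hdec
  have hA₁ : Agree g s₁ := hA₀.of_frame hF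
  have hD₁ : s₁.a .D = tupleDig g τ := by
    rw [hD]
    funext i
    rw [hA₀.v _ (by decide), hA₀.v _ (by decide), hA₀.tupleDig_eq, ha₀]
    split_ifs with hi
    · rfl
    · rw [h.dz i (by omega), hg.tupleDig_eq_zero hτ (by omega)]
  have hW := h.congr' hA₁ (fun i hi => by rw [hD₁, hg.tupleDig_eq_zero hτ hi])
    (fun x hx => by
      rw [hF.v x (by clear hok hCD; revert x; decide)]; exact hv₀ x (by clear hok hCD; revert x; decide))
    (fun b hb => by rw [hF.a b (by revert b; decide), ha₀])
  obtain ⟨hW₁, hE₁⟩ := hW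
  have hok' : s₁.v .ok = if TupleOK g s p τ then 1 else 0 := by
    rw [hok]
    refine if_congr ?_ rfl rfl
    rw [hv₀ .ar (by decide), hv₀ .p (by decide), har, hp, TupleOK]
    refine forall_congr' fun j => imp_congr_right fun _ => ?_
    rw [hA₀.childOK_iff, h.agree.childOK_iff, Marked, Marked, ha₀, hv₀ .V (by decide)]
  by_cases hT : TupleOK g s p τ
  · rw [if_pos hT] at hok'
    rw [run_branch, if_pos (by simp [hok'])] at hrun
    obtain ⟨sy, hsy, hsya, hcomb⟩ := hS.comb p hND
    have hex : ∀ j : Fin (ar sy), ∃ t : RTree ar Empty,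
        Sem (g.a .CH (p * g.v .R + j)) (τ / g.v .V ^ (j : ℕ) % g.v .V) t ∧
          dl.UnfoldsAt (s₁.a .CD j) t := by
      intro j
      have hj : (j : ℕ) < g.a .AR (g.a .IN p) := hsya ▸ j.2
      obtain ⟨hm, -⟩ := (h.agree.childOK_iff p τ j).1 (hT j hj)
      obtain ⟨t, h1, h2, -⟩ := h.good _ _ (Nat.mod_lt _ hg.V_pos) hm
      refine ⟨t, h1, ?_⟩
      rw [hCD j (by rw [hv₀ _ (by decide), har]; exact hj), ha₀, hv₀ .p (by decide), hp,
        hA₀.v .R (by decide), hA₀.v .V (by decide), h.agree.a .CH (by decide)]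
      exact h2
    choose ch hch using hex
    obtain ⟨hlt, hSem⟩ := hcomb τ ch hτ (fun j => (hch j).1) fun j hj =>
      ((h.agree.childOK_iff p τ j).1 (hT j (hsya ▸ hj))).2
    obtain ⟨s₂, hs₂⟩ : ∃ s₂, s₂ = (s₁.set .op (g.a .OP (g.a .IN p))).set .x (g.a .OA (g.a .IN p)) :=
      ⟨_, rfl⟩
    have hc₁ : s₁.v .c = g.a .IN p := by rw [hF.v _ (by decide), hv₀ _ (by decide), hc]
    have har₁ : s₁.v .ar = g.a .AR (g.a .IN p) := by rw [hF.v _ (by decide), hv₀ _ (by decide), har]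
    have hp₁ : s₁.v .p = p := by rw [hF.v _ (by decide), hv₀ _ (by decide), hp]
    have hrun₂ : run applyTuple s = run emit (run (evalPoints;; evalFree;;
        wr .RS (§.N + §.k) (rd .RK (§.c));; encodeRS) s₂) := by
      rw [hrun, hs₂]
      simp only [run_seq, run_set, ev_rd, ev_rv, hc₁, LState.set_a, LState.set_v, reduceCtorEq,
        if_false, hA₁.a .OP (by decide), hA₁.a .OA (by decide)]
    have hA₂ : Agree g s₂ := by
      refine ⟨fun x hx => ?_, fun b hb => by rw [hs₂]; exact hA₁.a b hb⟩
      have : x ≠ .op ∧ x ≠ .x := by clear hok hCD; revert x; decide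
      simp [hs₂, this]
      exact hA₁.v x hx
    obtain ⟨hW₂, hE₂⟩ := hW₁.congr (s' := s₂) hA₂ (by simp [hs₂]) (by simp [hs₂]) (by simp [hs₂])
    have hval := run_resVal hg hA₂ (g.a .IN p) τ (by simp [hs₂, har₁]) (by simp [hs₂])
      (by simp [hs₂]) (by simp [hs₂, hc₁]) (by simp [hs₂, hD₁]) hlt
    have hF₃ := run_frame (evalPoints;; evalFree;; wr .RS (§.N + §.k) (rd .RK (§.c));; encodeRS) s₂
    generalize run (evalPoints;; evalFree;; wr .RS (§.N + §.k) (rd .RK (§.c));; encodeRS) s₂ = s₃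
      at hrun₂ hval hF₃
    obtain ⟨hW₃, hE₃⟩ := hW₂.of_frame hF₃
    have hvlt : resVal g (g.a .IN p) τ < g.v .V := by
      rw [hg.V_eq]; exact ofDig_lt hlt
    obtain ⟨dl', h1, h2, h3⟩ := run_emit hW₃ (p := p) (sy := sy) (ch := ch)
      (by rw [hF₃.v _ (by decide)]; simp [hs₂, hp₁]) hval
      (hg.nd p hND).1.ne' (hg.nd p hND).2 hvlt
      (by rw [hF₃.v _ (by decide), hsy]; simp [hs₂, hc₁])
      (by rw [hF₃.v _ (by decide), hsya]; simp [hs₂, har₁])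
      (hsya ▸ hg.ar_le _) (fun j => by
        have e : s₃.a .CD = s₁.a .CD := by rw [hF₃.a _ (by decide)]; simp [hs₂]
        rw [e]; exact (hch j).2) hSem
    rw [← hrun₂] at h1 h2 h3
    exact ⟨dl', h1, ((hE₁.trans hE₂).trans hE₃).trans h2, fun _ => h3⟩
  · rw [if_neg hT] at hok'
    rw [run_branch, if_neg (by simp [hok']), run_skip] at hrun
    rw [hrun]
    exact ⟨dl, hW₁, hE₁, fun h => absurd h hT⟩

theorem TupleOK.mono {s s' : PState} {p τ : ℕ} (h : TupleOK g s p τ) (hE : Ext s s') (hA : Agree g s)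
    (hA' : Agree g s') : TupleOK g s' p τ := fun j hj => by
  have := (hA.childOK_iff p τ j).1 (h j hj)
  exact (hA'.childOK_iff p τ j).2 ⟨hE.marked hA hA' this.1, this.2⟩

/-- After the symbol of the node `p` has been applied to all tuples, its values include the results
for all tuples of known values. -/
theorem run_combine (hg : GOK g) (hS : SemOK f g Sem) {dl : TreeDag ar} {s : PState}
    (h : WInv f g Sem dl s) {p : ℕ} (hp : s.v .p = p) (hND : g.a .ND p ≠ 0) :
    ∃ dl', WInv f g Sem dl' (run combine s) ∧ Ext s (run combine s) ∧
      ∀ τ < g.v .VR, TupleOK g s p τ → Marked (run combine s) p (resVal g (g.a .IN p) τ) := by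
  obtain ⟨s₀, hs₀⟩ : ∃ s₀, s₀ = run (set .c (rd .IN (§.p));; set .ar (rd .AR (§.c));; mul .pR .p .R .R;;
    set .tc 0) s := ⟨_, rfl⟩
  have hrun : run combine s = run (loop .VR tupleStep) s₀ := by rw [hs₀]; rfl
  have hF₀ : Frame _ s s₀ := hs₀ ▸ run_frame _ s
  obtain ⟨hW₀, hE₀⟩ := h.of_frame hF₀
  have hA₀ := hW₀.agree
  have f1 : s₀.v .c = g.a .IN p ∧ s₀.v .ar = g.a .AR (g.a .IN p) ∧ s₀.v .pR = p * g.v .R ∧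
      s₀.v .tc = 0 ∧ s₀.v .p = p := by
    rw [hs₀]
    simp only [run_seq, run_set]
    rw [run_mul _ le_rfl (by decide) (by decide) (by decide) (by decide) (by decide) (by decide)
        (by decide)]
    simp [hp, h.agree.a .IN (by decide), h.agree.a .AR (by decide), h.agree.v .R (by decide)]
  obtain ⟨f1, f2, f3, f4, f5⟩ := f1
  have key := loop_inv (fun i s' => s'.v .tc = i ∧ ∃ dl', WInv f g Sem dl' s' ∧ Ext s₀ s' ∧
    ∀ τ < i, τ < g.v .VR → TupleOK g s₀ p τ → Marked s' p (resVal g (g.a .IN p) τ)) tupleStep .VR s₀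
    ⟨f4, dl, hW₀, Ext.refl _, by simp⟩ ?_
  · rw [hrun]
    obtain ⟨-, dl', h1, h2, h3⟩ := key
    rw [hA₀.v _ (by decide)] at h3
    exact ⟨dl', h1, hE₀.trans h2, fun τ hτ hT => h3 τ hτ hτ (hT.mono hE₀ h.agree hA₀)⟩
  · rintro i s' hi hF ⟨h1, dl', h2, h3, h4⟩
    rw [hA₀.v _ (by decide)] at hi
    obtain ⟨dl'', g1, g2, g3⟩ := run_applyTuple hg hS h2 (p := p) (by rw [hF.v _ (by decide), f5]) h1 hi hND
      (by rw [hF.v _ (by decide), f1]) (by rw [hF.v _ (by decide), f2]) (by rw [hF.v _ (by decide), f3])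
    have htc : (run applyTuple s').v .tc = i := by rw [run_v _ _ (by decide), h1]
    simp only [tupleStep, run_seq]
    generalize run applyTuple s' = s₁ at g1 g2 g3 htc
    obtain ⟨k1, k2⟩ := g1.of_frame (run_frame (set .tc (§.tc + 1)) s₁)
    refine ⟨by simp [htc], dl'', k1, (h3.trans g2).trans k2, fun τ hτ hτV hT => ?_⟩
    rcases Nat.lt_succ_iff_lt_or_eq.1 hτ with hlt | rfl
    · exact (g2.trans k2).marked h2.agree k1.agree (h4 τ hlt hτV hT)
    · exact k2.marked g1.agree k1.agree (g3 (hT.mono h3 hA₀ h2.agree))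

/-- The invariant holds initially with the empty graph, and all values of nodes without children are
known after the first phase. The other rules are left to the queue. -/
theorem run_combineAll (hg : GOK g) (hS : SemOK f g Sem) {s : PState} (hA : Agree g s)
    (hD : ∀ i, s.a .D i = 0) (hMK : ∀ i, s.a .MK i = 0) :
    ∃ dl, WInv f g Sem dl (run combineAll s) ∧ ∀ p τ, g.a .ND p ≠ 0 → τ < g.v .VR →
      g.a .AR (g.a .IN p) = 0 → Marked (run combineAll s) p (resVal g (g.a .IN p) τ) := by
  obtain ⟨s₀, hs₀⟩ : ∃ s₀, s₀ = run (set .wl 1;; wr .DW 0 1;; set .tail 0;; set .nd 0;; set .u 0) s :=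
    ⟨_, rfl⟩
  have hrun : run combineAll s = run (loop .len combineStep) s₀ := by rw [hs₀]; rfl
  have hF₀ : Frame _ s s₀ := hs₀ ▸ run_frame _ s
  have hA₀ : Agree g s₀ := hA.of_frame hF₀
  have f1 : s₀.v .wl = 1 ∧ s₀.a .DW 0 = 1 ∧ s₀.v .tail = 0 ∧ s₀.v .nd = 0 ∧ s₀.v .u = 0 := by
    rw [hs₀]; simp
  obtain ⟨f1, f2, f3, f4, f5⟩ := f1
  have hM₀ : ∀ u v, ¬ Marked s₀ u v := fun u v => by
    rw [Marked, hF₀.a _ (by decide)]; simp [hMK]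
  have hW₀ : WInv f g Sem [] s₀ := by
    refine ⟨hA₀, fun i _ => ?_, by simp [f3], by simp [f3], fun u v _ h => absurd h (hM₀ u v),
      fun u v _ h => absurd h (hM₀ u v), by simp [f4], by simp [f1, f2, TreeDag.encode], by simp [f4],
      by simp [f1]⟩
    rw [hF₀.a _ (by decide), hD]
  have key := loop_inv (fun i s' => s'.v .u = i ∧ ∃ dl, WInv f g Sem dl s' ∧
    ∀ p < i, ∀ τ < g.v .VR, g.a .ND p ≠ 0 →
      g.a .AR (g.a .IN p) = 0 → Marked s' p (resVal g (g.a .IN p) τ)) combineStep .len s₀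
    ⟨f5, [], hW₀, by simp⟩ ?_
  · rw [hrun]
    obtain ⟨-, dl, h1, h2⟩ := key
    rw [hA₀.v _ (by decide)] at h2
    exact ⟨dl, h1, fun p τ hp hτ h0 => h2 p (hg.nd p hp).2 τ hτ hp h0⟩
  · rintro i s' hi hF ⟨h1, dl, h2, h3⟩
    have hND := h2.agree.a .ND (by decide)
    obtain ⟨s₁, hs₁⟩ : ∃ s₁, s₁ = run (branch (rd .ND (§.u)) (set .p (§.u);; combine) skip) s' :=
      ⟨_, rfl⟩
    have hu : s₁.v .u = i := by rw [hs₁, run_v _ _ (by decide), h1]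
    have hstep : ∃ dl', WInv f g Sem dl' s₁ ∧ Ext s' s₁ ∧ ∀ τ < g.v .VR, g.a .ND i ≠ 0 →
        TupleOK g s' i τ → Marked s₁ i (resVal g (g.a .IN i) τ) := by
      rw [hs₁, run_branch]
      simp only [ev_rd, ev_rv, h1, hND]
      split_ifs with h0
      · obtain ⟨k1, k2⟩ := h2.of_frame (run_frame (set .p (§.u)) s')
        obtain ⟨dl', k3, k4, k5⟩ := run_combine hg hS k1 (p := i) (by simp [h1]) h0
        exact ⟨dl', k3, k2.trans k4, fun τ hτ _ hT => k5 τ hτ (hT.mono k2 h2.agree k1.agree)⟩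
      · exact ⟨dl, h2, Ext.refl _, fun τ _ h => absurd h h0⟩
    obtain ⟨dl', k1, k2, k3⟩ := hstep
    have e : run combineStep s' = run (set .u (§.u + 1)) s₁ := by rw [hs₁]; rfl
    obtain ⟨k4, k5⟩ := k1.of_frame (run_frame (set .u (§.u + 1)) s₁)
    rw [e]
    refine ⟨by simp [hu], dl', k4, fun p hp τ hτ hNp h0 => ?_⟩
    rcases Nat.lt_succ_iff_lt_or_eq.1 hp with hlt | rfl
    · exact (k2.trans k5).marked h2.agree k4.agree (h3 p hlt τ hτ hNp h0)
    · exact k5.marked k1.agree k4.agree (k3 τ hτ hNp fun j hj => by omega)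

/-- An entry of the queue triggers the three rules in which it may be a premise. -/
theorem run_processEntry (hg : GOK g) (hS : SemOK f g Sem) {dl : TreeDag ar} {s : PState}
    (h : WInv f g Sem dl s) {u v : ℕ} (ht : s.v .t < s.v .tail) (hu : s.a .QU (s.v .t) = u)
    (hv : s.a .QV (s.v .t) = v) :
    ∃ dl', WInv f g Sem dl' (run processEntry s) ∧ Ext s (run processEntry s) ∧
      (g.a .NX u ≠ 0 → Marked (run processEntry s) (g.a .NX u) v) ∧
      (g.a .CP u ≠ 0 → Marked (run processEntry s) (g.a .CP u) v) ∧
      (g.a .PA u ≠ 0 → ∀ τ < g.v .VR, TupleOK g s (g.a .PA u) τ →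
        Marked (run processEntry s) (g.a .PA u) (resVal g (g.a .IN (g.a .PA u)) τ)) := by
  obtain ⟨hu0, hul, hvV, hm⟩ := h.entry _ ht
  rw [hu] at hu0 hul hm
  rw [hv] at hvV hm
  have hG := h.good u v hvV hm
  obtain ⟨s₀, hs₀⟩ : ∃ s₀, s₀ = run (set .u (rd .QU (§.t));; set .v (rd .QV (§.t));;
    mul .idx .u .V .V;; set .idx (§.idx + §.v);;
    set .cd (rd .DP (§.idx));; set .ce (rd .DE (§.idx));; set .to (rd .NX (§.u))) s := ⟨_, rfl⟩
  have hF₀ : Frame _ s s₀ := hs₀ ▸ run_frame _ s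
  obtain ⟨hW₀, hE₀⟩ := h.of_frame hF₀
  have f1 : s₀.v .u = u ∧ s₀.v .v = v ∧ s₀.v .cd = s.a .DP (u * g.v .V + v) ∧
      s₀.v .ce = s.a .DE (u * g.v .V + v) ∧ s₀.v .to = g.a .NX u := by
    rw [hs₀]
    simp only [run_seq, run_set]
    rw [run_mul _ le_rfl (by decide) (by decide) (by decide) (by decide) (by decide) (by decide)
        (by decide)]
    simp [hu, hv, h.agree.a .NX (by decide), h.agree.v .V (by decide)]
  obtain ⟨f1, f2, f3, f4, f5⟩ := f1
  have hrun : run processEntry s = run (set .to (rd .CP (§.u));; push;;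
    branch (rd .PA (§.u)) (set .p (rd .PA (§.u));; combine) skip) (run push s₀) := by rw [hs₀]; rfl
  obtain ⟨a1, a2, a3⟩ := run_push hW₀ (by rw [f5]; exact hg.nx_lt u) (by rw [f2]; exact hvV)
    (fun h0 => by
      rw [f5] at h0 ⊢
      rw [f2, f3, f4]
      obtain ⟨t, t1, t2⟩ := hG
      exact ⟨t, hS.next u v t t1 h0, t2⟩)
  have hF₁ := run_frame push s₀
  rw [hrun]
  generalize run push s₀ = s₁ at a1 a2 a3 hF₁
  rw [f5, f2] at a3
  obtain ⟨s₂, hs₂⟩ : ∃ s₂, s₂ = run (set .to (rd .CP (§.u))) s₁ := ⟨_, rfl⟩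
  have hF₂ : Frame _ s₁ s₂ := hs₂ ▸ run_frame _ s₁
  obtain ⟨hW₂, hE₂⟩ := a1.of_frame hF₂
  have v1 : s₂.v .u = u := by rw [hF₂.v _ (by decide), hF₁.v _ (by decide), f1]
  have v2 : s₂.v .v = v := by rw [hF₂.v _ (by decide), hF₁.v _ (by decide), f2]
  have v3 : s₂.v .cd = s.a .DP (u * g.v .V + v) := by
    rw [hF₂.v _ (by decide), hF₁.v _ (by decide), f3]
  have v4 : s₂.v .ce = s.a .DE (u * g.v .V + v) := by
    rw [hF₂.v _ (by decide), hF₁.v _ (by decide), f4]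
  have v5 : s₂.v .to = g.a .CP u := by
    rw [hs₂]
    simp [a1.agree.a .CP (by decide), hF₁.v .u (by decide), f1]
  have hE₀₂ := (hE₀.trans a2).trans hE₂
  have hrun₂ : run (set .to (rd .CP (§.u));; push;;
    branch (rd .PA (§.u)) (set .p (rd .PA (§.u));; combine) skip) s₁ =
    run (branch (rd .PA (§.u)) (set .p (rd .PA (§.u));; combine) skip) (run push s₂) := by
      rw [hs₂]; rfl
  obtain ⟨b1, b2, b3⟩ := run_push hW₂ (by rw [v5]; exact hg.cp_lt u) (by rw [v2]; exact hvV)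
    (fun h0 => by
      rw [v5] at h0 ⊢
      rw [v2, v3, v4]
      obtain ⟨t, t1, t2⟩ := hG
      exact ⟨t, hS.up u v t t1 h0, t2⟩)
  have hF₃ := run_frame push s₂
  rw [hrun₂]
  generalize run push s₂ = s₃ at b1 b2 b3 hF₃
  rw [v5, v2] at b3
  have w1 : s₃.v .u = u := by rw [hF₃.v _ (by decide), v1]
  rw [run_branch]
  simp only [ev_rd, ev_rv, w1, b1.agree.a .PA (by decide)]
  split_ifs with h0
  · obtain ⟨k1, k2⟩ := b1.of_frame (run_frame (set .p (rd .PA (§.u))) s₃)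
    obtain ⟨dl', k3, k4, k5⟩ := run_combine hg hS k1 (p := g.a .PA u)
      (by simp [w1, b1.agree.a .PA (by decide)]) (hg.pa u h0)
    refine ⟨dl', k3, (hE₀₂.trans b2).trans (k2.trans k4), fun h => ?_, fun h => ?_,
      fun _ τ hτ hT => ?_⟩
    · exact ((hE₂.trans b2).trans (k2.trans k4)).marked a1.agree k3.agree (a3 h)
    · exact (k2.trans k4).marked b1.agree k3.agree (b3 h)
    · exact k5 τ hτ (hT.mono ((hE₀₂.trans b2).trans k2) h.agree k1.agree)
  · exact ⟨dl, b1, hE₀₂.trans b2, fun h => (hE₂.trans b2).marked a1.agree b1.agree (a3 h), b3,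
      fun h => absurd h h0⟩

/-- The known values are closed under all rules that the first `i` entries of the queue give rise
to. -/
structure Done (g s : PState) (i : ℕ) : Prop where
  next : ∀ t < i, t < s.v .tail → g.a .NX (s.a .QU t) ≠ 0 →
    Marked s (g.a .NX (s.a .QU t)) (s.a .QV t)
  up : ∀ t < i, t < s.v .tail → g.a .CP (s.a .QU t) ≠ 0 →
    Marked s (g.a .CP (s.a .QU t)) (s.a .QV t)
  comb : ∀ p τ, g.a .ND p ≠ 0 → τ < g.v .VR → TupleOK g s p τ → (∀ j < g.a .AR (g.a .IN p),
    ∃ t < i, t < s.v .tail ∧ s.a .QU t = g.a .CH (p * g.v .R + j) ∧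
      s.a .QV t = τ / g.v .V ^ j % g.v .V) → Marked s p (resVal g (g.a .IN p) τ)

/-- The entries of the queue are different pairs of an item and a value, so that the queue is no
longer than the loop that handles it. -/
theorem WInv.tail_le (hg : GOK g) {dl : TreeDag ar} {s : PState} (h : WInv f g Sem dl s) :
    s.v .tail ≤ g.v .MV := by
  have : (Finset.range (s.v .tail)).card ≤ (Finset.range (g.v .MV)).card := by
    refine Finset.card_le_card_of_injOn (fun t => s.a .QU t * g.v .V + s.a .QV t) ?_ ?_
    · intro t ht
      obtain ⟨-, h1, h2, -⟩ := h.entry t (by simpa using ht)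
      simp only [Finset.coe_range, Set.mem_Iio, hg.MV_eq]
      have : (s.a .QU t + 1) * g.v .V ≤ (g.v .len + g.v .len) * g.v .V := Nat.mul_le_mul_right _ h1
      rw [add_mul, one_mul] at this
      omega
    · intro t ht t' ht' he
      have ht := h.entry t (by simpa using ht)
      have ht' := h.entry t' (by simpa using ht')
      have := pair_index ht.2.2.1 ht'.2.2.1 he
      exact h.inj t (by simp_all) t' (by simp_all) this.1 this.2
  simpa using this

/-- In the end the known values are closed under the three rules. A tuple of values for the children
of a node takes effect when the last of its components is handled: all components are known then,
and this entry triggers the evaluation of its parent. -/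
theorem run_saturate (hg : GOK g) (hS : SemOK f g Sem) {dl : TreeDag ar} {s : PState}
    (h : WInv f g Sem dl s) (h0 : ∀ p τ, g.a .ND p ≠ 0 → τ < g.v .VR →
      g.a .AR (g.a .IN p) = 0 → Marked s p (resVal g (g.a .IN p) τ)) :
    ∃ dl', WInv f g Sem dl' (run saturate s) ∧
      (∀ u v, v < g.v .V → Marked (run saturate s) u v → g.a .NX u ≠ 0 →
        Marked (run saturate s) (g.a .NX u) v) ∧
      (∀ u v, v < g.v .V → Marked (run saturate s) u v → g.a .CP u ≠ 0 →
        Marked (run saturate s) (g.a .CP u) v) ∧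
      (∀ p τ, g.a .ND p ≠ 0 → τ < g.v .VR → TupleOK g (run saturate s) p τ →
        Marked (run saturate s) p (resVal g (g.a .IN p) τ)) := by
  obtain ⟨hW₀, hE₀⟩ := h.of_frame (run_frame (set .t 0) s)
  have ht₀ : (run (set .t 0) s).v .t = 0 := by simp
  rw [saturate, run_seq]
  generalize run (set .t 0) s = s₀ at hW₀ hE₀ ht₀
  have key := loop_inv (fun i s' => s'.v .t = i ∧ ∃ dl, WInv f g Sem dl s' ∧ Ext s₀ s' ∧ Done g s' i)
    saturateStep .MV s₀ ⟨ht₀, dl, hW₀, Ext.refl _, by simp, by simp, fun p τ hp hτ hT hj => ?_⟩ ?_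
  · obtain ⟨-, dl', h1, -, h3⟩ := key
    rw [hW₀.agree.v _ (by decide)] at h3
    have hlt : ∀ t < (run (loop .MV saturateStep) s₀).v .tail, t < g.v .MV := fun t ht =>
      ht.trans_le (h1.tail_le hg)
    refine ⟨dl', h1, fun u v hv hm hn => ?_, fun u v hv hm hn => ?_, fun p τ hp hτ hT => ?_⟩
    · obtain ⟨t, ht, rfl, rfl⟩ := h1.queued u v hv hm
      exact h3.next t (hlt t ht) ht hn
    · obtain ⟨t, ht, rfl, rfl⟩ := h1.queued u v hv hm
      exact h3.up t (hlt t ht) ht hn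
    · refine h3.comb p τ hp hτ hT fun j hj => ?_
      obtain ⟨t, ht, e⟩ := h1.queued _ _ (Nat.mod_lt _ hg.V_pos)
        ((h1.agree.childOK_iff p τ j).1 (hT j hj)).1
      exact ⟨t, hlt t ht, ht, e⟩
  · -- no entry has been handled, so a node all of whose children have been handled has no children
    refine hE₀.marked h.agree hW₀.agree (h0 p τ hp hτ ?_)
    by_contra hne
    obtain ⟨t, ht, -⟩ := hj 0 (Nat.pos_of_ne_zero hne)
    omega
  · rintro i s' hi hF ⟨h1, dl', h2, h3, h4⟩
    obtain ⟨s₁, hs₁⟩ : ∃ s₁, s₁ = run (branch (ltE (§.t) (§.tail)) processEntry skip) s' := ⟨_, rfl⟩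
    have ht : s₁.v .t = i := by rw [hs₁, run_v _ _ (by decide), h1]
    have hstep : ∃ dl', WInv f g Sem dl' s₁ ∧ Ext s' s₁ ∧ (s'.v .tail ≤ i → s₁ = s') ∧
        (i < s'.v .tail → (g.a .NX (s'.a .QU i) ≠ 0 → Marked s₁ (g.a .NX (s'.a .QU i)) (s'.a .QV i)) ∧
        (g.a .CP (s'.a .QU i) ≠ 0 → Marked s₁ (g.a .CP (s'.a .QU i)) (s'.a .QV i)) ∧
        (g.a .PA (s'.a .QU i) ≠ 0 → ∀ τ < g.v .VR, TupleOK g s' (g.a .PA (s'.a .QU i)) τ →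
          Marked s₁ (g.a .PA (s'.a .QU i)) (resVal g (g.a .IN (g.a .PA (s'.a .QU i))) τ))) := by
      rw [hs₁, run_branch]
      simp only [ev_ltE, ev_rv, h1]
      by_cases hlt : i < s'.v .tail
      · obtain ⟨dl'', k⟩ := run_processEntry hg hS h2 (u := s'.a .QU i) (v := s'.a .QV i)
          (by rw [h1]; exact hlt) (by rw [h1]) (by rw [h1])
        rw [if_pos (by simp [hlt])]
        exact ⟨dl'', k.1, k.2.1, fun h => by omega, fun _ => k.2.2⟩
      · rw [if_neg (by simp [hlt])]
        exact ⟨dl', h2, Ext.refl _, fun _ => rfl, fun h => absurd h hlt⟩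
    obtain ⟨dl'', k1, k2, k3, k4⟩ := hstep
    have e : run saturateStep s' = run (set .t (§.t + 1)) s₁ := by rw [hs₁]; rfl
    obtain ⟨k5, k6⟩ := k1.of_frame (run_frame (set .t (§.t + 1)) s₁)
    rw [e]
    refine ⟨by simp [ht], dl'', k5, (h3.trans k2).trans k6, ?_⟩
    have htl : (run (set .t (§.t + 1)) s₁).v .tail = s₁.v .tail := by simp
    generalize run (set .t (§.t + 1)) s₁ = s₂ at k5 k6 htl
    have hold : ∀ t < i + 1, t < s₂.v .tail → t < s'.v .tail ∧ s₂.a .QU t = s'.a .QU t ∧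
        s₂.a .QV t = s'.a .QV t := by
      intro t hti htt
      have hlt : t < s'.v .tail := by
        by_cases hle : s'.v .tail ≤ i
        · rwa [htl, k3 hle] at htt
        · omega
      exact ⟨hlt, (k2.trans k6).queue t hlt⟩
    have hmm : ∀ u v, Marked s' u v → Marked s₂ u v := fun u v => (k2.trans k6).marked h2.agree k5.agree
    have hm₁ : ∀ u v, Marked s₁ u v → Marked s₂ u v := fun u v => k6.marked k1.agree k5.agree
    refine ⟨fun t hti htt hn => ?_, fun t hti htt hn => ?_, fun p τ hp hτ hT hj => ?_⟩
    · obtain ⟨hlt, e1, e2⟩ := hold t hti htt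
      rw [e1] at hn
      rw [e1, e2]
      rcases Nat.lt_succ_iff_lt_or_eq.1 hti with h | rfl
      · exact hmm _ _ (h4.next t h hlt hn)
      · exact hm₁ _ _ ((k4 hlt).1 hn)
    · obtain ⟨hlt, e1, e2⟩ := hold t hti htt
      rw [e1] at hn
      rw [e1, e2]
      rcases Nat.lt_succ_iff_lt_or_eq.1 hti with h | rfl
      · exact hmm _ _ (h4.up t h hlt hn)
      · exact hm₁ _ _ ((k4 hlt).2.1 hn)
    · have hT' : TupleOK g s' p τ := fun j hjj => by
        refine (h2.agree.childOK_iff p τ j).2 ⟨?_, ((k5.agree.childOK_iff p τ j).1 (hT j hjj)).2⟩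
        obtain ⟨t, hti, htt, e1, e2⟩ := hj j hjj
        obtain ⟨hlt, e3, e4⟩ := hold t hti htt
        rw [← e1, ← e2, e3, e4]
        exact (h2.entry t hlt).2.2.2
      by_cases hall : ∀ j < g.a .AR (g.a .IN p), ∃ t < i, t < s'.v .tail ∧
          s'.a .QU t = g.a .CH (p * g.v .R + j) ∧ s'.a .QV t = τ / g.v .V ^ j % g.v .V
      · exact hmm _ _ (h4.comb p τ hp hτ hT' hall)
      · -- component `j` is the entry that has just been handled, and `p` is its parent
        push Not at hall
        obtain ⟨j, hjj, hno⟩ := hall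
        obtain ⟨t, hti, htt, e1, e2⟩ := hj j hjj
        obtain ⟨hlt, e3, e4⟩ := hold t hti htt
        rw [e3] at e1
        rw [e4] at e2
        rcases Nat.lt_succ_iff_lt_or_eq.1 hti with h | rfl
        · exact absurd e2 (hno t h hlt e1)
        · have hpa : g.a .PA (s'.a .QU t) = p := by rw [e1]; exact hg.ch p hp j hjj
          have := (k4 hlt).2.2 (by rw [hpa]; exact (hg.nd p hp).1.ne') τ hτ (by rw [hpa]; exact hT')
          rw [hpa] at this
          exact hm₁ _ _ this

end Worklist

/-! ### The answer -/

section Answer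

variable {S : Type*} {ar : S → ℕ} {f : S → ℕ} {g : PState} {Sem : ℕ → ℕ → RTree ar Empty → Prop}

/-- The digits of the value of a solution: true in the positive structures only, no free variables,
and a formula. -/
def tgtDigit (g : PState) (e : ℕ) : ℕ :=
  if e < g.v .N then g.a .POS e else if e < g.v .N + g.v .k then 0 else 1

/-- The value of a solution. -/
def tgtVal (g : PState) : ℕ := ofDig (g.v .b) (tgtDigit g) (g.v .E)

theorem run_targetRS (s : PState) (he : s.v .e = 0) :
    ∀ e < s.v .N, (run (loop .N targetBody) s).a .RS e = s.a .POS e := by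
  refine (loop_inv (fun i s' => s'.v .e = i ∧ ∀ e < i, s'.a .RS e = s.a .POS e) targetBody .N s
    (by simp [he]) ?_).2
  rintro i s' hi hF ⟨h1, h2⟩
  have hP := hF.a .POS (by decide)
  refine ⟨by simp [targetBody, h1], fun e he => ?_⟩
  simp only [targetBody, run_seq, run_set, run_wr, LState.set_a, LState.wr_a, if_true, ev_rv, ev_rd,
    h1, hP, Function.update_apply]
  split_ifs with hc
  · rw [hc]
  · exact h2 e (by omega)

theorem run_zeroRS (s : PState) (he : s.v .i = 0) :
    (∀ i < s.v .k, (run (loop .k zeroBody) s).a .RS (s.v .N + i) = 0) ∧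
      ∀ e < s.v .N, (run (loop .k zeroBody) s).a .RS e = s.a .RS e := by
  refine (loop_inv (fun i s' => s'.v .i = i ∧ (∀ j < i, s'.a .RS (s.v .N + j) = 0) ∧
    ∀ e < s.v .N, s'.a .RS e = s.a .RS e) zeroBody .k s (by simp [he]) ?_).2
  rintro i s' hi hF ⟨h1, h2, h3⟩
  have hP := hF.v .N (by decide)
  refine ⟨by simp [zeroBody, h1], fun e he => ?_, fun e he => ?_⟩ <;>
  simp only [zeroBody, run_seq, run_set, run_wr, LState.set_a, LState.wr_a, if_true, ev_rv, ev_rd,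
    ev_add, ev_ofNat, h1, hP, Function.update_apply]
  · split_ifs with hc
    · rfl
    · exact h2 e (by omega)
  · rw [if_neg (by omega)]
    exact h3 e he

/-- The answer is the graph up to the node that witnesses the target value of the start symbol, so
that this node is the last one, as `TreeDag.Represents` demands. -/
theorem run_answer (hg : GOK g) {dl : TreeDag ar} {s : PState} (h : WInv f g Sem dl s)
    (hpos : ∀ e, g.a .POS e ≤ 1) :
    (run answer s).v .i ≤ 1 + (g.v .R + 1) * g.v .MV ∧
    ((Marked s (g.v .st) (tgtVal g) ∧ ∃ d t, Sem (g.v .st) (tgtVal g) t ∧ TreeDag.Represents d t ∧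
      (List.range ((run answer s).v .i)).map ((run answer s).a .DW) = 1 :: d.encode f) ∨
    (¬ Marked s (g.v .st) (tgtVal g) ∧
      (List.range ((run answer s).v .i)).map ((run answer s).a .DW) = [0])) := by
  have htd : ∀ e, tgtDigit g e < g.v .b := fun e => by
    have := hpos e
    rw [tgtDigit, hg.b_eq]
    split_ifs <;> omega
  have htV : tgtVal g < g.v .V := by rw [hg.V_eq]; exact ofDig_lt fun e _ => htd e
  -- the state in which all digits have been written
  obtain ⟨s₀, hs₀⟩ : ∃ s₀, s₀ = run (set .e 0) s := ⟨_, rfl⟩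
  have hF₀ : Frame _ s s₀ := hs₀ ▸ run_frame _ s
  obtain ⟨hW₀, hE₀⟩ := h.of_frame hF₀
  have k1 := run_targetRS s₀ (by simp [hs₀])
  have hF₁ := run_frame (loop .N targetBody) s₀
  have e1 : run answer s = run (set .i 0;; loop .k zeroBody;;
    wr .RS (§.N + §.k) 1;; encodeRS;; mul .idx .st .V .V;; set .idx (§.idx + §.val);;
    branch (rd .MK (§.idx)) (set .i (rd .DE (§.idx))) (wr .DW 0 0;; set .i 1))
    (run (loop .N targetBody) s₀) := by rw [hs₀]; rfl
  generalize run (loop .N targetBody) s₀ = s₁ at k1 hF₁ e1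
  obtain ⟨hW₁, hE₁⟩ := hW₀.of_frame hF₁
  obtain ⟨s₂, hs₂⟩ : ∃ s₂, s₂ = run (set .i 0) s₁ := ⟨_, rfl⟩
  have hF₂ : Frame _ s₁ s₂ := hs₂ ▸ run_frame _ s₁
  obtain ⟨hW₂, hE₂⟩ := hW₁.of_frame hF₂
  have k2 := run_zeroRS s₂ (by simp [hs₂])
  have hF₃ := run_frame (loop .k zeroBody) s₂
  have e2 : run answer s = run (wr .RS (§.N + §.k) 1;; encodeRS;; mul .idx .st .V .V;;
    set .idx (§.idx + §.val);;
    branch (rd .MK (§.idx)) (set .i (rd .DE (§.idx))) (wr .DW 0 0;; set .i 1))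
    (run (loop .k zeroBody) s₂) := by rw [e1, hs₂]; rfl
  generalize run (loop .k zeroBody) s₂ = s₃ at k2 hF₃ e2
  obtain ⟨hW₃, hE₃⟩ := hW₂.of_frame hF₃
  obtain ⟨s₄, hs₄⟩ : ∃ s₄, s₄ = run (wr .RS (§.N + §.k) 1) s₃ := ⟨_, rfl⟩
  have hF₄ : Frame _ s₃ s₄ := hs₄ ▸ run_frame _ s₃
  obtain ⟨hW₄, hE₄⟩ := hW₃.of_frame hF₄
  have hRS : ∀ e < g.v .E, s₄.a .RS e = tgtDigit g e := by
    intro e he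
    rw [hg.E_eq] at he
    rw [hs₄]
    simp only [run_wr, LState.wr_a, if_true, ev_add, ev_rv, hW₃.agree.v .N (by decide),
      hW₃.agree.v .k (by decide), Function.update_apply, tgtDigit, ev_ofNat]
    rw [hW₂.agree.v .N (by decide), hW₂.agree.v .k (by decide)] at k2
    rw [hW₀.agree.v .N (by decide), hW₀.agree.a .POS (by decide)] at k1
    by_cases h4 : e < g.v .N
    · rw [if_neg (by omega), if_pos h4, k2.2 e h4, hF₂.a _ (by decide), k1 e h4]
    · rw [if_neg h4]
      by_cases h5 : e < g.v .N + g.v .k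
      · have := k2.1 (e - g.v .N) (by omega)
        rw [Nat.add_sub_cancel' (by omega)] at this
        rw [if_neg (by omega), if_pos h5, this]
      · rw [if_pos (by omega), if_neg h5]
  have eb := hW₄.agree.v .b (by decide)
  have eE := hW₄.agree.v .E (by decide)
  have k5 := run_encodeRS s₄ (by rw [eb, eE]; intro e he; rw [hRS e he]; exact htd e)
  rw [eb, eE, ofDig_congr hRS, ← tgtVal] at k5
  have hF₅ := run_frame encodeRS s₄
  have e3 : run answer s = run (mul .idx .st .V .V;; set .idx (§.idx + §.val);;
    branch (rd .MK (§.idx)) (set .i (rd .DE (§.idx))) (wr .DW 0 0;; set .i 1))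
    (run encodeRS s₄) := by rw [e2, hs₄]; rfl
  generalize run encodeRS s₄ = s₅ at k5 hF₅ e3
  obtain ⟨hW₅, hE₅⟩ := hW₄.of_frame hF₅
  have hEx := (((hE₀.trans hE₁).trans hE₂).trans hE₃).trans (hE₄.trans hE₅)
  have hmark : Marked s₅ (g.v .st) (tgtVal g) ↔ Marked s (g.v .st) (tgtVal g) := by
    have : s₅.a .MK = s.a .MK := by
      rw [hF₅.a _ (by decide), hF₄.a _ (by decide), hF₃.a _ (by decide), hF₂.a _ (by decide),
        hF₁.a _ (by decide), hF₀.a _ (by decide)]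
    rw [Marked, Marked, this, hW₅.agree.v .V (by decide), h.agree.v .V (by decide)]
  have hst := hW₅.agree.v .st (by decide)
  have hV := hW₅.agree.v .V (by decide)
  rw [← hmark]
  have hbr : run answer s = if Marked s₅ (g.v .st) (tgtVal g) then
      run (set .i (rd .DE (§.idx))) ((s₅.set .mi (g.v .V)).set .idx (g.v .st * g.v .V + tgtVal g))
      else run (wr .DW 0 0;; set .i 1)
        ((s₅.set .mi (g.v .V)).set .idx (g.v .st * g.v .V + tgtVal g)) := by
    rw [e3]
    simp only [run_seq]
    rw [run_mul _ le_rfl (by decide) (by decide) (by decide) (by decide) (by decide) (by decide)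
      (by decide)]
    have : (LState.set ((s₅.set .idx (g.v .st * g.v .V)).set .mi (g.v .V)) .idx
        (g.v .st * g.v .V + tgtVal g) : PState) =
        (s₅.set .mi (g.v .V)).set .idx (g.v .st * g.v .V + tgtVal g) := by
      refine LState.ext' (fun x => ?_) (fun b => by simp)
      by_cases hx : x = .idx
      · simp [hx]
      · by_cases hy : x = .mi <;> simp [hx, hy]
    simp only [run_seq, run_set, run_branch, ev_add, ev_rv, LState.set_v, LState.set_a, reduceCtorEq,
      if_true, if_false, ev_rd, this, Marked, hV, hst, k5]
  by_cases hm : Marked s₅ (g.v .st) (tgtVal g)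
  · rw [if_pos hm] at hbr
    obtain ⟨t, t1, t2, t3⟩ := hW₅.good _ _ htV hm
    generalize s₅.a .DP (g.v .st * g.v .V + tgtVal g) = cd at t2 t3
    have hi : (run answer s).v .i = 1 + (TreeDag.encode f (dl.take (cd + 1))).length := by
      rw [← t3, hbr]; simp
    have hDW : (run answer s).a .DW = s₅.a .DW := by rw [hbr]; simp
    have hcd := unfoldsAt_lt_length t2
    have hpre : dl.encode f = TreeDag.encode f (dl.take (cd + 1)) ++
        TreeDag.encode f (dl.drop (cd + 1)) := by
      rw [← encode_append, List.take_append_drop]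
    have hwl : s₅.v .wl = 1 + (dl.encode f).length := by
      have := congrArg List.length hW₅.words
      simpa [add_comm] using this
    have hle : (run answer s).v .i ≤ s₅.v .wl := by
      rw [hi, hwl, hpre, List.length_append]; omega
    refine ⟨?_, Or.inl ⟨hm, dl.take (cd + 1), t, t1, ?_, ?_⟩⟩
    · refine hle.trans (hW₅.wl_le.trans ?_)
      gcongr
      exact hW₅.nd_le.trans (hW₅.tail_le hg)
    · rw [TreeDag.Represents, List.length_take, min_eq_left (by omega)]
      exact unfoldsAt_take t2 (by omega)
    · have h1 : (List.range ((run answer s).v .i)).map (s₅.a .DW) =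
          ((List.range (s₅.v .wl)).map (s₅.a .DW)).take ((run answer s).v .i) := by
        rw [← List.map_take, List.take_range, min_eq_left hle]
      rw [hDW, h1, hW₅.words, hi, hpre, add_comm, List.take_succ_cons, List.take_left]
  · rw [if_neg hm] at hbr
    refine ⟨?_, Or.inr ⟨hm, ?_⟩⟩ <;> simp [hbr]

end Answer

end Prog

end LoopProg

/-! ### Derivations in a regular tree grammar -/

section Grammar

variable {S : Type w} {ar : S → ℕ}

/-- Parallel derivations: `Derives G x t` says that the ground tree `t` results from `x` by rewriting
all nonterminals. -/
inductive Derives (G : RTG ar) : RTree ar (Fin G.numNT) → RTree ar Empty → Prop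
  | rule {B : Fin G.numNT} {r : RTree ar (Fin G.numNT)} {t : RTree ar Empty} (h : (B, r) ∈ G.rules)
      (hr : Derives G r t) : Derives G (.leaf B) t
  | node {s : S} {x : Fin (ar s) → RTree ar (Fin G.numNT)} {t : Fin (ar s) → RTree ar Empty}
      (h : ∀ i, Derives G (x i) (t i)) : Derives G (.node s x) (.node s t)

open Relation

theorem RTG.reflTransGen_context (G : RTG ar) {s : S} {ch : Fin (ar s) → RTree ar (Fin G.numNT)}
    (i : Fin (ar s)) {t : RTree ar (Fin G.numNT)} (h : ReflTransGen G.Step (ch i) t) :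
    ReflTransGen G.Step (.node s ch) (.node s (Function.update ch i t)) := by
  induction h with
  | refl => rw [Function.update_eq_self]
  | tail _ h ih =>
    refine ih.tail ?_
    have := RTG.Step.context (G := G) (s := s) (ch := Function.update ch i _) i
      (by rw [Function.update_self]; exact h)
    rwa [Function.update_idem] at this

/-- The children of a node can be rewritten independently. -/
theorem RTG.reflTransGen_node (G : RTG ar) {s : S} {x y : Fin (ar s) → RTree ar (Fin G.numNT)}
    (h : ∀ i, ReflTransGen G.Step (x i) (y i)) :
    ReflTransGen G.Step (.node s x) (.node s y) := by
  classical
  have key : ∀ A : Finset (Fin (ar s)),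
      ReflTransGen G.Step (.node s x) (.node s fun i => if i ∈ A then y i else x i) := by
    intro A
    induction A using Finset.induction_on with
    | empty => simpa using ReflTransGen.refl
    | insert a A ha ih =>
      refine ih.trans ?_
      have := G.reflTransGen_context (ch := fun i => if i ∈ A then y i else x i) a (t := y a)
        (by simpa [ha] using h a)
      convert this using 2
      funext i
      by_cases hi : i = a
      · subst hi; simp
      · simp [hi]
  simpa using key Finset.univ

theorem derives_ofGround (G : RTG ar) (t : RTree ar Empty) : Derives G t.ofGround t := by
  induction t with
  | leaf e => exact e.elim
  | node s ch ih => exact .node ih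

/-- A rewrite step in front of a parallel derivation can be absorbed. -/
theorem Derives.of_step {G : RTG ar} {x y : RTree ar (Fin G.numNT)} {t : RTree ar Empty}
    (h : G.Step x y) (hy : Derives G y t) : Derives G x t := by
  induction h generalizing t with
  | rule h => exact .rule h hy
  | @context s ch i t' _ ih =>
    cases hy with
    | node hc =>
      refine .node fun j => ?_
      by_cases hj : j = i
      · subst hj
        exact ih (by simpa using hc j)
      · simpa [hj] using hc j

/-- Parallel derivations describe the language of the grammar. -/
theorem mem_language_iff (G : RTG ar) (t : RTree ar Empty) :
    t ∈ G.language ↔ Derives G (.leaf G.start) t := by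
  constructor
  · intro h
    refine ReflTransGen.head_induction_on (motive := fun x _ => Derives G x t) h
      (derives_ofGround G t) fun hs _ ih => .of_step hs ih
  · intro h
    show ReflTransGen G.Step _ _
    generalize RTree.leaf G.start = x at h ⊢
    induction h with
    | rule h _ ih => exact ih.head (.rule h)
    | node _ ih => exact G.reflTransGen_node ih

end Grammar

/-! ### Expressions as trees -/

section Build

variable {L : FirstOrder.Language.{u, v}} {k : ℕ}

/-- The kind of the expressions whose root is the given symbol. -/
def FOSym.kind : FOSym L k → Kind
  | .rel _ => .formula
  | .fn _ => .term
  | .ite => .term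
  | .and => .formula
  | .or => .formula
  | .neg => .formula
  | .all _ => .formula
  | .ex _ => .formula
  | .var _ => .term

/-- The kind of the child number `j` below the given symbol. -/
def FOSym.kid : FOSym L k → ℕ → Kind
  | .rel _, _ => .term
  | .fn _, _ => .term
  | .ite, 0 => .formula
  | .ite, _ + 1 => .term
  | .and, _ => .formula
  | .or, _ => .formula
  | .neg, _ => .formula
  | .all _, _ => .formula
  | .ex _, _ => .formula
  | .var _, _ => .term

/-- The expression with the given root symbol and the given children. -/
def FOSym.build : (s : FOSym L k) → (∀ j : Fin s.arity, FOExpr L k (s.kid j)) → FOExpr L k s.kind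
  | .rel R, c => .rel R c
  | .fn F, c => .fn F c
  | .ite, c => .ite (c (0 : Fin 3)) (c (1 : Fin 3)) (c (2 : Fin 3))
  | .and, c => .and (c (0 : Fin 2)) (c (1 : Fin 2))
  | .or, c => .or (c (0 : Fin 2)) (c (1 : Fin 2))
  | .neg, c => .neg (c (0 : Fin 1))
  | .all x, c => .all x (c (0 : Fin 1))
  | .ex x, c => .ex x (c (0 : Fin 1))
  | .var x, _ => .var x

theorem FOSym.toTree_build (s : FOSym L k) (c : ∀ j : Fin s.arity, FOExpr L k (s.kid j)) :
    (s.build c).toTree = .node s fun j => (c j).toTree := by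
  cases s with
  | rel R => rfl
  | fn F => rfl
  | ite =>
    refine congrArg (RTree.node FOSym.ite) (funext fun j => ?_)
    change Fin 3 at j
    fin_cases j <;> rfl
  | and =>
    refine congrArg (RTree.node FOSym.and) (funext fun j => ?_)
    change Fin 2 at j
    fin_cases j <;> rfl
  | or =>
    refine congrArg (RTree.node FOSym.or) (funext fun j => ?_)
    change Fin 2 at j
    fin_cases j <;> rfl
  | neg =>
    refine congrArg (RTree.node FOSym.neg) (funext fun j => ?_)
    change Fin 1 at j
    fin_cases j; rfl
  | all x =>
    refine congrArg (RTree.node (FOSym.all x)) (funext fun j => ?_)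
    change Fin 1 at j
    fin_cases j; rfl
  | ex x =>
    refine congrArg (RTree.node (FOSym.ex x)) (funext fun j => ?_)
    change Fin 1 at j
    fin_cases j; rfl
  | var x =>
    refine congrArg (RTree.node (FOSym.var x)) (funext fun j => ?_)
    change Fin 0 at j
    exact j.elim0

/-- Every expression is built from its root symbol. The kind of the expression is determined by the
symbol, hence the cast. -/
theorem FOExpr.exists_build {κ : Kind} (φ : FOExpr L k κ) :
    ∃ (s : FOSym L k) (c : ∀ j : Fin s.arity, FOExpr L k (s.kid j)) (h : s.kind = κ),
      h ▸ s.build c = φ := by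
  cases φ with
  | rel R ts => exact ⟨.rel R, ts, rfl, rfl⟩
  | fn F ts => exact ⟨.fn F, ts, rfl, rfl⟩
  | or φ ψ => exact ⟨.or, fun j : Fin 2 => if (j : ℕ) = 0 then φ else ψ, rfl, rfl⟩
  | and φ ψ => exact ⟨.and, fun j : Fin 2 => if (j : ℕ) = 0 then φ else ψ, rfl, rfl⟩
  | neg φ => exact ⟨.neg, fun j : Fin 1 => φ, rfl, rfl⟩
  | ex x φ => exact ⟨.ex x, fun j : Fin 1 => φ, rfl, rfl⟩
  | all x φ => exact ⟨.all x, fun j : Fin 1 => φ, rfl, rfl⟩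
  | var x => exact ⟨.var x, fun j : Fin 0 => j.elim0, rfl, rfl⟩
  | ite φ t t' =>
    refine ⟨.ite, fun j : Fin 3 => match j with
      | 0 => φ
      | 1 => t
      | 2 => t', rfl, rfl⟩

/-- The value depends on the free variables only. -/
theorem FOExpr.eval_congr {M : Type} [L.Structure M] {κ : Kind} (φ : FOExpr L k κ)
    {a a' : Fin k → M} (h : ∀ x ∈ φ.freeVars, a x = a' x) : φ.eval M a = φ.eval M a' := by
  induction φ generalizing a a' with
  | rel R ts ih =>
    simp only [FOExpr.eval]
    congr 1
    exact funext fun i => ih i fun x hx => h x (Set.mem_iUnion.2 ⟨i, hx⟩)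
  | fn F ts ih =>
    simp only [FOExpr.eval]
    exact congrArg _ (funext fun i => ih i fun x hx => h x (Set.mem_iUnion.2 ⟨i, hx⟩))
  | or φ ψ ih ih' =>
    simp only [FOExpr.eval]
    rw [ih fun x hx => h x (Or.inl hx), ih' fun x hx => h x (Or.inr hx)]
  | and φ ψ ih ih' =>
    simp only [FOExpr.eval]
    rw [ih fun x hx => h x (Or.inl hx), ih' fun x hx => h x (Or.inr hx)]
  | neg φ ih =>
    simp only [FOExpr.eval]
    rw [ih fun x hx => h x hx]
  | ex y φ ih =>
    simp only [FOExpr.eval]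
    refine congrArg _ (funext fun b => ih fun x hx => ?_)
    by_cases hxy : x = y
    · subst hxy; simp
    · simpa [hxy] using h x ⟨hx, hxy⟩
  | all y φ ih =>
    simp only [FOExpr.eval]
    refine forall_congr fun b => ih fun x hx => ?_
    by_cases hxy : x = y
    · subst hxy; simp
    · simpa [hxy] using h x ⟨hx, hxy⟩
  | var y => exact h y rfl
  | ite φ t t' ih ih₁ ih₂ =>
    simp only [FOExpr.eval]
    rw [ih fun x hx => h x (Or.inl (Or.inl hx)), ih₁ fun x hx => h x (Or.inl (Or.inr hx)),
      ih₂ fun x hx => h x (Or.inr hx)]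

end Build

/-! ### The digits of the value of an expression -/

section Digits

variable {L : FirstOrder.Language.{u, v}} {k : ℕ}

/-- The number of a kind. -/
def Kind.code : Kind → ℕ
  | .formula => 1
  | .term => 0

open Classical in
/-- The value of an expression as a number. -/
noncomputable def Kind.num {n : ℕ} : (κ : Kind) → κ.Val (Fin n) → ℕ
  | .formula, P => if P then 1 else 0
  | .term, x => (x : Fin n)

/-- The value of an expression in a structure, under the assignment number `i`. -/
noncomputable def FinStruct.valNum (A : FinStruct L) {κ : Kind} (φ : FOExpr L k κ)
    (i : Fin (A.size ^ k)) : ℕ :=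
  letI := A.str
  κ.num (φ.eval (Fin A.size) (finFunctionFinEquiv.symm i))

/-- The number of pairs of one of the first `a` structures and an assignment in it. -/
def pointOff (k : ℕ) (As : List (FinStruct L)) (a : ℕ) : ℕ :=
  ((As.take a).map fun A => A.size ^ k).sum

open Classical in
/-- The digits `d` describe the expression: its values at all pairs of a structure and an assignment,
its free variables, and its kind. -/
structure IsDig (As : List (FinStruct L)) {κ : Kind} (φ : FOExpr L k κ) (d : ℕ → ℕ) : Prop where
  val : ∀ a A, As[a]? = some A → ∀ i : Fin (A.size ^ k), d (pointOff k As a + i) = A.valNum φ i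
  free : ∀ x : Fin k, d (pointOff k As As.length + x) = if x ∈ φ.freeVars then 1 else 0
  kind : d (pointOff k As As.length + k) = κ.code

/-- The number of the operation that belongs to a symbol. -/
def FOSym.opNum : FOSym L k → ℕ
  | .and => 0
  | .or => 1
  | .neg => 2
  | .ite => 3
  | .all _ => 4
  | .ex _ => 5
  | .var _ => 6
  | .fn _ => 7
  | .rel _ => 7

/-- The parameter of the operation that belongs to a symbol. -/
noncomputable def FOSym.opArg [Finite L.Symbols] : FOSym L k → ℕ
  | .and => 0
  | .or => 0
  | .neg => 0
  | .ite => 0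
  | .all x => x
  | .ex x => x
  | .var x => x
  | .fn (l := l) F => Finite.equivFin L.Symbols (.inl ⟨l, F⟩)
  | .rel (l := l) R => Finite.equivFin L.Symbols (.inr ⟨l, R⟩)

theorem pointOff_succ (As : List (FinStruct L)) {a : ℕ} {A : FinStruct L} (h : As[a]? = some A) :
    pointOff k As (a + 1) = pointOff k As a + A.size ^ k := by
  obtain ⟨h1, h2⟩ := List.getElem?_eq_some_iff.1 h
  rw [pointOff, List.take_add_one, h]
  simp [pointOff]

theorem pointOff_mono (As : List (FinStruct L)) {a b : ℕ} (h : a ≤ b) :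
    pointOff k As a ≤ pointOff k As b := by
  rw [pointOff, pointOff, ← Nat.add_sub_cancel' h, List.take_add, List.map_append, List.sum_append]
  omega

theorem pointOff_lt (As : List (FinStruct L)) {a i : ℕ} {A : FinStruct L} (h : As[a]? = some A)
    (hi : i < A.size ^ k) : pointOff k As a + i < pointOff k As As.length := by
  have h1 := pointOff_succ (k := k) As h
  have h2 := pointOff_mono (k := k) As (Nat.succ_le_of_lt (List.getElem?_eq_some_iff.1 h).1)
  simp only [Nat.succ_eq_add_one] at h2
  omega

/-- Every number below the number of points belongs to a structure and an assignment. -/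
theorem exists_point (As : List (FinStruct L)) {e : ℕ} (he : e < pointOff k As As.length) :
    ∃ a A, As[a]? = some A ∧ ∃ i < A.size ^ k, e = pointOff k As a + i := by
  have key : ∀ b, e < pointOff k As b → ∃ a A, As[a]? = some A ∧
      ∃ i < A.size ^ k, e = pointOff k As a + i := by
    intro b
    induction b with
    | zero => intro h; simp [pointOff] at h
    | succ b ih =>
      intro h
      by_cases hb : e < pointOff k As b
      · exact ih hb
      · rcases hA : As[b]? with _ | A
        · rw [pointOff, List.take_add_one, hA] at h
          simp at h
          exact absurd (by simpa [pointOff] using h) hb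
        · rw [pointOff_succ As hA] at h
          exact ⟨b, A, hA, e - pointOff k As b, by omega, by omega⟩
  exact key _ he

/-- The free variables of a compound expression, in terms of the numbers of operations: a quantifier
(4 or 5) removes its variable, and a variable symbol (6) adds it. -/
theorem FOSym.mem_freeVars_build [Finite L.Symbols] (s : FOSym L k)
    (c : ∀ j : Fin s.arity, FOExpr L k (s.kid j)) (x : Fin k) :
    x ∈ (s.build c).freeVars ↔ ¬ (s.opArg = x ∧ (s.opNum = 4 ∨ s.opNum = 5)) ∧
      ((s.opArg = x ∧ s.opNum = 6) ∨ ∃ j, x ∈ (c j).freeVars) := by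
  have e1 : ∀ P : Fin 1 → Prop, (∃ j, P j) ↔ P 0 := fun P => by simp
  have e2 : ∀ P : Fin 2 → Prop, (∃ j, P j) ↔ P 0 ∨ P 1 := fun P => Fin.exists_fin_two
  have e3 : ∀ P : Fin 3 → Prop, (∃ j, P j) ↔ (P 0 ∨ P 1) ∨ P 2 := fun P => by
    simp [Fin.exists_fin_succ, or_assoc]
  cases s with
  | rel R =>
    simp only [FOSym.build, FOExpr.freeVars, FOSym.opNum, Set.mem_iUnion]
    simp
    exact Iff.rfl
  | fn F =>
    simp only [FOSym.build, FOExpr.freeVars, FOSym.opNum, Set.mem_iUnion]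
    simp
    exact Iff.rfl
  | ite =>
    simp [FOSym.build, FOExpr.freeVars, FOSym.opNum]
    exact (e3 fun j => x ∈ (c j).freeVars).symm
  | and =>
    simp [FOSym.build, FOExpr.freeVars, FOSym.opNum]
    exact (e2 fun j => x ∈ (c j).freeVars).symm
  | or =>
    simp [FOSym.build, FOExpr.freeVars, FOSym.opNum]
    exact (e2 fun j => x ∈ (c j).freeVars).symm
  | neg =>
    simp [FOSym.build, FOExpr.freeVars, FOSym.opNum]
    exact (e1 fun j => x ∈ (c j).freeVars).symm
  | all y =>
    simp [FOSym.build, FOExpr.freeVars, FOSym.opNum, FOSym.opArg]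
    rw [and_comm, Fin.val_inj, eq_comm]
    exact and_congr_right fun _ => (e1 fun j => x ∈ (c j).freeVars).symm
  | ex y =>
    simp [FOSym.build, FOExpr.freeVars, FOSym.opNum, FOSym.opArg]
    rw [and_comm, Fin.val_inj, eq_comm]
    exact and_congr_right fun _ => (e1 fun j => x ∈ (c j).freeVars).symm
  | var y =>
    simp [FOSym.build, FOExpr.freeVars, FOSym.opNum, FOSym.opArg]
    rw [Fin.val_inj, eq_comm]
    exact ⟨Or.inl, fun h => h.elim id fun ⟨j, _⟩ => Fin.elim0 j⟩

end Digits

/-! ### The value of a compound expression -/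

theorem finFunctionFinEquiv_symm_val {n k : ℕ} (i : Fin (n ^ k)) (x : Fin k) :
    (finFunctionFinEquiv.symm i x : ℕ) = i / n ^ (x : ℕ) % n := rfl

theorem digit_mul_le {n : ℕ} (i x : ℕ) : n ^ x * (i / n ^ x % n) ≤ i :=
  (Nat.mul_le_mul_left _ (Nat.mod_le _ _)).trans (Nat.mul_div_le _ _)

/-- The number of an assignment after an update: one digit in base `n` is replaced. -/
theorem finFunctionFinEquiv_update {n k : ℕ} (i : Fin (n ^ k)) (x : Fin k) (b : Fin n) :
    (finFunctionFinEquiv (Function.update (finFunctionFinEquiv.symm i) x b) : ℕ) =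
      i - n ^ (x : ℕ) * (i / n ^ (x : ℕ) % n) + b * n ^ (x : ℕ) := by
  have h1 : (i : ℕ) = ∑ j, ((finFunctionFinEquiv.symm i j : Fin n) : ℕ) * n ^ (j : ℕ) := by
    rw [← finFunctionFinEquiv_apply, Equiv.apply_symm_apply]
  rw [finFunctionFinEquiv_apply, ← Finset.add_sum_erase _ _ (Finset.mem_univ x)]
  rw [← Finset.add_sum_erase _ _ (Finset.mem_univ x), finFunctionFinEquiv_symm_val] at h1
  have h2 : ∑ j ∈ Finset.univ.erase x, (Function.update (finFunctionFinEquiv.symm i) x b j : ℕ) *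
      n ^ (j : ℕ) = ∑ j ∈ Finset.univ.erase x, ((finFunctionFinEquiv.symm i j : Fin n) : ℕ) *
      n ^ (j : ℕ) := by
    refine Finset.sum_congr rfl fun j hj => ?_
    rw [Function.update_of_ne (Finset.ne_of_mem_erase hj)]
  rw [Function.update_self, h2]
  have h3 := mul_comm (n ^ (x : ℕ)) ((i : ℕ) / n ^ (x : ℕ) % n)
  omega

section Build

variable {L : FirstOrder.Language.{u, v}} [Finite L.Symbols] {k : ℕ}

open LoopProg LoopProg.Prog

/-- The arrays describe the structures. -/
structure StructOK (As : List (FinStruct L)) (k : ℕ) (g : PState) : Prop where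
  k_eq : g.v .k = k
  k_lt : k < g.v .R
  N_eq : g.v .N = pointOff k As As.length
  sb : ∀ (a : ℕ) (A : FinStruct L), As[a]? = some A → ∀ i < A.size ^ k, g.a .SB (pointOff k As a + i) = a * g.v .R
  ai : ∀ (a : ℕ) (A : FinStruct L), As[a]? = some A → ∀ i < A.size ^ k, g.a .AI (pointOff k As a + i) = i
  pw : ∀ (a : ℕ) (A : FinStruct L), As[a]? = some A → ∀ i < g.v .R, g.a .PW (a * g.v .R + i) = A.size ^ i
  tab : ∀ (a : ℕ) (A : FinStruct L), As[a]? = some A → ∀ sy : L.Symbols, ∀ i v, (A.table sy)[i]? = some v →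
    g.a .IN (g.a .TAB (a * g.v .R + Finite.equivFin L.Symbols sy) + i) = v
  size_le : ∀ (a : ℕ) (A : FinStruct L), As[a]? = some A → A.size ≤ g.v .n

/-- The arrays describe the symbols. -/
structure SymOK (L : FirstOrder.Language.{u, v}) [Finite L.Symbols] (k : ℕ) (g : PState) : Prop where
  ar : ∀ s : FOSym L k, g.a .AR s.code = s.arity
  op : ∀ s : FOSym L k, g.a .OP s.code = s.opNum
  arg : ∀ s : FOSym L k, g.a .OA s.code = s.opArg
  k0 : ∀ s : FOSym L k, g.a .K0 s.code = (s.kid 0).code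
  k1 : ∀ s : FOSym L k, g.a .K1 s.code = (s.kid 1).code
  rk : ∀ s : FOSym L k, g.a .RK s.code = s.kind.code

/-- The digits of values are less than the base, so that values can be coded by numbers below `V`.
-/
theorem IsDig.lt {As : List (FinStruct L)} {g : PState} (hg : GOK g) (hs : StructOK As k g) {κ : Kind}
    {φ : FOExpr L k κ} {d : ℕ → ℕ} (h : IsDig As φ d) {e : ℕ} (he : e < g.v .E) : d e < g.v .b := by
  classical
  rw [hg.E_eq, hs.k_eq] at he
  rw [hg.b_eq]
  rcases Nat.lt_or_ge e (g.v .N) with h1 | h1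
  · obtain ⟨a, A, hA, i, hi, rfl⟩ := exists_point As (hs.N_eq ▸ h1)
    rw [h.val a A hA ⟨i, hi⟩]
    have := hs.size_le a A hA
    cases κ with
    | formula =>
      simp only [FinStruct.valNum, Kind.num]
      split_ifs <;> omega
    | term =>
      simp only [FinStruct.valNum, Kind.num]
      refine (Fin.is_lt _).trans ?_
      omega
  · rcases Nat.lt_or_ge e (g.v .N + k) with h2 | h2
    · obtain ⟨y, rfl⟩ : ∃ y, e = g.v .N + y := ⟨e - g.v .N, by omega⟩
      have := h.free ⟨y, by omega⟩
      rw [← hs.N_eq] at this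
      simp only at this
      rw [this]
      split_ifs <;> omega
    · obtain rfl : e = g.v .N + k := by omega
      have := h.kind
      rw [← hs.N_eq] at this
      rw [this]
      cases κ <;> simp [Kind.code]

/-- All children but the first have the same kind. -/
theorem FOSym.kid_eq (s : FOSym L k) (j : ℕ) : s.kid j = if j ≠ 0 then s.kid 1 else s.kid 0 := by
  cases j with
  | zero => rfl
  | succ j => cases s <;> rfl

theorem FOSym.code_kid (s : FOSym L k) (j : ℕ) :
    (s.kid j).code = if j ≠ 0 then (s.kid 1).code else (s.kid 0).code := by
  rw [s.kid_eq]; split_ifs <;> rfl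

variable {As : List (FinStruct L)} {g : PState}

/-- The program computes the free variables of the compound expression. -/
theorem resDigit_free (hs : StructOK As k g) (hy : SymOK L k g) (s : FOSym L k) (τ : ℕ)
    (c : ∀ j : Fin s.arity, FOExpr L k (s.kid j))
    (hc : ∀ j, IsDig As (c j) fun e => tupleDig g τ (j * g.v .E + e)) (x : Fin k) [Decidable (x ∈ (s.build c).freeVars)] :
    resDigit g s.code τ (pointOff k As As.length + x) = if x ∈ (s.build c).freeVars then 1 else 0 := by
  classical
  have hx := x.2
  rw [← hs.N_eq, resDigit, if_neg (by omega), if_pos (by rw [hs.k_eq]; omega), Nat.add_sub_cancel_left]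
  have e1 : (∃ j < s.arity, tupleDig g τ (g.v .N + x + j * g.v .E) ≠ 0) ↔ ∃ j, x ∈ (c j).freeVars := by
    constructor
    · rintro ⟨j, hj, hne⟩
      refine ⟨⟨j, hj⟩, ?_⟩
      have := (hc ⟨j, hj⟩).free x
      rw [← hs.N_eq] at this
      simp only [add_comm (j * g.v .E)] at this
      by_contra hx
      rw [if_neg hx] at this
      exact hne this
    · rintro ⟨j, hj⟩
      refine ⟨j, j.2, ?_⟩
      have := (hc j).free x
      rw [← hs.N_eq, if_pos hj] at this
      simp only [add_comm (j * g.v .E)] at this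
      rw [this]
      exact one_ne_zero
  simp only [freeVal, evalState, if_true, reduceCtorEq, if_false, hy.ar, hy.op, hy.arg, e1,
    s.mem_freeVars_build c x]
  by_cases h1 : s.opArg = x ∧ (s.opNum = 4 ∨ s.opNum = 5)
  · simp [h1]
  · rw [if_neg h1]
    by_cases h2 : s.opArg = x ∧ s.opNum = 6
    · simp [h2]
    · simp [h1, h2]

theorem valNum_formula (A : FinStruct L) (φ : FOFormula L k) (i : Fin (A.size ^ k)) {P : Prop}
    [Decidable P] (h : (letI := A.str; φ.eval (Fin A.size) (finFunctionFinEquiv.symm i)) ↔ P) :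
    A.valNum φ i = if P then 1 else 0 := by
  classical exact if_congr h rfl rfl

theorem table_fn (A : FinStruct L) {l : ℕ} (F : L.Functions l) (y : Fin l → Fin A.size) :
    (A.table (.inl ⟨l, F⟩))[(finFunctionFinEquiv y : ℕ)]? = some (letI := A.str;
      ((FirstOrder.Language.Structure.funMap F y : Fin A.size) : ℕ)) := by
  rw [FinStruct.table, List.getElem?_ofFn, dif_pos (finFunctionFinEquiv y).2, Fin.eta,
    Equiv.symm_apply_apply]

open Classical in
theorem table_rel (A : FinStruct L) {l : ℕ} (R : L.Relations l) (y : Fin l → Fin A.size) :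
    (A.table (.inr ⟨l, R⟩))[(finFunctionFinEquiv y : ℕ)]? = some (letI := A.str;
      if FirstOrder.Language.Structure.RelMap R y then 1 else 0) := by
  rw [FinStruct.table, List.getElem?_ofFn, dif_pos (finFunctionFinEquiv y).2, Fin.eta,
    Equiv.symm_apply_apply]

/-- The program computes the value of the compound expression at every point. -/
theorem resDigit_val (hg : GOK g) (hs : StructOK As k g) (hy : SymOK L k g) (s : FOSym L k) (τ : ℕ)
    (c : ∀ j : Fin s.arity, FOExpr L k (s.kid j))
    (hc : ∀ j, IsDig As (c j) fun e => tupleDig g τ (j * g.v .E + e)) (a : ℕ) (A : FinStruct L)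
    (hA : As[a]? = some A) (i : Fin (A.size ^ k)) :
    resDigit g s.code τ (pointOff k As a + i) = A.valNum (s.build c) i := by
  classical
  have hlt := pointOff_lt (k := k) As hA i.2
  have hsb := hs.sb a A hA i i.2
  have hai := hs.ai a A hA i i.2
  have hR : 1 < g.v .R := hg.R_gt
  have hsz : g.a .PW (a * g.v .R + 1) = A.size := by rw [hs.pw a A hA 1 hR, pow_one]
  have hval : ∀ j : Fin s.arity, ∀ i' : Fin (A.size ^ k),
      tupleDig g τ (j * g.v .E + (pointOff k As a + i')) = A.valNum (c j) i' :=
    fun j i' => (hc j).val a A hA i'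
  rw [resDigit, if_pos (by rw [hs.N_eq]; exact hlt), hy.op, hy.arg, hy.ar]
  have ev : (evalState g s.code τ).v .E = g.v .E := rfl
  have ea : ∀ y, y ≠ .D → (evalState g s.code τ).a y = g.a y := fun x h1 => by simp [evalState, h1]
  have ed : (evalState g s.code τ).a .D = tupleDig g τ := rfl
  letI := A.str
  have hcoord : ∀ x : Fin k, coordVal (evalState g s.code τ) x (pointOff k As a + i) =
      (finFunctionFinEquiv.symm i x : Fin A.size) := by
    intro x
    rw [finFunctionFinEquiv_symm_val, coordVal, ea _ (by decide), ea _ (by decide), ea _ (by decide),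
      hsb, hai, hsz, hs.pw a A hA _ (x.2.trans hs.k_lt)]
  have hslice : ∀ (x : Fin k) (b : Fin A.size), sliceVal (evalState g s.code τ) x (pointOff k As a + i) b =
      tupleDig g τ (pointOff k As a + (finFunctionFinEquiv (Function.update
        (finFunctionFinEquiv.symm i) x b) : Fin (A.size ^ k))) := by
    intro x b
    have h1 := digit_mul_le (n := A.size) i x
    rw [sliceVal, hcoord, ed, ea .PW (by decide), ea .SB (by decide), hsb,
      hs.pw a A hA _ (x.2.trans hs.k_lt), finFunctionFinEquiv_update, finFunctionFinEquiv_symm_val]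
    congr 1
    omega
  have htab : ∀ (sy : L.Symbols) (l : ℕ) (y : Fin l → Fin A.size) (v : ℕ), l ≤ g.v .R →
      (A.table sy)[(finFunctionFinEquiv y : ℕ)]? = some v →
      (∀ j : Fin l, tupleDig g τ (j * g.v .E + (pointOff k As a + i)) = y j) →
      tabVal (evalState g s.code τ) (Finite.equivFin L.Symbols sy) l (pointOff k As a + i) = v := by
    intro sy l y v hl hv hd
    rw [tabVal, ed, ev, ea .IN (by decide), ea .TAB (by decide), ea .SB (by decide),
      ea .PW (by decide), hsb]
    refine Eq.trans ?_ (hs.tab a A hA sy _ v hv)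
    rw [finFunctionFinEquiv_apply, Finset.sum_range]
    congr 2
    refine Finset.sum_congr rfl fun j _ => ?_
    rw [hs.pw a A hA _ (j.2.trans_le hl), add_comm, hd j]
  cases s with
  | and =>
    obtain ⟨p0, hp0⟩ : ∃ p : Prop, p = FOExpr.eval (κ := .formula) (Fin A.size)
      (c (0 : Fin 2)) (finFunctionFinEquiv.symm i) := ⟨_, rfl⟩
    have h0 : tupleDig g τ ((pointOff k As a + i)) = if p0 then 1 else 0 :=
      ((congrArg (tupleDig g τ) (by simp)).trans (hval (0 : Fin 2) i)).trans
        (valNum_formula A (c (0 : Fin 2)) i (hp0 ▸ Iff.rfl))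
    obtain ⟨p1, hp1⟩ : ∃ p : Prop, p = FOExpr.eval (κ := .formula) (Fin A.size)
      (c (1 : Fin 2)) (finFunctionFinEquiv.symm i) := ⟨_, rfl⟩
    have h1 : tupleDig g τ (g.v .E + (pointOff k As a + i)) = if p1 then 1 else 0 :=
      ((congrArg (tupleDig g τ) (by simp)).trans (hval (1 : Fin 2) i)).trans
        (valNum_formula A (c (1 : Fin 2)) i (hp1 ▸ Iff.rfl))
    refine Eq.trans ?_ (valNum_formula A (FOSym.build .and c) i (P := p0 ∧ p1)
      (by rw [hp0, hp1]; exact Iff.rfl)).symm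
    simp only [pointVal, FOSym.opNum, if_true, ed, ev, h0, h1]
    clear hp0 hp1
    by_cases p0 <;> by_cases p1 <;> simp [*]
  | or =>
    obtain ⟨p0, hp0⟩ : ∃ p : Prop, p = FOExpr.eval (κ := .formula) (Fin A.size)
      (c (0 : Fin 2)) (finFunctionFinEquiv.symm i) := ⟨_, rfl⟩
    have h0 : tupleDig g τ ((pointOff k As a + i)) = if p0 then 1 else 0 :=
      ((congrArg (tupleDig g τ) (by simp)).trans (hval (0 : Fin 2) i)).trans
        (valNum_formula A (c (0 : Fin 2)) i (hp0 ▸ Iff.rfl))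
    obtain ⟨p1, hp1⟩ : ∃ p : Prop, p = FOExpr.eval (κ := .formula) (Fin A.size)
      (c (1 : Fin 2)) (finFunctionFinEquiv.symm i) := ⟨_, rfl⟩
    have h1 : tupleDig g τ (g.v .E + (pointOff k As a + i)) = if p1 then 1 else 0 :=
      ((congrArg (tupleDig g τ) (by simp)).trans (hval (1 : Fin 2) i)).trans
        (valNum_formula A (c (1 : Fin 2)) i (hp1 ▸ Iff.rfl))
    refine Eq.trans ?_ (valNum_formula A (FOSym.build .or c) i (P := p0 ∨ p1)
      (by rw [hp0, hp1]; exact Iff.rfl)).symm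
    simp only [pointVal, FOSym.opNum, ed, ev, h0, h1]
    clear hp0 hp1
    by_cases p0 <;> by_cases p1 <;> simp [*]
  | neg =>
    obtain ⟨p0, hp0⟩ : ∃ p : Prop, p = FOExpr.eval (κ := .formula) (Fin A.size)
      (c (0 : Fin 1)) (finFunctionFinEquiv.symm i) := ⟨_, rfl⟩
    have h0 : tupleDig g τ ((pointOff k As a + i)) = if p0 then 1 else 0 :=
      ((congrArg (tupleDig g τ) (by simp)).trans (hval (0 : Fin 1) i)).trans
        (valNum_formula A (c (0 : Fin 1)) i (hp0 ▸ Iff.rfl))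
    refine Eq.trans ?_ (valNum_formula A (FOSym.build .neg c) i (P := ¬ p0)
      (by rw [hp0]; exact Iff.rfl)).symm
    simp only [pointVal, FOSym.opNum, ed, ev, h0]
    clear hp0
    by_cases p0 <;> simp [*]
  | ite =>
    obtain ⟨p0, hp0⟩ : ∃ p : Prop, p = FOExpr.eval (κ := .formula) (Fin A.size)
      (c (0 : Fin 3)) (finFunctionFinEquiv.symm i) := ⟨_, rfl⟩
    have h0 : tupleDig g τ ((pointOff k As a + i)) = if p0 then 1 else 0 :=
      ((congrArg (tupleDig g τ) (by simp)).trans (hval (0 : Fin 3) i)).trans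
        (valNum_formula A (c (0 : Fin 3)) i (hp0 ▸ Iff.rfl))
    obtain ⟨t1, ht1⟩ : ∃ t : Fin A.size, t = FOExpr.eval (κ := .term) (Fin A.size)
      (c (1 : Fin 3)) (finFunctionFinEquiv.symm i) := ⟨_, rfl⟩
    have h1 : tupleDig g τ (g.v .E + (pointOff k As a + i)) = t1 :=
      ((congrArg (tupleDig g τ) (by simp)).trans (hval (1 : Fin 3) i)).trans
        (congrArg Fin.val ht1.symm)
    obtain ⟨t2, ht2⟩ : ∃ t : Fin A.size, t = FOExpr.eval (κ := .term) (Fin A.size)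
      (c (2 : Fin 3)) (finFunctionFinEquiv.symm i) := ⟨_, rfl⟩
    have h2 : tupleDig g τ (g.v .E + g.v .E + (pointOff k As a + i)) = t2 :=
      ((congrArg (tupleDig g τ) (by simp [two_mul])).trans (hval (2 : Fin 3) i)).trans
        (congrArg Fin.val ht2.symm)
    have h3 : A.valNum (FOSym.build .ite c) i = if p0 then (t1 : ℕ) else t2 := by
      rw [hp0, ht1, ht2]
      exact apply_ite Fin.val _ _ _
    rw [h3]
    simp only [pointVal, FOSym.opNum, ed, ev, h0, h1, h2]
    clear hp0
    by_cases p0 <;> simp [*]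
  | all x =>
    obtain ⟨p, hp⟩ : ∃ p : Fin (A.size ^ k) → Prop, p = fun i' => FOExpr.eval (κ := .formula) (Fin A.size)
      (c (0 : Fin 1)) (finFunctionFinEquiv.symm i') := ⟨_, rfl⟩
    have h0 : ∀ i' : Fin (A.size ^ k), tupleDig g τ (pointOff k As a + i') = if p i' then 1 else 0 := fun i' =>
      ((congrArg (tupleDig g τ) (by simp)).trans (hval (0 : Fin 1) i')).trans
        (valNum_formula A (c (0 : Fin 1)) i' (hp ▸ Iff.rfl))
    refine Eq.trans ?_ (valNum_formula A (FOSym.build (.all x) c) i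
      (P := ∀ b : Fin A.size, p (finFunctionFinEquiv (Function.update
        (finFunctionFinEquiv.symm i) x b))) ?_).symm
    · simp only [pointVal, FOSym.opNum, FOSym.opArg, ea .PW (by decide), ea .SB (by decide), hsb, hsz,
        Nat.reduceEqDiff, OfNat.ofNat_ne_zero, if_false, if_true]
      refine if_congr ?_ rfl rfl
      rw [Fin.forall_iff]
      refine forall_congr' fun b => ?_
      refine forall_congr' fun hb => ?_
      rw [hslice x ⟨b, hb⟩, h0]
      simp
    · simp only [hp, Equiv.symm_apply_apply]
      exact Iff.rfl
  | ex x =>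
    obtain ⟨p, hp⟩ : ∃ p : Fin (A.size ^ k) → Prop, p = fun i' => FOExpr.eval (κ := .formula) (Fin A.size)
      (c (0 : Fin 1)) (finFunctionFinEquiv.symm i') := ⟨_, rfl⟩
    have h0 : ∀ i' : Fin (A.size ^ k), tupleDig g τ (pointOff k As a + i') = if p i' then 1 else 0 := fun i' =>
      ((congrArg (tupleDig g τ) (by simp)).trans (hval (0 : Fin 1) i')).trans
        (valNum_formula A (c (0 : Fin 1)) i' (hp ▸ Iff.rfl))
    refine Eq.trans ?_ (valNum_formula A (FOSym.build (.ex x) c) i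
      (P := ∃ b : Fin A.size, p (finFunctionFinEquiv (Function.update
        (finFunctionFinEquiv.symm i) x b))) ?_).symm
    · simp only [pointVal, FOSym.opNum, FOSym.opArg, ea .PW (by decide), ea .SB (by decide), hsb, hsz,
        Nat.reduceEqDiff, OfNat.ofNat_ne_zero, if_false, if_true]
      refine if_congr ?_ rfl rfl
      rw [Fin.exists_iff]
      refine exists_congr fun b => ?_
      rw [← exists_prop]
      refine exists_congr fun hb => ?_
      rw [hslice x ⟨b, hb⟩, h0]
      simp
    · simp only [hp, Equiv.symm_apply_apply]
      exact Iff.rfl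
  | var x =>
    simp only [pointVal, FOSym.opNum, FOSym.opArg, hcoord]
    rfl
  | fn F =>
    simp only [pointVal, FOSym.opNum, FOSym.opArg]
    exact htab (.inl ⟨_, F⟩) _ (fun j => FOExpr.eval (κ := .term) (Fin A.size)
      (c j) (finFunctionFinEquiv.symm i)) _ (hy.ar (.fn F) ▸ hg.ar_le _)
      (table_fn A F _) (fun j => hval j i)
  | rel R =>
    simp only [pointVal, FOSym.opNum, FOSym.opArg]
    exact htab (.inr ⟨_, R⟩) _ (fun j => FOExpr.eval (κ := .term) (Fin A.size)
      (c j) (finFunctionFinEquiv.symm i)) _ (hy.ar (.rel R) ▸ hg.ar_le _)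
      (table_rel A R _) (fun j => hval j i)

/-- The value of a symbol, computed from the values of the children, describes the expression that the
symbol forms with the children. -/
theorem IsDig.build (hg : GOK g) (hs : StructOK As k g) (hy : SymOK L k g) (s : FOSym L k) (τ : ℕ)
    (c : ∀ j : Fin s.arity, FOExpr L k (s.kid j))
    (hc : ∀ j, IsDig As (c j) fun e => tupleDig g τ (j * g.v .E + e)) :
    IsDig As (s.build c) (resDigit g s.code τ) where
  val a A hA i := resDigit_val hg hs hy s τ c hc a A hA i
  free x := by classical exact resDigit_free hs hy s τ c hc x
  kind := by
    rw [← hs.N_eq, resDigit, if_neg (by omega), if_neg (by rw [hs.k_eq]; omega), hy.rk]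

end Build

/-! ### Items, values and trees -/

section Sem

variable {L : FirstOrder.Language.{u, v}} [Finite L.Symbols] {k : ℕ}

open LoopProg LoopProg.Prog

/-- The arrays describe the grammar. Item `u` stands for the tree `X u`: this is a subtree of a
right-hand side or, if `u` is at least the length of the input, a nonterminal. The occurrences of the
nonterminal `B` form a linked list that starts at the item of `B`; the field `reach` says, as an
induction principle, that every occurrence is in this list. -/
structure GramOK (G : FOGrammar L k)
    (X : ℕ → Option (RTree (FOSym.arity (L := L) (k := k)) (Fin G.numNT))) (g : PState) : Prop where
  node : ∀ p s xs, X p = some (.node s xs) → g.a .ND p ≠ 0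
  nd : ∀ p, g.a .ND p ≠ 0 → ∃ s xs, X p = some (.node s xs) ∧ g.a .IN p = s.code ∧
    ∀ j : Fin s.arity, X (g.a .CH (p * g.v .R + j)) = some (xs j)
  next : ∀ u t, X u = some t → g.a .NX u ≠ 0 → X (g.a .NX u) = some t
  up : ∀ u r, X u = some r → g.a .CP u ≠ 0 → ∃ B, (B, r) ∈ G.rules ∧ X (g.a .CP u) = some (.leaf B)
  reach : ∀ u B, X u = some (.leaf B) → ∀ Q : ℕ → Prop, Q (g.v .len + B) →
    (∀ w, Q w → g.a .NX w ≠ 0 → Q (g.a .NX w)) → Q u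
  rule : ∀ B r, (B, r) ∈ G.rules → ∃ u, X u = some r ∧ g.a .CP u = g.v .len + B
  len_pos : 0 < g.v .len
  start : g.v .st = g.v .len + G.start
  nonterminal : ∀ B : Fin G.numNT, X (g.v .len + B) = some (.leaf B)

variable {G : FOGrammar L k} {X : ℕ → Option (RTree (FOSym.arity (L := L) (k := k)) (Fin G.numNT))}
  {As : List (FinStruct L)} {g : PState}

/-- The tree `t` is derivable from the item `u`, and it represents an expression with the value `v`. -/
def ItemSem (As : List (FinStruct L)) (G : FOGrammar L k)
    (X : ℕ → Option (RTree (FOSym.arity (L := L) (k := k)) (Fin G.numNT))) (g : PState) (u v : ℕ)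
    (t : FOTree L k) : Prop :=
  ∃ y, X u = some y ∧ Derives G y t ∧ ∃ (κ : Kind) (φ : FOExpr L k κ) (d : ℕ → ℕ), φ.toTree = t ∧
    IsDig As φ d ∧ v = ofDig (g.v .b) d (g.v .E)

theorem IsDig.congr (hg : GOK g) (hs : StructOK As k g) {κ : Kind} {φ : FOExpr L k κ} {d d' : ℕ → ℕ}
    (h : IsDig As φ d) (he : ∀ e < g.v .E, d' e = d e) : IsDig As φ d' := by
  have hE := hg.E_eq
  rw [hs.k_eq] at hE
  refine ⟨fun a A hA i => ?_, fun y => ?_, ?_⟩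
  · have := pointOff_lt (k := k) As hA i.2
    rw [← hs.N_eq] at this
    rw [he _ (by omega), h.val a A hA i]
  · have := y.2
    rw [he _ (by rw [← hs.N_eq]; omega), h.free y]
  · rw [he _ (by rw [← hs.N_eq]; omega), h.kind]

theorem Kind.code_injective : Function.Injective Kind.code := by
  intro κ κ' h
  cases κ <;> cases κ' <;> simp_all [Kind.code]

/-- If component number `j` of a tuple is the value of an expression, its block of digits describes
this expression. -/
theorem tupleDig_of_component (hg : GOK g) (hs : StructOK As k g) {κ : Kind} {φ : FOExpr L k κ}
    {d : ℕ → ℕ} (h : IsDig As φ d) {τ j : ℕ}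
    (hτ : τ / g.v .V ^ j % g.v .V = ofDig (g.v .b) d (g.v .E)) {e : ℕ} (he : e < g.v .E) :
    tupleDig g τ (j * g.v .E + e) = d e := by
  rw [tupleDig_eq g τ j e he, hτ, ofDig_digit (fun e he => h.lt hg hs he) he]

/-- Soundness: the three rules preserve derivability. The test of the kinds ensures that the trees
of the children are combined to the tree of an expression; the grammar may generate other trees as
well, and they have no value. -/
theorem semOK (hg : GOK g) (hs : StructOK As k g) (hy : SymOK L k g) (hG : GramOK G X g) :
    SemOK FOSym.code g (ItemSem As G X g) where
  next u v t h h0 := by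
    obtain ⟨y, h1, h2⟩ := h
    exact ⟨y, hG.next u y h1 h0, h2⟩
  up u v t h h0 := by
    obtain ⟨y, h1, h2, h3⟩ := h
    obtain ⟨B, hB, hX⟩ := hG.up u y h1 h0
    exact ⟨_, hX, .rule hB h2, h3⟩
  comb p hp := by
    obtain ⟨s, xs, hX, hIN, hch⟩ := hG.nd p hp
    refine ⟨s, hIN.symm, by rw [hIN, hy.ar], fun τ ch hτ hsem hkind => ?_⟩
    have hE := hg.E_eq
    rw [hIN]
    have key : ∀ j : Fin s.arity, Derives G (xs j) (ch j) ∧ ∃ φ : FOExpr L k (s.kid j),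
        φ.toTree = ch j ∧ IsDig As φ fun e => tupleDig g τ (j * g.v .E + e) := by
      intro j
      obtain ⟨y, h1, h2, κ, φ, d, h3, h4, h5⟩ := hsem j
      rw [hch j, Option.some.injEq] at h1
      subst h1
      refine ⟨h2, ?_⟩
      have hdig : ∀ e < g.v .E, tupleDig g τ (j * g.v .E + e) = d e := fun e he =>
        tupleDig_of_component hg hs h4 h5 he
      have hk := hkind j j.2
      rw [add_assoc, hdig _ (by omega), hs.N_eq, hs.k_eq, h4.kind, hIN, hy.k0, hy.k1,
        ← s.code_kid] at hk
      obtain rfl := Kind.code_injective hk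
      exact ⟨φ, h3, h4.congr hg hs hdig⟩
    choose hder c hc hdig using key
    have hb := IsDig.build hg hs hy s τ c hdig
    refine ⟨fun e he => hb.lt hg hs he, _, hX, .node hder, _, s.build c, _, ?_, hb, rfl⟩
    rw [s.toTree_build]
    exact congrArg _ (funext hc)

/-- Every set of pairs of an item and a value that is closed under the rules contains the values of all
expressions that are derivable from an item. -/
theorem closed_complete (hg : GOK g) (hs : StructOK As k g) (hy : SymOK L k g) (hG : GramOK G X g)
    (M : ℕ → ℕ → Prop) (hnext : ∀ u v, v < g.v .V → M u v → g.a .NX u ≠ 0 → M (g.a .NX u) v)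
    (hup : ∀ u v, v < g.v .V → M u v → g.a .CP u ≠ 0 → M (g.a .CP u) v)
    (hcomb : ∀ p τ, g.a .ND p ≠ 0 → τ < g.v .VR → (∀ j < g.a .AR (g.a .IN p),
      M (g.a .CH (p * g.v .R + j)) (τ / g.v .V ^ j % g.v .V) ∧
      tupleDig g τ (j * g.v .E + g.v .N + g.v .k) =
        if j ≠ 0 then g.a .K1 (g.a .IN p) else g.a .K0 (g.a .IN p)) →
      M p (resVal g (g.a .IN p) τ))
    {y : RTree (FOSym.arity (L := L) (k := k)) (Fin G.numNT)} {t : FOTree L k} (h : Derives G y t) :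
    ∀ (κ : Kind) (φ : FOExpr L k κ), φ.toTree = t → ∃ d, IsDig As φ d ∧
      ∀ u, X u = some y → M u (ofDig (g.v .b) d (g.v .E)) := by
  induction h with
  | @rule B r t hB hr ih =>
    intro κ φ hφ
    obtain ⟨d, hd, hM⟩ := ih κ φ hφ
    refine ⟨d, hd, fun u hu => ?_⟩
    have hlt : ofDig (g.v .b) d (g.v .E) < g.v .V := by
      rw [hg.V_eq]; exact ofDig_lt fun e he => hd.lt hg hs he
    -- from the right-hand side to the nonterminal, and from there to all its occurrences
    obtain ⟨w, hw, hcp⟩ := hG.rule B r hB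
    have h0 := hup w _ hlt (hM w hw) (by rw [hcp]; have := hG.len_pos; omega)
    rw [hcp] at h0
    exact hG.reach u B hu (fun w => M w (ofDig (g.v .b) d (g.v .E))) h0 fun w h1 h2 =>
      hnext w _ hlt h1 h2
  | @node s xs ts hx ih =>
    intro κ φ hφ
    obtain ⟨s', c, rfl, rfl⟩ := φ.exists_build
    simp only [FOSym.toTree_build, RTree.node.injEq] at hφ
    obtain ⟨rfl, hφ⟩ := hφ
    have hφ' := congrFun (eq_of_heq hφ)
    have key := fun j => ih j _ (c j) (hφ' j)
    choose d hd hM using key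
    obtain ⟨val, hval⟩ : ∃ val : ℕ → ℕ, ∀ j : Fin s'.arity, val j = ofDig (g.v .b) (d j) (g.v .E) :=
      ⟨fun j => if h : j < s'.arity then ofDig (g.v .b) (d ⟨j, h⟩) (g.v .E) else 0, fun j => by simp⟩
    have hvlt : ∀ j < s'.arity, val j < g.v .V := fun j hj => by
      rw [hval ⟨j, hj⟩, hg.V_eq]; exact ofDig_lt fun e he => (hd ⟨j, hj⟩).lt hg hs he
    -- the tuple of the values of the children
    obtain ⟨τ, hτ⟩ : ∃ τ, τ = ofDig (g.v .V) val s'.arity := ⟨_, rfl⟩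
    have hτlt : τ < g.v .VR := by
      rw [hg.VR_eq, hτ]
      refine (ofDig_lt hvlt).trans_le (Nat.pow_le_pow_right hg.V_pos ?_)
      rw [← hy.ar]; exact hg.ar_le _
    have hcomp : ∀ j : Fin s'.arity, τ / g.v .V ^ (j : ℕ) % g.v .V = ofDig (g.v .b) (d j) (g.v .E) :=
      fun j => by rw [hτ, ofDig_digit hvlt j.2, hval]
    have hdig : ∀ j : Fin s'.arity, ∀ e < g.v .E, tupleDig g τ (j * g.v .E + e) = d j e := fun j e he =>
      tupleDig_of_component hg hs (hd j) (hcomp j) he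
    refine ⟨resDigit g s'.code τ, IsDig.build hg hs hy s' τ c fun j => (hd j).congr hg hs (hdig j),
      fun p hp => ?_⟩
    have hND := hG.node p _ _ hp
    obtain ⟨s₂, xs₂, hX, hIN, hch⟩ := hG.nd p hND
    rw [hp] at hX
    simp only [Option.some.injEq, RTree.node.injEq] at hX
    obtain ⟨rfl, hX⟩ := hX
    obtain rfl := eq_of_heq hX
    have := hcomb p τ hND hτlt fun j hj => by
      rw [hIN, hy.ar] at hj
      have hE := hg.E_eq
      refine ⟨?_, ?_⟩
      · rw [hcomp ⟨j, hj⟩]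
        exact hM ⟨j, hj⟩ _ (hch ⟨j, hj⟩)
      · rw [add_assoc, hdig ⟨j, hj⟩ _ (by omega), hs.N_eq, hs.k_eq, (hd ⟨j, hj⟩).kind, hIN, hy.k0, hy.k1,
          ← s'.code_kid]
    rw [hIN] at this
    exact this

/-- The last digit tells formulas from terms. -/
theorem kind_of_digits (hg : GOK g) (hs : StructOK As k g) {κ : Kind} {φ : FOExpr L k κ} {d : ℕ → ℕ}
    (hd : IsDig As φ d) (h : ∀ e < g.v .E, d e = tgtDigit g e) : κ = .formula := by
  have h1 := h (g.v .N + g.v .k) (by rw [hg.E_eq]; omega)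
  rw [tgtDigit, if_neg (by omega), if_neg (by omega), hs.N_eq, hs.k_eq, hd.kind] at h1
  cases κ <;> simp_all [Kind.code]

/-- The digits of a formula are those of the target exactly if it is a solution. -/
theorem digits_eq_target_iff (I : SepInstance L k) (hg : GOK g)
    (hs : StructOK (I.pos ++ I.neg) k g)
    (hpos : ∀ (a : ℕ) (A : FinStruct L), (I.pos ++ I.neg)[a]? = some A → ∀ i < A.size ^ k,
      g.a .POS (pointOff k (I.pos ++ I.neg) a + i) = if a < I.pos.length then 1 else 0)
    {φ : FOFormula L k} {d : ℕ → ℕ} (hd : IsDig (I.pos ++ I.neg) φ d) :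
    (∀ e < g.v .E, d e = tgtDigit g e) ↔ φ.IsSentence ∧
      (∀ A ∈ I.pos, A.Models φ) ∧ (∀ B ∈ I.neg, ¬ B.Models φ) := by
  have hE := hg.E_eq
  rw [hs.k_eq] at hE
  have hval : ∀ (a : ℕ) (A : FinStruct L), (I.pos ++ I.neg)[a]? = some A →
      ∀ asg : Fin k → Fin A.size, d (pointOff k (I.pos ++ I.neg) a + finFunctionFinEquiv asg) = 1 ↔
        (letI := A.str; φ.eval (Fin A.size) asg) := by
    classical
    intro a A hA asg
    rw [hd.val a A hA, valNum_formula A φ _ (P := letI := A.str; φ.eval (Fin A.size) asg)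
      (by rw [Equiv.symm_apply_apply])]
    split_ifs with h <;> simp [h]
  constructor
  · intro h
    have hpt : ∀ (a : ℕ) (A : FinStruct L), (I.pos ++ I.neg)[a]? = some A → ∀ i < A.size ^ k,
        d (pointOff k (I.pos ++ I.neg) a + i) = if a < I.pos.length then 1 else 0 := by
      intro a A hA i hi
      have hlt := pointOff_lt (k := k) _ hA hi
      rw [← hs.N_eq] at hlt
      rw [h _ (by omega), tgtDigit, if_pos hlt, hpos a A hA i hi]
    refine ⟨Set.eq_empty_of_forall_notMem fun y hy => ?_, fun A hA => ?_, fun B hB hM => ?_⟩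
    · have h1 := hd.free y
      have h2 := y.2
      rw [if_pos hy, ← hs.N_eq, h _ (by omega), tgtDigit, if_neg (by omega),
        if_pos (by rw [hs.k_eq]; omega)] at h1
      omega
    · obtain ⟨a, ha⟩ := List.mem_iff_getElem?.1 hA
      have hlt := (List.getElem?_eq_some_iff.1 ha).1
      have hA' : (I.pos ++ I.neg)[a]? = some A := by rw [List.getElem?_append_left hlt, ha]
      intro asg
      rw [← hval a A hA', hpt a A hA' _ (Fin.is_lt _), if_pos hlt]
    · obtain ⟨b, hb⟩ := List.mem_iff_getElem?.1 hB
      have hB' : (I.pos ++ I.neg)[I.pos.length + b]? = some B := by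
        rw [List.getElem?_append_right (by omega), Nat.add_sub_cancel_left, hb]
      have := (hval _ B hB' fun _ => ⟨0, B.size_pos⟩).2 (hM _)
      rw [hpt _ B hB' _ (Fin.is_lt _), if_neg (by omega)] at this
      omega
  · rintro ⟨hsen, hp, hn⟩ e he
    rw [tgtDigit]
    split_ifs with h1 h2
    · obtain ⟨a, A, hA, i, hi, rfl⟩ := exists_point _ (hs.N_eq ▸ h1)
      rw [hpos a A hA i hi]
      obtain ⟨asg, hasg⟩ : ∃ asg : Fin k → Fin A.size, i = (finFunctionFinEquiv asg : ℕ) :=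
        ⟨finFunctionFinEquiv.symm ⟨i, hi⟩, by simp⟩
      have key := hval a A hA asg
      rw [← hasg] at key
      split_ifs with hlt
      · rw [key]
        refine hp A ?_ asg
        rw [List.getElem?_append_left hlt] at hA
        exact List.mem_iff_getElem?.2 ⟨a, hA⟩
      · have hB : A ∈ I.neg := by
          rw [List.getElem?_append_right (by omega)] at hA
          exact List.mem_iff_getElem?.2 ⟨_, hA⟩
        -- a sentence that holds under one assignment holds under all of them
        have hne : d (pointOff k (I.pos ++ I.neg) a + i) ≠ 1 := fun h => by
          refine hn A hB fun asg' => ?_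
          letI := A.str
          have := key.1 h
          rwa [φ.eval_congr (a := asg) (a' := asg') fun y hy => by
            rw [FOExpr.IsSentence] at hsen; rw [hsen] at hy; exact hy.elim] at this
        have h01 : d (pointOff k (I.pos ++ I.neg) a + i) ≤ 1 := by
          classical
          rw [hd.val a A hA ⟨i, hi⟩, valNum_formula A φ _ Iff.rfl]
          split_ifs <;> omega
        omega
    · have h3 := hd.free ⟨e - g.v .N, by rw [hs.k_eq] at h2; omega⟩
      rw [← hs.N_eq, if_neg (by rw [show φ.freeVars = ∅ from hsen]; exact id)] at h3
      rw [← h3]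
      congr 1
      simp only
      omega
    · have h3 := hd.kind
      rw [← hs.N_eq] at h3
      rw [hs.k_eq] at h2
      rw [show e = g.v .N + k by omega, h3]
      rfl

end Sem

/-! ### Correctness of the saturation -/

section Core

variable {L : FirstOrder.Language.{u, v}} [Finite L.Symbols] {k : ℕ}

open LoopProg LoopProg.Prog

/-- The last three phases find out whether there is a solution, and write one. -/
theorem run_core (I : SepInstance L k)
    {X : ℕ → Option (RTree (FOSym.arity (L := L) (k := k)) (Fin I.grammar.numNT))} {s : PState}
    (hg : GOK s) (hs : StructOK (I.pos ++ I.neg) k s) (hy : SymOK L k s) (hG : GramOK I.grammar X s)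
    (hpos : ∀ (a : ℕ) (A : FinStruct L), (I.pos ++ I.neg)[a]? = some A → ∀ i < A.size ^ k,
      s.a .POS (pointOff k (I.pos ++ I.neg) a + i) = if a < I.pos.length then 1 else 0)
    (hpos' : ∀ e, s.a .POS e ≤ 1) (hD : ∀ i, s.a .D i = 0) (hMK : ∀ i, s.a .MK i = 0) {s' : PState}
    (hs' : s' = run answer (run saturate (run combineAll s))) :
    s'.v .i ≤ 1 + (s.v .R + 1) * s.v .MV ∧
    (((List.range (s'.v .i)).map (s'.a .DW) = [0] ∧ ¬ ∃ φ : FOFormula L k, I.IsSolution φ) ∨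
      ∃ (d : TreeDag (FOSym.arity (L := L) (k := k))) (φ : FOFormula L k),
        (List.range (s'.v .i)).map (s'.a .DW) = 1 :: d.encode FOSym.code ∧ d.Represents φ.toTree ∧
          I.IsSolution φ) := by
  have hS := semOK hg hs hy hG
  obtain ⟨dl₁, hW₁, h0⟩ := run_combineAll hg hS ⟨fun _ _ => rfl, fun _ _ => rfl⟩ hD hMK
  obtain ⟨dl₂, hW₂, hn, hu, hc⟩ := run_saturate hg hS hW₁ h0
  obtain ⟨hlen, hans⟩ := run_answer hg hW₂ hpos'
  rw [← hs'] at hlen hans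
  generalize run saturate (run combineAll s) = s₂ at hs' hW₂ hn hu hc hans
  refine ⟨hlen, ?_⟩
  have htd : ∀ e < s.v .E, tgtDigit s e < s.v .b := fun e _ => by
    have := hpos' e
    rw [tgtDigit, hg.b_eq]
    split_ifs <;> omega
  rcases hans with ⟨-, d, t, ⟨y, hX, hder, κ, φ, dg, rfl, hdig, hv⟩, hrep, hout⟩ | ⟨hm, hout⟩
  · have heq : ∀ e < s.v .E, dg e = tgtDigit s e := fun e he => by
      rw [← ofDig_digit (fun e he => hdig.lt hg hs he) he, ← hv, tgtVal, ofDig_digit htd he]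
    obtain rfl := kind_of_digits hg hs hdig heq
    rw [hG.start, hG.nonterminal, Option.some.injEq] at hX
    subst hX
    exact Or.inr ⟨d, φ, hout, hrep, (mem_language_iff _ _).2 hder,
      (digits_eq_target_iff I hg hs hpos hdig).1 heq⟩
  · refine Or.inl ⟨hout, ?_⟩
    rintro ⟨φ, hlang, hsol⟩
    obtain ⟨dg, hdig, hM⟩ := closed_complete hg hs hy hG (Marked s₂) hn hu (fun p τ hp hτ h =>
      hc p τ hp hτ fun j hj => (hW₂.agree.childOK_iff p τ j).2 (h j hj))
      ((mem_language_iff _ _).1 hlang) _ φ rfl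
    have := hM _ (hG.nonterminal I.grammar.start)
    rw [← hG.start, ofDig_congr ((digits_eq_target_iff I hg hs hpos hdig).2 hsol), ← tgtVal] at this
    exact hm this

end Core

namespace LoopProg

namespace Prog

open Pr (skip set wr branch loop)

/-! ### Reading the structures -/

/-- The list is written in the memory `f` from the address `p` on. -/
def At (f : ℕ → ℕ) : ℕ → List ℕ → Prop
  | _, [] => True
  | p, a :: l => f p = a ∧ At f (p + 1) l

theorem at_append {f : ℕ → ℕ} {p : ℕ} {l l' : List ℕ} :
    At f p (l ++ l') ↔ At f p l ∧ At f (p + l.length) l' := by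
  induction l generalizing p with
  | nil => simp [At]
  | cons a l ih => simp [At, ih, and_assoc, add_assoc, add_comm 1]

theorem At.getElem {f : ℕ → ℕ} {p : ℕ} {l : List ℕ} (h : At f p l) {i v : ℕ} (hi : l[i]? = some v) :
    f (p + i) = v := by
  induction l generalizing p i with
  | nil => simp at hi
  | cons a l ih =>
    cases i with
    | zero => simp at hi; rw [add_zero, h.1, hi]
    | succ i => rw [← ih h.2 (by simpa using hi)]; congr 1; omega

theorem at_of_getElem {f : ℕ → ℕ} {p : ℕ} {l : List ℕ} (h : ∀ i v, l[i]? = some v → f (p + i) = v) :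
    At f p l := by
  induction l generalizing p with
  | nil => trivial
  | cons a l ih =>
    refine ⟨h 0 a (by simp), ih fun i v hi => ?_⟩
    rw [← h (i + 1) v (by simpa using hi)]
    congr 1
    omega

theorem At.flatten {f : ℕ → ℕ} {p : ℕ} {ls : List (List ℕ)} (h : At f p ls.flatten) {j : ℕ}
    {l : List ℕ} (hj : ls[j]? = some l) : At f (p + (ls.take j).flatten.length) l := by
  induction ls generalizing p j with
  | nil => simp at hj
  | cons a ls ih =>
    rw [List.flatten_cons, at_append] at h
    cases j with
    | zero => simp at hj; subst hj; simpa using h.1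
    | succ j =>
      have := ih h.2 (j := j) (by simpa using hj)
      simpa [add_assoc] using this

theorem run_powLoop (s : PState) (hi : s.v .i = 0) (hpw : s.v .pw = 1) (hsz : s.v .sz ≤ s.v .len) :
    (run (loop .R powBody) s).a .PW = fun j =>
      if s.v .base ≤ j ∧ j < s.v .base + s.v .R then s.v .sz ^ (j - s.v .base) else s.a .PW j := by
  refine (loop_inv (fun i s' => s'.v .i = i ∧ s'.v .pw = s.v .sz ^ i ∧ s'.a .PW = fun j =>
    if s.v .base ≤ j ∧ j < s.v .base + i then s.v .sz ^ (j - s.v .base) else s.a .PW j) powBody .R s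
    ⟨hi, by simp [hpw], ?_⟩ ?_).2.2
  · funext j
    rw [if_neg (by omega)]
  · rintro i s' - hF ⟨h1, h2, h3⟩
    have hb := hF.v .base (by decide)
    have hs := hF.v .sz (by decide)
    have hl := hF.v .len (by decide)
    simp only [powBody, run_seq]
    rw [run_mul _ (by simp [run_wr, hs, hl, hsz]) (by decide) (by decide) (by decide) (by decide)
      (by decide) (by decide) (by decide)]
    refine ⟨by simp [h1], by simp [h2, hs, pow_succ], ?_⟩
    simp only [run_set, run_wr, LState.set_a, LState.wr_a, if_true, ev_add, ev_rv, h1, h2, h3, hb]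
    funext j
    rw [Function.update_apply]
    by_cases hj : j = s.v .base + i
    · subst hj; simp
    · rw [if_neg hj]
      congr 1
      simp only [eq_iff_iff]
      omega

theorem run_tabLoop (s : PState) (hi : s.v .i = 0) (w : ℕ → ℕ)
    (hw : ∀ i < s.v .J, s.a .PW (s.v .base + s.a .AR (s.v .CB + i)) = w i) :
    (run (loop .J tabBody) s).v .pos = s.v .pos + ∑ j ∈ Finset.range (s.v .J), w j ∧
    (run (loop .J tabBody) s).a .TAB = fun j => if s.v .base ≤ j ∧ j < s.v .base + s.v .J then
      s.v .pos + ∑ j ∈ Finset.range (j - s.v .base), w j else s.a .TAB j := by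
  refine (loop_inv (fun i s' => s'.v .i = i ∧
    s'.v .pos = s.v .pos + ∑ j ∈ Finset.range i, w j ∧ s'.a .TAB = fun j =>
    if s.v .base ≤ j ∧ j < s.v .base + i then s.v .pos + ∑ j ∈ Finset.range (j - s.v .base), w j
      else s.a .TAB j) tabBody .J s ⟨hi, by simp, ?_⟩ ?_).2
  · funext j
    rw [if_neg (by omega)]
  · rintro i s' hi hF ⟨h1, h2, h3⟩
    have hb := hF.v .base (by decide)
    have hc := hF.v .CB (by decide)
    have hP := hF.a .PW (by decide)
    have hA := hF.a .AR (by decide)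
    refine ⟨by simp [tabBody, h1], ?_, ?_⟩
    · simp [tabBody, h1, h2, hb, hc, hP, hA, hw i hi, Finset.sum_range_succ, add_assoc]
    · simp only [tabBody, run_seq, run_set, run_wr, LState.set_a, LState.wr_a, if_true, ev_add, ev_rv,
        h1, h2, h3, hb]
      funext j
      rw [Function.update_apply]
      by_cases hj : j = s.v .base + i
      · subst hj; simp
      · rw [if_neg hj]
        congr 1
        simp only [eq_iff_iff]
        omega

end Prog

end LoopProg

section Read

variable {L : FirstOrder.Language.{u, v}} [Finite L.Symbols] {k : ℕ}

open LoopProg LoopProg.Prog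
open Pr (skip set wr branch loop)

/-- The arity of a symbol of the signature. -/
def FirstOrder.Language.symArity (L : FirstOrder.Language.{u, v}) : L.Symbols → ℕ
  | .inl F => F.1
  | .inr R => R.1

theorem FinStruct.length_table (A : FinStruct L) (sy : L.Symbols) :
    (A.table sy).length = A.size ^ L.symArity sy := by
  rcases sy with ⟨l, F⟩ | ⟨l, R⟩ <;> simp [FinStruct.table, FirstOrder.Language.symArity]

/-- The constants that do not depend on the instance. -/
structure ConstOK (L : FirstOrder.Language.{u, v}) [Finite L.Symbols] (k : ℕ) (s : PState) : Prop where
  k_eq : s.v .k = k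
  J_eq : s.v .J = Nat.card L.Symbols
  NC_eq : s.v .NC = 4 + 3 * k + Nat.card L.Symbols
  CB_eq : s.v .CB = 4 + 3 * k
  R_gt : 1 < s.v .R
  k_lt : k < s.v .R
  J_le : Nat.card L.Symbols ≤ s.v .R
  ar_lt : ∀ c, s.a .AR c < s.v .R
  op_le : ∀ c, s.a .OP c ≤ 7
  oa_lt : ∀ c, s.a .OA c < s.v .R
  sym : SymOK L k s

/-- What has been read about the first structures. -/
structure ReadOK (As : List (FinStruct L)) (s : PState) : Prop where
  pw : ∀ (a : ℕ) (A : FinStruct L), As[a]? = some A → ∀ i < s.v .R,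
    s.a .PW (a * s.v .R + i) = A.size ^ i
  tab : ∀ (a : ℕ) (A : FinStruct L), As[a]? = some A → ∀ sy : L.Symbols, ∀ i v,
    (A.table sy)[i]? = some v →
    s.a .IN (s.a .TAB (a * s.v .R + Finite.equivFin L.Symbols sy) + i) = v
  size_le : ∀ (a : ℕ) (A : FinStruct L), As[a]? = some A → A.size ≤ s.v .n

theorem ConstOK.ar_sym {s : PState} (h : ConstOK L k s) (sy : L.Symbols) :
    s.a .AR (4 + 3 * k + Finite.equivFin L.Symbols sy) = L.symArity sy := by
  rcases sy with ⟨l, F⟩ | ⟨l, R⟩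
  · exact h.sym.ar (.fn F)
  · exact h.sym.ar (.rel R)

theorem ConstOK.of_frame {s s' : PState} {P : Prog} (h : ConstOK L k s) (hF : Frame P s s')
    (hv : ∀ x ∈ [Var.k, .J, .NC, .CB, .R], x ∉ P.wv := by decide)
    (ha : ∀ b ∈ [Arr.AR, .K0, .K1, .RK, .OP, .OA], b ∉ P.wa := by decide) : ConstOK L k s' := by
  have v : ∀ x ∈ [Var.k, .J, .NC, .CB, .R], s'.v x = s.v x := fun x hx => hF.v x (hv x hx)
  have a : ∀ b ∈ [Arr.AR, .K0, .K1, .RK, .OP, .OA], s'.a b = s.a b := fun b hb => hF.a b (ha b hb)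
  simp only [List.forall_mem_cons, List.not_mem_nil, false_imp_iff, implies_true, and_true] at v a
  obtain ⟨v1, v2, v3, v4, v5⟩ := v
  obtain ⟨a1, a2, a3, a4, a5, a6⟩ := a
  obtain ⟨h1, h2, h3, h4, h5, h6, h7, h8, h9, h10, g1, g2, g3, g4, g5, g6⟩ := h
  constructor
  all_goals first | (simp only [v1, v2, v3, v4, v5, a1, a5, a6]; assumption) | skip
  constructor
  all_goals (simp only [a1, a2, a3, a4, a5, a6]; assumption)

/-- The tables of the symbols of the signature. -/
noncomputable def FinStruct.tables (A : FinStruct L) : List (List ℕ) :=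
  List.ofFn fun j => A.table ((Finite.equivFin L.Symbols).symm j)

theorem FinStruct.encode_eq (A : FinStruct L) :
    A.encode = List.replicate A.size 1 ++ ([0] ++ A.tables.flatten) := by
  rw [FinStruct.encode, List.append_assoc]
  rfl

/-- The lengths of the tables, as the program computes them from the arities. -/
theorem FinStruct.length_take_tables (A : FinStruct L) {s : PState} (hc : ConstOK L k s) {j : ℕ}
    (hj : j ≤ Nat.card L.Symbols) : (A.tables.take j).flatten.length =
      ∑ i ∈ Finset.range j, A.size ^ s.a .AR (s.v .CB + i) := by
  induction j with
  | zero => simp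
  | succ j ih =>
    have h1 : A.tables[j]? = some (A.table ((Finite.equivFin L.Symbols).symm ⟨j, hj⟩)) := by
      rw [FinStruct.tables, List.getElem?_ofFn, dif_pos (by omega)]
    have h2 := hc.ar_sym ((Finite.equivFin L.Symbols).symm ⟨j, hj⟩)
    rw [Equiv.apply_symm_apply] at h2
    rw [List.take_add_one, h1, Finset.sum_range_succ, ← ih (by omega), hc.CB_eq, h2,
      ← FinStruct.length_table]
    simp

/-- The program reads one more structure: the size, from which it computes the powers, and the
addresses of the tables, which are skipped with the help of the powers. -/
theorem run_readStruct {As : List (FinStruct L)} {A : FinStruct L} {s : PState} (hc : ConstOK L k s)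
    (hr : ReadOK As s) (hbase : s.v .base = As.length * s.v .R)
    (hat : At (s.a .IN) (s.v .pos) A.encode) (hlen : A.size ≤ s.v .len) :
    let s' := run readStruct s
    ReadOK (As ++ [A]) s' ∧ s'.v .base = (As.length + 1) * s.v .R ∧
      s'.v .pos = s.v .pos + A.encode.length ∧ s'.v .n = max (s.v .n) A.size := by
  rw [FinStruct.encode_eq, at_append, at_append, List.length_replicate] at hat
  obtain ⟨hones, hzero, htabs⟩ := hat
  simp only [List.length_singleton] at htabs
  have hones' : ∀ i < A.size, s.a .IN (s.v .pos + i) = 1 := fun i hi =>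
    hones.getElem (by simp [hi])
  obtain ⟨s₀, hs₀⟩ : ∃ s₀, s₀ = run (unary .sz;; set .pos (§.pos + §.sz + 1);; set .pw 1;; set .i 0) s :=
    ⟨_, rfl⟩
  have hF₀ : Frame _ s s₀ := hs₀ ▸ run_frame _ s
  have f0 : s₀.v .sz = A.size ∧ s₀.v .pos = s.v .pos + A.size + 1 ∧ s₀.v .pw = 1 ∧ s₀.v .i = 0 := by
    rw [hs₀]
    simp only [run_seq]
    rw [run_unary s A.size hlen hones' (by rw [hzero.1]; omega) (by decide) (by decide)]
    simp
  obtain ⟨f1, f2, f3, f4⟩ := f0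
  have e1 : run readStruct s = run (set .i 0;; loop .J tabBody;; set .base (§.base + §.R);;
      set .n (iteE (ltE (§.n) (§.sz)) (§.sz) (§.n))) (run (loop .R powBody) s₀) := by rw [hs₀]; rfl
  have k1 := run_powLoop s₀ f4 f3 (by rw [f1, hF₀.v _ (by decide)]; exact hlen)
  have hF₁ := run_frame (loop .R powBody) s₀
  generalize run (loop .R powBody) s₀ = s₁ at e1 k1 hF₁
  obtain ⟨s₂, hs₂⟩ : ∃ s₂, s₂ = run (set .i 0) s₁ := ⟨_, rfl⟩
  have hF₂ : Frame _ s₁ s₂ := hs₂ ▸ run_frame _ s₁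
  have hv₂ : ∀ x ∈ [Var.J, .CB, .R, .base, .n], s₂.v x = s.v x := fun x hx => by
    rw [hF₂.v x (by revert x; decide), hF₁.v x (by revert x; decide), hF₀.v x (by revert x; decide)]
  have ha₂ : ∀ b ∈ [Arr.AR, .TAB, .IN], s₂.a b = s.a b := fun b hb => by
    rw [hF₂.a b (by revert b; decide), hF₁.a b (by revert b; decide), hF₀.a b (by revert b; decide)]
  have hPW : s₂.a .PW = fun j => if As.length * s.v .R ≤ j ∧ j < As.length * s.v .R + s.v .R then
      A.size ^ (j - As.length * s.v .R) else s.a .PW j := by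
    rw [hF₂.a _ (by decide), k1, hF₀.v .base (by decide), hF₀.v .R (by decide), hF₀.a .PW (by decide),
      f1, hbase]
  have hpos₂ : s₂.v .pos = s.v .pos + A.size + 1 := by
    rw [hF₂.v _ (by decide), hF₁.v _ (by decide), f2]
  have k2 := run_tabLoop s₂ (by simp [hs₂]) (fun i => A.size ^ s.a .AR (s.v .CB + i)) (fun i _ => by
    have := hc.ar_lt (s.v .CB + i)
    rw [hv₂ .base (by decide), hv₂ .CB (by decide), ha₂ .AR (by decide), hPW, hbase]
    simp only
    rw [if_pos (by omega), Nat.add_sub_cancel_left])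
  have e2 : run readStruct s = run (set .base (§.base + §.R);;
      set .n (iteE (ltE (§.n) (§.sz)) (§.sz) (§.n))) (run (loop .J tabBody) s₂) := by rw [e1, hs₂]; rfl
  have hF₃ := run_frame (loop .J tabBody) s₂
  generalize run (loop .J tabBody) s₂ = s₃ at e2 k2 hF₃
  obtain ⟨k3, k4⟩ := k2
  rw [hv₂ .J (by decide), hpos₂, hc.J_eq] at k3
  rw [hv₂ .J (by decide), hpos₂, hc.J_eq, hv₂ .base (by decide), ha₂ .TAB (by decide), hbase] at k4
  have hJR := hc.J_le
  have hR := hc.R_gt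
  have g1 : (run readStruct s).v .n = max (s.v .n) A.size := by
    have h1 : s₃.v .n = s.v .n := by rw [hF₃.v _ (by decide), hv₂ _ (by decide)]
    have h2 : s₃.v .sz = A.size := by
      rw [hF₃.v _ (by decide), hF₂.v _ (by decide), hF₁.v _ (by decide), f1]
    rw [e2]
    simp [h1, h2]
    split_ifs <;> omega
  have g2 : (run readStruct s).v .base = (As.length + 1) * s.v .R := by
    have h1 : s₃.v .base = s.v .base := by rw [hF₃.v _ (by decide), hv₂ _ (by decide)]
    have h2 : s₃.v .R = s.v .R := by rw [hF₃.v _ (by decide), hv₂ _ (by decide)]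
    rw [e2]
    simp [h1, h2, hbase, add_mul]
  have g3 : (run readStruct s).a .PW = s₂.a .PW := by
    rw [e2]
    simp [hF₃.a .PW (by decide)]
  have g4 : (run readStruct s).a .TAB = s₃.a .TAB := by rw [e2]; simp
  have hF := run_frame readStruct s
  have g5 : (run readStruct s).a .IN = s.a .IN := hF.a _ (by decide)
  have g6 : (run readStruct s).v .R = s.v .R := hF.v _ (by decide)
  have hlenT := A.length_take_tables hc le_rfl
  rw [List.take_of_length_le (by simp [FinStruct.tables])] at hlenT
  refine ⟨⟨fun a B hB i hi => ?_, fun a B hB sy i v hv => ?_, fun a B hB => ?_⟩, g2, ?_, g1⟩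
  · rw [g6] at hi ⊢
    rw [g3, hPW]
    simp only
    rcases lt_trichotomy a As.length with h | h | h
    · rw [List.getElem?_append_left h] at hB
      have : (a + 1) * s.v .R ≤ As.length * s.v .R := Nat.mul_le_mul_right _ h
      rw [add_mul] at this
      rw [if_neg (by omega), hr.pw a B hB i hi]
    · subst h
      simp at hB
      subst hB
      rw [if_pos (by omega), Nat.add_sub_cancel_left]
    · rw [List.getElem?_eq_none (by simp; omega)] at hB
      simp at hB
  · rw [g5, g4, g6, k4]
    simp only
    have hsy := (Finite.equivFin L.Symbols sy).2
    rcases lt_trichotomy a As.length with h | h | h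
    · rw [List.getElem?_append_left h] at hB
      have : (a + 1) * s.v .R ≤ As.length * s.v .R := Nat.mul_le_mul_right _ h
      rw [add_mul] at this
      rw [if_neg (by omega)]
      exact hr.tab a B hB sy i v hv
    · subst h
      simp at hB
      subst hB
      rw [if_pos (by omega), Nat.add_sub_cancel_left]
      have h1 := htabs.flatten (j := Finite.equivFin L.Symbols sy) (l := A.table sy) (by
        rw [FinStruct.tables, List.getElem?_ofFn, dif_pos hsy]
        simp)
      rw [A.length_take_tables hc hsy.le] at h1
      exact h1.getElem hv
    · rw [List.getElem?_eq_none (by simp; omega)] at hB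
      simp at hB
  · rw [g1]
    rcases lt_trichotomy a As.length with h | h | h
    · rw [List.getElem?_append_left h] at hB
      exact (hr.size_le a B hB).trans (le_max_left _ _)
    · subst h
      simp at hB
      subst hB
      exact le_max_right _ _
    · rw [List.getElem?_eq_none (by simp; omega)] at hB
      simp at hB
  · have h1 : (run readStruct s).v .pos = s₃.v .pos := by rw [e2]; simp
    rw [h1, k3, FinStruct.encode_eq, List.length_append, List.length_append, List.length_replicate,
      hlenT]
    simp
    omega

theorem at_flatMap {α : Type*} {f : ℕ → ℕ} {p : ℕ} {F : α → List ℕ} {l : List α}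
    (h : At f p (l.flatMap F)) {i : ℕ} {a : α} (hi : l[i]? = some a) :
    At f (p + ((l.take i).flatMap F).length) (F a) := by
  rw [List.flatMap_def] at h
  have := h.flatten (j := i) (l := F a) (by simp [hi])
  rwa [← List.map_take, ← List.flatMap_def] at this

/-- After all structures have been read, `n` is the maximum of their sizes. -/
theorem run_readStructs {As : List (FinStruct L)} {s : PState} (hc : ConstOK L k s)
    (hm : s.v .m = As.length) (hbase : s.v .base = 0) (hn : s.v .n = 0)
    (hat : At (s.a .IN) (s.v .pos) (As.flatMap FinStruct.encode)) (hlen : ∀ A ∈ As, A.size ≤ s.v .len) :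
    ReadOK As (run readStructs s) ∧
      (run readStructs s).v .pos = s.v .pos + (As.flatMap FinStruct.encode).length ∧
      (run readStructs s).v .n = (As.map FinStruct.size).foldr max 0 := by
  have key := loop_inv (fun i s' => ReadOK (As.take i) s' ∧ s'.v .base = i * s.v .R ∧
    s'.v .pos = s.v .pos + ((As.take i).flatMap FinStruct.encode).length ∧
    s'.v .n = ((As.take i).map FinStruct.size).foldr max 0) readStruct .m s ?_ ?_
  · rw [hm, List.take_length] at key
    exact ⟨key.1, key.2.2⟩
  · refine ⟨⟨?_, ?_, ?_⟩, by simp [hbase], by simp, by simp [hn]⟩ <;> simp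
  · rintro i s' hi hF ⟨h1, h2, h3, h4⟩
    rw [hm] at hi
    have hR := hF.v .R (by decide)
    have hA : As[i]? = some As[i] := List.getElem?_eq_getElem hi
    have hl : (As.take i).length = i := by rw [List.length_take]; omega
    obtain ⟨g1, g2, g3, g4⟩ := run_readStruct (A := As[i]) (hc.of_frame hF) h1
      (by rw [hl, h2, hR]) (by
        rw [h3, hF.a _ (by decide)]
        exact at_flatMap hat hA)
      (by rw [hF.v _ (by decide)]; exact hlen _ (List.getElem_mem hi))
    have ht : As.take (i + 1) = As.take i ++ [As[i]] := by rw [List.take_add_one, hA]; rfl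
    rw [ht]
    refine ⟨g1, by rw [g2, hl, hR], by rw [g3, h3, List.flatMap_append, List.length_append, List.flatMap_singleton, add_assoc],
      ?_⟩
    rw [g4, h4]
    have foldr_max : ∀ (l : List ℕ) (a : ℕ), l.foldr max a = max (l.foldr max 0) a := by
      intro l a
      induction l with
      | nil => simp
      | cons b l ih => simp [ih, max_assoc]
    rw [List.map_append, List.foldr_append, foldr_max]
    simp [foldr_max _ (As[i].size)]

end Read

namespace LoopProg

namespace Prog

open Pr (skip set wr branch loop)

/-! ### Points, and the number of values -/

theorem run_computeNK (s : PState) : (run computeNK s).v .nk = s.v .n ^ s.v .k := by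
  have key := loop_inv (fun i s' => s'.v .nk = s.v .n ^ i) (mul .w .nk .n .n;; set .nk (§.w)) .k
    (s.set .nk 1) (by simp) ?_
  · exact key
  · rintro i s' - hF h1
    simp only [run_seq]
    rw [run_mul _ le_rfl (by decide) (by decide) (by decide) (by decide) (by decide) (by decide)
      (by decide)]
    have := hF.v .n (by decide)
    simp at this
    simp [h1, this, pow_succ]

theorem run_computeV (s : PState) : (run computeV s).v .V = s.v .b ^ s.v .E := by
  have key := loop_inv (fun i s' => s'.v .V = s.v .b ^ i) (mul .w .V .b .b;; set .V (§.w)) .E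
    (s.set .V 1) (by simp) ?_
  · exact key
  · rintro i s' - hF h1
    simp only [run_seq]
    rw [run_mul _ le_rfl (by decide) (by decide) (by decide) (by decide) (by decide) (by decide)
      (by decide)]
    have := hF.v .b (by decide)
    simp at this
    simp [h1, this, pow_succ]

theorem run_computeVR (s : PState) : (run computeVR s).v .VR = s.v .V ^ s.v .R := by
  have key := loop_inv (fun i s' => s'.v .VR = s.v .V ^ i) (mul .w .VR .V .V;; set .VR (§.w)) .R
    (s.set .VR 1) (by simp) ?_
  · exact key
  · rintro i s' - hF h1
    simp only [run_seq]
    rw [run_mul _ le_rfl (by decide) (by decide) (by decide) (by decide) (by decide) (by decide)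
      (by decide)]
    have := hF.v .V (by decide)
    simp at this
    simp [h1, this, pow_succ]

theorem run_computeMV (s : PState) : (run computeMV s).v .MV = (s.v .len + s.v .len) * s.v .V := by
  simp only [computeMV, run_seq]
  rw [run_mul _ (by simp) (by decide) (by decide) (by decide) (by decide) (by decide) (by decide)
      (by decide)]
  simp

/-- The points of a structure get consecutive numbers. The loop runs over `n ^ k` assignments, and
only those that the structure has are listed. -/
theorem run_structPoints (s : PState) {c : ℕ} (hc : s.a .PW (s.v .base + s.v .k) = c)
    (hle : c ≤ s.v .nk) :
    let s' := run structPoints s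
    s'.v .N = s.v .N + c ∧ s'.v .base = s.v .base + s.v .R ∧ s'.v .A = s.v .A + 1 ∧
    (s'.a .SB = fun j => if s.v .N ≤ j ∧ j < s.v .N + c then s.v .base else s.a .SB j) ∧
    (s'.a .AI = fun j => if s.v .N ≤ j ∧ j < s.v .N + c then j - s.v .N else s.a .AI j) ∧
    (s'.a .POS = fun j => if s.v .N ≤ j ∧ j < s.v .N + c then if s.v .A < s.v .np then 1 else 0
      else s.a .POS j) := by
  have key := loop_inv (fun i s' => s'.v .i = i ∧ s'.v .N = s.v .N + min i c ∧
    (s'.a .SB = fun j => if s.v .N ≤ j ∧ j < s.v .N + min i c then s.v .base else s.a .SB j) ∧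
    (s'.a .AI = fun j => if s.v .N ≤ j ∧ j < s.v .N + min i c then j - s.v .N else s.a .AI j) ∧
    (s'.a .POS = fun j => if s.v .N ≤ j ∧ j < s.v .N + min i c then
      if s.v .A < s.v .np then 1 else 0 else s.a .POS j)) pointBody .nk (s.set .i 0) ?_ ?_
  · have hF := run_frame (loop .nk pointBody) (s.set .i 0)
    have e : run structPoints s = run (set .base (§.base + §.R);; set .A (§.A + 1))
      (run (loop .nk pointBody) (s.set .i 0)) := rfl
    generalize run (loop .nk pointBody) (s.set .i 0) = s₁ at key hF e
    rw [show (s.set .i 0).v .nk = s.v .nk by simp, min_eq_right hle] at key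
    obtain ⟨-, h1, h2, h3, h4⟩ := key
    have v1 := hF.v .base (by decide)
    have v2 := hF.v .R (by decide)
    have v3 := hF.v .A (by decide)
    simp at v1 v2 v3
    rw [e]
    refine ⟨by simp [h1], by simp [v1, v2], by simp [v3], by simp [h2], by simp [h3], by simp [h4]⟩
  · refine ⟨by simp, by simp, ?_, ?_, ?_⟩ <;>
    · funext j
      rw [if_neg (by omega)]
      simp
  · rintro i s' hi hF ⟨h1, h2, h3, h4, h5⟩
    have v1 := hF.v .base (by decide)
    have v2 := hF.v .k (by decide)
    have v3 := hF.v .A (by decide)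
    have v4 := hF.v .np (by decide)
    have v5 := hF.a .PW (by decide)
    simp at v1 v2 v3 v4 v5
    simp only [pointBody, run_seq, run_branch, ev_ltE, ev_rd, ev_rv, ev_add, h1, v1, v2, v5, hc]
    by_cases hlt : i < c
    · have e1 : min (i + 1) c = i + 1 := by omega
      have e2 : min i c = i := by omega
      rw [e2] at h2 h3 h4 h5
      simp only [hlt, if_true, ne_eq, one_ne_zero, not_false_eq_true, e1]
      refine ⟨by simp [h1], by simp [h2, add_assoc], ?_, ?_, ?_⟩ <;>
      · simp only [run_seq, run_set, run_wr, LState.set_a, LState.wr_a, if_true, ev_rv, h1, h2, h3, h4,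
          h5, v1, v3, v4, reduceCtorEq, if_false, ev_ltE, LState.wr_v]
        funext j
        rw [Function.update_apply]
        by_cases hj : j = s.v .N + i
        · subst hj; simp
        · rw [if_neg hj]
          congr 1
          simp only [eq_iff_iff]
          omega
    · have e1 : min (i + 1) c = c := by omega
      have e2 : min i c = c := by omega
      rw [e2] at h2 h3 h4 h5
      simp only [hlt, if_false, ne_eq, not_true_eq_false, e1]
      exact ⟨by simp [h1], by simp [h2], by simp [h3], by simp [h4], by simp [h5]⟩

end Prog

end LoopProg

section Read

variable {L : FirstOrder.Language.{u, v}} {k : ℕ}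

open LoopProg LoopProg.Prog
open Pr (skip set wr branch loop)

/-- The points are numbered as in `pointOff`: the structures one after the other. -/
theorem run_listPoints {As : List (FinStruct L)} {s : PState} (hm : s.v .m = As.length)
    (hk : s.v .k = k)
    (hpw : ∀ (a : ℕ) (A : FinStruct L), As[a]? = some A → s.a .PW (a * s.v .R + k) = A.size ^ k)
    (hle : ∀ (a : ℕ) (A : FinStruct L), As[a]? = some A → A.size ^ k ≤ s.v .nk)
    (hP : ∀ e, s.a .POS e = 0) :
    let s' := run listPoints s
    s'.v .N = pointOff k As As.length ∧ (∀ e, s'.a .POS e ≤ 1) ∧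
    ∀ (a : ℕ) (A : FinStruct L), As[a]? = some A → ∀ i < A.size ^ k,
      s'.a .SB (pointOff k As a + i) = a * s.v .R ∧ s'.a .AI (pointOff k As a + i) = i ∧
      s'.a .POS (pointOff k As a + i) = if a < s.v .np then 1 else 0 := by
  obtain ⟨s₀, hs₀⟩ : ∃ s₀, s₀ = ((s.set .N 0).set .base 0).set .A 0 := ⟨_, rfl⟩
  have key := loop_inv (fun j s' => s'.v .N = pointOff k As j ∧ s'.v .base = j * s.v .R ∧
    s'.v .A = j ∧ (∀ e, s'.a .POS e ≤ 1) ∧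
    ∀ (a : ℕ) (A : FinStruct L), a < j → As[a]? = some A → ∀ i < A.size ^ k,
      s'.a .SB (pointOff k As a + i) = a * s.v .R ∧ s'.a .AI (pointOff k As a + i) = i ∧
      s'.a .POS (pointOff k As a + i) = if a < s.v .np then 1 else 0) structPoints .m s₀ ?_ ?_
  · rw [show s₀.v .m = As.length by simp [hs₀, hm]] at key
    have e : run listPoints s = run (loop .m structPoints) s₀ := by rw [hs₀]; rfl
    rw [e]
    exact ⟨key.1, key.2.2.2.1, fun a A hA => key.2.2.2.2 a A (List.getElem?_eq_some_iff.1 hA).1 hA⟩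
  · exact ⟨by simp [hs₀, pointOff], by simp [hs₀], by simp [hs₀], by simp [hs₀, hP], by simp⟩
  · rintro j s' hj hF ⟨h1, h2, h3, h4, h5⟩
    have v1 := hF.v .R (by decide)
    have v2 := hF.v .k (by decide)
    have v3 := hF.v .np (by decide)
    have v4 := hF.v .nk (by decide)
    have v5 := hF.a .PW (by decide)
    simp [hs₀] at v1 v2 v3 v4 v5 hj
    rw [hm] at hj
    have hA : As[j]? = some As[j] := List.getElem?_eq_getElem hj
    obtain ⟨g1, g2, g3, g4, g5, g6⟩ := run_structPoints s' (c := As[j].size ^ k)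
      (by rw [v5, h2, v2, hk]; exact hpw j _ hA) (by rw [v4]; exact hle j _ hA)
    rw [h1] at g1 g4 g5 g6
    refine ⟨by rw [g1, pointOff_succ As hA], by rw [g2, h2, v1, add_mul, one_mul], by rw [g3, h3],
      fun e => ?_, fun a A ha hA' i hi => ?_⟩
    · rw [g6]
      have := h4 e
      simp only
      split_ifs <;> omega
    · rw [g4, g5, g6]
      simp only
      rcases Nat.lt_succ_iff_lt_or_eq.1 ha with hlt | rfl
      · have h6 := pointOff_succ (k := k) As hA'
        have h7 := pointOff_mono (k := k) As (Nat.succ_le_of_lt hlt)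
        simp only [Nat.succ_eq_add_one] at h7
        rw [if_neg (by omega), if_neg (by omega), if_neg (by omega)]
        exact h5 a A hlt hA' i hi
      · rw [hA, Option.some.injEq] at hA'
        subst hA'
        rw [if_pos (by omega), if_pos (by omega), if_pos (by omega), h2, h3, v3]
        exact ⟨rfl, by omega, rfl⟩

end Read

namespace LoopProg

namespace Prog

open Pr (skip set wr branch loop)

/-! ### Reading the grammar -/

section Invariants

variable {S : Type*} {ar : S → ℕ} {n : ℕ}

/-- A place where the next tree has to be put: its parent, or `0` for the root of a right-hand side, the
child position, and the tree. -/
abbrev Slot (ar : S → ℕ) (n : ℕ) := ℕ × ℕ × RTree ar (Fin n)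

/-- Invariant for the map `X` from items to trees; the words from `pos` on have not been read. -/
structure ItemInv (X : ℕ → Option (RTree ar (Fin n))) (pos len : ℕ) : Prop where
  none : ∀ u, pos ≤ u → u < len → X u = none
  nonterminal : ∀ B : Fin n, X (len + B) = some (.leaf B)

/-- Invariant for the inner nodes, their children and the parents. -/
structure NodeInv (code : S → ℕ) (IN ND CH PA : ℕ → ℕ) (R : ℕ) (X : ℕ → Option (RTree ar (Fin n)))
    (pos : ℕ) (stk : List (Slot ar n)) : Prop where
  nd : ∀ p, ND p ≠ 0 → 0 < p ∧ p < pos ∧ ∃ s xs, X p = some (.node s xs) ∧ IN p = code s ∧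
    ∀ j : Fin (ar s), (∃ q ∈ stk, q.1 = p ∧ q.2.1 = j) ∨
      (X (CH (p * R + j)) = some (xs j) ∧ PA (CH (p * R + j)) = p)
  node : ∀ p s xs, X p = some (.node s xs) → ND p ≠ 0
  pa : ∀ u, PA u ≠ 0 → ND (PA u) ≠ 0
  slot : ∀ q ∈ stk, q.1 ≠ 0 → ∃ s xs, X q.1 = some (.node s xs) ∧ ∃ h : q.2.1 < ar s,
    xs ⟨q.2.1, h⟩ = q.2.2

/-- Invariant for the roots of the right-hand sides. -/
structure RuleInv (rules rest : List (Fin n × RTree ar (Fin n))) (CP : ℕ → ℕ)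
    (X : ℕ → Option (RTree ar (Fin n))) (pos len lhs : ℕ) (stk : List (Slot ar n)) : Prop where
  sub : ∀ q ∈ rest, q ∈ rules
  up : ∀ u, CP u ≠ 0 → u < pos ∧ ∃ B r, (B, r) ∈ rules ∧ X u = some r ∧ CP u = len + B
  all : ∀ B r, (B, r) ∈ rules → (∃ u, X u = some r ∧ CP u = len + B) ∨ (B, r) ∈ rest ∨
    ∃ q ∈ stk, q.1 = 0 ∧ q.2.2 = r ∧ lhs = B
  slot : ∀ q ∈ stk, q.1 = 0 → ∃ B : Fin n, lhs = B ∧ (B, q.2.2) ∈ rules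

/-- Invariant for the lists of the occurrences of the nonterminals. -/
structure ListInv (NX : ℕ → ℕ) (X : ℕ → Option (RTree ar (Fin n))) (pos len : ℕ) : Prop where
  next : ∀ u t, X u = some t → NX u ≠ 0 → X (NX u) = some t
  reach : ∀ u B, X u = some (.leaf B) → ∀ Q : ℕ → Prop, Q (len + B) →
    (∀ w, Q w → NX w ≠ 0 → Q (NX w)) → Q u
  fresh : ∀ u, pos ≤ u → u < len → NX u = 0
  lt : ∀ u, NX u < len

variable {code : S → ℕ} {IN ND CH PA CP NX : ℕ → ℕ} {R pos len lhs : ℕ}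
  {X : ℕ → Option (RTree ar (Fin n))} {stk : List (Slot ar n)}
  {rules rest : List (Fin n × RTree ar (Fin n))}

/-- The tree that starts at `pos` becomes an item. -/
theorem ItemInv.step (h : ItemInv X pos len) (hpos : pos < len) (t : RTree ar (Fin n)) :
    ItemInv (Function.update X pos (some t)) (pos + 1) len where
  none u h1 h2 := by rw [Function.update_of_ne (by omega)]; exact h.none u (by omega) h2
  nonterminal B := by rw [Function.update_of_ne (by omega)]; exact h.nonterminal B

theorem ItemInv.update_eq (h : ItemInv X pos len) (hpos : pos < len) {t : RTree ar (Fin n)} {u : ℕ}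
    {t' : RTree ar (Fin n)} (hu : X u = some t') : Function.update X pos (some t) u = some t' := by
  rw [Function.update_of_ne, hu]
  rintro rfl
  rw [h.none u le_rfl hpos] at hu
  exact absurd hu (by simp)

/-- The right-hand side of the next rule gets a slot, with parent `0`. -/
theorem NodeInv.start (h : NodeInv code IN ND CH PA R X pos []) (j : ℕ) (r : RTree ar (Fin n)) :
    NodeInv code IN ND CH PA R X (pos + 1) [(0, j, r)] where
  nd p hp := by
    obtain ⟨h1, h2, s, xs, h3, h4, h5⟩ := h.nd p hp
    exact ⟨h1, by omega, s, xs, h3, h4, fun j => Or.inr ((h5 j).resolve_left (by simp))⟩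
  node := h.node
  pa := h.pa
  slot q hq := by simp at hq; simp [hq]

/-- The tree in the topmost slot is the one that starts at `pos`; its children, if any, get new
slots. -/
theorem NodeInv.pop (h : NodeInv code IN ND CH PA R X pos stk) (hX : ItemInv X pos len)
    (hpos : pos < len) (hpos0 : 0 < pos) {q : Slot ar n} {stk' new : List (Slot ar n)}
    (hstk : stk = q :: stk') (har : ∀ s, ar s ≤ R) {ND' CH' PA' : ℕ → ℕ}
    (hPA : PA' = if q.1 ≠ 0 then Function.update PA pos q.1 else PA)
    (hCH : CH' = if q.1 ≠ 0 then Function.update CH (q.1 * R + q.2.1) pos else CH)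
    (hnode : ∀ s xs, q.2.2 = .node s xs → ND' = Function.update ND pos 1 ∧ IN pos = code s ∧
      new = List.ofFn fun j : Fin (ar s) => (pos, (j : ℕ), xs j))
    (hleaf : ∀ B, q.2.2 = .leaf B → ND' = ND ∧ new = []) :
    NodeInv code IN ND' CH' PA' R (Function.update X pos (some q.2.2)) (pos + 1) (new ++ stk') := by
  have hup := fun (u : ℕ) (t' : RTree ar (Fin n)) (hu : X u = some t') =>
    hX.update_eq hpos (t := q.2.2) hu
  have hXpos := hX.none pos le_rfl hpos
  have hNDpos : ND pos = 0 := by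
    by_contra hne
    exact absurd (h.nd pos hne).2.1 (by omega)
  have hmono : ∀ p, ND p ≠ 0 → ND' p ≠ 0 := by
    intro p hp
    rcases hq : q.2.2 with B | ⟨s, xs⟩
    · rw [(hleaf B hq).1]; exact hp
    · rw [(hnode s xs hq).1, Function.update_apply]
      split_ifs <;> simp_all
  have hnew : ∀ q' ∈ new, ∃ s xs, q.2.2 = .node s xs ∧ ∃ j : Fin (ar s), q' = (pos, (j : ℕ), xs j) := by
    intro q' hq'
    rcases hq : q.2.2 with B | ⟨s, xs⟩
    · rw [(hleaf B hq).2] at hq'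
      simp at hq'
    · rw [(hnode s xs hq).2.2, List.mem_ofFn] at hq'
      obtain ⟨j, rfl⟩ := hq'
      exact ⟨s, xs, rfl, j, rfl⟩
  have hold : ∀ p, ND p ≠ 0 → 0 < p ∧ p < pos + 1 ∧ ∃ s xs,
      Function.update X pos (some q.2.2) p = some (.node s xs) ∧ IN p = code s ∧
      ∀ j : Fin (ar s), (∃ q' ∈ new ++ stk', q'.1 = p ∧ q'.2.1 = j) ∨
      (Function.update X pos (some q.2.2) (CH' (p * R + j)) = some (xs j) ∧ PA' (CH' (p * R + j)) = p) := by
    intro p hp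
    obtain ⟨h1, h2, s, xs, h3, h4, h5⟩ := h.nd p hp
    refine ⟨h1, by omega, s, xs, hup _ _ h3, h4, fun j => ?_⟩
    by_cases hpj : q.1 = p ∧ q.2.1 = j
    · obtain ⟨rfl, hj⟩ := hpj
      right
      have hq0 : q.1 ≠ 0 := h1.ne'
      rw [if_pos hq0] at hPA hCH
      obtain ⟨s', xs', k1, hlt, k2⟩ := h.slot q (by simp [hstk]) hq0
      rw [h3] at k1
      simp only [Option.some.injEq, RTree.node.injEq] at k1
      obtain ⟨rfl, k1⟩ := k1
      obtain rfl := eq_of_heq k1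
      rw [hCH, hj, Function.update_self, Function.update_self, hPA, Function.update_self, ← k2]
      exact ⟨congrArg some (congrArg xs (Fin.ext hj)), rfl⟩
    · rcases h5 j with ⟨q', hq', e1, e2⟩ | ⟨e1, e2⟩
      · left
        rw [hstk, List.mem_cons] at hq'
        rcases hq' with rfl | hq'
        · exact absurd ⟨e1, e2⟩ hpj
        · exact ⟨q', by simp [hq'], e1, e2⟩
      · right
        have hne : CH (p * R + j) ≠ pos := fun he => by
          rw [he, hXpos] at e1; simp at e1
        have hCHp : CH' (p * R + j) = CH (p * R + j) := by
          rw [hCH]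
          split_ifs with hq0
          · rw [Function.update_of_ne]
            intro he
            obtain ⟨s', xs', -, hlt, -⟩ := h.slot q (by simp [hstk]) hq0
            have hj := j.2
            have := har s
            have := har s'
            have := pair_index (V := R) (v := j) (v' := q.2.1) (by omega) (by omega) he
            exact hpj ⟨this.1.symm, this.2.symm⟩
          · rfl
        rw [hCHp]
        refine ⟨hup _ _ e1, ?_⟩
        rw [hPA]
        split_ifs
        · rw [Function.update_of_ne hne, e2]
        · exact e2
  constructor
  · intro p hp
    by_cases hp' : ND p ≠ 0
    · exact hold p hp'
    · rcases hq : q.2.2 with B | ⟨s, xs⟩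
      · rw [(hleaf B hq).1] at hp
        exact absurd hp hp'
      · obtain ⟨k1, k2, k3⟩ := hnode s xs hq
        obtain rfl : p = pos := by
          by_contra hne
          rw [k1, Function.update_of_ne hne] at hp
          exact hp' hp
        refine ⟨hpos0, by omega, s, xs, Function.update_self _ _ _, k2, fun j => Or.inl ?_⟩
        exact ⟨(p, (j : ℕ), xs j), List.mem_append_left _ (by rw [k3]; exact List.mem_ofFn.2 ⟨j, rfl⟩),
          rfl, rfl⟩
  · intro p s xs hp
    by_cases hpp : p = pos
    · subst hpp
      rw [Function.update_self, Option.some.injEq] at hp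
      rw [(hnode s xs hp).1, Function.update_self]
      exact one_ne_zero
    · rw [Function.update_of_ne hpp] at hp
      exact hmono p (h.node p s xs hp)
  · intro u hu
    apply hmono
    rw [hPA] at hu ⊢
    split_ifs at hu ⊢ with hq0
    · by_cases hup : u = pos
      · subst hup
        rw [Function.update_self]
        obtain ⟨s', xs', k1, -⟩ := h.slot q (by simp [hstk]) hq0
        exact h.node _ _ _ k1
      · rw [Function.update_of_ne hup] at hu ⊢
        exact h.pa u hu
    · exact h.pa u hu
  · intro q' hq' h0
    rw [List.mem_append] at hq'
    rcases hq' with hq' | hq'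
    · obtain ⟨s, xs, k1, j, rfl⟩ := hnew q' hq'
      exact ⟨s, xs, by rw [← k1]; exact Function.update_self _ _ _, j.2, rfl⟩
    · obtain ⟨s, xs, k1, k2⟩ := h.slot q' (by simp [hstk, hq']) h0
      exact ⟨s, xs, hup _ _ k1, k2⟩

/-- The next rule is moved from the rules that have not been read to the stack. -/
theorem RuleInv.start {B : Fin n} {r : RTree ar (Fin n)}
    (h : RuleInv rules ((B, r) :: rest) CP X pos len lhs []) (j : ℕ) :
    RuleInv rules rest CP X (pos + 1) len B [(0, j, r)] where
  sub q hq := h.sub q (by simp [hq])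
  up u hu := by
    obtain ⟨h1, h2⟩ := h.up u hu
    exact ⟨by omega, h2⟩
  all B' r' hr := by
    rcases h.all B' r' hr with h1 | h1 | ⟨q, hq, -⟩
    · exact Or.inl h1
    · rw [List.mem_cons] at h1
      rcases h1 with h1 | h1
      · obtain ⟨rfl, rfl⟩ := Prod.mk.inj h1
        exact Or.inr (Or.inr ⟨(0, j, r'), by simp⟩)
      · exact Or.inr (Or.inl h1)
    · simp at hq
  slot q hq _ := by
    simp at hq
    subst hq
    exact ⟨B, rfl, h.sub _ (by simp)⟩

/-- If the topmost slot has no parent, its tree is the root of a right-hand side, and it gets a link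
to the left-hand side. -/
theorem RuleInv.pop (h : RuleInv rules rest CP X pos len lhs stk) (hX : ItemInv X pos len)
    (hpos : pos < len) {q : Slot ar n} {stk' new : List (Slot ar n)} (hstk : stk = q :: stk')
    {CP' : ℕ → ℕ} (hCP : CP' = if q.1 ≠ 0 then CP else Function.update CP pos (len + lhs))
    (hnew : ∀ q' ∈ new, q'.1 ≠ 0) :
    RuleInv rules rest CP' (Function.update X pos (some q.2.2)) (pos + 1) len lhs (new ++ stk') where
  sub := h.sub
  up u hu := by
    have hold : CP u ≠ 0 → u < pos + 1 ∧ ∃ B r, (B, r) ∈ rules ∧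
        Function.update X pos (some q.2.2) u = some r ∧ CP u = len + B := by
      intro hu
      obtain ⟨h1, B, r, h2, h3, h4⟩ := h.up u hu
      exact ⟨by omega, B, r, h2, hX.update_eq hpos h3, h4⟩
    rw [hCP] at hu ⊢
    split_ifs at hu ⊢ with hq0
    · exact hold hu
    · by_cases hup : u = pos
      · subst hup
        obtain ⟨B, h1, h2⟩ := h.slot q (by simp [hstk]) (not_not.1 hq0)
        exact ⟨by omega, B, q.2.2, h2, Function.update_self _ _ _, by rw [Function.update_self, h1]⟩
      · rw [Function.update_of_ne hup] at hu
        have := hold hu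
        rwa [← Function.update_of_ne hup (len + lhs) CP] at this
  all B r hr := by
    rcases h.all B r hr with ⟨u, h1, h2⟩ | h1 | ⟨q', hq', h1, h2, h3⟩
    · refine Or.inl ⟨u, hX.update_eq hpos h1, ?_⟩
      have := h.up u (by omega)
      rw [hCP]
      split_ifs
      · exact h2
      · rw [Function.update_of_ne (by omega), h2]
    · exact Or.inr (Or.inl h1)
    · rw [hstk, List.mem_cons] at hq'
      rcases hq' with rfl | hq'
      · refine Or.inl ⟨pos, by rw [Function.update_self, h2], ?_⟩
        rw [hCP, if_neg (not_not.2 h1), Function.update_self, h3]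
      · exact Or.inr (Or.inr ⟨q', by simp [hq'], h1, h2, h3⟩)
  slot q' hq' h0 := by
    rw [List.mem_append] at hq'
    rcases hq' with hq' | hq'
    · exact absurd h0 (hnew q' hq')
    · exact h.slot q' (by simp [hstk, hq']) h0

theorem ListInv.skip (h : ListInv NX X pos len) : ListInv NX X (pos + 1) len :=
  ⟨h.next, h.reach, fun u h1 h2 => h.fresh u (by omega) h2, h.lt⟩

theorem ListInv.node (h : ListInv NX X pos len) (hX : ItemInv X pos len) (hpos : pos < len) (s : S)
    (xs : Fin (ar s) → RTree ar (Fin n)) :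
    ListInv NX (Function.update X pos (some (.node s xs))) (pos + 1) len where
  next u t hu h0 := by
    by_cases hup : u = pos
    · subst hup
      exact absurd (h.fresh u le_rfl hpos) h0
    · rw [Function.update_of_ne hup] at hu
      exact hX.update_eq hpos (h.next u t hu h0)
  reach u B hu := by
    by_cases hup : u = pos
    · subst hup
      rw [Function.update_self] at hu
      simp at hu
    · rw [Function.update_of_ne hup] at hu
      exact h.reach u B hu
  fresh u h1 h2 := h.fresh u (by omega) h2
  lt := h.lt

/-- An occurrence of the nonterminal `B` is inserted at the front of the list of its occurrences. -/
theorem ListInv.leaf (h : ListInv NX X pos len) (hX : ItemInv X pos len) (hpos : pos < len)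
    (hpos0 : 0 < pos) (B : Fin n) :
    ListInv (Function.update (Function.update NX pos (NX (len + B))) (len + B) pos)
      (Function.update X pos (some (.leaf B))) (pos + 1) len := by
  have e1 : ∀ u, u ≠ pos → u ≠ len + B →
      Function.update (Function.update NX pos (NX (len + B))) (len + B) pos u = NX u := fun u h1 h2 => by
    rw [Function.update_of_ne h2, Function.update_of_ne h1]
  have e2 : Function.update (Function.update NX pos (NX (len + B))) (len + B) pos (len + B) = pos :=
    Function.update_self _ _ _
  have e3 : Function.update (Function.update NX pos (NX (len + B))) (len + B) pos pos =
      NX (len + B) := by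
    rw [Function.update_of_ne (by omega), Function.update_self]
  have hcl : ∀ Q : ℕ → Prop, (∀ w, Q w →
      Function.update (Function.update NX pos (NX (len + B))) (len + B) pos w ≠ 0 →
      Q (Function.update (Function.update NX pos (NX (len + B))) (len + B) pos w)) →
      ∀ w, Q w → NX w ≠ 0 → Q (NX w) := by
    intro Q hQ w hw h0
    by_cases h1 : w = pos
    · subst h1
      exact absurd (h.fresh w le_rfl hpos) h0
    · by_cases h2 : w = len + B
      · subst h2
        have := hQ _ hw (by rw [e2]; omega)
        rw [e2] at this
        have := hQ _ this (by rw [e3]; exact h0)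
        rwa [e3] at this
      · have := hQ _ hw (by rw [e1 w h1 h2]; exact h0)
        rwa [e1 w h1 h2] at this
  constructor
  · intro u t hu h0
    by_cases h1 : u = pos
    · subst h1
      rw [Function.update_self, Option.some.injEq] at hu
      subst hu
      rw [e3] at h0 ⊢
      exact hX.update_eq hpos (h.next _ _ (hX.nonterminal B) h0)
    · rw [Function.update_of_ne h1] at hu
      by_cases h2 : u = len + B
      · subst h2
        rw [hX.nonterminal B] at hu
        rw [e2, Function.update_self, hu]
      · rw [e1 u h1 h2] at h0 ⊢
        exact hX.update_eq hpos (h.next u t hu h0)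
  · intro u B' hu Q h0 hQ
    by_cases h1 : u = pos
    · subst h1
      rw [Function.update_self, Option.some.injEq, RTree.leaf.injEq] at hu
      subst hu
      have := hQ _ h0 (by rw [e2]; omega)
      rwa [e2] at this
    · rw [Function.update_of_ne h1] at hu
      exact h.reach u B' hu Q h0 (hcl Q hQ)
  · intro u h1 h2
    rw [e1 u (by omega) (by omega)]
    exact h.fresh u (by omega) h2
  · intro u
    by_cases h1 : u = pos
    · rw [h1, e3]
      exact h.lt _
    · by_cases h2 : u = len + B
      · rw [h2, e2]
        exact hpos
      · rw [e1 u h1 h2]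
        exact h.lt u

end Invariants

/-- The slots of the children are pushed in reverse order, so that the first child is on top. -/
theorem run_pushLoop (s : PState) (har : s.v .ar ≤ s.v .R) :
    (run (loop .R pushSlot) s).v .sp = s.v .sp + s.v .ar ∧
    (run (loop .R pushSlot) s).a .SKp = (fun i =>
      if s.v .sp ≤ i ∧ i < s.v .sp + s.v .ar then s.v .pos else s.a .SKp i) ∧
    (run (loop .R pushSlot) s).a .SKj = (fun i =>
      if s.v .sp ≤ i ∧ i < s.v .sp + s.v .ar then s.v .ar - 1 - (i - s.v .sp) else s.a .SKj i) := by
  have key := loop_inv (fun i s' => s'.v .ar = s.v .ar - i ∧ s'.v .sp = s.v .sp + min i (s.v .ar) ∧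
    s'.a .SKp = (fun j => if s.v .sp ≤ j ∧ j < s.v .sp + min i (s.v .ar) then s.v .pos
      else s.a .SKp j) ∧
    s'.a .SKj = (fun j => if s.v .sp ≤ j ∧ j < s.v .sp + min i (s.v .ar) then
      s.v .ar - 1 - (j - s.v .sp) else s.a .SKj j)) pushSlot .R s ?_ ?_
  · rw [min_eq_right har] at key
    exact key.2
  · refine ⟨by simp, by simp, ?_, ?_⟩ <;>
    · funext j
      rw [if_neg (by omega)]
  · rintro i s' - hF ⟨h1, h2, h3, h4⟩
    have v1 := hF.v .pos (by decide)
    simp only [pushSlot, run_branch, ev_rv, h1]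
    by_cases hlt : i < s.v .ar
    · have e1 : min (i + 1) (s.v .ar) = i + 1 := by omega
      have e2 : min i (s.v .ar) = i := by omega
      rw [e2] at h2 h3 h4
      rw [if_pos (by omega), e1]
      refine ⟨by simp [h1]; omega, by simp [h2, add_assoc], ?_, ?_⟩ <;>
      · simp only [run_seq, run_set, run_wr, LState.set_a, LState.wr_a, if_true, ev_rv, h1, h2, h3, h4,
          v1, reduceCtorEq, if_false, LState.wr_v, LState.set_v, ev_sub, ev_ofNat]
        funext j
        rw [Function.update_apply]
        by_cases hj : j = s.v .sp + i
        · subst hj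
          simp
          try omega
        · rw [if_neg hj]
          congr 1
          simp only [eq_iff_iff]
          omega
    · have e1 : min (i + 1) (s.v .ar) = s.v .ar := by omega
      have e2 : min i (s.v .ar) = s.v .ar := by omega
      rw [e2] at h2 h3 h4
      rw [if_neg (by omega), e1]
      exact ⟨by rw [run_skip]; omega, by simp [h2], by simp [h3], by simp [h4]⟩

/-- The place of the tree that starts at `pos` is taken from the stack and filled. -/
def placeTree : Prog :=
  set .sp (§.sp - 1);; set .p (rd .SKp (§.sp));; set .j (rd .SKj (§.sp));;
    branch (§.p)
      (wr .PA (§.pos) (§.p);; mul .idx .p .R .R;; wr .CH (§.idx + §.j) (§.pos))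
      (wr .CP (§.pos) (§.len + §.lhs))

theorem run_placeTree (s : PState) :
    (run placeTree s).v .sp = s.v .sp - 1 ∧
    (run placeTree s).a .PA = (if s.a .SKp (s.v .sp - 1) ≠ 0 then
      Function.update (s.a .PA) (s.v .pos) (s.a .SKp (s.v .sp - 1)) else s.a .PA) ∧
    (run placeTree s).a .CH = (if s.a .SKp (s.v .sp - 1) ≠ 0 then
      Function.update (s.a .CH) (s.a .SKp (s.v .sp - 1) * s.v .R + s.a .SKj (s.v .sp - 1)) (s.v .pos)
      else s.a .CH) ∧
    (run placeTree s).a .CP = (if s.a .SKp (s.v .sp - 1) ≠ 0 then s.a .CP else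
      Function.update (s.a .CP) (s.v .pos) (s.v .len + s.v .lhs)) := by
  simp only [placeTree, run_seq, run_branch]
  by_cases h : s.a .SKp (s.v .sp - 1) = 0
  · rw [if_neg (by simp [h])]
    simp [h]
  · rw [if_pos (by simp [h])]
    rw [run_mul _ (by simp) (by decide) (by decide) (by decide) (by decide)
      (by decide) (by decide) (by decide)]
    simp [h]

/-- With a nonempty stack, the word at `pos` is the root of the tree in the topmost slot. -/
theorem run_readWord_pop (s : PState) (h : s.v .sp ≠ 0) : run readWord s =
    run (branch (ltE (§.w) (§.NC)) (wr .ND (§.pos) 1;; set .ar (rd .AR (§.w));; loop .R pushSlot)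
      (set .idx (§.len + (§.w - §.NC));; wr .NX (§.pos) (rd .NX (§.idx));; wr .NX (§.idx) (§.pos)))
      (run placeTree (s.set .w (s.a .IN (s.v .pos)))) := by
  rw [readWord, run_seq, run_branch, if_pos (by simpa using h)]
  rfl

section Read

variable {S : Type*} {ar : S → ℕ} {n : ℕ}

/-- The words of the trees that still have to be read. -/
def restWords (code : S → ℕ) (NC : ℕ) (stk : List (Slot ar n)) (rest : List (Fin n × RTree ar (Fin n))) :
    List ℕ :=
  (stk.flatMap fun q => q.2.2.encode code fun B : Fin n => NC + B) ++
    rest.flatMap fun r => (r.1 : ℕ) :: r.2.encode code fun B : Fin n => NC + B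

/-- Invariant of the main loop of the phase that reads the grammar: the rest of the input is the prefix
notation of the trees in the slots and of the rules that have not been read. -/
structure ReadInv (code : S → ℕ) (rules : List (Fin n × RTree ar (Fin n))) (s : PState)
    (X : ℕ → Option (RTree ar (Fin n))) (stk : List (Slot ar n))
    (rest : List (Fin n × RTree ar (Fin n))) : Prop where
  words : At (s.a .IN) (s.v .pos) (restWords code (s.v .NC) stk rest)
  len_eq : s.v .pos + (restWords code (s.v .NC) stk rest).length = s.v .len
  sp_eq : s.v .sp = stk.length
  slots : ∀ i q, stk[i]? = some q → s.a .SKp (stk.length - 1 - i) = q.1 ∧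
    s.a .SKj (stk.length - 1 - i) = q.2.1
  pos_pos : 0 < s.v .pos
  item : ItemInv X (s.v .pos) (s.v .len)
  node : NodeInv code (s.a .IN) (s.a .ND) (s.a .CH) (s.a .PA) (s.v .R) X (s.v .pos) stk
  rule : RuleInv rules rest (s.a .CP) X (s.v .pos) (s.v .len) (s.v .lhs) stk
  list : ListInv (s.a .NX) X (s.v .pos) (s.v .len)

variable {code : S → ℕ} {rules : List (Fin n × RTree ar (Fin n))} {s : PState}
  {X : ℕ → Option (RTree ar (Fin n))} {stk : List (Slot ar n)}
  {rest : List (Fin n × RTree ar (Fin n))}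

theorem encode_ne_nil {X : Type*} (code : S → ℕ) (f : X → ℕ) (t : RTree ar X) :
    t.encode code f ≠ [] := by
  cases t <;> simp [RTree.encode]

theorem restWords_eq_nil {NC : ℕ} (h : restWords code NC stk rest = []) : stk = [] ∧ rest = [] := by
  rw [restWords, List.append_eq_nil_iff, List.flatMap_eq_nil_iff, List.flatMap_eq_nil_iff] at h
  exact ⟨List.eq_nil_iff_forall_not_mem.2 fun q hq => encode_ne_nil _ _ _ (h.1 q hq),
    List.eq_nil_iff_forall_not_mem.2 fun q hq => by simpa using h.2 q hq⟩

/-- With an empty stack, the word at `pos` is the left-hand side of the next rule. -/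
theorem ReadInv.step_rule {r : Fin n × RTree ar (Fin n)} (h : ReadInv code rules s X [] (r :: rest))
    (hpos : s.v .pos < s.v .len) :
    ReadInv code rules (run (readWord;; set .pos (§.pos + 1)) s) X [(0, s.a .SKj 0, r.2)] rest := by
  have hw := h.words
  have hl := h.len_eq
  have hs : s.v .sp = 0 := by rw [h.sp_eq]; rfl
  simp only [restWords, List.flatMap_nil, List.nil_append, List.flatMap_cons, List.cons_append, At,
    List.length_cons] at hw hl
  have e : run (readWord;; set .pos (§.pos + 1)) s =
      ((((((s.set .w (s.a .IN (s.v .pos))).set .lhs (s.a .IN (s.v .pos))).wr .SKp 0 0).set .sp 1)).set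
        .pos (s.v .pos + 1)) := by
    rw [run_seq, readWord, run_seq, run_branch, if_neg (by simp [hs])]
    simp
  rw [e]
  constructor
  · simpa [restWords] using hw.2
  · simp [restWords]
    simp at hl
    omega
  · simp
  · intro i q hq
    cases i with
    | zero => simp at hq; subst hq; simp
    | succ i => simp at hq
  · simp
  · have := h.item
    simp
    exact ⟨fun u h1 h2 => this.none u (by omega) h2, this.nonterminal⟩
  · simpa using h.node.start _ _
  · have := h.rule.start (s.a .SKj 0)
    simpa [hw.1] using this
  · simpa using h.list.skip

/-- With a nonempty stack, the word at `pos` is a symbol, whose children get slots, or a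
nonterminal. -/
theorem ReadInv.step_pop {q : Slot ar n} (h : ReadInv code rules s X (q :: stk) rest)
    (hpos : s.v .pos < s.v .len) (hcode : ∀ s', code s' < s.v .NC)
    (har : ∀ s', s.a .AR (code s') = ar s') (har' : ∀ s', ar s' ≤ s.v .R) : ∃ X' stk',
    ReadInv code rules (run (readWord;; set .pos (§.pos + 1)) s) X' stk' rest := by
  have hw := h.words
  have hl := h.len_eq
  have hs : s.v .sp = stk.length + 1 := by rw [h.sp_eq]; rfl
  obtain ⟨hk1, hk2⟩ := h.slots 0 q (by simp)
  simp only [List.length_cons, add_tsub_cancel_right, tsub_zero] at hk1 hk2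
  have hslots : ∀ i q', stk[i]? = some q' → stk.length - 1 - i < stk.length ∧
      s.a .SKp (stk.length - 1 - i) = q'.1 ∧ s.a .SKj (stk.length - 1 - i) = q'.2.1 := by
    intro i q' hq'
    have := h.slots (i + 1) q' (by simpa using hq')
    have hi := (List.getElem?_eq_some_iff.1 hq').1
    simp only [List.length_cons] at this
    rw [show stk.length + 1 - 1 - (i + 1) = stk.length - 1 - i by omega] at this
    exact ⟨by omega, this⟩
  rw [run_seq, run_readWord_pop s (by omega)]
  obtain ⟨g1, g2, g3, g4⟩ := run_placeTree (s.set .w (s.a .IN (s.v .pos)))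
  have hF := run_frame placeTree (s.set .w (s.a .IN (s.v .pos)))
  generalize run placeTree (s.set .w (s.a .IN (s.v .pos))) = t at g1 g2 g3 g4 hF
  simp only [LState.set_v, LState.set_a, reduceCtorEq, if_false, hs, add_tsub_cancel_right, hk1,
    hk2] at g1 g2 g3 g4
  have v1 := hF.v .pos (by decide)
  have v2 := hF.v .len (by decide)
  have v3 := hF.v .NC (by decide)
  have v4 := hF.v .R (by decide)
  have v5 := hF.v .lhs (by decide)
  have v6 := hF.v .w (by decide)
  have a1 := hF.a .IN (by decide)
  have a2 := hF.a .AR (by decide)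
  have a3 := hF.a .ND (by decide)
  have a4 := hF.a .NX (by decide)
  have a5 := hF.a .SKp (by decide)
  have a6 := hF.a .SKj (by decide)
  simp only [LState.set_v, LState.set_a, reduceCtorEq, if_false, if_true] at v1 v2 v3 v4 v5 v6 a1 a2 a3 a4 a5 a6
  have hitem := h.item.step hpos q.2.2
  rcases hq : q.2.2 with B | ⟨σ, xs⟩
  · simp only [restWords, List.flatMap_cons, hq, RTree.encode, List.cons_append, List.nil_append, At,
      List.length_cons] at hw hl
    refine ⟨Function.update X (s.v .pos) (some q.2.2), [] ++ stk, ?_⟩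
    have hnode := h.node.pop (new := []) h.item hpos h.pos_pos rfl har' g2 g3 (ND' := s.a .ND) (by simp [hq])
      (by simp)
    have hrule := h.rule.pop (new := []) h.item hpos rfl g4 (by simp)
    have hlist := h.list.leaf h.item hpos h.pos_pos B
    have hne : s.v .len + (B : ℕ) ≠ s.v .pos := by omega
    rw [run_branch, if_neg (by simp [v6, v3, hw.1])]
    have e : run (set .idx (§.len + (§.w - §.NC));; wr .NX (§.pos) (rd .NX (§.idx));;
        wr .NX (§.idx) (§.pos)) t = ((t.set .idx (s.v .len + B)).wr .NX (s.v .pos)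
          (s.a .NX (s.v .len + B))).wr .NX (s.v .len + B) (s.v .pos) := by
      simp [v2, v6, v3, hw.1, v1, a4]
    rw [e]
    constructor
    · simpa [restWords, a1, v1, v3] using hw.2
    · simp [restWords, v1, v2, v3]
      simp at hl
      omega
    · simp [g1]
    · intro i q' hq'
      simpa [a5, a6] using (hslots i q' hq').2
    · simp
    · simpa [v1, v2] using hitem
    · simpa [v1, v4, a1, a3] using hnode
    · simpa [v1, v2, v5] using hrule
    · simpa [v1, v2, a4, hq] using hlist
  · simp only [restWords, List.flatMap_cons, hq, RTree.encode, List.cons_append, At,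
      List.length_cons] at hw hl
    set new : List (Slot ar n) := List.ofFn fun j : Fin (ar σ) => (s.v .pos, (j : ℕ), xs j) with hnew
    refine ⟨Function.update X (s.v .pos) (some q.2.2), new ++ stk, ?_⟩
    have hnewlen : new.length = ar σ := by simp [hnew]
    have hnode := h.node.pop (new := new) (ND' := Function.update (s.a .ND) (s.v .pos) 1) h.item hpos
      h.pos_pos rfl har' g2 g3 (by
        intro s' xs' he
        rw [hq, RTree.node.injEq] at he
        obtain ⟨rfl, he⟩ := he
        obtain rfl := eq_of_heq he
        exact ⟨rfl, hw.1, rfl⟩) (by simp [hq])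
    have hrule := h.rule.pop (new := new) h.item hpos rfl g4 (by
      intro q' hq'
      rw [hnew, List.mem_ofFn] at hq'
      obtain ⟨j, rfl⟩ := hq'
      exact h.pos_pos.ne')
    have hlist := h.list.node h.item hpos σ xs
    have hwords : (new.flatMap fun q => q.2.2.encode code fun B : Fin n => s.v .NC + B) =
        (List.ofFn fun i => (xs i).encode code fun B : Fin n => s.v .NC + B).flatten := by
      rw [hnew, List.flatMap_def, List.map_ofFn]
      rfl
    rw [run_branch, if_pos (by simp [v6, v3, hw.1, hcode]), run_seq, run_seq]
    obtain ⟨p1, p2, p3⟩ := run_pushLoop ((t.wr .ND (s.v .pos) 1).set .ar (ar σ)) (by simp [v4, har'])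
    have hF' := run_frame (loop .R pushSlot) ((t.wr .ND (s.v .pos) 1).set .ar (ar σ))
    have e : run (set .ar (rd .AR (§.w))) (run (wr .ND (§.pos) 1) t) =
        (t.wr .ND (s.v .pos) 1).set .ar (ar σ) := by
      simp [v1, a2, v6, hw.1, har]
    rw [e]
    generalize run (loop .R pushSlot) ((t.wr .ND (s.v .pos) 1).set .ar (ar σ)) = t' at p1 p2 p3 hF'
    simp [g1, v1, a5, a6] at p1 p2 p3
    have v1' := hF'.v .pos (by decide)
    have v2' := hF'.v .len (by decide)
    have v3' := hF'.v .NC (by decide)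
    have v4' := hF'.v .R (by decide)
    have v5' := hF'.v .lhs (by decide)
    have a1' := hF'.a .IN (by decide)
    have a3' := hF'.a .ND (by decide)
    have a4' := hF'.a .NX (by decide)
    have a7' := hF'.a .PA (by decide)
    have a8' := hF'.a .CH (by decide)
    have a9' := hF'.a .CP (by decide)
    simp [v1, v2, v3, v4, v5, a1, a3, a4] at v1' v2' v3' v4' v5' a1' a3' a4' a7' a8' a9'
    constructor
    · simpa [restWords, a1', v1', v3', hwords] using hw.2
    · simp only [run_set, restWords, v1', v2', v3', hwords, LState.set_v, LState.set_a, reduceCtorEq,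
        if_false, if_true, List.flatMap_append, ev_add, ev_rv, ev_ofNat]
      simp only [List.append_assoc] at hl ⊢
      omega
    · simp [p1, hnewlen, add_comm]
    · intro i q' hq'
      simp only [run_set, LState.set_a, p2, p3, List.length_append, hnewlen]
      by_cases hi : i < ar σ
      · rw [List.getElem?_append_left (by omega), hnew, List.getElem?_ofFn, dif_pos hi,
          Option.some.injEq] at hq'
        subst hq'
        rw [if_pos (by omega), if_pos (by omega)]
        exact ⟨rfl, by simp only; omega⟩
      · rw [List.getElem?_append_right (by omega), hnewlen] at hq'
        have := hslots _ _ hq'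
        rw [if_neg (by omega), if_neg (by omega),
          show ar σ + stk.length - 1 - i = stk.length - 1 - (i - ar σ) by omega]
        exact this.2
    · simp
    · simpa [v1', v2'] using hitem
    · simpa [v1', v4', a1', a3', a7', a8'] using hnode
    · simpa [v1', v2', v5', a9'] using hrule
    · simpa [v1', v2', a4', hq] using hlist

end Read

end Prog

end LoopProg

section Read

variable {L : FirstOrder.Language.{u, v}} [Finite L.Symbols] {k : ℕ}

open LoopProg LoopProg.Prog
open Pr (skip set wr branch loop)

theorem FOSym.code_lt (s : FOSym L k) : s.code < 4 + 3 * k + Nat.card L.Symbols := by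
  cases s with
  | fn f => simp only [FOSym.code]; have := (Finite.equivFin L.Symbols (.inl ⟨_, f⟩)).2; omega
  | rel f => simp only [FOSym.code]; have := (Finite.equivFin L.Symbols (.inr ⟨_, f⟩)).2; omega
  | _ => simp only [FOSym.code]; omega

/-- The numerical relations that concern the grammar. -/
structure LinkOK (g : PState) : Prop where
  nd : ∀ p, g.a .ND p ≠ 0 → 0 < p ∧ p < g.v .len
  ch : ∀ p, g.a .ND p ≠ 0 → ∀ j < g.a .AR (g.a .IN p), g.a .PA (g.a .CH (p * g.v .R + j)) = p
  pa : ∀ u, g.a .PA u ≠ 0 → g.a .ND (g.a .PA u) ≠ 0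
  cp_lt : ∀ u, g.a .CP u < g.v .len + g.v .len
  nx_lt : ∀ u, g.a .NX u < g.v .len + g.v .len

/-- When the whole input has been read, no slots and no rules are left, and the invariants of the
main loop say that the arrays describe the grammar. -/
theorem run_readGrammar (G : FOGrammar L k) {s : PState} (hc : ConstOK L k s)
    (hpos : 0 < s.v .pos) (hat : At (s.a .IN) (s.v .pos) (FOGrammar.encode G))
    (hlen : s.v .pos + (FOGrammar.encode G).length = s.v .len)
    (h0 : ∀ b ∈ [Arr.CP, .PA, .ND, .NX], ∀ i, s.a b i = 0) :
    LinkOK (run readGrammar s) ∧ ∃ X, GramOK G X (run readGrammar s) := by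
  have hn : G.numNT + 3 ≤ (FOGrammar.encode G).length := by simp [FOGrammar.encode]
  have hat' := hat
  rw [FOGrammar.encode, at_append, at_append] at hat'
  obtain ⟨⟨hat1, hat2⟩, hat3⟩ := hat'
  simp only [List.length_append, List.length_replicate, List.length_cons, List.length_nil, At,
    and_true] at hat1 hat2 hat3
  obtain ⟨s₀, hs₀⟩ : ∃ s₀, s₀ = ((((s.set .nn G.numNT).set .pos (s.v .pos + G.numNT + 1)).set .st
    (s.v .len + G.start)).set .pos (s.v .pos + G.numNT + 1 + 2)).set .sp 0 := ⟨_, rfl⟩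
  have e : run readGrammar s = run (loop .len wordStep) s₀ := by
    rw [readGrammar, run_seq, run_unary s G.numNT (by omega)
      (fun i hi => hat1.getElem (by simp [hi])) (by simp [hat2.1]) (by decide) (by decide), hs₀]
    simp only [run_seq, run_set]
    congr 1
    simp [hat2.2.1]
  rw [e]
  have hinit : ReadInv FOSym.code G.rules s₀ (fun u => if h : s.v .len ≤ u ∧ u - s.v .len < G.numNT then
      some (.leaf ⟨_, h.2⟩) else none) [] G.rules := by
    have hw : restWords FOSym.code (s.v .NC) [] G.rules = G.rules.flatMap fun r => (r.1 : ℕ) ::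
        r.2.encode FOSym.code fun B : Fin G.numNT => 4 + 3 * k + Nat.card L.Symbols + (B : ℕ) := by
      simp [restWords, hc.NC_eq]
    have hX : ∀ u s' xs, (if h : s.v .len ≤ u ∧ u - s.v .len < G.numNT then
      some (RTree.leaf (ar := FOSym.arity (L := L) (k := k)) (⟨u - s.v .len, h.2⟩ : Fin G.numNT)) else none) =
        some (.node s' xs) → False := by
      intro u s' xs
      split_ifs <;> simp
    have z1 : s₀.a .CP = fun _ => 0 := by funext i; simpa [hs₀] using h0 .CP (by simp) i
    have z2 : s₀.a .PA = fun _ => 0 := by funext i; simpa [hs₀] using h0 .PA (by simp) i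
    have z3 : s₀.a .ND = fun _ => 0 := by funext i; simpa [hs₀] using h0 .ND (by simp) i
    have z4 : s₀.a .NX = fun _ => 0 := by funext i; simpa [hs₀] using h0 .NX (by simp) i
    have l0 : s₀.v .len = s.v .len := by simp [hs₀]
    constructor
    · simp only [hs₀, LState.set_v, LState.set_a, reduceCtorEq, if_false, if_true, hw]
      rw [show s.v .pos + G.numNT + 1 + 2 = s.v .pos + (G.numNT + 3) by omega]
      exact hat3
    · simp only [hs₀, LState.set_v, LState.set_a, reduceCtorEq, if_false, if_true, hw]
      rw [← hlen, FOGrammar.encode]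
      simp only [List.length_append, List.length_replicate, List.length_cons, List.length_nil]
      omega
    · simp [hs₀]
    · simp
    · simp [hs₀]
    · rw [l0]
      exact ⟨fun u h1 h2 => dif_neg (by omega), fun B => by rw [dif_pos (by simp)]; simp⟩
    · rw [z2, z3]
      exact ⟨by simp, fun p s' xs h => (hX _ _ _ h).elim, by simp, by simp⟩
    · rw [z1]
      exact ⟨by simp, by simp, fun B r h => .inr (.inl h), by simp⟩
    · rw [z4, l0]
      refine ⟨by simp, fun u B hu Q hQ _ => ?_, by simp, by simp; omega⟩
      split_ifs at hu with h
      simp only [Option.some.injEq, RTree.leaf.injEq] at hu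
      subst hu
      simp only at hQ
      rwa [show s.v .len + (u - s.v .len) = u by omega] at hQ
  have key := loop_inv (fun i s' => s'.v .pos = min (s₀.v .pos + i) (s.v .len) ∧
    ∃ X stk rest, ReadInv FOSym.code G.rules s' X stk rest) wordStep .len s₀ ?_ ?_
  · obtain ⟨k1, X, stk, rest, hR⟩ := key
    have hF := run_frame (loop .len wordStep) s₀
    generalize run (loop .len wordStep) s₀ = s' at k1 hR hF
    have v1 := hF.v .len (by decide)
    have v2 := hF.v .R (by decide)
    have v3 := hF.v .st (by decide)
    have a1 := hF.a .AR (by decide)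
    simp [hs₀] at v1 v2 v3 a1
    have hp : s'.v .pos = s.v .len := by
      rw [k1]
      simp [hs₀]
    have hnil := hR.len_eq
    rw [hp, v1, Nat.add_eq_left, List.length_eq_zero_iff] at hnil
    obtain ⟨rfl, rfl⟩ := restWords_eq_nil hnil
    constructor
    · constructor
      · intro p h
        obtain ⟨h1, h2, -⟩ := hR.node.nd p h
        exact ⟨h1, by omega⟩
      · intro p h j hj
        obtain ⟨-, -, σ, xs, -, h4, h5⟩ := hR.node.nd p h
        rw [h4, a1, hc.sym.ar] at hj
        exact ((h5 ⟨j, hj⟩).resolve_left (by simp)).2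
      · exact hR.node.pa
      · intro u
        by_cases h : s'.a .CP u = 0
        · omega
        · obtain ⟨-, B, -, -, -, h4⟩ := hR.rule.up u h
          have := B.2
          omega
      · intro u
        have := hR.list.lt u
        omega
    · refine ⟨X, ?_⟩
      constructor
      · exact hR.node.node
      · intro p h
        obtain ⟨-, -, σ, xs, h3, h4, h5⟩ := hR.node.nd p h
        exact ⟨σ, xs, h3, h4, fun j => ((h5 j).resolve_left (by simp)).1⟩
      · exact hR.list.next
      · intro u r hu h
        obtain ⟨-, B, r', h2, h3, h4⟩ := hR.rule.up u h
        rw [hu, Option.some.injEq] at h3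
        subst h3
        exact ⟨B, h2, by rw [h4]; exact hR.item.nonterminal B⟩
      · exact hR.list.reach
      · intro B r h
        rcases hR.rule.all B r h with h1 | h1 | ⟨q, hq, -⟩
        · exact h1
        · simp at h1
        · simp at hq
      · omega
      · rw [v3, v1]
      · exact hR.item.nonterminal
  · exact ⟨by simp [hs₀]; omega, _, _, _, hinit⟩
  · rintro i s' hi hF ⟨h1, X, stk, rest, hR⟩
    have v1 := hF.v .len (by decide)
    have v2 := hF.v .R (by decide)
    have v3 := hF.v .NC (by decide)
    have a1 := hF.a .AR (by decide)
    simp [hs₀] at v1 v2 v3 a1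
    rw [wordStep, run_branch]
    by_cases hp : s'.v .pos < s'.v .len
    · rw [if_pos (by simp [hp])]
      refine ⟨?_, ?_⟩
      · have := run_v readWord s' (x := .pos) (by decide)
        rw [run_seq, run_set]
        simp [this]
        omega
      · cases stk with
        | nil =>
          cases rest with
          | nil =>
            have := hR.len_eq
            simp [restWords] at this
            omega
          | cons r rest => exact ⟨_, _, _, hR.step_rule hp⟩
        | cons q stk =>
          obtain ⟨X', stk', h⟩ := hR.step_pop hp (fun σ => by rw [v3, hc.NC_eq]; exact σ.code_lt)
            (fun σ => by rw [a1, hc.sym.ar])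
            (fun σ => by rw [v2, ← hc.sym.ar σ]; exact (hc.ar_lt _).le)
          exact ⟨X', stk', rest, h⟩
    · rw [if_neg (by simp [hp]), run_skip]
      exact ⟨by omega, X, stk, rest, hR⟩

end Read

namespace LoopProg

namespace Prog

open Pr (skip set wr branch loop)

/-! ### The constants of the program -/

/-- Writes `f 0, …, f (n - 1)` to an array. -/
def writeTable (a : Arr) (f : ℕ → ℕ) : ℕ → Prog
  | 0 => skip
  | n + 1 => writeTable a f n;; wr a (.c n) (.c (f n))

theorem run_writeTable (a : Arr) (f : ℕ → ℕ) (n : ℕ) (s : PState) :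
    (run (writeTable a f n) s).v = s.v ∧ ∀ b, (run (writeTable a f n) s).a b =
      if b = a then fun i => if i < n then f i else s.a a i else s.a b := by
  induction n with
  | zero =>
    refine ⟨rfl, fun b => ?_⟩
    split_ifs with h
    · subst h; rfl
    · rfl
  | succ n ih =>
    rw [writeTable, run_seq, run_wr]
    refine ⟨ih.1, fun b => ?_⟩
    rw [LState.wr_a]
    split_ifs with h
    · subst h
      rw [ih.2, if_pos rfl]
      funext i
      simp only [Function.update_apply, Ex.ev]
      split_ifs <;> first | rfl | omega | (subst_vars; rfl)
    · rw [ih.2, if_neg h]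

theorem lv_writeTable (a : Arr) (f : ℕ → ℕ) (n : ℕ) : (writeTable a f n).lv = [] := by
  induction n with
  | zero => rfl
  | succ n ih => simp [writeTable, Pr.lv, ih]

theorem oneBig_writeTable (big : List Var) (a : Arr) (f : ℕ → ℕ) (n : ℕ) :
    (writeTable a f n).oneBig big = true := by
  induction n with
  | zero => rfl
  | succ n ih => simp [writeTable, Pr.oneBig, ih]

/-- All phases after the constants have been written. -/
def phases : Prog :=
  readHeader;; readStructs;; computeNK;; listPoints;; computeBE;; computeV;; computeVR;; computeMV;;
    readGrammar;; combineAll;; saturate;; answer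

end Prog

end LoopProg

section Prelude

variable (L : FirstOrder.Language.{u, v}) [Finite L.Symbols] (k : ℕ)

open LoopProg LoopProg.Prog
open Pr (skip set wr branch loop)

theorem FOSym.code_injective : Function.Injective (FOSym.code (L := L) (k := k)) := by
  have h1 := fun sy : L.Symbols => (Finite.equivFin L.Symbols sy).2
  have h2 := fun sy sy' : L.Symbols => (Fin.ext_iff (a := Finite.equivFin L.Symbols sy)
    (b := Finite.equivFin L.Symbols sy')).symm.trans (Finite.equivFin L.Symbols).apply_eq_iff_eq
  intro s t h
  cases s <;> cases t <;> simp only [FOSym.code] at h <;>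
    first
    | rfl
    | omega
    | (congr 1; omega)
    | (rw [Nat.add_left_cancel_iff, h2] at h
       simp only [Sum.inl.injEq, Sum.inr.injEq, Sigma.mk.injEq, reduceCtorEq] at h
       obtain ⟨rfl, h⟩ := h
       obtain rfl := eq_of_heq h
       rfl)
    | (rw [Nat.add_left_cancel_iff, h2] at h
       simp at h)

/-- A strict bound for the number of symbols of the signature, their arities, and `k`. It is at least
`4`, and thus larger than the arities of the other symbols of the ranked alphabet. -/
noncomputable def radix : ℕ :=
  4 + k + Nat.card L.Symbols +
    ∑ j, L.symArity ((Finite.equivFin L.Symbols).symm j)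

open Classical in
/-- The table of a function on the symbols of the alphabet. -/
noncomputable def symTable (f : FOSym L k → ℕ) (c : ℕ) : ℕ :=
  if h : ∃ s : FOSym L k, s.code = c then f h.choose else 0

theorem symTable_code (f : FOSym L k → ℕ) (s : FOSym L k) : symTable L k f s.code = f s := by
  have h : ∃ s' : FOSym L k, s'.code = s.code := ⟨s, rfl⟩
  rw [symTable, dif_pos h, FOSym.code_injective L k h.choose_spec]

theorem symTable_le (f : FOSym L k → ℕ) {B : ℕ} (h : ∀ s, f s ≤ B) (c : ℕ) : symTable L k f c ≤ B := by
  rw [symTable]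
  split_ifs
  · exact h _
  · exact Nat.zero_le _

theorem symArity_lt (sy : L.Symbols) : L.symArity sy < radix L k := by
  have := Finset.single_le_sum (f := fun j => L.symArity ((Finite.equivFin L.Symbols).symm j))
    (fun _ _ => Nat.zero_le _) (Finset.mem_univ (Finite.equivFin L.Symbols sy))
  rw [Equiv.symm_apply_apply] at this
  rw [radix]
  omega

theorem FOSym.arity_lt (s : FOSym L k) : s.arity < radix L k := by
  cases s with
  | rel R => exact symArity_lt L k (.inr ⟨_, R⟩)
  | fn F => exact symArity_lt L k (.inl ⟨_, F⟩)
  | _ => simp only [FOSym.arity, radix]; omega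

theorem FOSym.opArg_lt (s : FOSym L k) : s.opArg < radix L k := by
  cases s with
  | rel R => have := (Finite.equivFin L.Symbols (.inr ⟨_, R⟩)).2; simp only [FOSym.opArg, radix]; omega
  | fn F => have := (Finite.equivFin L.Symbols (.inl ⟨_, F⟩)).2; simp only [FOSym.opArg, radix]; omega
  | _ => simp only [FOSym.opArg, radix]; omega

theorem FOSym.opNum_le (s : FOSym L k) : s.opNum ≤ 7 := by
  cases s <;> simp [FOSym.opNum]

/-- Writes the constants that depend on the signature and on `k`. -/
noncomputable def prelude : Prog :=
  set .k (.c k);; set .J (.c (Nat.card L.Symbols));; set .R (.c (radix L k));;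
  set .NC (.c (4 + 3 * k + Nat.card L.Symbols));; set .CB (.c (4 + 3 * k));;
  writeTable .AR (symTable L k FOSym.arity) (4 + 3 * k + Nat.card L.Symbols);;
  writeTable .OP (symTable L k FOSym.opNum) (4 + 3 * k + Nat.card L.Symbols);;
  writeTable .OA (symTable L k FOSym.opArg) (4 + 3 * k + Nat.card L.Symbols);;
  writeTable .K0 (symTable L k fun s => (s.kid 0).code) (4 + 3 * k + Nat.card L.Symbols);;
  writeTable .K1 (symTable L k fun s => (s.kid 1).code) (4 + 3 * k + Nat.card L.Symbols);;
  writeTable .RK (symTable L k fun s => s.kind.code) (4 + 3 * k + Nat.card L.Symbols)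

theorem run_prelude_v (input : List ℕ) (x : Var) :
    (run (prelude L k) (initState Arr.IN Var.len input)).v x = match x with
      | .k => k
      | .J => Nat.card L.Symbols
      | .R => radix L k
      | .NC => 4 + 3 * k + Nat.card L.Symbols
      | .CB => 4 + 3 * k
      | .len => input.length
      | _ => 0 := by
  have hv : (run (prelude L k) (initState Arr.IN Var.len input)).v =
      ((((((initState Arr.IN Var.len input).set .k k).set .J (Nat.card L.Symbols)).set .R
      (radix L k)).set .NC (4 + 3 * k + Nat.card L.Symbols)).set .CB (4 + 3 * k)).v := by
    simp only [prelude, run_seq, (run_writeTable _ _ _ _).1]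
    rfl
  rw [hv]
  cases x <;> rfl

theorem run_prelude_a (input : List ℕ) (b : Arr) :
    (run (prelude L k) (initState Arr.IN Var.len input)).a b = match b with
      | .AR => fun i => if i < 4 + 3 * k + Nat.card L.Symbols then symTable L k FOSym.arity i else 0
      | .OP => fun i => if i < 4 + 3 * k + Nat.card L.Symbols then symTable L k FOSym.opNum i else 0
      | .OA => fun i => if i < 4 + 3 * k + Nat.card L.Symbols then symTable L k FOSym.opArg i else 0
      | .K0 => fun i => if i < 4 + 3 * k + Nat.card L.Symbols then
          symTable L k (fun s => (s.kid 0).code) i else 0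
      | .K1 => fun i => if i < 4 + 3 * k + Nat.card L.Symbols then
          symTable L k (fun s => (s.kid 1).code) i else 0
      | .RK => fun i => if i < 4 + 3 * k + Nat.card L.Symbols then
          symTable L k (fun s => s.kind.code) i else 0
      | .IN => fun i => input.getD i 0
      | _ => fun _ => 0 := by
  simp only [prelude, run_seq, (run_writeTable _ _ _ _).2]
  cases b <;> rfl

theorem constOK_prelude (input : List ℕ) :
    ConstOK L k (run (prelude L k) (initState Arr.IN Var.len input)) := by
  have hv := run_prelude_v L k input
  have ha := run_prelude_a L k input
  generalize run (prelude L k) (initState Arr.IN Var.len input) = s at hv ha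
  have hlt : ∀ σ : FOSym L k, σ.code < 4 + 3 * k + Nat.card L.Symbols := FOSym.code_lt
  have hr : 0 < radix L k := by rw [radix]; omega
  have hsym : ∀ (f : FOSym L k → ℕ) (σ : FOSym L k), (if σ.code < 4 + 3 * k + Nat.card L.Symbols then
      symTable L k f σ.code else 0) = f σ := fun f σ => by rw [if_pos (hlt σ), symTable_code]
  have hle : ∀ (f : FOSym L k → ℕ) (B : ℕ), (∀ σ, f σ ≤ B) → ∀ c,
      (if c < 4 + 3 * k + Nat.card L.Symbols then symTable L k f c else 0) ≤ B := fun f B h c => by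
    have := symTable_le L k f h c
    split_ifs <;> omega
  refine ⟨hv .k, hv .J, hv .NC, hv .CB, ?_, ?_, ?_, fun c => ?_, fun c => ?_, fun c => ?_,
    ⟨fun σ => ?_, fun σ => ?_, fun σ => ?_, fun σ => ?_, fun σ => ?_, fun σ => ?_⟩⟩
  · rw [hv .R]; simp only [radix]; omega
  · rw [hv .R]; simp only [radix]; omega
  · rw [hv .R]; simp only [radix]; omega
  · have := hle FOSym.arity _ (fun σ => Nat.le_sub_one_of_lt (FOSym.arity_lt L k σ)) c
    rw [hv .R, ha .AR]
    exact lt_of_le_of_lt this (Nat.sub_one_lt hr.ne')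
  · rw [ha .OP]
    exact hle FOSym.opNum _ (FOSym.opNum_le L k) c
  · have := hle FOSym.opArg _ (fun σ => Nat.le_sub_one_of_lt (FOSym.opArg_lt L k σ)) c
    rw [hv .R, ha .OA]
    exact lt_of_le_of_lt this (Nat.sub_one_lt hr.ne')
  · rw [ha .AR]; exact hsym _ σ
  · rw [ha .OP]; exact hsym _ σ
  · rw [ha .OA]; exact hsym _ σ
  · rw [ha .K0]; exact hsym _ σ
  · rw [ha .K1]; exact hsym _ σ
  · rw [ha .RK]; exact hsym _ σ

end Prelude

namespace LoopProg

namespace Prog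

/-- All phases that read the input and prepare the saturation. -/
def readPhases : Prog :=
  readHeader;; readStructs;; computeNK;; listPoints;; computeBE;; computeV;; computeVR;; computeMV;;
    readGrammar

end Prog

end LoopProg

/-! ### The state after the input has been read -/

section Prepare

variable {L : FirstOrder.Language.{u, v}} [Finite L.Symbols] {k : ℕ}

open LoopProg LoopProg.Prog
open Pr (skip set wr branch loop)

theorem at_getD (l : List ℕ) : At (fun i => l.getD i 0) 0 l :=
  at_of_getElem fun i v h => by simp [List.getD_eq_getElem?_getD, h]

theorem SepInstance.encode_eq (I : SepInstance L k) : I.encode = [I.pos.length, I.neg.length] ++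
    ((I.pos ++ I.neg).flatMap FinStruct.encode ++ FOGrammar.encode I.grammar) := by
  simp [SepInstance.encode]

theorem FinStruct.size_le_length (A : FinStruct L) : A.size ≤ A.encode.length := by
  rw [FinStruct.encode_eq]
  simp

theorem size_le_length_flatMap {As : List (FinStruct L)} {A : FinStruct L} (h : A ∈ As) :
    A.size ≤ (As.flatMap FinStruct.encode).length := by
  obtain ⟨l, l', rfl⟩ := List.append_of_mem h
  have := A.size_le_length
  simp only [List.flatMap_append, List.flatMap_cons, List.length_append]
  omega

/-- The values of the variables that bound the loops, when the saturation begins. -/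
structure BoundVals (I : SepInstance L k) (s : PState) : Prop where
  m : s.v .m = I.numStructs
  n : s.v .n = I.maxSize
  nk : s.v .nk = I.maxSize ^ k
  N : s.v .N = pointOff k (I.pos ++ I.neg) (I.pos ++ I.neg).length
  b : s.v .b = s.v .n + 2
  E : s.v .E = s.v .N + k + 1
  V : s.v .V = s.v .b ^ s.v .E
  VR : s.v .VR = s.v .V ^ s.v .R
  MV : s.v .MV = (s.v .len + s.v .len) * s.v .V

/-- After the first phases everything that the saturation relies on holds. -/
theorem run_readPhases (I : SepInstance L k) {s : PState} (hc : ConstOK L k s)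
    (hlen : s.v .len = I.encode.length) (hIN : s.a .IN = fun i => I.encode.getD i 0)
    (h0 : ∀ b ∈ [Arr.CP, .PA, .ND, .NX, .POS, .D, .MK], ∀ i, s.a b i = 0) {s' : PState}
    (hs' : s' = run readPhases s) :
    GOK s' ∧ StructOK (I.pos ++ I.neg) k s' ∧ ConstOK L k s' ∧ (∃ X, GramOK I.grammar X s') ∧
    (∀ (a : ℕ) (A : FinStruct L), (I.pos ++ I.neg)[a]? = some A → ∀ i < A.size ^ k,
      s'.a .POS (pointOff k (I.pos ++ I.neg) a + i) = if a < I.pos.length then 1 else 0) ∧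
    (∀ e, s'.a .POS e ≤ 1) ∧ (∀ i, s'.a .D i = 0) ∧ (∀ i, s'.a .MK i = 0) ∧ BoundVals I s' := by
  have hat := at_getD I.encode
  rw [← hIN, I.encode_eq, at_append, at_append] at hat
  rw [I.encode_eq, List.length_append, List.length_append] at hlen
  obtain ⟨hat1, hat2, hat3⟩ := hat
  simp only [List.length_cons, List.length_nil, At, and_true] at hat1 hat2 hat3 hlen
  obtain ⟨a1, e1⟩ : ∃ a, a = run readHeader s := ⟨_, rfl⟩
  obtain ⟨a2, e2⟩ : ∃ a, a = run readStructs a1 := ⟨_, rfl⟩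
  obtain ⟨a3, e3⟩ : ∃ a, a = run computeNK a2 := ⟨_, rfl⟩
  obtain ⟨a4, e4⟩ : ∃ a, a = run listPoints a3 := ⟨_, rfl⟩
  obtain ⟨a5, e5⟩ : ∃ a, a = run computeBE a4 := ⟨_, rfl⟩
  obtain ⟨a6, e6⟩ : ∃ a, a = run computeV a5 := ⟨_, rfl⟩
  obtain ⟨a7, e7⟩ : ∃ a, a = run computeVR a6 := ⟨_, rfl⟩
  obtain ⟨a8, e8⟩ : ∃ a, a = run computeMV a7 := ⟨_, rfl⟩
  have e9 : s' = run readGrammar a8 := by rw [hs', e8, e7, e6, e5, e4, e3, e2, e1]; rfl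
  -- frames that end in the final state
  have f8 : Frame readGrammar a8 s' := e9 ▸ run_frame _ _
  have f7 : Frame (computeMV;; readGrammar) a7 s' := by
    rw [e9, e8]; exact run_frame (computeMV;; readGrammar) a7
  have f6 : Frame (computeVR;; computeMV;; readGrammar) a6 s' := by
    rw [e9, e8, e7]; exact run_frame (computeVR;; computeMV;; readGrammar) a6
  have f5 : Frame (computeV;; computeVR;; computeMV;; readGrammar) a5 s' := by
    rw [e9, e8, e7, e6]; exact run_frame (computeV;; computeVR;; computeMV;; readGrammar) a5
  have f4 : Frame (computeBE;; computeV;; computeVR;; computeMV;; readGrammar) a4 s' := by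
    rw [e9, e8, e7, e6, e5]
    exact run_frame (computeBE;; computeV;; computeVR;; computeMV;; readGrammar) a4
  have f2 : Frame (computeNK;; listPoints;; computeBE;; computeV;; computeVR;; computeMV;; readGrammar)
      a2 s' := by
    rw [e9, e8, e7, e6, e5, e4, e3]
    exact run_frame
      (computeNK;; listPoints;; computeBE;; computeV;; computeVR;; computeMV;; readGrammar) a2
  have f1 : Frame (readStructs;; computeNK;; listPoints;; computeBE;; computeV;; computeVR;;
      computeMV;; readGrammar) a1 s' := by
    rw [e9, e8, e7, e6, e5, e4, e3, e2]
    exact run_frame (readStructs;; computeNK;; listPoints;; computeBE;; computeV;; computeVR;;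
      computeMV;; readGrammar) a1
  have f0 : Frame readPhases s s' := hs' ▸ run_frame _ _
  -- frames that begin in the initial state
  have g1 : Frame readHeader s a1 := e1 ▸ run_frame _ _
  have g3 : Frame (readHeader;; readStructs;; computeNK) s a3 := by
    rw [e3, e2, e1]; exact run_frame (readHeader;; readStructs;; computeNK) s
  have g8 : Frame (readHeader;; readStructs;; computeNK;; listPoints;; computeBE;; computeV;;
      computeVR;; computeMV) s a8 := by
    rw [e8, e7, e6, e5, e4, e3, e2, e1]
    exact run_frame (readHeader;; readStructs;; computeNK;; listPoints;; computeBE;; computeV;;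
      computeVR;; computeMV) s
  have g23 : Frame computeNK a2 a3 := e3 ▸ run_frame _ _
  have g28 : Frame (computeNK;; listPoints;; computeBE;; computeV;; computeVR;; computeMV) a2 a8 := by
    rw [e8, e7, e6, e5, e4, e3]
    exact run_frame (computeNK;; listPoints;; computeBE;; computeV;; computeVR;; computeMV) a2
  -- after the header, `pos` is the address of the first structure
  have m1 : a1.v .m = (I.pos ++ I.neg).length := by
    simp [e1, readHeader, hat1.1, hat1.2]
  have np1 : a1.v .np = I.pos.length := by simp [e1, readHeader, hat1.1]
  have pos1 : a1.v .pos = 2 := by simp [e1, readHeader]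
  have in1 : a1.a .IN = s.a .IN := g1.a .IN (by decide)
  have len1 : a1.v .len = s.v .len := g1.v .len (by decide)
  -- after the structures, `pos` is the address of the grammar
  obtain ⟨hR, pos2, n2⟩ := run_readStructs (As := I.pos ++ I.neg) (hc.of_frame g1) m1
    (by simp [e1, readHeader]) (by simp [e1, readHeader])
    (by rw [in1, pos1]; exact hat2) (by
      intro A hA
      have := size_le_length_flatMap hA
      rw [len1]
      omega)
  rw [← e2] at hR pos2 n2
  have nk3 := run_computeNK a2
  rw [← e3] at nk3
  have k2 := f2.v .k (by decide)
  have k0 := f0.v .k (by decide)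
  have R2 := f2.v .R (by decide)
  have R0 := f0.v .R (by decide)
  have R3 := g3.v .R (by decide)
  have len0 := f0.v .len (by decide)
  have ks : s'.v .k = k := k0.trans hc.k_eq
  have PW23 := g23.a .PW (by decide)
  have k3 := g3.v .k (by decide)
  have hpw2 : ∀ (a : ℕ) (A : FinStruct L), (I.pos ++ I.neg)[a]? = some A → ∀ i < s'.v .R,
      a2.a .PW (a * s'.v .R + i) = A.size ^ i := fun a A hA i hi => by
    rw [R2] at hi ⊢
    exact hR.pw a A hA i hi
  obtain ⟨N4, P4, L4⟩ := run_listPoints (k := k) (As := I.pos ++ I.neg) (s := a3)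
    (by rw [g23.v .m (by decide), e2, run_v _ _ (by decide), m1]) (k3.trans hc.k_eq)
    (fun a A hA => by
      rw [PW23, R3, ← R0]
      exact hpw2 a A hA k (by rw [R0]; exact hc.k_lt))
    (fun a A hA => by
      rw [nk3, ← k2, ks]
      exact Nat.pow_le_pow_left (hR.size_le a A hA) k)
    (fun e => by rw [g3.a .POS (by decide)]; exact h0 .POS (by simp) e)
  rw [← e4] at N4 P4 L4
  have np3 : a3.v .np = I.pos.length := by
    rw [g23.v .np (by decide), e2, run_v _ _ (by decide), np1]
  have POS4 := f4.a .POS (by decide)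
  have SB4 := f4.a .SB (by decide)
  have AI4 := f4.a .AI (by decide)
  have N4' := f4.v .N (by decide)
  have b5 : a5.v .b = a4.v .n + 2 := by simp [e5, computeBE]
  have E5 : a5.v .E = a4.v .N + a4.v .k + 1 := by simp [e5, computeBE]
  have V6 := run_computeV a5
  have VR7 := run_computeVR a6
  have MV8 := run_computeMV a7
  rw [← e6] at V6
  rw [← e7] at VR7
  rw [← e8] at MV8
  -- the last phase reads the grammar to the end of the input
  have pos8 : a8.v .pos = a2.v .pos := g28.v .pos (by decide)
  have in8 : a8.a .IN = s.a .IN := g8.a .IN (by decide)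
  have len8 : a8.v .len = s.v .len := g8.v .len (by decide)
  obtain ⟨hL, hG⟩ := run_readGrammar I.grammar (s := a8) (hc.of_frame g8)
    (by rw [pos8, pos2, pos1]; omega)
    (by rw [in8, pos8, pos2, pos1]; exact hat3)
    (by rw [len8, pos8, pos2, pos1, hlen]; omega)
    (fun b hb i => by
      rw [g8.a b (by revert hb; clear * -; revert b; decide)]
      exact h0 b (by revert hb; clear * -; revert b; decide) i)
  rw [← e9] at hL hG
  have hC := hc.of_frame f0
  have hn : s'.v .n = (List.map FinStruct.size (I.pos ++ I.neg)).foldr max 0 :=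
    (f2.v .n (by decide)).trans n2
  have hN : s'.v .N = pointOff k (I.pos ++ I.neg) (I.pos ++ I.neg).length := N4'.trans N4
  have hb : s'.v .b = s'.v .n + 2 := by
    rw [f5.v .b (by decide), b5, f4.v .n (by decide)]
  have hE : s'.v .E = s'.v .N + s'.v .k + 1 := by
    rw [f5.v .E (by decide), E5, N4', f4.v .k (by decide)]
  have hV : s'.v .V = s'.v .b ^ s'.v .E := by
    rw [f6.v .V (by decide), V6, f5.v .E (by decide), f5.v .b (by decide)]
  have hVR : s'.v .VR = s'.v .V ^ s'.v .R := by
    rw [f7.v .VR (by decide), VR7, f6.v .V (by decide), f6.v .R (by decide)]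
  have hMV : s'.v .MV = (s'.v .len + s'.v .len) * s'.v .V := by
    rw [f8.v .MV (by decide), MV8, f7.v .V (by decide), f7.v .len (by decide)]
  have hS : StructOK (I.pos ++ I.neg) k s' := by
    refine ⟨ks, hC.k_lt, hN, fun a A hA i hi => ?_, fun a A hA i hi => ?_, fun a A hA i hi => ?_,
      fun a A hA sy i v hv => ?_, fun a A hA => ?_⟩
    · rw [SB4, (L4 a A hA i hi).1, R3, R0]
    · rw [AI4, (L4 a A hA i hi).2.1]
    · rw [f2.a .PW (by decide)]
      exact hpw2 a A hA i hi
    · rw [f2.a .IN (by decide), f2.a .TAB (by decide), R2]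
      exact hR.tab a A hA sy i v hv
    · rw [f2.v .n (by decide)]
      exact hR.size_le a A hA
  have hpt : ∀ e < s'.v .N, ∃ (a : ℕ) (A : FinStruct L), (I.pos ++ I.neg)[a]? = some A ∧
      s'.a .SB e = a * s'.v .R ∧ s'.a .AI e < A.size ^ k := by
    intro e he
    obtain ⟨a, A, hA, i, hi, rfl⟩ := exists_point _ (hN ▸ he)
    exact ⟨a, A, hA, hS.sb a A hA i hi, (hS.ai a A hA i hi).symm ▸ hi⟩
  have hnk : s'.v .nk = s'.v .n ^ k := by
    rw [show s'.v .nk = a3.v .nk by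
      rw [f4.v .nk (by decide), e4, run_v _ _ (by decide)], nk3, ← k2, ks, f2.v .n (by decide)]
  refine ⟨?_, hS, hC, hG, fun a A hA i hi => ?_, fun e => ?_, fun i => ?_, fun i => ?_, ?_⟩
  · refine ⟨hb, hE, hV, hVR, hMV, hC.R_gt, fun c => (hC.ar_lt c).le, hC.op_le, hC.oa_lt,
      fun e he i hi => ?_, fun e he => ?_, fun e he => ?_, hL.nd, hL.ch, hL.pa, hL.cp_lt, hL.nx_lt⟩
    · obtain ⟨a, A, hA, h1, -⟩ := hpt e he
      rw [h1, hS.pw a A hA i hi]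
      exact pow_pos A.size_pos _
    · obtain ⟨a, A, hA, h1, -⟩ := hpt e he
      rw [h1, hS.pw a A hA 1 hC.R_gt, pow_one]
      exact hS.size_le a A hA
    · obtain ⟨a, A, hA, -, h2⟩ := hpt e he
      rw [hnk]
      exact h2.trans_le (Nat.pow_le_pow_left (hS.size_le a A hA) k)
  · rw [POS4, (L4 a A hA i hi).2.2, np3]
  · rw [POS4]
    exact P4 e
  · rw [f0.a .D (by decide)]
    exact h0 .D (by simp) i
  · rw [f0.a .MK (by decide)]
    exact h0 .MK (by simp) i
  · refine ⟨?_, hn, ?_, hN, hb, ?_, hV, hVR, hMV⟩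
    · rw [f1.v .m (by decide), m1]
      rfl
    · rw [hnk, hn]
      rfl
    · rw [hE, ks]

end Prepare

namespace LoopProg

namespace Prog

/-! ### Running time -/

/-- The variables that bound the loops of `P` may be evaluated in a later state, because the program
`Q` that leads there does not change them. -/
theorem RunsIn.of_frame {P Q : Prog} {s s' : PState} {B : Var → ℕ} (hF : Frame Q s s')
    (hQ : ∀ p ∈ P.lv, p ∉ Q.wv) (hP : ∀ p ∈ P.lv, p ∉ P.wv) (hB : ∀ p ∈ P.lv, s'.v p ≤ B p) :
    RunsIn layout P s (P.bd B) :=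
  RunsIn.of_bd B (fun p hp => (hF.v p (hQ p hp)) ▸ hB p hp) hP

/-- All loop bounds have been computed before they are used, and they are not changed later, so that
they may be evaluated in the state before the saturation. -/
theorem runsIn_phases {s s' : PState} (hs' : s' = run readPhases s) {B : Var → ℕ}
    (hB : ∀ p ∈ phases.lv, s'.v p ≤ B p) : RunsIn layout phases s (phases.bd B) := by
  have hsub : ∀ P : Prog, P.lv ⊆ phases.lv → ∀ p ∈ P.lv, s'.v p ≤ B p := fun P h p hp => hB p (h hp)
  obtain ⟨a1, e1⟩ : ∃ a, a = run readHeader s := ⟨_, rfl⟩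
  obtain ⟨a2, e2⟩ : ∃ a, a = run readStructs a1 := ⟨_, rfl⟩
  obtain ⟨a3, e3⟩ : ∃ a, a = run computeNK a2 := ⟨_, rfl⟩
  obtain ⟨a4, e4⟩ : ∃ a, a = run listPoints a3 := ⟨_, rfl⟩
  obtain ⟨a5, e5⟩ : ∃ a, a = run computeBE a4 := ⟨_, rfl⟩
  obtain ⟨a6, e6⟩ : ∃ a, a = run computeV a5 := ⟨_, rfl⟩
  obtain ⟨a7, e7⟩ : ∃ a, a = run computeVR a6 := ⟨_, rfl⟩
  obtain ⟨a8, e8⟩ : ∃ a, a = run computeMV a7 := ⟨_, rfl⟩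
  have e9 : s' = run readGrammar a8 := by rw [hs', e8, e7, e6, e5, e4, e3, e2, e1]; rfl
  have f8 : Frame (readGrammar) a8 s' := by
    rw [e9]
    exact run_frame (readGrammar) a8
  have f7 : Frame (computeMV;; readGrammar) a7 s' := by
    rw [e9, e8]
    exact run_frame (computeMV;; readGrammar) a7
  have f6 : Frame (computeVR;; computeMV;; readGrammar) a6 s' := by
    rw [e9, e8, e7]
    exact run_frame (computeVR;; computeMV;; readGrammar) a6
  have f5 : Frame (computeV;; computeVR;; computeMV;; readGrammar) a5 s' := by
    rw [e9, e8, e7, e6]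
    exact run_frame (computeV;; computeVR;; computeMV;; readGrammar) a5
  have f4 : Frame (computeBE;; computeV;; computeVR;; computeMV;; readGrammar) a4 s' := by
    rw [e9, e8, e7, e6, e5]
    exact run_frame (computeBE;; computeV;; computeVR;; computeMV;; readGrammar) a4
  have f3 : Frame (listPoints;; computeBE;; computeV;; computeVR;; computeMV;; readGrammar) a3 s' := by
    rw [e9, e8, e7, e6, e5, e4]
    exact run_frame (listPoints;; computeBE;; computeV;; computeVR;; computeMV;; readGrammar) a3
  have f2 : Frame (computeNK;; listPoints;; computeBE;; computeV;; computeVR;; computeMV;; readGrammar) a2 s' := by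
    rw [e9, e8, e7, e6, e5, e4, e3]
    exact run_frame (computeNK;; listPoints;; computeBE;; computeV;; computeVR;; computeMV;; readGrammar) a2
  have f1 : Frame (readStructs;; computeNK;; listPoints;; computeBE;; computeV;; computeVR;; computeMV;; readGrammar) a1 s' := by
    rw [e9, e8, e7, e6, e5, e4, e3, e2]
    exact run_frame (readStructs;; computeNK;; listPoints;; computeBE;; computeV;; computeVR;; computeMV;; readGrammar) a1
  -- the loop bounds of a phase have their final values when it begins
  refine RunsIn.seq (RunsIn.of_bd B (fun p hp => absurd hp (by revert p; decide)) (by decide)) ?_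
  rw [← e1]
  refine RunsIn.seq (RunsIn.of_frame f1 (by decide) (by decide) (hsub _ (by decide))) ?_
  rw [← e2]
  refine RunsIn.seq (RunsIn.of_frame f2 (by decide) (by decide) (hsub _ (by decide))) ?_
  rw [← e3]
  refine RunsIn.seq (RunsIn.of_frame f3 (by decide) (by decide) (hsub _ (by decide))) ?_
  rw [← e4]
  refine RunsIn.seq (RunsIn.of_frame f4 (by decide) (by decide) (hsub _ (by decide))) ?_
  rw [← e5]
  refine RunsIn.seq (RunsIn.of_frame f5 (by decide) (by decide) (hsub _ (by decide))) ?_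
  rw [← e6]
  refine RunsIn.seq (RunsIn.of_frame f6 (by decide) (by decide) (hsub _ (by decide))) ?_
  rw [← e7]
  refine RunsIn.seq (RunsIn.of_frame f7 (by decide) (by decide) (hsub _ (by decide))) ?_
  rw [← e8]
  refine RunsIn.seq (RunsIn.of_frame f8 (by decide) (by decide) (hsub _ (by decide))) ?_
  rw [← e9]
  refine RunsIn.seq (RunsIn.of_bd B (hsub _ (by decide)) (by decide)) ?_
  refine RunsIn.seq (RunsIn.of_bd B (fun p hp => ?_) (by decide)) (RunsIn.of_bd B (fun p hp => ?_) (by decide))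
  · rw [run_v combineAll s' (by revert p; decide)]
    exact hsub saturate (by decide) p hp
  · rw [run_v saturate _ (by revert p; decide), run_v combineAll s' (by revert p; decide)]
    exact hsub answer (by decide) p hp

/-- The variables that bound loops; the others may be as large as they like. -/
def loopBound (s : PState) (p : Var) : ℕ := if p ∈ phases.lv then s.v p else 0

theorem loopBound_le {s : PState} {S G : ℕ} (hS : ∀ p ∈ [Var.J, .m, .VR, .nk, .n, .R, .N, .k, .E, .b, .V],
    s.v p ≤ S) (hG : ∀ p ∈ [Var.len, .MV], s.v p ≤ S * G) :
    (∀ p ∉ [Var.len, .MV], loopBound s p ≤ S) ∧ ∀ p ∈ [Var.len, .MV], loopBound s p ≤ S * G := by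
  refine ⟨fun p hp => ?_, fun p hp => ?_⟩
  · rw [loopBound]
    split_ifs with h
    · have hall : ∀ p ∈ phases.lv, p ∈ [Var.len, .MV] ∨
          p ∈ [Var.J, .m, .VR, .nk, .n, .R, .N, .k, .E, .b, .V] := by decide
      exact hS p ((hall p h).resolve_left hp)
    · exact Nat.zero_le _
  · rw [loopBound]
    split_ifs with h
    · exact hG p hp
    · exact Nat.zero_le _

/-- Loops over the length of the input or the number of pairs are never nested. -/
theorem oneBig_phases : phases.oneBig [Var.len, .MV] = true := by decide

end Prog

end LoopProg

section Time

variable {L : FirstOrder.Language.{u, v}} [Finite L.Symbols] {k : ℕ}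

open LoopProg LoopProg.Prog
open Pr (skip set wr branch loop)

variable (L k) in
/-- The whole program. -/
noncomputable def synthesis : Prog := prelude L k;; phases

theorem lv_prelude : (prelude L k).lv = [] := by
  simp [prelude, Pr.lv, lv_writeTable]

theorem oneBig_synthesis : (synthesis L k).oneBig [Var.len, .MV] = true := by
  simp [synthesis, prelude, Pr.oneBig, oneBig_writeTable, oneBig_phases]

/-- The running time of the whole program, when `S * G` bounds the two big loop variables, and `S`
bounds the others. -/
theorem runsIn_synthesis {s s' : PState} (hs' : s' = run readPhases (run (prelude L k) s)) {S G : ℕ}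
    (hS1 : 1 ≤ S) (hG1 : 1 ≤ G)
    (hS : ∀ p ∈ [Var.J, .m, .VR, .nk, .n, .R, .N, .k, .E, .b, .V], s'.v p ≤ S)
    (hG : ∀ p ∈ [Var.len, .MV], s'.v p ≤ S * G) : ∃ T,
    RunsIn layout (synthesis L k) s T ∧
      T ≤ (synthesis L k).weight * (S ^ (synthesis L k).depth * G) := by
  obtain ⟨h1, h2⟩ := loopBound_le hS hG
  refine ⟨(synthesis L k).bd (loopBound s'), ?_,
    Pr.bd_le_of_oneBig hS1 hG1 h1 h2 _ oneBig_synthesis⟩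
  rw [synthesis, Pr.bd]
  refine RunsIn.seq (RunsIn.of_bd (loopBound s') ?_ ?_) (runsIn_phases hs' ?_)
  · simp [lv_prelude]
  · simp [lv_prelude]
  · intro p hp
    rw [loopBound, if_pos hp]

/-! ### Lengths of encodings -/

theorem RTree.length_encode {S X : Type*} {ar : S → ℕ} (f : S → ℕ) (g : X → ℕ) (t : RTree ar X) :
    (t.encode f g).length = t.size := by
  induction t with
  | leaf B => rfl
  | node s xs ih =>
    simp only [RTree.encode, RTree.size, List.length_cons, List.length_flatten, List.map_ofFn,
      List.sum_ofFn, Function.comp_def, ih]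
    omega

theorem FOGrammar.length_encode (G : FOGrammar L k) : (FOGrammar.encode G).length = G.size + 3 := by
  simp only [FOGrammar.encode, RTG.size, List.length_append, List.length_replicate, List.length_cons,
    List.length_nil, List.length_flatMap, RTree.length_encode]
  rw [add_right_comm]
  congr 3
  exact List.map_congr_left fun r _ => by omega

theorem RTG.size_pos {S : Type*} {ar : S → ℕ} (G : RTG ar) : 0 < G.size := by
  have := G.start.2
  rw [RTG.size]
  omega

/-- For a fixed signature, the length of a structure is polynomial in its size. -/
theorem FinStruct.length_encode_le (A : FinStruct L) {n : ℕ} (h : A.size ≤ n) :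
    A.encode.length ≤ n + 1 + radix L k * n ^ radix L k := by
  have h1 : ∀ j, (A.table ((Finite.equivFin L.Symbols).symm j)).length ≤ n ^ radix L k := fun j => by
    rw [A.length_table]
    exact (Nat.pow_le_pow_left h _).trans
      (Nat.pow_le_pow_right (A.size_pos.trans_le h) (symArity_lt L k _).le)
  have h2 : (∑ j, (A.table ((Finite.equivFin L.Symbols).symm j)).length) ≤
      Nat.card L.Symbols * n ^ radix L k := by
    simpa using Finset.sum_le_card_nsmul Finset.univ _ _ fun j _ => h1 j
  have h3 : Nat.card L.Symbols * n ^ radix L k ≤ radix L k * n ^ radix L k :=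
    Nat.mul_le_mul_right _ (by rw [radix]; omega)
  rw [FinStruct.encode_eq]
  simp only [List.length_append, List.length_replicate, List.length_cons, List.length_nil,
    List.length_flatten, FinStruct.tables, List.map_ofFn, List.sum_ofFn, Function.comp_def]
  omega

theorem le_foldr_max {l : List ℕ} {a : ℕ} (h : a ∈ l) : a ≤ l.foldr max 0 := by
  induction l with
  | nil => simp at h
  | cons b l ih =>
    rw [List.mem_cons] at h
    rcases h with rfl | h
    · exact le_max_left _ _
    · exact (ih h).trans (le_max_right _ _)

theorem SepInstance.size_le_maxSize (I : SepInstance L k) {A : FinStruct L} (h : A ∈ I.pos ++ I.neg) :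
    A.size ≤ I.maxSize :=
  le_foldr_max (List.mem_map_of_mem h)

/-- The length of the input is polynomial in `m` and `n`, up to the size of the grammar, which
enters linearly. -/
theorem SepInstance.length_encode_le (I : SepInstance L k) : I.encode.length ≤
    I.numStructs * (I.maxSize + 1 + radix L k * I.maxSize ^ radix L k) + I.grammar.size + 5 := by
  have h : ((I.pos ++ I.neg).flatMap FinStruct.encode).length ≤
      I.numStructs * (I.maxSize + 1 + radix L k * I.maxSize ^ radix L k) := by
    rw [List.length_flatMap, SepInstance.numStructs]
    have := List.sum_le_card_nsmul ((I.pos ++ I.neg).map fun A => A.encode.length)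
      (I.maxSize + 1 + radix L k * I.maxSize ^ radix L k) (by
        intro x hx
        obtain ⟨A, hA, rfl⟩ := List.mem_map.1 hx
        exact A.length_encode_le (I.size_le_maxSize hA))
    simpa only [List.length_map, smul_eq_mul] using this
  rw [I.encode_eq, List.length_append, List.length_append, FOGrammar.length_encode]
  simp only [List.length_cons, List.length_nil]
  omega

/-- Since domains are written in unary, all parameters of the instance are at most the length of the
input. -/
theorem SepInstance.numStructs_le_length (I : SepInstance L k) :
    I.numStructs ≤ I.encode.length ∧ I.maxSize ≤ I.encode.length ∧
      I.grammar.size ≤ I.encode.length := by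
  have h1 : I.encode.length = 2 + (((I.pos ++ I.neg).flatMap FinStruct.encode).length +
      (I.grammar.size + 3)) := by
    rw [I.encode_eq, List.length_append, List.length_append, FOGrammar.length_encode]
    simp only [List.length_cons, List.length_nil]
  have h2 : ∀ As : List (FinStruct L), As.length ≤ (As.flatMap FinStruct.encode).length ∧
      (As.map FinStruct.size).foldr max 0 ≤ (As.flatMap FinStruct.encode).length := by
    intro As
    induction As with
    | nil => simp
    | cons A As ih =>
      have := A.size_le_length
      have := A.size_pos
      simp only [List.flatMap_cons, List.length_append, List.length_cons, List.map_cons,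
        List.foldr_cons]
      omega
  have := h2 (I.pos ++ I.neg)
  refine ⟨?_, ?_, by omega⟩
  · rw [SepInstance.numStructs]; omega
  · rw [SepInstance.maxSize]; omega

theorem pointOff_le (As : List (FinStruct L)) {n : ℕ} (h : ∀ A ∈ As, A.size ≤ n) :
    pointOff k As As.length ≤ As.length * n ^ k := by
  have := List.sum_le_card_nsmul (As.map fun A => A.size ^ k) (n ^ k) (by
    intro x hx
    obtain ⟨A, hA, rfl⟩ := List.mem_map.1 hx
    exact Nat.pow_le_pow_left (h A hA) k)
  simpa [pointOff] using this

end Time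

/-! ### The polynomial bounds -/

section Final

variable {L : FirstOrder.Language.{u, v}} [Finite L.Symbols] {k : ℕ}

open LoopProg LoopProg.Prog
open Pr (skip set wr branch loop)

/-- All quantities that bound loops are at most `2 ^ poly`, up to a factor `G` for the length of the
input and the number of entries of the queue. -/
theorem bounds_arith {r k Q J m n nk N b E V VR len MV G : ℕ} (hr : 4 + k + J ≤ r) (hG : 1 ≤ G)
    (hm : m ≤ Q) (hn : n ≤ Q) (hnk : nk ≤ Q + 1) (hN : N ≤ Q) (hb : b = n + 2) (hE : E = N + k + 1)
    (hV : V = b ^ E) (hVR : VR = V ^ r) (hMV : MV = (len + len) * V)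
    (hlen : len ≤ m * (n + 1 + r * n ^ r) + G + 5) :
    (J ≤ 2 ^ ((r + 5) * (Q + r) ^ 2) ∧ m ≤ 2 ^ ((r + 5) * (Q + r) ^ 2) ∧
    VR ≤ 2 ^ ((r + 5) * (Q + r) ^ 2) ∧ nk ≤ 2 ^ ((r + 5) * (Q + r) ^ 2) ∧
    n ≤ 2 ^ ((r + 5) * (Q + r) ^ 2) ∧ r ≤ 2 ^ ((r + 5) * (Q + r) ^ 2) ∧
    N ≤ 2 ^ ((r + 5) * (Q + r) ^ 2) ∧ k ≤ 2 ^ ((r + 5) * (Q + r) ^ 2) ∧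
    E ≤ 2 ^ ((r + 5) * (Q + r) ^ 2) ∧ b ≤ 2 ^ ((r + 5) * (Q + r) ^ 2) ∧
    V ≤ 2 ^ ((r + 5) * (Q + r) ^ 2)) ∧
    len ≤ 2 ^ ((r + 5) * (Q + r) ^ 2) * G ∧ MV ≤ 2 ^ ((r + 5) * (Q + r) ^ 2) * G := by
  obtain ⟨z, hz⟩ : ∃ z, z = Q + r := ⟨_, rfl⟩
  rw [← hz]
  have hz4 : 4 ≤ z := by omega
  have hzz : z ≤ z ^ 2 := by nlinarith
  have hz5 : 1 + (r + 3) * z ^ 2 + z ^ 2 ≤ (r + 5) * z ^ 2 := by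
    have : (r + 5) * z ^ 2 = (r + 3) * z ^ 2 + z ^ 2 + z ^ 2 := by ring
    rw [this]
    generalize (r + 3) * z ^ 2 = y
    omega
  have hz2 : z ≤ 2 ^ z := Nat.lt_two_pow_self.le
  have hzS : z ≤ 2 ^ ((r + 5) * z ^ 2) :=
    hz2.trans (Nat.pow_le_pow_right two_pos (by nlinarith))
  -- the base and the number of digits are at most `z`
  have hV2 : V ≤ 2 ^ z ^ 2 := by
    calc V = b ^ E := hV
      _ ≤ z ^ E := Nat.pow_le_pow_left (by omega) _
      _ ≤ z ^ z := Nat.pow_le_pow_right (by omega) (by omega)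
      _ ≤ (2 ^ z) ^ z := Nat.pow_le_pow_left hz2 _
      _ = 2 ^ z ^ 2 := by rw [← pow_mul, sq]
  have hVR2 : VR ≤ 2 ^ ((r + 5) * z ^ 2) := by
    calc VR = V ^ r := hVR
      _ ≤ (2 ^ z ^ 2) ^ r := Nat.pow_le_pow_left hV2 _
      _ = 2 ^ (z ^ 2 * r) := by rw [← pow_mul]
      _ ≤ _ := Nat.pow_le_pow_right two_pos (by nlinarith)
  have hp1 : z ≤ z ^ (r + 2) := Nat.le_self_pow (by omega) z
  have hp2 : z * z ≤ z ^ (r + 2) := by rw [← sq]; exact Nat.pow_le_pow_right (by omega) (by omega)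
  -- apart from `G`, the length is at most `z ^ (r + 3)`, and `z ≤ 2 ^ z`
  have hlen2 : len ≤ 2 ^ ((r + 3) * z) * G := by
    have h1 : m * (n + 1 + r * n ^ r) ≤ z * (z + z * z ^ r) := by
      refine Nat.mul_le_mul (by omega) (Nat.add_le_add (by omega) (Nat.mul_le_mul (by omega) ?_))
      exact Nat.pow_le_pow_left (by omega) r
    have h2 : z * (z + z * z ^ r) = z * z + z ^ (r + 2) := by ring
    have h3 : 4 * z ^ (r + 2) ≤ z ^ (r + 3) := by
      rw [pow_succ z (r + 2), mul_comm]
      exact Nat.mul_le_mul_left _ hz4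
    have h4 : z ^ (r + 3) ≤ 2 ^ ((r + 3) * z) := by
      rw [mul_comm, pow_mul]
      exact Nat.pow_le_pow_left hz2 _
    have h5 : m * (n + 1 + r * n ^ r) + 6 ≤ 2 ^ ((r + 3) * z) := by omega
    calc len ≤ m * (n + 1 + r * n ^ r) + 5 + G := by omega
      _ ≤ (m * (n + 1 + r * n ^ r) + 5) * G + 1 * G := by
          rw [one_mul]; exact Nat.add_le_add_right (Nat.le_mul_of_pos_right _ hG) _
      _ = (m * (n + 1 + r * n ^ r) + 6) * G := by ring
      _ ≤ _ := Nat.mul_le_mul_right _ h5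
  have hlen3 : len ≤ 2 ^ ((r + 3) * z ^ 2) * G :=
    hlen2.trans (Nat.mul_le_mul_right _ (Nat.pow_le_pow_right two_pos (Nat.mul_le_mul_left _ hzz)))
  refine ⟨⟨by omega, by omega, hVR2, by omega, by omega, by omega, by omega, by omega, by omega,
    by omega, hV2.trans (Nat.pow_le_pow_right two_pos (by nlinarith))⟩, ?_, ?_⟩
  · exact hlen3.trans (Nat.mul_le_mul_right _ (Nat.pow_le_pow_right two_pos
      (Nat.mul_le_mul_right _ (by omega))))
  · have h := Nat.pow_le_pow_right (n := 2) two_pos hz5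
    calc MV = 2 * len * V := by rw [hMV]; ring
      _ ≤ 2 * (2 ^ ((r + 3) * z ^ 2) * G) * 2 ^ z ^ 2 :=
          Nat.mul_le_mul (Nat.mul_le_mul_left _ hlen3) hV2
      _ = 2 ^ (1 + (r + 3) * z ^ 2 + z ^ 2) * G := by
          rw [pow_add, pow_add, pow_one]
          generalize 2 ^ ((r + 3) * z ^ 2) = x
          generalize 2 ^ z ^ 2 = y
          ring
      _ ≤ _ := Nat.mul_le_mul_right _ h

/-- Separator synthesis for `FO(k)` is solvable in exponential time, for a fixed finite signature and
a fixed `k`. One program reads an instance and answers `0` if there is no solution; otherwise it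
answers `1`, followed by a solution as a tree with shared subtrees. Its running time is both
`O(2 ^ poly(m n ^ k) |G|)` (with `n` in place of `n ^ k` if `k = 0`) and exponential in the length of
the input. -/
theorem mainTheorem1 (L : FirstOrder.Language.{u, v}) [Finite L.Symbols] (k : ℕ) :
    ∃ (P : RAM.Program) (p q : Polynomial ℕ) (C : ℕ), ∀ I : SepInstance L k,
      ∃ (out : List ℕ) (T : ℕ),
        P.Outputs I.encode out T ∧
        T ≤ C * 2 ^ p.eval (I.numStructs * I.maxSize ^ max k 1) * I.grammar.size ∧
        T ≤ 2 ^ q.eval I.encode.length ∧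
        ((out = [0] ∧ ¬ ∃ φ : FOFormula L k, I.IsSolution φ) ∨
          ∃ (d : TreeDag (FOSym.arity (L := L) (k := k))) (φ : FOFormula L k),
            out = 1 :: d.encode FOSym.code ∧ d.Represents φ.toTree ∧ I.IsSolution φ) := by
  obtain ⟨r, hr⟩ : ∃ r, r = radix L k := ⟨_, rfl⟩
  obtain ⟨W, hW⟩ : ∃ W, W = (synthesis L k).weight := ⟨_, rfl⟩
  obtain ⟨D, hD⟩ : ∃ D, D = (synthesis L k).depth := ⟨_, rfl⟩
  -- `7 + 14 * len` steps for the input, `W * (S ^ D * G)` for the loop program, and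
  -- `19 * (1 + (r + 1) * MV)` for the output, where `len` and `MV` are at most `S * G`
  obtain ⟨C, hC⟩ : ∃ C, C = 59 + W + 19 * r := ⟨_, rfl⟩
  -- with `Q = m * n ^ max k 1`, loop bounds are at most `S = 2 ^ ((r + 5) * (Q + r) ^ 2)`, and the
  -- running time is at most `C * S ^ (D + 1) * |G|`; moreover `Q ≤ len ^ (max k 1 + 1)`
  refine ⟨toRAM layout .IN .DW .i (synthesis L k),
    Polynomial.C ((D + 1) * (r + 5)) * (Polynomial.X + Polynomial.C r) ^ 2,
    Polynomial.C C + Polynomial.C ((D + 1) * (r + 5)) *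
      (Polynomial.X ^ (max k 1 + 1) + Polynomial.C r) ^ 2 + Polynomial.X, C, fun I => ?_⟩
  simp only [Polynomial.eval_add, Polynomial.eval_mul, Polynomial.eval_pow, Polynomial.eval_C,
    Polynomial.eval_X]
  obtain ⟨s, hs⟩ : ∃ s, s = run (prelude L k) (initState Arr.IN Var.len I.encode) := ⟨_, rfl⟩
  obtain ⟨s', hs'⟩ : ∃ s', s' = run readPhases s := ⟨_, rfl⟩
  have hc := constOK_prelude L k I.encode
  have hv := run_prelude_v L k I.encode
  have ha := run_prelude_a L k I.encode
  rw [← hs] at hc hv ha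
  obtain ⟨hg, hst, hc', ⟨X, hX⟩, hpos, hpos', hD0, hMK, hbv⟩ := run_readPhases I hc (hv .len) (ha .IN)
    (fun b hb i => by
      rw [ha b]
      simp only [List.mem_cons, List.not_mem_nil, or_false] at hb
      rcases hb with rfl | rfl | rfl | rfl | rfl | rfl | rfl <;> rfl) hs'
  obtain ⟨hout, hans⟩ := run_core I hg hst hc'.sym hX hpos hpos' hD0 hMK rfl
  have hR : s'.v .R = r := by rw [hs', run_v _ _ (by decide), hv .R, hr]
  have hlen : s'.v .len = I.encode.length := by rw [hs', run_v _ _ (by decide), hv .len]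
  obtain ⟨Q, hQ⟩ : ∃ Q, Q = I.numStructs * I.maxSize ^ max k 1 := ⟨_, rfl⟩
  have hG := I.grammar.size_pos
  -- without structures, `n = 0`
  have hmn : I.numStructs ≤ Q ∧ I.maxSize ≤ Q ∧ I.maxSize ^ k ≤ Q + 1 ∧
      I.numStructs * I.maxSize ^ k ≤ Q := by
    have hle := fun A hA => I.size_le_maxSize (A := A) hA
    rcases Nat.eq_zero_or_pos I.numStructs with h0 | h0
    · have h1 : I.maxSize = 0 := by
        rw [SepInstance.numStructs, List.length_eq_zero_iff] at h0
        rw [SepInstance.maxSize, h0]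
        rfl
      rw [h0, h1]
      refine ⟨Nat.zero_le _, Nat.zero_le _, ?_, by simp⟩
      cases k <;> simp
    · have h1 : 0 < I.maxSize := by
        obtain ⟨A, hA⟩ := List.exists_mem_of_length_pos h0
        exact A.size_pos.trans_le (hle A hA)
      have h2 : I.maxSize ^ k ≤ I.maxSize ^ max k 1 := Nat.pow_le_pow_right h1 (le_max_left _ _)
      have h3 : I.maxSize ≤ I.maxSize ^ max k 1 := Nat.le_self_pow (by omega) _
      have h4 : I.maxSize ^ max k 1 ≤ Q := hQ ▸ Nat.le_mul_of_pos_left _ h0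
      refine ⟨?_, by omega, by omega, hQ ▸ Nat.mul_le_mul_left _ h2⟩
      rw [hQ]
      exact Nat.le_mul_of_pos_right _ (by omega)
  obtain ⟨hsmall, hl, hmv⟩ := bounds_arith (r := r) (k := k) (Q := Q) (J := Nat.card L.Symbols)
    (by rw [hr, radix]; omega) hG (hbv.m.le.trans hmn.1) (hbv.n.le.trans hmn.2.1)
    (hbv.nk.le.trans hmn.2.2.1)
    (hbv.N.le.trans ((pointOff_le _ fun A hA => I.size_le_maxSize hA).trans hmn.2.2.2))
    hbv.b hbv.E hbv.V (hR ▸ hbv.VR) hbv.MV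
    (by rw [hlen, hbv.m, hbv.n, hr]; exact I.length_encode_le)
  obtain ⟨S, hS⟩ : ∃ S, S = 2 ^ ((r + 5) * (Q + r) ^ 2) := ⟨_, rfl⟩
  rw [← hS] at hsmall hl hmv
  have hS1 : 1 ≤ S := hS ▸ Nat.one_le_two_pow
  obtain ⟨T, hT, hTle⟩ := runsIn_synthesis (s := initState Arr.IN Var.len I.encode)
    (s' := s') (by rw [hs', hs]) hS1 hG
    (by
      simp only [List.forall_mem_cons, List.not_mem_nil, false_imp_iff, implies_true, and_true]
      rw [hR, hc'.k_eq, hc'.J_eq]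
      exact hsmall)
    (by
      simp only [List.forall_mem_cons, List.not_mem_nil, false_imp_iff, implies_true, and_true]
      exact ⟨hl, hmv⟩)
  obtain ⟨T', hT', hO⟩ := toRAM_outputs (bo := .DW) (len := .i) rfl hT
  have hrun : run (synthesis L k) (initState Arr.IN Var.len I.encode) =
      run answer (run saturate (run combineAll s')) := by
    rw [hs', hs]; rfl
  rw [hrun] at hT' hO
  have key : T' ≤ C * 2 ^ ((D + 1) * (r + 5) * (Q + r) ^ 2) * I.grammar.size := by
    have e : 2 ^ ((D + 1) * (r + 5) * (Q + r) ^ 2) = S ^ (D + 1) := by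
      rw [show (D + 1) * (r + 5) * (Q + r) ^ 2 = (r + 5) * (Q + r) ^ 2 * (D + 1) by ring, pow_mul, hS]
    have h1 : S ≤ S ^ (D + 1) := Nat.le_self_pow (by omega) S
    have h2 : S ^ D ≤ S ^ (D + 1) := Nat.pow_le_pow_right hS1 (by omega)
    obtain ⟨Y, hY⟩ : ∃ Y, Y = S ^ (D + 1) * I.grammar.size := ⟨_, rfl⟩
    have h3 : S * I.grammar.size ≤ Y := hY ▸ Nat.mul_le_mul_right _ h1
    have h4 : W * (S ^ D * I.grammar.size) ≤ W * Y :=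
      Nat.mul_le_mul_left _ (hY ▸ Nat.mul_le_mul_right _ h2)
    have h5 : 1 ≤ Y := by
      rw [hY]
      exact Nat.mul_pos (hS1.trans h1) hG
    have h6 : (s'.v .R + 1) * s'.v .MV ≤ (r + 1) * Y := by
      rw [hR]
      exact Nat.mul_le_mul_left _ (hmv.trans h3)
    have h7 : C * Y = 59 * Y + W * Y + 19 * (r * Y) := by rw [hC]; ring
    have h8 : (r + 1) * Y = r * Y + Y := by ring
    rw [← hW, ← hD] at hTle
    rw [hlen] at hl
    rw [e, mul_assoc, ← hY]
    omega
  refine ⟨_, T', hO, hQ ▸ key, key.trans ?_, hans⟩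
  obtain ⟨l1, l2, l3⟩ := I.numStructs_le_length
  have hQl : Q ≤ I.encode.length ^ (max k 1 + 1) := by
    rw [hQ, pow_succ, mul_comm]
    exact Nat.mul_le_mul (Nat.pow_le_pow_left l2 _) l1
  rw [pow_add, pow_add]
  refine Nat.mul_le_mul (Nat.mul_le_mul Nat.lt_two_pow_self.le
    (Nat.pow_le_pow_right two_pos ?_)) (l3.trans Nat.lt_two_pow_self.le)
  exact Nat.mul_le_mul_left _ (Nat.pow_le_pow_left (Nat.add_le_add_right hQl _) 2)

end Final
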